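/- **Setting.** Let $\Pi=(0,1)\times\mathbb R$ and, for $w=(u,v)$, $\mathcal D w=\big((-i\partial_x+\partial_y)v,\ (-i\partial_x-\partial_y)u\big)$ with boundary conditions $u(0,y)=0$, $v(1,y)=0$ (in the weak sense). For $\gamma\in\mathbb R$ let $\mathcal L_\gamma$ be the space of $w$ with $\int_\Pi e^{2\gamma|y|}(|u|^2+|v|^2)\,dx\,dy<\infty$, and $\mathcal H_\gamma$ the space of $w\in\mathcal L_\gamma$ with $\mathcal Dw\in\mathcal L_\gamma$ that satisfy the boundary conditions. For $j\ge1$ let $\kappa_j$ be the point of $[(j-1)\pi,j\pi)$ where $\kappa^{-2}\sin^2\kappa$ is maximal (with value $1$ at $\kappa=0$), and $\omega_j>0$, $\omega_j^{-2}=\kappa_j^{-2}\sin^2\kappa_j$. Fix $N\ge2$ and let $\omega_\varepsilon^{-1}=\omega_N^{-1}+\varepsilon$, $\kappa(\lambda)=\sqrt{\omega_\varepsilon^2-\lambda^2}$, $G(\lambda,\varepsilon)=\frac{\sin\kappa(\lambda)}{\kappa(\lambda)}-\frac{(-1)^{N+1}}{\omega_\varepsilon}$. Let $\gamma>0$ be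 such that for $\varepsilon=0$ every root $\lambda$ of $\cos\kappa(\lambda)-\lambda\frac{\sin\kappa(\lambda)}{\kappa(\lambda)}=0$ with $|\mathrm{Im}\,\lambda|\le\gamma$ is real, and let $0<a<\omega_N-1$ be such that $\lambda=1$ is the only zero of $G(\cdot,0)$ in $|\lambda-1|\le a$. **Waves.** The indices are $(j,\tau)$, $1\le j\le N$, $\tau=\pm$, without $(1,+)$. For $j<N$ let $\kappa_j^\pm\in((j-1)\pi,j\pi)$ be the roots of $\frac{\sin\kappa}{\kappa}=\frac{(-1)^{j+1}}{\omega_\varepsilon}$ with $\kappa_j^+<\kappa_j<\kappa_j^-$, $\lambda_j^\pm=\kappa_j^\pm\cot\kappa_j^\pm$, and $$\mathbf w_j^\tau=\sqrt{\tfrac{\omega_\varepsilon}{|\lambda_j^\tau-1|}}\;e^{-i\lambda_j^\tau y}\big(\sin(\kappa_j^\tau x),\,(-1)^{j+1}i\sin(\kappa_j^\tau(x-1))\big).$$ For $j=N$ put, with $m=0$ for the sign $+$ and $m=1$ for the sign $-$, $$\mathbf w_N^{\varepsilon\pm}=\frac1{2\pi i}\oint_{|\lambda-1|=a}\frac{(\lambda-1)^m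 e^{-i\lambda y}}{G(\lambda,\varepsilon)}\big(\sin(\kappa(\lambda)x),\,(-1)^{N+1}i\sin(\kappa(\lambda)(x-1))\big)\,d\lambda .$$ Let $q(w,\tilde w)=-\int_0^1(u\overline{\tilde v}-v\overline{\tilde u})\,dx$ at $y=0$, $a^\varepsilon=iq(\mathbf w_N^{\varepsilon+},\mathbf w_N^{\varepsilon+})$, $b^\varepsilon=-iq(\mathbf w_N^{\varepsilon+},\mathbf w_N^{\varepsilon-})$, and $$\mathbf w_N^+=\frac{\mathbf w_N^{\varepsilon+}+(a^\varepsilon/b^\varepsilon)\,\mathbf w_N^{\varepsilon-}}{N_1^\varepsilon},\qquad \mathbf w_N^-=\frac{\mathbf w_N^{\varepsilon+}}{N_2^\varepsilon},$$ with $N_1^\varepsilon,N_2^\varepsilon>0$ such that $q(\mathbf w_N^\pm,\mathbf w_N^\pm)=\pm i$. **Scattering matrix.** Let $R_0>0$ and let $\chi_\pm=\chi_\pm(y)$ be real smooth functions with $\chi_+=1,\chi_-=0$ for $y>R_0$ and $\chi_+=0,\chi_-=1$ for $y<-R_0$. Put $V_k^\pm=\chi_\pm\mathbf w_k^\pm$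 and $W_k^\pm=\chi_\mp\mathbf w_k^\pm$. Let $\mathcal P$ be a real continuous function on $\overline\Pi$ with $|\mathcal P|\le1$ that vanishes for $|y|>R_0$. A matrix $\mathbf S=(\mathbf S_{k\tau}^{j\theta})$ is called a scattering matrix for $(\varepsilon,\delta)$ if the kernel of $\mathcal D+(\delta\mathcal P-\omega_\varepsilon)I:\mathcal H_{-\gamma}\to\mathcal L_{-\gamma}$ has a basis of the form $$z_k^\tau=V_k^\tau+\sum_{(j,\theta)}\mathbf S_{k\tau}^{j\theta}W_j^\theta+\tilde z_k^\tau,\qquad \tilde z_k^\tau\in\mathcal H_\gamma .$$ **Theorem.** For every $N\ge2$ numbers $\gamma$ and $a$ as above exist. For all such $\gamma,a$ and all $R_0,\chi_\pm$ as above there are $\varepsilon_0,\delta_0>0$ and $C$ such that, for every $\mathcal P$ as above: for all $(\varepsilon,\delta)\in[0,\varepsilon_0]\times[-\delta_0,\delta_0]$ there is exactly one scattering matrix $\mathbf S(\varepsilon,\delta)$; its entries are (jointly) real-analytic functions of $(\varepsilon,\delta)$ on $[0,\varepsilon_0]\times[-\delta_0,\delta_0]$; and $\mathbf s=\mathbf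 S-\mathbb I$ satisfies, for all such $(\varepsilon,\delta)$ and all indices, $$\Big|\mathbf s_{j\tau}^{k\theta}+i\delta\int_\Pi\mathcal P\,\mathbf w_j^\tau\cdot\overline{\mathbf w_k^\theta}\,dx\,dy\Big|\le C\delta^2 .$$ -/

import Mathlib

open MeasureTheory Set
open scoped ContDiff ComplexConjugate

namespace ZigzagRibbon

noncomputable section

/-! ### The ribbon, the Dirac operator and the weighted spaces

A point of the plane is `p = (x, y)`, and a spinor field `w = (u, v)` is a function
`ℝ × ℝ → ℂ × ℂ`; only its restriction to the strip matters. -/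

/-- The strip `Π = (0,1) × ℝ`. -/
def strip : Set (ℝ × ℝ) := Ioo 0 1 ×ˢ univ

/-- Lebesgue measure on the strip. -/
def stripMeasure : Measure (ℝ × ℝ) := (volume : Measure (ℝ × ℝ)).restrict strip

def dX (φ : ℝ × ℝ → ℂ) (p : ℝ × ℝ) : ℂ := fderiv ℝ φ p (1, 0)

def dY (φ : ℝ × ℝ → ℂ) (p : ℝ × ℝ) : ℂ := fderiv ℝ φ p (0, 1)

/-- Smooth compactly supported functions on the plane. Their restrictions to the strip need not
vanish on its boundary. -/
def IsTest (φ : ℝ × ℝ → ℂ) : Prop := ContDiff ℝ ∞ φ ∧ HasCompactSupport φ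

/-- `𝒟 w = f` in the strip, together with `u = 0` on `x = 0` and `v = 0` on `x = 1`, where
`w = (u, v)`, `𝒟 w = ((-i∂ₓ + ∂_y) v, (-i∂ₓ - ∂_y) u)`. Both the equation and the boundary
conditions are in the weak sense: the test functions for the `u`-equation vanish
near `x = 1` and are arbitrary at `x = 0`, so that the identity forces the trace of `u` on `x = 0`
to vanish; symmetrically for `v`. -/
def HasDirac (w f : ℝ × ℝ → ℂ × ℂ) : Prop :=
  (∀ φ, IsTest φ → tsupport φ ⊆ {p | p.1 < 1} →
    ∫ p, (f p).2 * φ p ∂stripMeasure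
      = ∫ p, (w p).1 * (Complex.I * dX φ p + dY φ p) ∂stripMeasure) ∧
  (∀ φ, IsTest φ → tsupport φ ⊆ {p | 0 < p.1} →
    ∫ p, (f p).1 * φ p ∂stripMeasure
      = ∫ p, (w p).2 * (Complex.I * dX φ p - dY φ p) ∂stripMeasure)

/-- `w ∈ 𝓛_γ`, i.e. `∫_Π e^{2γ|y|} (|u|² + |v|²) dx dy < ∞`, for `γ` of either sign. -/
def MemL (γ : ℝ) (w : ℝ × ℝ → ℂ × ℂ) : Prop :=
  MemLp (fun p => Real.exp (γ * |p.2|) • w p) 2 stripMeasure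

/-- `w ∈ 𝓗_γ`: both `w` and `𝒟 w` are in `𝓛_γ`, and `w` satisfies the boundary conditions. -/
def MemH (γ : ℝ) (w : ℝ × ℝ → ℂ × ℂ) : Prop :=
  MemL γ w ∧ ∃ f, MemL γ f ∧ HasDirac w f

/-- The kernel of `𝒟 + (δ P - En) I`, at energy `En`, as an operator from `𝓗_{-γ}` to `𝓛_{-γ}`. -/
def diracKernel (γ En δ : ℝ) (P : ℝ × ℝ → ℝ) : Set (ℝ × ℝ → ℂ × ℂ) :=
  {w | MemH (-γ) w ∧ HasDirac w (fun p => (En - δ * P p) • w p)}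

/-! ### Thresholds and the dispersion relation -/

theorem exists_kappaMax {j : ℕ} (hj : 1 ≤ j) :
    ∃ κ ∈ Ico ((j - 1 : ℝ) * Real.pi) (j * Real.pi),
      IsMaxOn (fun t => Real.sinc t ^ 2) (Ico ((j - 1 : ℝ) * Real.pi) (j * Real.pi)) κ := by
  have hpi := Real.pi_pos
  have hj' : (1 : ℝ) ≤ j := by exact_mod_cast hj
  obtain ⟨κ, hκ, hmax⟩ := (isCompact_Icc (a := (j - 1 : ℝ) * Real.pi)
    (b := j * Real.pi)).exists_isMaxOn (nonempty_Icc.2 (by nlinarith))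
    (f := fun t => Real.sinc t ^ 2) (Real.continuous_sinc.pow 2).continuousOn
  rcases lt_or_eq_of_le hκ.2 with h | h
  · exact ⟨κ, ⟨hκ.1, h⟩, fun t ht => hmax ⟨ht.1, ht.2.le⟩⟩
  · have h0 : Real.sinc κ ^ 2 = 0 := by
      rw [h, Real.sinc_of_ne_zero (by positivity), Real.sin_nat_mul_pi]; simp
    refine ⟨(j - 1 : ℝ) * Real.pi, ⟨le_rfl, by nlinarith⟩, fun t ht => ?_⟩
    have h1 : Real.sinc t ^ 2 ≤ Real.sinc κ ^ 2 := hmax ⟨ht.1, ht.2.le⟩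
    show Real.sinc t ^ 2 ≤ Real.sinc ((j - 1 : ℝ) * Real.pi) ^ 2
    rw [h0] at h1
    exact h1.trans (sq_nonneg _)

/-- `κ_j`, `j ≥ 1`: the point of `[(j-1)π, jπ)` where `sin² κ / κ²` is maximal. -/
def kappaMax (j : ℕ) : ℝ :=
  Classical.epsilon fun κ => κ ∈ Ico ((j - 1 : ℝ) * Real.pi) (j * Real.pi) ∧
    IsMaxOn (fun t => Real.sinc t ^ 2) (Ico ((j - 1 : ℝ) * Real.pi) (j * Real.pi)) κ

theorem kappaMax_spec {j : ℕ} (hj : 1 ≤ j) :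
    kappaMax j ∈ Ico ((j - 1 : ℝ) * Real.pi) (j * Real.pi) ∧
    IsMaxOn (fun t => Real.sinc t ^ 2) (Ico ((j - 1 : ℝ) * Real.pi) (j * Real.pi))
      (kappaMax j) :=
  Classical.epsilon_spec (p := fun κ => κ ∈ Ico ((j - 1 : ℝ) * Real.pi) (j * Real.pi) ∧
    IsMaxOn (fun t => Real.sinc t ^ 2) (Ico ((j - 1 : ℝ) * Real.pi) (j * Real.pi)) κ)
    (exists_kappaMax hj)

/-- The threshold `ω_N`, given by `1 / ω_N² = sin² κ_N / κ_N²`. -/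
def omegaThreshold (N : ℕ) : ℝ := |Real.sinc (kappaMax N)|⁻¹

/-- The energy `ω_ε`, given by `1 / ω_ε = 1 / ω_N + ε`. -/
def omega (N : ℕ) (ε : ℝ) : ℝ := ((omegaThreshold N)⁻¹ + ε)⁻¹

/-- `sin z / z`, an entire function. -/
def csinc (z : ℂ) : ℂ := if z = 0 then 1 else Complex.sin z / z

/-- `κ(λ) = √(En² - λ²)`. -/
def kappa (En : ℝ) (l : ℂ) : ℂ := Complex.sqrt ((En : ℂ) ^ 2 - l ^ 2)

/-- `cos κ - λ sin κ / κ` with `κ² = En² - λ²` (an even function of `κ`). Its zeros `λ` are the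
exponents of the solutions `e^{-iλy}(𝒰(x), 𝒱(x))` of the unperturbed problem. -/
def dispersion (En : ℝ) (l : ℂ) : ℂ :=
  Complex.cos (kappa En l) - l * csinc (kappa En l)

/-- `(-1)^{j+1}`. -/
def parity (j : ℕ) : ℝ := (-1) ^ (j + 1)

/-- `g(λ, ε) - (-1)^{N+1} / ω_ε`, where `g(λ, ε) = sin κ(λ) / κ(λ)`. -/
def gap (N : ℕ) (ε : ℝ) (l : ℂ) : ℂ :=
  csinc (kappa (omega N ε) l) - (parity N / omega N ε : ℝ)

/-- Admissible exponential weights `γ > 0`: at the threshold, the closed strip `|Im λ| ≤ γ`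
contains only real roots of the dispersion relation. -/
def AdmissibleWeight (N : ℕ) (γ : ℝ) : Prop :=
  0 < γ ∧ ∀ l : ℂ, dispersion (omegaThreshold N) l = 0 → |l.im| ≤ γ → l.im = 0

/-- Admissible radii `a > 0` of the contour `|λ - 1| = a`: the disc `|λ - 1| ≤ a` does not reach
the branch point `λ = ω_N` of `κ(λ)`, and at the threshold it contains no zero of `gap` except
the (double) zero `λ = 1`. -/
def AdmissibleRadius (N : ℕ) (a : ℝ) : Prop :=
  0 < a ∧ a < omegaThreshold N - 1 ∧ ∀ l : ℂ, ‖l - 1‖ ≤ a → gap N 0 l = 0 → l = 1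

/-! ### The waves -/

/-- `e^{-iλy} (sin κx, s i sin κ(x-1))`. -/
def planeWave (s : ℝ) (κ l : ℂ) (p : ℝ × ℝ) : ℂ × ℂ :=
  Complex.exp (-Complex.I * l * p.2) •
    (Complex.sin (κ * p.1), s * Complex.I * Complex.sin (κ * (p.1 - 1)))

/-- `κ_j^τ` (`τ = true` stands for `+`, `τ = false` for `-`): the root of
`sin κ / κ = (-1)^{j+1} / En` in `((j-1)π, jπ)` with `κ < κ_j` for `+`, and `κ_j < κ` for `-`. -/
def kappaBranch (En : ℝ) (j : ℕ) (τ : Bool) : ℝ :=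
  Classical.epsilon fun κ => κ ∈ Ioo ((j - 1 : ℝ) * Real.pi) (j * Real.pi) ∧
    Real.sin κ / κ = parity j / En ∧ (if τ then κ < kappaMax j else kappaMax j < κ)

/-- `λ_j^τ = κ_j^τ cot κ_j^τ`. -/
def lambdaBranch (En : ℝ) (j : ℕ) (τ : Bool) : ℝ :=
  kappaBranch En j τ * Real.cot (kappaBranch En j τ)

/-- The normalized oscillatory wave `√En |λ_j^τ - 1|^{-1/2} w_j^τ`. -/
def oscWave (En : ℝ) (j : ℕ) (τ : Bool) (p : ℝ × ℝ) : ℂ × ℂ :=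
  (Real.sqrt En / Real.sqrt |lambdaBranch En j τ - 1|) •
    planeWave (parity j) (kappaBranch En j τ) (lambdaBranch En j τ) p

/-- The contour integral
`(2πi)⁻¹ ∮_{|λ-1|=a} (λ-1)^m e^{-iλy} (sin κx, (-1)^{N+1} i sin κ(x-1)) / gap dλ`;
`m = 0` gives the wave `𝐰_N^{ε+}`, and `m = 1` the wave `𝐰_N^{ε-}`. -/
def contourWave (N : ℕ) (a ε : ℝ) (m : ℕ) (p : ℝ × ℝ) : ℂ × ℂ :=
  (2 * Real.pi * Complex.I)⁻¹ • ∮ l in C(1, a),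
    ((l - 1) ^ m / gap N ε l) • planeWave (parity N) (kappa (omega N ε) l) l p

/-- `q_b(w, w') = -∫₀¹ (u \bar v' - v \bar u')(x, b) dx`, which does not depend on `b` if `w` and
`w'` solve the unperturbed problem at the same energy. -/
def qForm (b : ℝ) (w w' : ℝ × ℝ → ℂ × ℂ) : ℂ :=
  -∫ x in (0 : ℝ)..1, ((w (x, b)).1 * conj (w' (x, b)).2 - (w (x, b)).2 * conj (w' (x, b)).1)

/-- `a^ε = i q(𝐰_N^{ε+}, 𝐰_N^{ε+})`. -/
def aCoeff (N : ℕ) (a ε : ℝ) : ℝ :=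
  (Complex.I * qForm 0 (contourWave N a ε 0) (contourWave N a ε 0)).re

/-- `b^ε = -i q(𝐰_N^{ε+}, 𝐰_N^{ε-})`. -/
def bCoeff (N : ℕ) (a ε : ℝ) : ℝ :=
  (-Complex.I * qForm 0 (contourWave N a ε 0) (contourWave N a ε 1)).re

/-- `𝐰_N^{ε+} + α_ε 𝐰_N^{ε-}` with `α_ε = a^ε / b^ε`. -/
def plusWave (N : ℕ) (a ε : ℝ) (p : ℝ × ℝ) : ℂ × ℂ :=
  contourWave N a ε 0 p + (aCoeff N a ε / bCoeff N a ε) • contourWave N a ε 1 p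

/-- The waves `𝐰_N^±`: `plusWave` and `𝐰_N^{ε+}`, divided by the positive
factors `N₁^ε` and `N₂^ε` for which `q(𝐰_N^±, 𝐰_N^±) = ± i`. -/
def edgeWave (N : ℕ) (a ε : ℝ) (τ : Bool) (p : ℝ × ℝ) : ℂ × ℂ :=
  if τ then
    (Real.sqrt (-Complex.I * qForm 0 (plusWave N a ε) (plusWave N a ε)).re)⁻¹ • plusWave N a ε p
  else (Real.sqrt (aCoeff N a ε))⁻¹ • contourWave N a ε 0 p

/-- The indices `(j, τ)`, `1 ≤ j ≤ N`, `τ = ±`, without `(1, +)`: there are `2N - 1` of them. -/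
def channels (N : ℕ) : Finset (ℕ × Bool) :=
  (Finset.Icc 1 N ×ˢ Finset.univ).erase (1, true)

/-- The index type of the scattering matrix. -/
abbrev Channel (N : ℕ) : Type := {k : ℕ × Bool // k ∈ channels N}

/-- The wave `𝐰_j^τ` at energy `ω_ε`. -/
def wave (N : ℕ) (a ε : ℝ) (k : Channel N) : ℝ × ℝ → ℂ × ℂ :=
  if k.1.1 < N then oscWave (omega N ε) k.1.1 k.1.2 else edgeWave N a ε k.1.2

/-! ### The augmented scattering matrix -/

/-- Smooth cutoffs: `χ₊ = 1`, `χ₋ = 0` for `y > R₀`, and `χ₊ = 0`, `χ₋ = 1` for `y < -R₀`.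
Here `χ true = χ₊` and `χ false = χ₋`. -/
def IsCutoff (R₀ : ℝ) (χ : Bool → ℝ → ℝ) : Prop :=
  (∀ τ, ContDiff ℝ ∞ (χ τ)) ∧
  (∀ y, R₀ < y → χ true y = 1 ∧ χ false y = 0) ∧
  (∀ y, y < -R₀ → χ true y = 0 ∧ χ false y = 1)

/-- The incoming wave `V_j^± = χ_± 𝐰_j^±`. -/
def inWave (N : ℕ) (χ : Bool → ℝ → ℝ) (a ε : ℝ) (k : Channel N) (p : ℝ × ℝ) : ℂ × ℂ :=
  χ k.1.2 p.2 • wave N a ε k p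

/-- The outgoing wave `W_j^± = χ_∓ 𝐰_j^±`. -/
def outWave (N : ℕ) (χ : Bool → ℝ → ℝ) (a ε : ℝ) (k : Channel N) (p : ℝ × ℝ) : ℂ × ℂ :=
  χ (!k.1.2) p.2 • wave N a ε k p

/-- Potentials: real-valued, continuous on the closed strip, supported in `|y| ≤ R₀`, and bounded
by one. -/
def IsPotential (R₀ : ℝ) (P : ℝ × ℝ → ℝ) : Prop :=
  ContinuousOn P (Icc 0 1 ×ˢ univ) ∧
  ∀ p ∈ (Icc 0 1 ×ˢ univ : Set (ℝ × ℝ)), |P p| ≤ 1 ∧ (R₀ < |p.2| → P p = 0)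

/-- `S` is a matrix of coefficients `S_{kτ}^{jθ}` (row `(k, τ)`, column `(j, θ)`) for which
there is a basis of the kernel of `𝒟 + (δ P - ω_ε) I : 𝓗_{-γ} → 𝓛_{-γ}` (functions that agree
almost everywhere being identified) of the form
`z_k^τ = V_k^τ + ∑ S_{kτ}^{jθ} W_j^θ + r_k^τ` with `r_k^τ ∈ 𝓗_γ`. -/
def IsScatteringMatrix (N : ℕ) (χ : Bool → ℝ → ℝ) (γ a ε δ : ℝ) (P : ℝ × ℝ → ℝ)
    (S : Matrix (Channel N) (Channel N) ℂ) : Prop :=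
  ∃ z : Channel N → ℝ × ℝ → ℂ × ℂ,
    (∀ k, z k ∈ diracKernel γ (omega N ε) δ P) ∧
    (∀ w ∈ diracKernel γ (omega N ε) δ P,
      ∃! c : Channel N → ℂ, w =ᵐ[stripMeasure] fun p => ∑ k, c k • z k p) ∧
    ∀ k, MemH γ fun p => z k p - (inWave N χ a ε k p + ∑ j, S k j • outWave N χ a ε j p)

/-- `∫_Π P w · \bar w' dx dy`, where `w · \bar w' = u \bar u' + v \bar v'`. -/
def pairing (P : ℝ × ℝ → ℝ) (w w' : ℝ × ℝ → ℂ × ℂ) : ℂ :=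
  ∫ p, (P p : ℂ) * ((w p).1 * conj (w' p).1 + (w p).2 * conj (w' p).2) ∂stripMeasure

end

end ZigzagRibbon

open ZigzagRibbon

namespace ZigzagRibbon

noncomputable section

open Complex hiding norm_div norm_mul norm_nonneg norm_pow inv_zero
open Real hiding cos cos_add cos_sub exp exp_add exp_zero hasDerivAt_cos hasDerivAt_sin norm_two sin
  sin_neg sin_sq_add_cos_sq sin_sub sqrt zero_lt_one cauchy
open Filter Metric
open Prod (smul_fst smul_snd fst_add snd_add)
open intervalIntegral (integral_of_le integral_eq_sub_of_hasDerivAt integral_hasDerivAt_right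
  integral_zero_ae norm_integral_le_of_norm_le_const integral_mono_on)
open intervalIntegral renaming integral_const_mul → iint_const_mul, integral_add → iint_add,
  integral_nonneg → iint_nonneg, integral_mul_const → iint_mul_const,
  norm_integral_le_of_norm_le → norm_iint_le
open scoped Topology InnerProductSpace Interval

local notation:max "ℝ²" => ℝ × ℝ
local notation:max "ℂ²" => ℂ × ℂ
local notation:max "ωₜ" => omegaThreshold
local notation:max "Λ" => lambdaBranch
local notation:max "Disp" => dispersion
local notation:max "μₛ" => stripMeasure
local notation:max "𝕀" => Icc (0 : ℝ) 1
local notation:max "𝕁" => Ioo (0 : ℝ) 1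
local notation:max "𝓦" => ℝ × ℝ → ℂ × ℂ

variable {N j : ℕ} {τ : Bool} {s E En γ t r η κ T K C : ℝ} {l : ℂ} {φ : ℝ² → ℂ} {w w' : 𝓦}
  {F : ℝ → ℂ²}

lemma cont_int {V : Type*} [NormedAddCommGroup V] {f : ℝ → V} {a b : ℝ}
    (hf : Continuous f := by fun_prop) : IntervalIntegrable f volume a b :=
  hf.intervalIntegrable a b

/-! ### Linear relations, their adjoints and finite-rank parametrices -/

section Abstract

variable {H : Type*} [NormedAddCommGroup H] [InnerProductSpace ℂ H] {ι : Type*} [Fintype ι]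
  [DecidableEq ι] {D : Submodule ℂ (H × H)} {B J M Q F : H →L[ℂ] H} {E₀ : ℝ}

/-- `(p, q)` belongs to the adjoint of the relation `D`. -/
def AdjointRel (D : Submodule ℂ (H × H)) (p q : H) : Prop :=
  ∀ a b : H, (a, b) ∈ D → ⟪b, p⟫_ℂ = ⟪a, q⟫_ℂ

lemma AdjointRel.isClosed (D : Submodule ℂ (H × H)) : IsClosed {x : H × H | AdjointRel D x.1 x.2}
  := by
  simp only [AdjointRel, ofPred_forall]
  refine isClosed_iInter fun a => isClosed_iInter fun b => isClosed_iInter fun _ => ?_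
  exact isClosed_eq (continuous_const.inner continuous_fst) (continuous_const.inner continuous_snd)

lemma ex_param [CompleteSpace H] {ι 𝒩 : Type*} [Fintype ι] [AddCommGroup 𝒩] [Module ℂ 𝒩] (D :
  Submodule ℂ (H × H)) (e : 𝒩 →ₗ[ℂ] H) (he : DenseRange e) (l : 𝒩 →ₗ[ℂ] (ι → ℂ)) (T : LinearMap.ker
  l →ₗ[ℂ] H) (C : ℝ) (hC : ∀ f, ‖T f‖ ≤ C * ‖e f‖) (E₀ : ℂ) (hT : ∀ f, AdjointRel D (T f) (e f + E₀
  • T f)) : ∃ Q F : H →L[ℂ] H, FiniteDimensional ℂ F.range ∧ Module.finrank ℂ F.range ≤ Fintype.card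
  ι ∧ ∀ h, AdjointRel D (Q h) (h - F h + E₀ • Q h) := by
  set Z : Submodule ℂ H := (Submodule.map e (LinearMap.ker l)).topologicalClosure with hZ
  have : CompleteSpace Z := (Submodule.isClosed_topologicalClosure _).completeSpace_coe
  have hmem : ∀ f : LinearMap.ker l, e f ∈ Z := fun f =>
    Submodule.le_topologicalClosure _ (Submodule.mem_map_of_mem f.2)
  let e' : LinearMap.ker l →ₗ[ℂ] Z := (e.comp (LinearMap.ker l).subtype).codRestrict Z hmem
  have he' : DenseRange e' := by
    intro z
    have hz : (z : H) ∈ closure (Submodule.map e (LinearMap.ker l) : Set H) := by aesop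
    rw [closure_subtype]
    convert hz using 2
    ext x
    constructor
    · rintro ⟨y, ⟨f, rfl⟩, rfl⟩
      exact ⟨f, f.2, rfl⟩
    · rintro ⟨f, hf, rfl⟩
      exact ⟨e' ⟨f, hf⟩, ⟨⟨f, hf⟩, rfl⟩, rfl⟩
  have hC' := hC
  let Q₁ : Z →L[ℂ] H := T.extendOfNorm e'
  have hQ₁ : ∀ f, Q₁ (e' f) = T f := fun f => LinearMap.extendOfNorm_eq he' ⟨C, hC'⟩ f
  have hrel : ∀ z : Z, AdjointRel D (Q₁ z) (z + E₀ • Q₁ z) := by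
    intro z
    have hcl := (AdjointRel.isClosed D).preimage (f := fun z : Z => (Q₁ z, (z : H) + E₀ • Q₁ z)) (by fun_prop)
    refine he'.induction_on z hcl ?_
    intro f
    rw [hQ₁]
    exact hT f
  let F : H →L[ℂ] H := Zᗮ.starProjection
  have hFe : ∀ f : LinearMap.ker l, F (e f) = 0 := fun f => by
    rw [Submodule.starProjection_apply_eq_zero_iff]
    exact Submodule.le_orthogonal_orthogonal Z (hmem f)
  -- the range of `F` is the closure of the finite-dimensional space `F (e 𝒩)`
  let Fe : 𝒩 →ₗ[ℂ] H := F.toLinearMap.comp e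
  have hker : LinearMap.ker l ≤ LinearMap.ker Fe := fun f hf => hFe ⟨f, hf⟩
  have hfd := Module.Finite.equiv l.quotKerEquivRange.symm
  let Fq : (𝒩 ⧸ LinearMap.ker l) →ₗ[ℂ] H := (LinearMap.ker l).liftQ Fe hker
  have hrange : LinearMap.range Fe = LinearMap.range Fq := by rw [Submodule.range_liftQ]
  have hfdr : FiniteDimensional ℂ (LinearMap.range Fe) := by rw [hrange]; infer_instance
  have hle : F.range ≤ LinearMap.range Fe := by
    rintro _ ⟨x, rfl⟩
    have hcl : IsClosed (LinearMap.range Fe : Set H) := Submodule.closed_of_finiteDimensional _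
    have := hcl.preimage F.continuous
    exact he.induction_on x this fun f => ⟨f, rfl⟩
  have hfdF := Submodule.finiteDimensional_of_le hle
  refine ⟨Q₁.comp Z.orthogonalProjectionOnto, F, hfdF, ?_, fun h => ?_⟩
  · calc Module.finrank ℂ F.range ≤ Module.finrank ℂ (LinearMap.range Fe) :=
          Submodule.finrank_mono hle
      _ = Module.finrank ℂ (LinearMap.range Fq) := by rw [hrange]
      _ ≤ Module.finrank ℂ (𝒩 ⧸ LinearMap.ker l) := LinearMap.finrank_range_le Fq
      _ = Module.finrank ℂ (LinearMap.range l) := l.quotKerEquivRange.finrank_eq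
      _ ≤ Module.finrank ℂ (ι → ℂ) := Submodule.finrank_le _
      _ = Fintype.card ι := Module.finrank_fintype_fun_eq_card ℂ
  · have h1 : h - F h = (Z.orthogonalProjectionOnto h : H) := by
      have := Submodule.starProjection_add_starProjection_orthogonal (K := Z) h
      rw [Submodule.starProjection_apply] at this
      rw [sub_eq_iff_eq_add]
      exact this.symm
    rw [h1]
    exact hrel _

/-- The correction of `B` to the vectors orthogonal to the `w j`. -/
def deflate (B : H →L[ℂ] H) (w g : ι → H) : H →L[ℂ] H :=
  B.comp (1 - ∑ j, (innerSL ℂ (w j)).smulRight (g j))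

lemma deflate_apply (B : H →L[ℂ] H) (w g : ι → H) (h : H) : deflate B w g h = B (h - ∑ j, ⟪w j,
  h⟫_ℂ • g j) := by
  simp [deflate]

lemma inner_deflated_eq_zero {w g : ι → H} (hwg : ∀ i j, ⟪w i, g j⟫_ℂ = if i = j then 1 else 0) (h
  : H) (i : ι) : ⟪w i, h - ∑ j, ⟪w j, h⟫_ℂ • g j⟫_ℂ = 0 := by simp_all

lemma adjointRel_of_orth [FiniteDimensional ℂ F.range] (hrank : Module.finrank ℂ F.range ≤
  Fintype.card ι) (hQ : ∀ h, AdjointRel D (Q h) (h - F h + (E₀ : ℂ) • Q h)) (hunit : IsUnit (1 - ((E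
  - E₀ : ℝ) : ℂ) • Q)) {w g : ι → H} (hw : ∀ j, (w j, (E : ℂ) • w j) ∈ D) (hwg : ∀ i j, ⟪w i, g j⟫_ℂ
  = if i = j then 1 else 0) {h : H} (hh : ∀ j, ⟪w j, h⟫_ℂ = 0) : AdjointRel D ((Q * Ring.inverse (1
  - ((E - E₀ : ℝ) : ℂ) • Q)) h) (h + (E : ℂ) • (Q * Ring.inverse (1 - ((E - E₀ : ℝ) : ℂ) • Q)) h) :=
  by
  set A : H →L[ℂ] H := Ring.inverse (1 - ((E - E₀ : ℝ) : ℂ) • Q) with hA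
  have hA1 : ∀ x, A x = x + ((E - E₀ : ℝ) : ℂ) • Q (A x) := by
    intro x
    have := congrArg (fun B : H →L[ℂ] H => B x) (Ring.mul_inverse_cancel _ hunit)
    simp only [mul_apply_eq_comp, sub_apply, one_apply_eq_self, smul_apply] at this
    rw [← hA] at this
    exact sub_eq_iff_eq_add.1 this
  have hrel : ∀ x, AdjointRel D (Q (A x)) (x - F (A x) + (E : ℂ) • Q (A x)) := by
    intro x
    have h1 := hQ (A x)
    have h2 : A x - F (A x) + (E₀ : ℂ) • Q (A x) = x - F (A x) + (E : ℂ) • Q (A x) := by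
      nth_rewrite 1 [hA1 x]
      push_cast
      module
    rwa [h2] at h1
  have hinner : ∀ x j, ⟪w j, x⟫_ℂ = ⟪w j, F (A x)⟫_ℂ := by
    intro x j
    have h1 := hrel x _ _ (hw j)
    rw [inner_smul_left, inner_add_right, inner_sub_right, inner_smul_right, conj_ofReal] at h1
    linear_combination -h1
  let φ : F.range →ₗ[ℂ] (ι → ℂ) :=
    LinearMap.pi fun j => (innerSL ℂ (w j)).toLinearMap.comp F.range.subtype
  have hφ : ∀ v j, φ v j = ⟪w j, (v : H)⟫_ℂ := fun v j => rfl
  have hsurj : Function.Surjective φ := by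
    intro c
    refine ⟨⟨F (A (∑ j, c j • g j)), ⟨_, rfl⟩⟩, funext fun i => ?_⟩
    rw [hφ, ← hinner]
    simp [inner_sum, inner_smul_right, hwg]
  have hcard : Module.finrank ℂ F.range = Module.finrank ℂ (ι → ℂ) := by
    refine le_antisymm (by simpa using hrank) ?_
    exact LinearMap.finrank_le_finrank_of_surjective hsurj
  have hinj := (LinearMap.injective_iff_surjective_of_finrank_eq_finrank hcard).2 hsurj
  have hzero : F (A h) = 0 := by
    have : (⟨F (A h), ⟨_, rfl⟩⟩ : F.range) = 0 := hinj (by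
      ext j
      rw [hφ, ← hinner, hh]
      simp)
    exact congrArg Subtype.val this
  have := hrel h
  rw [hzero, sub_zero] at this
  exact this

lemma eq_sum_of_mem_relation {w g : ι → H} (hwg : ∀ i j, ⟪w i, g j⟫_ℂ = if i = j then 1 else 0)
  (hB : ∀ h, (∀ j, ⟪w j, h⟫_ℂ = 0) → AdjointRel D (B h) (h + (E : ℂ) • B h)) {a : H} (ha : (a, (E :
  ℂ) • a) ∈ D) : a = ∑ j, ⟪g j, a⟫_ℂ • w j := by
  refine ext_inner_right ℂ fun x => ?_
  have h1 := hB _ (inner_deflated_eq_zero hwg x) _ _ ha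
  rw [inner_smul_left, inner_add_right, inner_smul_right, conj_ofReal, inner_sub_right, inner_sum] at h1
  have h2 : ⟪a, x⟫_ℂ = ∑ j, ⟪a, ⟪w j, x⟫_ℂ • g j⟫_ℂ := by grind
  rw [h2, sum_inner]
  refine Finset.sum_congr rfl fun j _ => ?_
  rw [inner_smul_left, inner_smul_right, inner_conj_symm, mul_comm]

end Abstract

section AbstractScattering

variable {H : Type*} [NormedAddCommGroup H] [InnerProductSpace ℂ H] {ι : Type*} [Fintype ι]
  [DecidableEq ι] {D : Submodule ℂ (H × H)} {B J M Q F : H →L[ℂ] H} {E₀ : ℝ}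

lemma _root_.IsBoundedBilinearMap.anAt_comp {X E F G : Type*} [NormedAddCommGroup X] [NormedSpace
  ℝ X] [NormedAddCommGroup E] [NormedSpace ℝ E] [NormedAddCommGroup F] [NormedSpace ℝ F]
  [NormedAddCommGroup G] [NormedSpace ℝ G] {b : E × F → G} (hb : IsBoundedBilinearMap ℝ b) {u : X →
  E} {v : X → F} {x : X} (hu : AnalyticAt ℝ u x) (hv : AnalyticAt ℝ v x) : AnalyticAt ℝ (fun x => b
  (u x, v x)) x := by
  have h := (hb.toContinuousLinearMap.analyticAt_bilinear (u x, v x)).comp₂ hu hv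
  exact h

lemma bilin_inner : IsBoundedBilinearMap ℝ fun p : H × H => ⟪p.1, p.2⟫_ℂ where
  add_left x y z := inner_add_left _ _ _
  smul_left c x y := by simp
  add_right x y z := inner_add_right _ _ _
  smul_right c x y := by simp
  bound := ⟨1, one_pos, fun x y => by simpa using norm_inner_le_norm x y⟩

lemma bilin_rankOne :
    IsBoundedBilinearMap ℝ fun p : H × H => (innerSL ℂ p.1).smulRight p.2 where
  add_left x y z := by ext; simp [inner_add_left, add_smul]
  smul_left c x y := by
    ext v
    show ⟪c • x, v⟫_ℂ • y = c • (⟪x, v⟫_ℂ • y)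
    rw [← coe_smul, inner_smul_left, conj_ofReal, mul_smul, coe_smul]
  add_right x y z := by ext; simp
  smul_right c x y := by
    ext v
    show ⟪x, v⟫_ℂ • (c • y) = c • (⟪x, v⟫_ℂ • y)
    rw [smul_comm]
  bound := ⟨1, one_pos, fun x y => by simp⟩

lemma bilin_apply :
    IsBoundedBilinearMap ℝ fun p : (H →L[ℂ] H) × H => p.1 p.2 where
  add_left x y z := rfl
  smul_left c x y := rfl
  add_right x y z := map_add _ _ _
  smul_right c x y := by simp
  bound := ⟨1, one_pos, fun x y => by simpa using x.le_opNorm y⟩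

/-- The outgoing resolvent. -/
def outgoing (J B : H →L[ℂ] H) (w W g : ι → H) :
    H →L[ℂ] H :=
  J.comp (deflate B w g) + I • ∑ j, (innerSL ℂ (w j)).smulRight (W j)

lemma outgoing_apply (J B : H →L[ℂ] H) (w W g : ι → H) (h : H) : outgoing J B w W g h = J (deflate
  B w g h) + I • ∑ j, ⟪w j, h⟫_ℂ • W j := by
  simp [outgoing]

lemma outgoing_mem {w W g : ι → H} (hJ : ∀ p q, AdjointRel D p q → (J p, J q) ∈ D) (hwg : ∀ i j,
  ⟪w i, g j⟫_ℂ = if i = j then 1 else 0) (hB : ∀ h, (∀ j, ⟪w j, h⟫_ℂ = 0) → AdjointRel D (B h) (h +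
  (E : ℂ) • B h)) (hW : ∀ j, (W j, (E : ℂ) • W j - I • J (g j)) ∈ D) (h : H) : (outgoing J B w W g
  h, J h + (E : ℂ) • outgoing J B w W g h) ∈ D := by
  have h1 := hJ _ _ (hB _ (inner_deflated_eq_zero hwg h))
  have h2 : ∑ j, (I * ⟪w j, h⟫_ℂ) • (W j, (E : ℂ) • W j - I • J (g j)) ∈ D :=
    Submodule.sum_mem _ fun j _ => Submodule.smul_mem _ _ (hW j)
  have h3 := Submodule.add_mem _ h1 h2
  convert h3 using 1
  refine Prod.ext ?_ ?_
  · simp [outgoing_apply, deflate_apply, Finset.smul_sum, mul_smul, Prod.fst_sum]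
  · simp only [outgoing_apply, deflate_apply, snd_add, Prod.snd_sum, smul_snd, map_add, map_sub,
      map_sum, map_smul, smul_add, smul_sub, Finset.smul_sum, Finset.sum_sub_distrib, smul_smul]
    have e1 : ∀ j, I * ⟪w j, h⟫_ℂ * I = - ⟪w j, h⟫_ℂ := fun j => by
      linear_combination ⟪w j, h⟫_ℂ * I_mul_I
    have e2 : ∀ j, E * (I * ⟪w j, h⟫_ℂ) = I * ⟪w j, h⟫_ℂ * E := fun j => by ring
    simp only [e1, e2, neg_smul, Finset.sum_neg_distrib]
    abel

/-- Solution of the perturbed problem for one value of the parameters. -/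
lemma ex_pert_basis {w W g : ι → H} {δ : ℂ} (hJ : ∀ p q, AdjointRel D p q → (J p, J q) ∈ D) (hw :
  ∀ j, (w j, (E : ℂ) • w j) ∈ D) (hwg : ∀ i j, ⟪w i, g j⟫_ℂ = if i = j then 1 else 0) (hB : ∀ h, (∀
  j, ⟪w j, h⟫_ℂ = 0) → AdjointRel D (B h) (h + (E : ℂ) • B h)) (hW : ∀ j, (W j, (E : ℂ) • W j - I •
  J (g j)) ∈ D) (hunit : IsUnit (1 - (-δ) • (M * outgoing J B w W g))) : ∃ z : ι → H, (∀ k, (z k, (E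
  : ℂ) • z k - δ • J (M (z k))) ∈ D) ∧ (∀ a, (a, (E : ℂ) • a - δ • J (M a)) ∈ D → ∃! c : ι → ℂ, a =
  ∑ k, c k • z k) ∧ ∀ k, ∃ p q, AdjointRel D p q ∧ z k = w k + J p + ∑ j, (-(δ * I * ⟪w j,
  Ring.inverse (1 - (-δ) • (M * outgoing J B w W g)) (M (w k))⟫_ℂ)) • W j := by
  set R := outgoing J B w W g with hR
  set A := Ring.inverse (1 - (-δ) • (M * R)) with hA
  have hA1 : ∀ x, A x + δ • M (R (A x)) = x := by
    intro x
    have := congrArg (fun B : H →L[ℂ] H => B x) (Ring.mul_inverse_cancel _ hunit)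
    simpa [hA] using this
  have hA2 : ∀ x, A (x + δ • M (R x)) = x := by
    intro x
    have := congrArg (fun B : H →L[ℂ] H => B x) (Ring.inverse_mul_cancel _ hunit)
    simpa [hA] using this
  have hRD := outgoing_mem hJ hwg hB hW
  rw [← hR] at hRD
  set ζ : ι → H := fun k => A (M (w k)) with hζ
  set z : ι → H := fun k => w k - δ • R (ζ k) with hz
  have hMz : ∀ k, M (z k) = ζ k := by
    intro k
    have := hA1 (M (w k))
    simp only [hz, map_sub, map_smul]
    rw [sub_eq_iff_eq_add]
    exact this.symm
  refine ⟨z, fun k => ?_, fun a ha => ?_, fun k => ?_⟩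
  · rw [hMz]
    have := Submodule.sub_mem _ (hw k) (Submodule.smul_mem _ δ (hRD (ζ k)))
    convert this using 1
    refine Prod.ext rfl ?_
    simp only [hz, Prod.snd_sub, smul_snd, smul_sub, smul_add]
    rw [smul_comm (E : ℂ) δ]
    abel
  · have h0 : (a + δ • R (M a), E • (a + δ • R (M a))) ∈ D := by
      have := Submodule.add_mem _ ha (Submodule.smul_mem _ δ (hRD (M a)))
      convert this using 1
      refine Prod.ext rfl ?_
      simp only [snd_add, smul_snd, smul_add]
      rw [smul_comm E δ]
      abel
    have h1 := eq_sum_of_mem_relation hwg hB h0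
    set c : ι → ℂ := fun j => ⟪g j, a + δ • R (M a)⟫_ℂ with hc
    have hMa : M a = ∑ k, c k • ζ k := by
      have h2 : M a + δ • M (R (M a)) = ∑ j, c j • M (w j) := by
        have := congrArg M h1
        rw [map_add, map_smul, map_sum] at this
        simpa only [map_smul] using this
      have h3 := hA2 (M a)
      rw [h2, map_sum] at h3
      rw [← h3]
      simp [hζ]
    refine ⟨c, ?_, fun c' hc' => ?_⟩
    · have h2 : a = ∑ j, c j • w j - δ • R (M a) := by grind
      simp only []
      conv_lhs => rw [h2, hMa]
      simp only [hz, smul_sub, Finset.sum_sub_distrib, map_sum, map_smul, Finset.smul_sum]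
      congr 1
      exact Finset.sum_congr rfl fun j _ => smul_comm _ _ _
    · have h2 : a + δ • R (M a) = ∑ k, c' k • w k := by
        have hM : M a = ∑ k, c' k • ζ k := by simp_all
        rw [hM]
        conv_lhs => rw [hc']
        simp only [hz, smul_sub, Finset.sum_sub_distrib, map_sum, map_smul, Finset.smul_sum]
        rw [sub_add_eq_add_sub, sub_eq_iff_eq_add]
        congr 1
        exact Finset.sum_congr rfl fun j _ => smul_comm _ _ _
      have hgw : ∀ i j, ⟪g i, w j⟫_ℂ = if i = j then 1 else 0 := by
        intro i j
        rw [← inner_conj_symm, hwg]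
        by_cases h : i = j <;> simp [h, eq_comm]
      ext j
      simp only [hc, h2]
      simp [inner_sum, inner_smul_right, hgw]
  · have h1 := hB _ (inner_deflated_eq_zero hwg (ζ k))
    refine ⟨-(δ • deflate B w g (ζ k)), -(δ • ((ζ k - ∑ j, ⟪w j, ζ k⟫_ℂ • g j)
      + (E : ℂ) • deflate B w g (ζ k))), ?_, ?_⟩
    · intro a b hab
      have := h1 a b hab
      simp only [inner_neg_right, inner_smul_right, deflate_apply]
      rw [this]
    · simp only [hz, hR, outgoing_apply, smul_add, map_neg, map_smul, neg_smul,
        Finset.sum_neg_distrib, Finset.smul_sum, smul_smul, ← mul_assoc]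
      abel

end AbstractScattering

section AbstractScattering

variable {H : Type*} [NormedAddCommGroup H] [InnerProductSpace ℂ H] {ι : Type*} [Fintype ι]
  [DecidableEq ι] {D : Submodule ℂ (H × H)} {B J M Q F : H →L[ℂ] H} {E₀ : ℝ}

lemma ex_scattering_matrix [CompleteSpace H] (hJ : ∀ p q, AdjointRel D p q → (J p, J q) ∈ D) (hfin
  : FiniteDimensional ℂ F.range) (hrank : Module.finrank ℂ F.range ≤ Fintype.card ι) (hQ : ∀ h,
  AdjointRel D (Q h) (h - F h + (E₀ : ℂ) • Q h)) {En : ℝ → ℝ} (hEn : AnalyticAt ℝ En 0) (hEn0 : En 0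
  = E₀) {w W g : ℝ → ι → H} (hwa : ∀ j, AnalyticAt ℝ (fun t => w t j) 0) (hWa : ∀ j, AnalyticAt ℝ
  (fun t => W t j) 0) (hga : ∀ j, AnalyticAt ℝ (fun t => g t j) 0) (hr : 0 < r) (hw : ∀ t ∈ Icc 0 r,
  ∀ j, (w t j, (En t : ℂ) • w t j) ∈ D) (hwg : ∀ t ∈ Icc 0 r, ∀ i j, ⟪w t i, g t j⟫_ℂ = if i = j
  then 1 else 0) (hW : ∀ t ∈ Icc 0 r, ∀ j, (W t j, (En t : ℂ) • W t j - I • J (g t j)) ∈ D) (K : ℝ)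
  : ∃ ε₀ > (0 : ℝ), ε₀ ≤ r ∧ ∃ δ₀ > (0 : ℝ), ∃ C : ℝ, ∀ M : H →L[ℂ] H, ‖M‖ ≤ K → ∃ S : ℝ → ℝ →
  Matrix ι ι ℂ, (∀ t ∈ Icc 0 ε₀, ∀ δ ∈ Icc (-δ₀) δ₀, ∃ z : ι → H, (∀ k, (z k, (En t : ℂ) • z k - (δ
  : ℂ) • J (M (z k))) ∈ D) ∧ (∀ a, (a, (En t : ℂ) • a - (δ : ℂ) • J (M a)) ∈ D → ∃! c : ι → ℂ, a = ∑
  k, c k • z k) ∧ ∀ k, ∃ p q, AdjointRel D p q ∧ z k = w t k + J p + ∑ j, ((S t δ - 1) k j) • W t j)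
  ∧ (∀ j k, AnalyticOn ℝ (fun q : ℝ² => S q.1 q.2 j k) (Icc 0 ε₀ ×ˢ Icc (-δ₀) δ₀)) ∧ ∀ t ∈ Icc 0 ε₀,
  ∀ δ ∈ Icc (-δ₀) δ₀, ∀ j k, ‖(S t δ - 1) j k - -I * δ * ⟪w t k, M (w t j)⟫_ℂ‖ ≤ C * δ ^ 2 := by
  -- the unperturbed resolvent and its analyticity
  set B : ℝ → H →L[ℂ] H := fun t => Q * Ring.inverse (1 - (En t - E₀) • Q) with hBdef
  have hBdef' : ∀ t, B t = Q * Ring.inverse (1 - ((En t - E₀ : ℝ) : ℂ) • Q) := fun t => by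
    simp only [hBdef, coe_smul]
  have hEa : AnalyticAt ℝ (fun t => 1 - (En t - E₀) • Q) 0 :=
    analyticAt_const.sub ((hEn.sub analyticAt_const).smul analyticAt_const)
  have h0 : (1 : H →L[ℂ] H) - (En 0 - E₀) • Q = 1 := by simp [hEn0]
  have hinv : AnalyticAt ℝ (Ring.inverse : (H →L[ℂ] H) → _) (1 - (En 0 - E₀) • Q) := by
    rw [h0]; exact analyticAt_inverse (1 : (H →L[ℂ] H)ˣ)
  have hBa : AnalyticAt ℝ B 0 := analyticAt_const.mul (hinv.comp' (f := fun t => 1 - (En t - E₀) • Q) hEa)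
  have hunit : ∀ᶠ t in 𝓝 0, IsUnit (1 - (En t - E₀) • Q) := by
    refine hEa.continuousAt.eventually ?_
    exact Units.isOpen.mem_nhds (by simp [hEn0])
  set R : ℝ → H →L[ℂ] H := fun t => outgoing J (B t) (w t) (W t) (g t) with hRdef
  have hsum : ∀ {v : ℝ → ι → H}, (∀ j, AnalyticAt ℝ (fun t => v t j) 0) → AnalyticAt ℝ (fun t => ∑
    j, (innerSL ℂ (w t j)).smulRight (v t j)) 0 := by
    intro v hv
    have := Finset.analyticAt_fun_sum Finset.univ (fun j _ =>
        bilin_rankOne.anAt_comp (hwa j) (hv j))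
    simpa using this
  have hRa : AnalyticAt ℝ R 0 := by
    have h1 : AnalyticAt ℝ (fun t => J * (B t * (1 - ∑ j, (innerSL ℂ (w t j)).smulRight (g t j))) +
      (I • (1 : H →L[ℂ] H)) * ∑ j, (innerSL ℂ (w t j)).smulRight (W t j)) 0 :=
      (analyticAt_const.mul (hBa.mul (analyticAt_const.sub (hsum hga)))).add
        (analyticAt_const.mul (hsum hWa))
    refine h1.congr (Eventually.of_forall fun t => ?_)
    simp only [hRdef, outgoing, deflate]
    ext x
    simp
  -- a common interval with uniform bounds
  set K' : ℝ := ‖R 0‖ + ∑ j, ‖w 0 j‖ + 1 with hK'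
  have hK'1 : 1 ≤ K' := by
    have : 0 ≤ ∑ j, ‖w 0 j‖ := Finset.sum_nonneg fun j _ => norm_nonneg _
    have := norm_nonneg (R 0)
    linarith
  have hbR : ∀ᶠ t in 𝓝 0, ‖R t‖ < K' := by
    refine hRa.continuousAt.norm.eventually (gt_mem_nhds ?_)
    have : 0 ≤ ∑ j, ‖w 0 j‖ := Finset.sum_nonneg fun j _ => norm_nonneg _
    linarith
  have hbw : ∀ᶠ t in 𝓝 0, ∀ j, ‖w t j‖ < K' := by
    rw [eventually_all]
    intro j
    refine (hwa j).continuousAt.norm.eventually (gt_mem_nhds ?_)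
    have h1 := norm_nonneg (R 0)
    have h2 := Finset.single_le_sum (f := fun j => ‖w 0 j‖) (fun j _ => norm_nonneg _)
      (Finset.mem_univ j)
    linarith
  have hwa' : ∀ᶠ t in 𝓝 0, ∀ j, AnalyticAt ℝ (fun t => w t j) t := by
    rw [Filter.eventually_all]
    exact fun j => (hwa j).eventually_analyticAt
  obtain ⟨ε₁, hε₁, hall⟩ := Metric.eventually_nhds_iff.1
    (hunit.and (hbR.and (hbw.and (hwa'.and hRa.eventually_analyticAt))))
  set ε₀ := min (ε₁ / 2) r with hε₀
  have hε₀pos : 0 < ε₀ := lt_min (by linarith) hr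
  have hall' : ∀ t ∈ Icc 0 ε₀, _ := fun t ht => hall (by
    rw [Real.dist_eq, sub_zero, abs_of_nonneg ht.1]
    have := ht.2.trans (min_le_left _ _)
    linarith)
  set K₁ := |K| + 1 with hK₁
  have hK₁1 : 1 ≤ K₁ := by have := abs_nonneg K; linarith
  set δ₀ := (2 * K₁ * K')⁻¹ with hδ₀
  have hden : 0 < 2 * K₁ * K' := by positivity
  have hδ₀pos : 0 < δ₀ := inv_pos.2 hden
  refine ⟨ε₀, hε₀pos, min_le_right _ _, δ₀, hδ₀pos, 2 * K₁ ^ 2 * K' ^ 3, fun M hM => ?_⟩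
  have hMK : ‖M‖ ≤ K₁ := hM.trans ((le_abs_self K).trans (by linarith))
  have hsmall : ∀ t ∈ Icc 0 ε₀, ∀ δ ∈ Icc (-δ₀) δ₀, ‖(-(δ : ℂ)) • (M * R t)‖ ≤ 1 / 2 := by
    intro t ht δ hδ
    have h1 : ‖M * R t‖ ≤ K₁ * K' := (norm_mul_le _ _).trans
      (mul_le_mul hMK (hall' t ht).2.1.le (norm_nonneg _) (by linarith))
    rw [norm_smul, norm_neg, norm_real, norm_eq_abs]
    calc |δ| * ‖M * R t‖ ≤ δ₀ * (K₁ * K') :=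
          mul_le_mul (abs_le.2 hδ) h1 (norm_nonneg _) hδ₀pos.le
      _ = 1 / 2 := by rw [hδ₀]; field_simp
  have hunit' : ∀ t ∈ Icc 0 ε₀, ∀ δ ∈ Icc (-δ₀) δ₀, IsUnit (1 - (-(δ : ℂ)) • (M * R t)) :=
    fun t ht δ hδ => isUnit_one_sub_of_norm_lt_one ((hsmall t ht δ hδ).trans_lt (by norm_num))
  set A : ℝ → ℝ → H →L[ℂ] H := fun t δ => Ring.inverse (1 - (-(δ : ℂ)) • (M * R t)) with hA
  set S : ℝ → ℝ → Matrix ι ι ℂ := fun t δ => 1 +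
    Matrix.of fun k j => -((δ : ℂ) * I * ⟪w t j, A t δ (M (w t k))⟫_ℂ) with hS
  have hSapp : ∀ t δ k j, (S t δ - 1) k j = -((δ : ℂ) * I * ⟪w t j, A t δ (M (w t k))⟫_ℂ) := by
    intro t δ k j
    simp [hS]
  refine ⟨S, fun t ht δ hδ => ?_, fun j k => ?_, fun t ht δ hδ j k => ?_⟩
  · have htr : t ∈ Icc 0 r := ⟨ht.1, ht.2.trans (min_le_right _ _)⟩
    have hu := (hall' t ht).1
    have hB : ∀ h, (∀ j, ⟪w t j, h⟫_ℂ = 0) → AdjointRel D (B t h) (h + (En t : ℂ) • B t h) := by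
      intro h hh
      rw [hBdef']
      refine adjointRel_of_orth hrank hQ ?_ (hw t htr) (hwg t htr) hh
      simpa only [coe_smul] using hu
    obtain ⟨z, hz1, hz2, hz3⟩ := ex_pert_basis hJ (hw t htr)
      (hwg t htr) hB (hW t htr) (hunit' t ht δ hδ)
    refine ⟨z, hz1, hz2, fun k => ?_⟩
    obtain ⟨p, q, hpq, h⟩ := hz3 k
    refine ⟨p, q, hpq, h.trans ?_⟩
    simp only [hSapp]
    rfl
  · rintro ⟨t, δ⟩ ⟨ht, hδ⟩
    refine AnalyticAt.analyticWithinAt ?_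
    have hd := hall' t ht
    have hw' : ∀ j, AnalyticAt ℝ (fun q => w q.1 j) (t, δ) := fun j =>
      (hd.2.2.2.1 j).comp' (g := fun t => w t j) (f := fun q => q.1) (x := (t, δ)) analyticAt_fst
    have hR' : AnalyticAt ℝ (fun q => R q.1) (t, δ) := hd.2.2.2.2.comp' analyticAt_fst
    have hop : AnalyticAt ℝ (fun q : ℝ² => 1 - (-q.2) • (M * R q.1)) (t, δ) :=
      analyticAt_const.sub (analyticAt_snd.neg.smul (analyticAt_const.mul hR'))
    have hu : IsUnit (1 - (-δ) • (M * R t)) := by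
      have := hunit' t ht δ hδ
      rwa [← ofReal_neg, coe_smul] at this
    have hA' : AnalyticAt ℝ (fun q => A q.1 q.2) (t, δ) := by
      have h1 : AnalyticAt ℝ (Ring.inverse : (H →L[ℂ] H) → _) ((fun q => 1 - (-q.2) • (M * R q.1))
        (t, δ)) :=
        analyticAt_inverse hu.unit
      refine (h1.comp' (f := fun q => 1 - (-q.2) • (M * R q.1)) hop).congr (Eventually.of_forall fun q => ?_)
      simp only [hA, ← ofReal_neg, coe_smul]
    have hM' : AnalyticAt ℝ (fun q => M (w q.1 j)) (t, δ) :=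
      bilin_apply.anAt_comp (analyticAt_const) (hw' j)
    have hAM := bilin_apply.anAt_comp hA' hM'
    have hin := bilin_inner.anAt_comp (hw' k) hAM
    have hδa : AnalyticAt ℝ (fun q : ℝ² => ((q.2 : ℝ) : ℂ)) (t, δ) :=
      (ofRealCLM.analyticAt δ).comp' analyticAt_snd
    have := (analyticAt_const (𝕜 := ℝ) (x := (t, δ)) (v := (1 : Matrix ι ι ℂ) j k)).add
      ((hδa.mul (analyticAt_const (v := I))).mul hin).neg
    refine this.congr (Eventually.of_forall fun q => ?_)
    simp [hS]
  · have hd := hall' t ht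
    have hA1 : A t δ (M (w t j)) = M (w t j) - (δ : ℂ) • A t δ (M (R t (M (w t j)))) := by
      have := congrArg (fun T : H →L[ℂ] H => T (M (w t j)))
        (Ring.inverse_mul_cancel _ (hunit' t ht δ hδ))
      simp only [hA]
      rw [eq_sub_iff_add_eq]
      simpa using this
    have hAn : ‖A t δ‖ ≤ 2 := by
      have h1 := hsmall t ht δ hδ
      have h2 : A t δ = 1 + ((-(δ : ℂ)) • (M * R t)) * A t δ := by
        have := Ring.mul_inverse_cancel _ (hunit' t ht δ hδ)
        rw [sub_mul, one_mul, sub_eq_iff_eq_add] at this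
        exact this
      have h3 : ‖A t δ‖ ≤ 1 + 1 / 2 * ‖A t δ‖ := by
        conv_lhs => rw [h2]
        refine (norm_add_le _ _).trans (add_le_add ContinuousLinearMap.norm_id_le
          ((norm_mul_le _ _).trans (mul_le_mul_of_nonneg_right h1 (norm_nonneg _))))
      linarith
    rw [hSapp, hA1, inner_sub_right, inner_smul_right]
    have e : -(δ * I * (⟪w t k, M (w t j)⟫_ℂ - δ * ⟪w t k, A t δ (M (R t (M (w t j))))⟫_ℂ)) - -I * δ
      * ⟪w t k, M (w t j)⟫_ℂ = δ ^ 2 * (I * ⟪w t k, A t δ (M (R t (M (w t j))))⟫_ℂ) := by ring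
    rw [e, norm_mul, norm_pow, norm_real, norm_eq_abs, sq_abs, norm_mul, norm_I, one_mul, mul_comm]
    refine mul_le_mul_of_nonneg_right ?_ (sq_nonneg _)
    have hwk := (hd.2.2.1 k).le
    have hwj := (hd.2.2.1 j).le
    calc ‖⟪w t k, A t δ (M (R t (M (w t j))))⟫_ℂ‖
        ≤ ‖w t k‖ * ‖A t δ (M (R t (M (w t j))))‖ := norm_inner_le_norm _ _
      _ ≤ K' * (2 * (K₁ * (K' * (K₁ * K')))) := by
          have hK'0 : 0 ≤ K' := by linarith
          have hK₁0 : 0 ≤ K₁ := by linarith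
          refine mul_le_mul hwk ?_ (norm_nonneg _) hK'0
          refine (A t δ).le_of_opNorm_le_of_le hAn ?_
          refine M.le_of_opNorm_le_of_le hMK ?_
          refine (R t).le_of_opNorm_le_of_le hd.2.1.le ?_
          exact M.le_of_opNorm_le_of_le hMK hwj
      _ = 2 * K₁ ^ 2 * K' ^ 3 := by ring

end AbstractScattering

/-! ### Tools from analysis -/

section Tools

open scoped FourierTransform ENNReal

lemma fourier_toLp_ae_eq {g : ℝ → ℂ} (h1 : Integrable g) (h2 : MemLp g 2) : (𝓕 (h2.toLp g) : Lp ℂ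
  2 (volume : Measure ℝ)) =ᵐ[volume] 𝓕 g := by
  have hcont : Continuous (𝓕 g) :=
    VectorFourier.fourierIntegral_continuous continuous_fourierChar (by fun_prop) h1
  refine ae_eq_of_integral_contDiff_smul_eq
    ((Lp.memLp _).locallyIntegrable (by norm_num)) hcont.locallyIntegrable fun φ hφ hφc => ?_
  have hφ₁ : HasCompactSupport (ofRealCLM ∘ φ) := hφc.comp_left rfl
  have hφ₂ : ContDiff ℝ ∞ (ofRealCLM ∘ φ) := by fun_prop
  let s : SchwartzMap ℝ ℂ := hφ₁.toSchwartzMap hφ₂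
  have hs : ∀ x, s x = (φ x) := fun x => rfl
  have h3 := congrArg (fun T : TemperedDistribution ℝ ℂ => T s)
    (Lp.fourier_toTemperedDistribution_eq (h2.toLp g))
  simp only [TemperedDistribution.fourier_apply, Lp.toTemperedDistribution_apply] at h3
  have h4 : ∫ ξ, s ξ • 𝓕 g ξ = ∫ x, 𝓕 s x • g x := by
    have := VectorFourier.integral_fourierIntegral_smul_eq_flip (μ := volume) (ν := volume)
      (L := innerₗ ℝ) continuous_fourierChar (by fun_prop) s.integrable h1
    rw [flip_innerₗ] at this
    exact this.symm
  calc ∫ x, φ x • (𝓕 (h2.toLp g) : Lp ℂ 2 (volume : Measure ℝ)) x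
      = ∫ x, s x • (𝓕 (h2.toLp g) : Lp ℂ 2 (volume : Measure ℝ)) x := by
        refine integral_congr_ae (.of_forall fun x => ?_)
        simp only [hs, real_smul, smul_eq_mul]
    _ = ∫ x, (𝓕 s) x • (h2.toLp g) x := h3.symm
    _ = ∫ x, 𝓕 s x • g x := by
        refine integral_congr_ae ?_
        filter_upwards [h2.coeFn_toLp] with x hx
        rw [hx, SchwartzMap.fourier_coe]
    _ = ∫ ξ, s ξ • 𝓕 g ξ := h4.symm
    _ = ∫ x, φ x • 𝓕 g x := by
        refine integral_congr_ae (.of_forall fun x => ?_)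
        simp only [hs, real_smul, smul_eq_mul]

lemma eLpNorm_fourier_eq {g : ℝ → ℂ} (h1 : Integrable g) (h2 : MemLp g 2) : eLpNorm (𝓕 g) 2 volume
  = eLpNorm g 2 volume := by
  rw [← eLpNorm_congr_ae (fourier_toLp_ae_eq h1 h2), ← eLpNorm_congr_ae h2.coeFn_toLp,
    ← Lp.enorm_def, ← Lp.enorm_def, ← ofReal_norm, ← ofReal_norm, Lp.norm_fourier_eq]

/-- Cauchy's estimate for the second-order Taylor remainder. -/
lemma norm_taylor_le {V : Type*} [NormedAddCommGroup V] [NormedSpace ℂ V] [CompleteSpace V] {f : ℂ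
  → V} {c : ℂ} {R M : ℝ} (hR : 0 < R) (hf : DifferentiableOn ℂ f (ball c R)) (hM : ∀ z ∈ ball c R,
  ‖f z‖ ≤ M) {z : ℂ} (hz : z ∈ ball c (R / 4)) : ‖f z - f c - (z - c) • deriv f c‖ ≤ 32 * M / R ^ 2
  * ‖z - c‖ ^ 2 := by
  have cauchy : ∀ {h : ℂ → V} {ρ N : ℝ}, 0 < ρ → ρ ≤ R → DifferentiableOn ℂ h (ball c ρ) → (∀ z ∈
    ball c ρ, ‖h z‖ ≤ N) → ∀ x ∈ ball c (ρ / 2), ‖deriv h x‖ ≤ N / (ρ / 4) := by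
    intro h ρ N hρ _ hh hN x hx
    have hsub : closedBall x (ρ / 4) ⊆ ball c ρ := fun y hy => by
      rw [mem_closedBall] at hy; rw [mem_ball] at hx ⊢
      linarith [dist_triangle y x c]
    refine norm_deriv_le_of_forall_mem_sphere_norm_le (by positivity)
      ((hh.mono hsub).diffContOnCl_ball subset_rfl) fun y hy => hN y (hsub (sphere_subset_closedBall hy))
  have h1 : ∀ x ∈ ball c (R / 2), ‖deriv f x‖ ≤ M / (R / 4) := cauchy hR le_rfl hf hM
  have hd : DifferentiableOn ℂ (deriv f) (ball c (R / 2)) :=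
    (hf.deriv isOpen_ball).mono (ball_subset_ball (by linarith))
  have h2 : ∀ x ∈ ball c (R / 2 / 2), ‖deriv (deriv f) x‖ ≤ M / (R / 4) / (R / 2 / 4) :=
    cauchy (by positivity) (by linarith) hd h1
  have hz' : z ∈ ball c (R / 2 / 2) := by grind
  have hball : ∀ x ∈ ball c (R / 2 / 2), HasDerivAt (deriv f) (deriv (deriv f) x) x := fun x hx =>
    (hd.differentiableAt (isOpen_ball.mem_nhds (ball_subset_ball (by linarith) hx))).hasDerivAt
  have hfd : ∀ x ∈ ball c (R / 2 / 2), HasDerivAt f (deriv f x) x := fun x hx =>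
    (hf.differentiableAt (isOpen_ball.mem_nhds (ball_subset_ball (by linarith) hx))).hasDerivAt
  have hc : c ∈ ball c (R / 2 / 2) := mem_ball_self (by positivity)
  have h3 : ∀ x ∈ ball c (R / 2 / 2), ‖deriv f x - deriv f c‖ ≤ 32 * M / R ^ 2 * ‖x - c‖ := by
    intro x hx
    have := (convex_ball c (R / 2 / 2)).norm_image_sub_le_of_norm_hasDerivWithin_le
      (fun y hy => (hball y hy).hasDerivWithinAt) h2 hc hx
    refine this.trans (le_of_eq ?_)
    field_simp
    ring
  have hM0 := (norm_nonneg _).trans (hM c (mem_ball_self hR))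
  -- apply the mean value inequality on the ball of radius `‖z - c‖`
  set ρ := ‖z - c‖ with hρ
  have hsub : closedBall c ρ ⊆ ball c (R / 2 / 2) := fun y hy => by
    rw [mem_closedBall] at hy; rw [mem_ball] at hz' ⊢
    rw [dist_eq_norm] at hz'
    linarith
  have h4 := (convex_closedBall c ρ).norm_image_sub_le_of_norm_hasDerivWithin_le
    (f := fun x => f x - (x - c) • deriv f c)
    (y := z)
    (fun x hx => by
      have h5 := (hfd x (hsub hx)).sub (((hasDerivAt_id x).sub_const c).smul_const (deriv f c))
      rw [one_smul] at h5
      exact h5.hasDerivWithinAt)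
    (fun x hx => (h3 x (hsub hx)).trans (by
      rw [mem_closedBall, dist_eq_norm] at hx
      exact mul_le_mul_of_nonneg_left hx (by positivity)))
    (mem_closedBall_self (norm_nonneg _)) (by simp [hρ, dist_eq_norm])
  calc ‖f z - f c - (z - c) • deriv f c‖
      = ‖f z - (z - c) • deriv f c - (f c - (c - c) • deriv f c)‖ := by congr 1; simp; abel
    _ ≤ 32 * M / R ^ 2 * ρ * ‖z - c‖ := h4
    _ = 32 * M / R ^ 2 * ρ ^ 2 := by linarith

lemma aesm_deriv {α V : Type*} [MeasurableSpace α] {μ : Measure α} [NormedAddCommGroup V]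
  [NormedSpace ℂ V] {U : Set ℂ} (hU : IsOpen U) {f : ℂ → α → V} (hmeas : ∀ z ∈ U,
  AEStronglyMeasurable (f z) μ) (hdiff : ∀ᵐ a ∂μ, DifferentiableOn ℂ (fun z => f z a) U) {c : ℂ} (hc
  : c ∈ U) : AEStronglyMeasurable (fun a => deriv (fun z => f z a) c) μ := by
  obtain ⟨ρ, hρ, hball⟩ := isOpen_iff.1 hU c hc
  let u : ℕ → ℂ := fun n => c + (ρ / 2 * (1 / (n + 1)) : ℝ)
  have hu0 : ∀ n : ℕ, (0 : ℝ) < ρ / 2 * (1 / ((n : ℝ) + 1)) := fun n =>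
    mul_pos (half_pos hρ) (one_div_pos.2 (by positivity))
  have hu : ∀ n, u n ∈ U := fun n => hball (by
    simp only [u, mem_ball, dist_eq_norm, add_sub_cancel_left, norm_real,
      norm_eq_abs, abs_of_pos (hu0 n)]
    have : 1 / ((n : ℝ) + 1) ≤ 1 := by
      rw [div_le_one (by positivity)]; linarith [(Nat.cast_nonneg n : (0 : ℝ) ≤ n)]
    nlinarith)
  have hlim : Tendsto u atTop (𝓝[≠] c) := by
    refine tendsto_nhdsWithin_iff.2 ⟨?_, Eventually.of_forall fun n => ?_⟩
    · have h1 : Tendsto (fun n : ℕ => ρ / 2 * (1 / ((n : ℝ) + 1))) atTop (𝓝 0) := by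
        simpa using tendsto_one_div_add_atTop_nhds_zero_nat.const_mul (ρ / 2)
      have h2 := (continuous_ofReal.tendsto 0).comp h1
      simpa [u] using h2.const_add c
    · simp only [u, mem_compl_iff, mem_singleton_iff, add_eq_left, ofReal_eq_zero]
      exact (hu0 n).ne'
  refine aestronglyMeasurable_of_tendsto_ae atTop
    (f := fun n a => (u n - c)⁻¹ • (f (u n) a - f c a))
    (fun n => ((hmeas _ (hu n)).sub (hmeas _ hc)).const_smul _) ?_
  filter_upwards [hdiff] with a ha
  have h1 := (ha.differentiableAt (hU.mem_nhds hc)).hasDerivAt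
  exact (hasDerivAt_iff_tendsto_slope.1 h1).comp hlim

lemma diffOn_int {α V : Type*} [MeasurableSpace α] {μ : Measure α} [NormedAddCommGroup V]
  [NormedSpace ℂ V] [CompleteSpace V] {U : Set ℂ} (hU : IsOpen U) {f : ℂ → α → V} {bound : α → ℝ}
  (hmeas : ∀ z ∈ U, AEStronglyMeasurable (f z) μ) (hdiff : ∀ᵐ a ∂μ, DifferentiableOn ℂ (fun z => f z
  a) U) (hb : ∀ᵐ a ∂μ, ∀ z ∈ U, ‖f z a‖ ≤ bound a) (hbound : Integrable bound μ) : DifferentiableOn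
  ℂ (fun z => ∫ a, f z a ∂μ) U := by
  intro c hc
  obtain ⟨ρ, hρ, hball⟩ := isOpen_iff.1 hU c hc
  have hint : ∀ z ∈ U, Integrable (f z) μ := fun z hz =>
    hbound.mono' (hmeas z hz) (hb.mono fun a ha => ha z hz)
  have h := hasDerivAt_integral_of_dominated_loc_of_deriv_le (μ := μ) (F := f) (x₀ := c)
    (s := ball c (ρ / 2)) (bound := fun a => bound a / (ρ / 4))
    (F' := fun z a => deriv (fun z => f z a) z) (ball_mem_nhds c (by positivity))
    (eventually_of_mem (hU.mem_nhds hc) hmeas) (hint c hc)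
    (aesm_deriv hU hmeas hdiff hc) ?_ (hbound.div_const _) ?_
  · exact h.2.differentiableAt.differentiableWithinAt
  · filter_upwards [hdiff, hb] with a ha hba x hx
    have hsub : closedBall x (ρ / 4) ⊆ U := fun y hy => hball (by
      rw [mem_closedBall] at hy; rw [mem_ball] at hx ⊢
      linarith [dist_triangle y x c])
    exact norm_deriv_le_of_forall_mem_sphere_norm_le (by positivity)
      ((ha.mono hsub).diffContOnCl_ball subset_rfl)
      fun y hy => hba y (hsub (sphere_subset_closedBall hy))
  · filter_upwards [hdiff] with a ha x hx
    exact (ha.differentiableAt (hU.mem_nhds (hball (ball_subset_ball (by linarith) hx)))).hasDerivAt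

/-- A family of functions depending holomorphically on a parameter, with an `L²` majorant,
is holomorphic as an `L²`-valued map. -/
lemma diffOn_toLp {α V : Type*} [MeasurableSpace α] {μ : Measure α} [NormedAddCommGroup V]
  [NormedSpace ℂ V] [CompleteSpace V] {U : Set ℂ} (hU : IsOpen U) {f : ℂ → α → V} {bound : α → ℝ}
  (hbound : MemLp bound 2 μ) (hdiff : ∀ᵐ a ∂μ, DifferentiableOn ℂ (fun z => f z a) U) (hb : ∀ᵐ a ∂μ,
  ∀ z ∈ U, ‖f z a‖ ≤ bound a) {F : ℂ → Lp V 2 μ} (hF : ∀ z ∈ U, F z =ᵐ[μ] f z) : DifferentiableOn ℂ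
  F U := by
  intro c hc
  obtain ⟨ρ, hρ, hball⟩ := isOpen_iff.1 hU c hc
  have hmeas : ∀ z ∈ U, AEStronglyMeasurable (f z) μ := fun z hz =>
    (Lp.aestronglyMeasurable (F z)).congr (hF z hz)
  have hdm := aesm_deriv hU hmeas hdiff hc
  have hdb : ∀ᵐ a ∂μ, ‖deriv (fun z => f z a) c‖ ≤ (ρ / 4)⁻¹ * bound a := by
    filter_upwards [hdiff, hb] with a ha hba
    have hsub : closedBall c (ρ / 4) ⊆ U := (closedBall_subset_ball (by linarith)).trans hball
    rw [inv_mul_eq_div]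
    exact norm_deriv_le_of_forall_mem_sphere_norm_le (by positivity)
      ((ha.mono hsub).diffContOnCl_ball subset_rfl)
      fun y hy => hba y (hsub (sphere_subset_closedBall hy))
  have hdL := (hbound.const_mul (ρ / 4)⁻¹).mono' hdm hdb
  set K : ℝ := 32 / ρ ^ 2 * ‖hbound.toLp bound‖ with hK
  have hmain : ∀ z ∈ ball c (ρ / 4), ‖F z - F c - (z - c) • hdL.toLp _‖ ≤ K * ‖z - c‖ ^ 2 := by
    intro z hz
    have hzU := hball (ball_subset_ball (by linarith) hz)
    have h1 : ∀ᵐ a ∂μ, ‖(F z - F c - (z - c) • hdL.toLp _ : Lp V 2 μ) a‖ ≤ (32 / ρ ^ 2 * ‖z - c‖ ^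
      2) * ‖(hbound.toLp bound) a‖ := by
      filter_upwards [Lp.coeFn_sub (F z - F c) ((z - c) • hdL.toLp _), Lp.coeFn_sub (F z) (F c),
        Lp.coeFn_smul (z - c) (hdL.toLp _), hdL.coeFn_toLp, hF z hzU, hF c hc, hdiff, hb,
        hbound.coeFn_toLp] with a e1 e2 e3 e4 e5 e6 hd hba e7
      rw [e1, Pi.sub_apply, e2, Pi.sub_apply, e3, Pi.smul_apply, e4, e5, e6, e7]
      have h2 := norm_taylor_le hρ (hd.mono hball) (fun y hy => hba y (hball hy)) hz
      refine h2.trans ?_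
      have h3 : bound a ≤ ‖bound a‖ := le_abs_self _
      calc 32 * bound a / ρ ^ 2 * ‖z - c‖ ^ 2 = (32 / ρ ^ 2 * ‖z - c‖ ^ 2) * bound a := by ring
        _ ≤ _ := mul_le_mul_of_nonneg_left h3 (by positivity)
    refine (Lp.norm_le_mul_norm_of_ae_le_mul h1).trans (le_of_eq ?_)
    rw [hK]; ring
  refine HasDerivAt.differentiableAt (f' := hdL.toLp _) ?_ |>.differentiableWithinAt
  rw [hasDerivAt_iff_isLittleO]
  have hO : (fun z => F z - F c - (z - c) • hdL.toLp _) =O[𝓝 c] fun z => ‖z - c‖ ^ 2 := by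
    refine Asymptotics.IsBigO.of_bound K ?_
    filter_upwards [ball_mem_nhds c (by positivity : 0 < ρ / 4)] with z hz
    simpa using hmain z hz
  refine hO.trans_isLittleO ?_
  have : (fun z => ‖z - c‖ ^ 2) =o[𝓝 c] fun z => ‖z - c‖ ^ 1 := by
    have h := Asymptotics.isLittleO_pow_pow (𝕜 := ℝ) (m := 1) (n := 2) (by norm_num)
    have ht : Tendsto (fun z => ‖z - c‖) (𝓝 c) (𝓝 0) := by
      have : Continuous fun z => ‖z - c‖ := by fun_prop
      simpa using this.tendsto c
    exact h.comp_tendsto ht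
  simp only [pow_one] at this
  exact this.of_norm_right

end Tools

/-! ### Thresholds -/

lemma parity_mul_self (j : ℕ) : parity j * parity j = 1 := by
  rw [parity, ← pow_add, ← two_mul]; exact (even_two_mul _).neg_one_pow

lemma parity_ne_zero (j : ℕ) : parity j ≠ 0 := fun h => by simpa [h] using parity_mul_self j

lemma abs_parity (j : ℕ) : |parity j| = 1 := by simp [parity, abs_pow]

lemma parity_eq_or (i j : ℕ) : parity i = parity j ∨ parity i = -parity j := by
  have h : ∀ k, parity k = 1 ∨ parity k = -1 := fun k => neg_one_pow_eq_or ℝ _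
  rcases h i with hi | hi <;> rcases h j with hj | hj <;> simp [hi, hj]

lemma parity_mul_sin_pos (ht : t ∈ Ioo ((j - 1 : ℝ) * π) (j * π)) : 0 < parity j * Real.sin t :=
  by
  have h1 : Real.sin (t - (j - 1) * π) = parity j * Real.sin t := by
    have h2 : t - (j - 1) * π = t + π - j * π := by ring
    rw [h2, sin_sub_nat_mul_pi, Real.sin_add_pi, parity, pow_succ]
    ring
  rw [← h1]
  refine sin_pos_of_pos_of_lt_pi (by linarith [ht.1]) ?_
  have := ht.2
  linarith

/-- The numerator `t cos t - sin t` of `(sin t / t)'`. -/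
def sincNum (t : ℝ) : ℝ := t * Real.cos t - Real.sin t

lemma derivAt_sincNum (t : ℝ) : HasDerivAt sincNum (-(t * Real.sin t)) t := by
  have := ((hasDerivAt_id t).mul (Real.hasDerivAt_cos t)).sub (Real.hasDerivAt_sin t)
  refine this.congr_deriv ?_
  simp only [id]
  ring

lemma derivAt_sinc (ht : t ≠ 0) : HasDerivAt sinc (sincNum t / t ^ 2) t := by
  have h := (Real.hasDerivAt_sin t).div (hasDerivAt_id t) ht
  have h2 : HasDerivAt (fun x => Real.sin x / x) (sincNum t / t ^ 2) t := by
    refine h.congr_deriv ?_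
    simp only [id, sincNum]
    ring
  refine h2.congr_of_eventuallyEq ?_
  filter_upwards [isOpen_ne.mem_nhds ht] with x hx
  exact sinc_of_ne_zero hx

lemma pos_of_mem_Ioo_branch (hj : 1 ≤ j) (ht : (j - 1 : ℝ) * π < t) : 0 < t := by
  have : (1 : ℝ) ≤ j := by exact_mod_cast hj
  have := mul_nonneg (sub_nonneg.2 this) pi_pos.le
  linarith

lemma anti_parity_sincNum (hj : 1 ≤ j) : StrictAntiOn (fun t => parity j * sincNum t) (Icc
  ((j - 1 : ℝ) * π) (j * π)) := by
  refine strictAntiOn_of_deriv_neg (convex_Icc _ _) ?_ fun t ht => ?_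
  · exact fun t _ => ((derivAt_sincNum t).const_mul _).continuousAt.continuousWithinAt
  · rw [interior_Icc] at ht
    rw [((derivAt_sincNum t).const_mul _).deriv]
    have h1 := parity_mul_sin_pos ht
    have h2 := pos_of_mem_Ioo_branch hj ht.1
    nlinarith [mul_pos h1 h2]

lemma parity_sinc_pos (hj : 1 ≤ j) (ht : t ∈ Ioo ((j - 1 : ℝ) * π) (j * π)) : 0 < parity j * sinc
  t := by
  have h2 := pos_of_mem_Ioo_branch hj ht.1
  rw [sinc_of_ne_zero h2.ne', ← mul_div_assoc]
  exact div_pos (parity_mul_sin_pos ht) h2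

lemma kappaMax_one : kappaMax 1 = 0 := by
  obtain ⟨h1, h2⟩ := kappaMax_spec le_rfl
  by_contra hne
  have hpos : 0 < kappaMax 1 := lt_of_le_of_ne (by grind) (Ne.symm hne)
  have h3 : sinc 0 ^ 2 ≤ sinc (kappaMax 1) ^ 2 := h2 (by simp [pi_pos])
  rw [sinc_zero, sinc_of_ne_zero hne] at h3
  have h4 := sin_lt hpos
  have h5 := sin_pos_of_pos_of_lt_pi hpos (by grind)
  have h6 := (div_lt_one hpos).2 h4
  have h7 := div_pos h5 hpos
  nlinarith

lemma kappaMax_nonneg (hj : 1 ≤ j) : 0 ≤ kappaMax j := by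
  have h := (kappaMax_spec hj).1.1
  have : (1 : ℝ) ≤ j := by exact_mod_cast hj
  exact (mul_nonneg (sub_nonneg.2 this) pi_pos.le).trans h

lemma kappaMax_lt (hj : 1 ≤ j) : kappaMax j < j * π := (kappaMax_spec hj).1.2

lemma kappaMax_mem_Ioo (hj : 2 ≤ j) : kappaMax j ∈ Ioo ((j - 1 : ℝ) * π) (j * π) := by
  have hj1 : 1 ≤ j := by omega
  obtain ⟨h1, h2⟩ := kappaMax_spec hj1
  refine ⟨lt_of_le_of_ne h1.1 fun h => ?_, h1.2⟩
  set t := (j - 1 / 2) * π with ht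
  have htm : t ∈ Ioo ((j - 1) * π) (j * π) := by grind
  have h3 : sinc t ^ 2 ≤ sinc (kappaMax j) ^ 2 := h2 ⟨htm.1.le, htm.2⟩
  have h4 := parity_sinc_pos hj1 htm
  have h5 : sinc (kappaMax j) = 0 := by
    have hne : (j - 1) * π ≠ 0 := by
      have : (2 : ℝ) ≤ j := by exact_mod_cast hj
      have := pi_pos
      exact (mul_pos (by linarith) this).ne'
    rw [← h, sinc_of_ne_zero hne]
    have h6 : ((j - 1 : ℕ) : ℝ) = j - 1 := by push_cast [hj1]; ring
    rw [← h6, Real.sin_nat_mul_pi, zero_div]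
  rw [h5] at h3
  have h6 : sinc t = 0 := by nlinarith [sq_nonneg (sinc t)]
  simp [h6] at h4

lemma sincNum_kappaMax (hj : 1 ≤ j) : sincNum (kappaMax j) = 0 := by
  rcases hj.eq_or_lt with rfl | h
  · simp [kappaMax_one, sincNum]
  have hm := kappaMax_mem_Ioo h
  have hpos := pos_of_mem_Ioo_branch hj hm.1
  have h1 : IsLocalMax (fun t => sinc t ^ 2) (kappaMax j) := by
    filter_upwards [Ioo_mem_nhds hm.1 hm.2] with t ht
    exact (kappaMax_spec hj).2 ⟨ht.1.le, ht.2⟩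
  have h2 := h1.hasDerivAt_eq_zero ((derivAt_sinc hpos.ne').pow 2)
  have h3 := parity_sinc_pos hj hm
  have h4 : sinc (kappaMax j) ≠ 0 := fun h => by simp [h] at h3
  simpa [h4, hpos.ne'] using h2

lemma sincNum_pos_left (hj : 1 ≤ j) (h1 : (j - 1 : ℝ) * π ≤ t) (h2 : t < kappaMax j) : 0 < parity
  j * sincNum t := by
  have hm := kappaMax_lt hj
  have := anti_parity_sincNum hj ⟨h1, (h2.trans hm).le⟩ ⟨h1.trans h2.le, hm.le⟩ h2
  simpa [sincNum_kappaMax hj] using this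

lemma sincNum_neg_right (hj : 1 ≤ j) (h1 : kappaMax j < t) (h2 : t ≤ j * π) : parity j * sincNum t
  < 0 := by
  have hm := (kappaMax_spec hj).1
  have := anti_parity_sincNum hj ⟨hm.1, hm.2.le⟩ ⟨hm.1.trans h1.le, h2⟩ h1
  simpa [sincNum_kappaMax hj] using this

lemma smonoOn_parity_sinc (hj : 1 ≤ j) : StrictMonoOn (fun t => parity j * sinc t) (Icc ((j - 1 :
  ℝ) * π) (kappaMax j)) := by
  refine strictMonoOn_of_deriv_pos (convex_Icc _ _)
    (continuous_const.mul continuous_sinc).continuousOn fun t ht => ?_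
  rw [interior_Icc] at ht
  have h0 := pos_of_mem_Ioo_branch hj ht.1
  rw [((derivAt_sinc h0.ne').const_mul _).deriv, ← mul_div_assoc]
  exact div_pos (sincNum_pos_left hj ht.1.le ht.2) (by positivity)

lemma anti_parity_sinc (hj : 1 ≤ j) : StrictAntiOn (fun t => parity j * sinc t) (Icc
  (kappaMax j) (j * π)) := by
  refine strictAntiOn_of_deriv_neg (convex_Icc _ _)
    (continuous_const.mul continuous_sinc).continuousOn fun t ht => ?_
  rw [interior_Icc] at ht
  have h0 := (kappaMax_nonneg hj).trans_lt ht.1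
  rw [((derivAt_sinc h0.ne').const_mul _).deriv, ← mul_div_assoc]
  exact div_neg_of_neg_of_pos (sincNum_neg_right hj ht.1 ht.2.le) (by positivity)

lemma parity_sinc_kappaMax_pos (hj : 1 ≤ j) : 0 < parity j * sinc (kappaMax j) := by
  rcases hj.eq_or_lt with rfl | h
  · simp [kappaMax_one, parity]
  · exact parity_sinc_pos hj (kappaMax_mem_Ioo h)

lemma inv_omegaThr (hj : 1 ≤ j) : (ωₜ j)⁻¹ = parity j * sinc (kappaMax j) := by
  rw [omegaThreshold, inv_inv, ← abs_of_pos (parity_sinc_kappaMax_pos hj), abs_mul, abs_parity,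
    one_mul]

lemma omegaThr_pos (hj : 1 ≤ j) : 0 < ωₜ j := by
  rw [← inv_pos, inv_omegaThr hj]; exact parity_sinc_kappaMax_pos hj

lemma cos_kappaMax (hj : 1 ≤ j) : Real.cos (kappaMax j) = sinc (kappaMax j) := by
  have h := sincNum_kappaMax hj
  by_cases h0 : kappaMax j = 0
  · simp [h0]
  · rw [sinc_of_ne_zero h0, eq_div_iff h0]
    rw [sincNum] at h
    linarith

lemma omegaThr_sq (hj : 1 ≤ j) : ωₜ j ^ 2 = 1 + kappaMax j ^ 2 := by
  have h1 := inv_omegaThr hj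
  have hpos := omegaThr_pos hj
  have h2 : (ωₜ j)⁻¹ ^ 2 = sinc (kappaMax j) ^ 2 := by
    rw [h1, mul_pow, pow_two (parity j), parity_mul_self, one_mul]
  have h3 : Real.sin (kappaMax j) = kappaMax j * sinc (kappaMax j) := by
    by_cases h0 : kappaMax j = 0
    · simp [h0]
    · rw [sinc_of_ne_zero h0]; field_simp
  have h4 := Real.sin_sq_add_cos_sq (kappaMax j)
  rw [h3, cos_kappaMax hj] at h4
  have h5 : (ωₜ j)⁻¹ ^ 2 * (1 + kappaMax j ^ 2) = 1 := by grind
  rw [inv_pow] at h5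
  have h6 : ωₜ j ^ 2 ≠ 0 := by positivity
  field_simp at h5
  linarith

lemma kappaMax_smono {i : ℕ} (hi : 1 ≤ i) (hij : i < j) : kappaMax i < kappaMax j := by
  have hj := hi.trans hij.le
  refine (kappaMax_lt hi).trans_le (le_trans ?_ (kappaMax_spec hj).1.1)
  refine mul_le_mul_of_nonneg_right ?_ pi_pos.le
  have : (i : ℝ) + 1 ≤ j := by exact_mod_cast hij
  linarith

lemma omegaThr_smono {i : ℕ} (hi : 1 ≤ i) (hij : i < j) : ωₜ i < ωₜ j :=
  by
  have hj := hi.trans hij.le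
  have h := kappaMax_smono hi hij
  refine lt_of_pow_lt_pow_left₀ 2 (omegaThr_pos hj).le ?_
  rw [omegaThr_sq hi, omegaThr_sq hj]
  nlinarith [kappaMax_nonneg hi]

lemma omegaThr_one : ωₜ 1 = 1 := by simp [omegaThreshold, kappaMax_one]

lemma one_lt_omegaThr (hN : 2 ≤ N) : 1 < ωₜ N := by
  rw [← omegaThr_one]; exact omegaThr_smono le_rfl hN

/-! ### Branches of the Disp relation -/

/-- The characterization of `kappaBranch`. -/
def IsBranch (En : ℝ) (j : ℕ) (τ : Bool) (κ : ℝ) : Prop := κ ∈ Ioo ((j - 1 : ℝ) * π) (j * π) ∧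
    Real.sin κ / κ = parity j / En ∧ (if τ then κ < kappaMax j else kappaMax j < κ)

lemma IsBranch.unique (hj : 1 ≤ j) {κ' : ℝ} (h : IsBranch En j τ κ) (h' : IsBranch En j τ κ') : κ
  = κ' := by
  have e : ∀ {x}, IsBranch En j τ x → parity j * sinc x = parity j * (parity j / En) :=
    fun hx => by rw [sinc_of_ne_zero (pos_of_mem_Ioo_branch hj hx.1.1).ne', hx.2.1]
  have heq := (e h).trans (e h').symm
  cases τ
  · simp only [IsBranch, Bool.false_eq_true, if_false] at h h'
    exact (anti_parity_sinc hj).injOn ⟨h.2.2.le, h.1.2.le⟩ ⟨h'.2.2.le, h'.1.2.le⟩ heq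
  · simp only [IsBranch, if_true] at h h'
    exact (smonoOn_parity_sinc hj).injOn ⟨h.1.1.le, h.2.2.le⟩ ⟨h'.1.1.le, h'.2.2.le⟩ heq

lemma sinc_nat_mul_pi {n : ℕ} (hn : n ≠ 0) : sinc (n * π) = 0 := by
  rw [sinc_of_ne_zero (mul_ne_zero (by positivity) pi_ne_zero), Real.sin_nat_mul_pi, zero_div]

lemma ex_isBranch (hj : 1 ≤ j) (hτ : (j, τ) ≠ (1, true)) (hEn : ωₜ j < En) : ∃ κ,
  IsBranch En j τ κ := by
  have hEpos := (omegaThr_pos hj).trans hEn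
  have h1 : En⁻¹ < parity j * sinc (kappaMax j) := by
    rw [← inv_omegaThr hj]
    exact inv_strictAnti₀ (omegaThr_pos hj) hEn
  have h0 : 0 < En⁻¹ := inv_pos.2 hEpos
  have hcont : Continuous fun t => parity j * sinc t := continuous_const.mul continuous_sinc
  have hm := (kappaMax_spec hj).1
  have hfin : ∀ {x : ℝ}, 0 < x → parity j * sinc x = En⁻¹ → Real.sin x / x = parity j / En := by
    intro x hx h
    rw [← sinc_of_ne_zero hx.ne', div_eq_mul_inv, ← h, ← mul_assoc, parity_mul_self, one_mul]
  cases τ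
  · obtain ⟨x, hx, hxe⟩ := intermediate_value_Ioo' hm.2.le hcont.continuousOn
      (show En⁻¹ ∈ Ioo (parity j * sinc (j * π)) (parity j * sinc (kappaMax j)) by
        rw [sinc_nat_mul_pi (by omega)]; exact ⟨by simpa using h0, h1⟩)
    have hx0 := (kappaMax_nonneg hj).trans_lt hx.1
    exact ⟨x, ⟨hm.1.trans_lt hx.1, hx.2⟩, hfin hx0 hxe, by grind⟩
  · have hj2 : 2 ≤ j := by grind
    have hcast : ((j - 1 : ℕ) : ℝ) = j - 1 := by push_cast [hj]; ring
    obtain ⟨x, hx, hxe⟩ := intermediate_value_Ioo hm.1 hcont.continuousOn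
      (show En⁻¹ ∈ Ioo (parity j * sinc ((j - 1 : ℝ) * π))
        (parity j * sinc (kappaMax j)) by
        rw [← hcast, sinc_nat_mul_pi (by omega)]; exact ⟨by simpa using h0, h1⟩)
    exact ⟨x, ⟨hx.1, hx.2.trans hm.2⟩, hfin (pos_of_mem_Ioo_branch hj hx.1) hxe, by grind⟩

lemma kappaBr_spec (hj : 1 ≤ j) (hτ : (j, τ) ≠ (1, true)) (hEn : ωₜ j < En) : IsBranch
  En j τ (kappaBranch En j τ) :=
  Classical.epsilon_spec (ex_isBranch hj hτ hEn)

lemma IsBranch.pos (hj : 1 ≤ j) (h : IsBranch En j τ κ) : 0 < κ := pos_of_mem_Ioo_branch hj h.1.1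

lemma IsBranch.sin_ne_zero (h : IsBranch En j τ κ) : Real.sin κ ≠ 0 := fun h0 => by
  simpa [h0] using parity_mul_sin_pos h.1

lemma IsBranch.sin_eq (hj : 1 ≤ j) (h : IsBranch En j τ κ) : Real.sin κ = parity j / En * κ := by
  rw [← h.2.1, div_mul_cancel₀ _ (h.pos hj).ne']

lemma IsBranch.cos_eq (hj : 1 ≤ j) (h : IsBranch En j τ κ) : Real.cos κ = κ * Real.cot κ * (parity
  j / En) := by
  rw [Real.cot_eq_cos_div_sin]
  have h1 := h.sin_ne_zero
  rw [← h.2.1]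
  have := (h.pos hj).ne'
  field_simp

lemma IsBranch.sq_add_sq (hEn : 0 < En) (hj : 1 ≤ j) (h : IsBranch En j τ κ) : κ ^ 2 + (κ *
  Real.cot κ) ^ 2 = En ^ 2 := by
  have h1 := Real.sin_sq_add_cos_sq κ
  rw [h.cos_eq hj, h.sin_eq hj] at h1
  have h2 := parity_mul_self j
  have h3 : (parity j / En) ^ 2 * En ^ 2 = 1 := by grind
  linear_combination (En ^ 2) * h1 - (κ ^ 2 + (κ * Real.cot κ) ^ 2) * h3

lemma IsBranch.lambda_sub_one (h : IsBranch En j τ κ) : κ * Real.cot κ - 1 = sincNum κ / Real.sin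
  κ := by
  have h1 := h.sin_ne_zero
  rw [Real.cot_eq_cos_div_sin, sincNum]
  field_simp

lemma IsBranch.lambda_gt (hj : 1 ≤ j) (h : IsBranch En j true κ) : 1 < κ * Real.cot κ := by
  have h1 := sincNum_pos_left hj h.1.1.le (by simpa using h.2.2)
  have h2 := parity_mul_sin_pos h.1
  have h3 : sincNum κ / Real.sin κ = (parity j * sincNum κ) / (parity j * Real.sin κ) := by grind
  have := h.lambda_sub_one
  rw [h3] at this
  linarith [div_pos h1 h2]

lemma IsBranch.lambda_lt (hj : 1 ≤ j) (h : IsBranch En j false κ) : κ * Real.cot κ < 1 := by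
  have h1 := sincNum_neg_right hj (by simpa using h.2.2) h.1.2.le
  have h2 := parity_mul_sin_pos h.1
  have h3 : sincNum κ / Real.sin κ = (parity j * sincNum κ) / (parity j * Real.sin κ) := by grind
  have := h.lambda_sub_one
  rw [h3] at this
  linarith [div_neg_of_neg_of_pos h1 h2]

lemma IsBranch.index_unique {i : ℕ} (hi : 1 ≤ i) {σ : Bool} (h : IsBranch En i σ κ) (h' : IsBranch
  En j τ κ) : i = j ∧ σ = τ := by
  have hij : i = j := by
    have h1 := h.1.1.trans h'.1.2
    have h2 := h'.1.1.trans h.1.2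
    have h3 := (mul_lt_mul_iff_left₀ pi_pos).1 h1
    have h4 := (mul_lt_mul_iff_left₀ pi_pos).1 h2
    have h5 : (i : ℝ) < j + 1 := by linarith
    have h6 : (j : ℝ) < i + 1 := by linarith
    have h7 : i < j + 1 := by exact_mod_cast h5
    have h8 : j < i + 1 := by exact_mod_cast h6
    omega
  subst hij
  refine ⟨rfl, ?_⟩
  have a := h.2.2
  have b := h'.2.2
  cases σ <;> cases τ <;> simp at a b ⊢ <;> linarith

/-- Positive solutions of `|sin κ| / κ = 1 / ω_N` lie on the branches, or at the threshold. -/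
lemma isBranch_or_eq_kappaMax (hN : 1 ≤ N) (hκ : 0 < κ) (h : |sinc κ| = (ωₜ N)⁻¹) : κ
  = kappaMax N ∨ ∃ j τ, 1 ≤ j ∧ j < N ∧ (j, τ) ≠ (1, true) ∧ IsBranch (ωₜ N) j τ κ := by
  have hω := omegaThr_pos hN
  set j := ⌊κ / π⌋₊ + 1 with hj
  have hj1 : 1 ≤ j := by omega
  have hlo : (j - 1) * π ≤ κ := by
    have := Nat.floor_le (div_nonneg hκ.le pi_pos.le)
    rw [hj]; push_cast
    rw [add_sub_cancel_right]
    exact (le_div_iff₀ pi_pos).1 this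
  have hhi : κ < j * π := by
    have := Nat.lt_floor_add_one (κ / π)
    rw [hj]; push_cast
    exact (div_lt_iff₀ pi_pos).1 this
  have hlo' : (j - 1) * π < κ := by
    refine lt_of_le_of_ne hlo fun he => ?_
    have h1 : ((j - 1 : ℕ) : ℝ) = j - 1 := by grind
    rw [← he, ← h1, sinc_nat_mul_pi, abs_zero] at h
    · exact (inv_pos.2 hω).ne h
    · rintro h0
      rw [← h1, h0] at he
      simp at he
      exact hκ.ne he
  have hs : parity j * sinc κ = (ωₜ N)⁻¹ := by
    rw [← h, ← abs_of_pos (parity_sinc_pos hj1 ⟨hlo', hhi⟩), abs_mul, abs_parity, one_mul]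
  have hle : (ωₜ N)⁻¹ ≤ (ωₜ j)⁻¹ := by
    have h1 := (kappaMax_spec hj1).2 ⟨hlo, hhi⟩
    rw [← h, omegaThreshold, inv_inv]
    exact sq_le_sq.1 h1
  have hjN : j ≤ N := by
    by_contra hcon
    have := omegaThr_smono hN (not_le.1 hcon)
    have := inv_strictAnti₀ hω this
    linarith
  have hneq : j ≠ N → κ ≠ kappaMax j := by
    intro hne he
    have h1 := omegaThr_smono hj1 (lt_of_le_of_ne hjN hne)
    have h2 := inv_strictAnti₀ (omegaThr_pos hj1) h1
    rw [he, ← inv_omegaThr hj1] at hs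
    linarith
  have hsin : Real.sin κ / κ = parity j / ωₜ N := by
    rw [← sinc_of_ne_zero hκ.ne', div_eq_mul_inv, ← hs, ← mul_assoc, parity_mul_self, one_mul]
  rcases eq_or_ne j N with he | hne
  · left
    rw [← he] at hs ⊢
    rw [inv_omegaThr hj1] at hs
    have hm := (kappaMax_spec hj1).1
    rcases le_total κ (kappaMax j) with hc | hc
    · exact (smonoOn_parity_sinc hj1).injOn ⟨hlo, hc⟩ ⟨hm.1, le_rfl⟩ hs
    · exact (anti_parity_sinc hj1).injOn ⟨hc, hhi.le⟩ ⟨le_rfl, hm.2.le⟩ hs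
  · right
    have hlt := lt_of_le_of_ne hjN hne
    rcases lt_or_gt_of_ne (hneq hne) with hc | hc
    · refine ⟨j, true, hj1, hlt, ?_, ⟨hlo', hhi⟩, hsin, by simpa using hc⟩
      intro he
      rw [(Prod.mk.inj he).1, kappaMax_one] at hc
      linarith
    · exact ⟨j, false, hj1, hlt, by simp, ⟨hlo', hhi⟩, hsin, by simpa using hc⟩

/-! ### Entire functions of `κ²` -/

/-- `cos √s`. -/
def cosSqrt (s : ℂ) : ℂ := cos (sqrt s)

/-- `sin √s / √s`. -/
def sincSqrt (s : ℂ) : ℂ := csinc (sqrt s)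

lemma sqrt_sq_eq (s : ℂ) : sqrt s ^ 2 = s := by
  rw [sqrt, ← cpow_nat_mul]
  norm_num

lemma csinc_neg (z : ℂ) : csinc (-z) = csinc z := by by_cases h : z = 0 <;> simp [csinc, h]

lemma mul_csinc (z : ℂ) : z * csinc z = sin z := by
  by_cases h : z = 0
  · simp [h]
  · rw [csinc, if_neg h]; field_simp

lemma cosSqrt_eq {κ s : ℂ} (h : κ ^ 2 = s) : cosSqrt s = cos κ := by
  have h1 : sqrt s ^ 2 = κ ^ 2 := by rw [sqrt_sq_eq, h]
  rcases sq_eq_sq_iff_eq_or_eq_neg.1 h1 with h2 | h2 <;> simp [cosSqrt, h2]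

lemma sincSqrt_eq {κ s : ℂ} (h : κ ^ 2 = s) : sincSqrt s = csinc κ := by
  have h1 : sqrt s ^ 2 = κ ^ 2 := by rw [sqrt_sq_eq, h]
  rcases sq_eq_sq_iff_eq_or_eq_neg.1 h1 with h2 | h2 <;> simp [sincSqrt, h2, csinc_neg]

lemma diff_csinc : Differentiable ℂ csinc := by
  have h : csinc = dslope sin 0 := by
    ext z
    by_cases hz : z = 0
    · simp [hz, csinc, dslope_same]
    · rw [dslope_of_ne _ hz, csinc, if_neg hz, slope_def_field]; simp
  rw [h, ← differentiableOn_univ]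
  exact (differentiableOn_dslope univ_mem).2 differentiable_sin.differentiableOn

lemma derivAt_csinc {z : ℂ} (hz : z ≠ 0) : HasDerivAt csinc ((cos z - csinc z) / z) z := by
  have h := (hasDerivAt_sin z).div (hasDerivAt_id z) hz
  have h2 : HasDerivAt (fun x => sin x / x) ((cos z - csinc z) / z) z := by
    refine h.congr_deriv ?_
    simp only [csinc, if_neg hz, id]
    field_simp
  refine h2.congr_of_eventuallyEq ?_
  filter_upwards [isOpen_ne.mem_nhds hz] with x hx
  rw [csinc, if_neg hx]

lemma ex_local_sqrt {s : ℂ} (hs : s ≠ 0) : ∃ r : ℂ → ℂ, (∀ z, r z ^ 2 = z) ∧ r s ≠ 0 ∧ HasDerivAt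
  r (1 / (2 * r s)) s := by
  have key : ∀ r : ℂ → ℂ, (∀ z, r z ^ 2 = z) → DifferentiableAt ℂ r s → r s ≠ 0 ∧ HasDerivAt r (1 /
    (2 * r s)) s := by
    intro r hr hd
    have h0 : r s ≠ 0 := fun h => hs (by grind)
    refine ⟨h0, ?_⟩
    have h1 : HasDerivAt (fun z => r z ^ 2) 1 s := by simp only [hr]; exact hasDerivAt_id s
    have h2 := (hd.hasDerivAt.pow 2).unique h1
    have h3 : deriv r s = 1 / (2 * r s) := by grind
    rw [← h3]; exact hd.hasDerivAt
  by_cases h : s ∈ slitPlane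
  · exact ⟨sqrt, sqrt_sq_eq, key _ sqrt_sq_eq (differentiableAt_sqrt h)⟩
  · have h' : -s ∈ slitPlane := by
      rw [mem_slitPlane_iff, not_or, not_lt, not_not] at h
      rw [mem_slitPlane_iff]
      left
      rw [neg_re]
      rcases h.1.lt_or_eq with h1 | h1
      · linarith
      · exact absurd (ext h1 h.2) hs
    have hr : ∀ z, (I * sqrt (-z)) ^ 2 = z := fun z => by rw [mul_pow, sqrt_sq_eq, I_sq]; ring
    refine ⟨fun z => I * sqrt (-z), hr, key _ hr ?_⟩
    have h1 := differentiableAt_sqrt h'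
    exact (h1.comp s differentiableAt_id.neg).const_mul _

lemma derivAt_cosSqrt' {s : ℂ} (hs : s ≠ 0) : HasDerivAt cosSqrt (-sincSqrt s / 2) s := by
  obtain ⟨r, hr, h0, hd⟩ := ex_local_sqrt hs
  have h1 : cosSqrt = fun z => cos (r z) := funext fun z => cosSqrt_eq (hr z)
  rw [h1, sincSqrt_eq (hr s)]
  refine ((hasDerivAt_cos (r s)).comp s hd).congr_deriv ?_
  rw [← mul_csinc]
  field_simp

lemma derivAt_sincSqrt {s : ℂ} (hs : s ≠ 0) : HasDerivAt sincSqrt ((cosSqrt s - sincSqrt s) / (2 *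
  s)) s := by
  obtain ⟨r, hr, h0, hd⟩ := ex_local_sqrt hs
  have h1 : sincSqrt = fun z => csinc (r z) := funext fun z => sincSqrt_eq (hr z)
  rw [cosSqrt_eq (hr s), h1]
  refine ((derivAt_csinc h0).comp s hd).congr_deriv ?_
  have h2 := hr s
  have h3 : (cos (r s) - csinc (r s)) / r s * (1 / (2 * r s)) = (cos (r s) - csinc (r s)) / (2 * r s
    ^ 2) := by field_simp
  rw [h3, h2]

lemma diff_of_ne_zero {f : ℂ → ℂ} (h : ∀ s ≠ 0, DifferentiableAt ℂ f s) (hc : ContinuousAt f 0) :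
  Differentiable ℂ f := by
  intro s
  by_cases hs : s = 0
  · rw [hs]
    refine (analyticAt_of_differentiable_on_punctured_nhds_of_continuousAt ?_ hc).differentiableAt
    filter_upwards [self_mem_nhdsWithin] with z hz
    exact h z hz
  · exact h s hs

lemma contAt_sqrt_zero : ContinuousAt sqrt 0 := continuousAt_sqrt (by simp)

lemma diff_cosSqrt : Differentiable ℂ cosSqrt :=
  diff_of_ne_zero (fun _ hs => (derivAt_cosSqrt' hs).differentiableAt)
    (continuous_cos.continuousAt.comp contAt_sqrt_zero)

lemma diff_sincSqrt : Differentiable ℂ sincSqrt :=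
  diff_of_ne_zero (fun _ hs => (derivAt_sincSqrt hs).differentiableAt)
    (diff_csinc.continuous.continuousAt.comp contAt_sqrt_zero)

lemma cosSqrt_sq_add (s : ℂ) : cosSqrt s ^ 2 + s * sincSqrt s ^ 2 = 1 := by
  have h := sin_sq_add_cos_sq (sqrt s)
  rw [← mul_csinc, mul_pow, sqrt_sq_eq] at h
  rw [cosSqrt, sincSqrt]
  linear_combination h

lemma cosSqrt_zero : cosSqrt 0 = 1 := by simp [cosSqrt]

lemma sincSqrt_zero : sincSqrt 0 = 1 := by simp [sincSqrt, csinc]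

lemma cosSqrt_ofReal_sq (t : ℝ) : cosSqrt ((t ^ 2 : ℝ) : ℂ) = (Real.cos t : ℂ) := by
  rw [cosSqrt_eq (by push_cast; ring), ofReal_cos]

lemma csinc_ofReal (t : ℝ) : csinc (t : ℂ) = (sinc t : ℂ) := by
  by_cases h : t = 0
  · simp [h, csinc]
  · rw [csinc, if_neg (by exact_mod_cast h), sinc_of_ne_zero h]
    push_cast
    rfl

lemma sincSqrt_ofReal_sq (t : ℝ) : sincSqrt ((t ^ 2 : ℝ) : ℂ) = (sinc t : ℂ) := by
  rw [sincSqrt_eq (by push_cast; ring), csinc_ofReal]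

lemma sincSqrt_neg_sq (ht : 0 < t) : sincSqrt ((-(t ^ 2) : ℝ) : ℂ) = (Real.sinh t / t : ℝ) := by
  have h : (t * I) ^ 2 = ((-(t ^ 2) : ℝ) : ℂ) := by rw [mul_pow, I_sq]; push_cast; ring
  have h0 : (t : ℂ) ≠ 0 := by exact_mod_cast ht.ne'
  rw [sincSqrt_eq h, csinc, if_neg (mul_ne_zero h0 I_ne_zero), sin_mul_I]
  push_cast
  field_simp

lemma disp_eq (E : ℝ) (l : ℂ) : Disp E l = cosSqrt ((E : ℂ) ^ 2 - l ^ 2) - l * sincSqrt ((E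
  : ℂ) ^ 2 - l ^ 2) := rfl

lemma gap_eq (N : ℕ) (ε : ℝ) (l : ℂ) : gap N ε l = sincSqrt ((omega N ε : ℂ) ^ 2 - l ^ 2) -
  (parity N / omega N ε : ℝ) := rfl

lemma diff_disp (E : ℝ) : Differentiable ℂ (Disp E) := by
  have h1 : Differentiable ℂ fun l : ℂ => (E : ℂ) ^ 2 - l ^ 2 := by fun_prop
  exact (diff_cosSqrt.comp h1).sub (differentiable_id.mul (diff_sincSqrt.comp h1))

lemma disp_mul (E : ℝ) (l : ℂ) : Disp E l * (cosSqrt ((E : ℂ) ^ 2 - l ^ 2) + l * sincSqrt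
  ((E : ℂ) ^ 2 - l ^ 2)) = 1 - (E : ℂ) ^ 2 * sincSqrt ((E : ℂ) ^ 2 - l ^ 2) ^ 2 := by
  rw [disp_eq]
  linear_combination cosSqrt_sq_add (E ^ 2 - l ^ 2)

lemma sq_mul_sincSqrt_of_disp (h : Disp E l = 0) : (E : ℂ) ^ 2 * sincSqrt ((E : ℂ) ^ 2 - l ^
  2) ^ 2 = 1 := by
  have := disp_mul E l
  rw [h, zero_mul] at this
  linear_combination this

lemma sub_sq_ne_zero_of_disp (hE : 1 < E) (h : Disp E l = 0) : (E : ℂ) ^ 2 - l ^ 2 ≠ 0 := fun h0 => by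
  have := sq_mul_sincSqrt_of_disp h
  rw [h0, sincSqrt_zero, one_pow, mul_one] at this
  have h1 : E ^ 2 = 1 := by exact_mod_cast this
  nlinarith

lemma derivAt_disp (h : (E : ℂ) ^ 2 - l ^ 2 ≠ 0) : HasDerivAt (Disp E) (((E : ℂ) ^ 2 * (l -
  1) * sincSqrt ((E : ℂ) ^ 2 - l ^ 2) + l ^ 2 * Disp E l) / ((E : ℂ) ^ 2 - l ^ 2)) l := by
  have h1 : HasDerivAt (fun l : ℂ => (E : ℂ) ^ 2 - l ^ 2) (-(2 * l)) l := by
    simpa using (hasDerivAt_pow 2 l).const_sub ((E : ℂ) ^ 2)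
  have h2 := ((derivAt_cosSqrt' h).comp l h1).sub
    ((hasDerivAt_id l).mul ((derivAt_sincSqrt h).comp l h1))
  refine h2.congr_deriv ?_
  rw [disp_eq]
  simp
  field_simp
  ring

lemma deriv_disp_ne_zero (hE : 1 < E) (h : Disp E l = 0) (hl : l ≠ 1) : deriv (Disp E) l ≠ 0 := by
  have h0 := sub_sq_ne_zero_of_disp hE h
  rw [(derivAt_disp h0).deriv, h, mul_zero, add_zero]
  have h1 := sq_mul_sincSqrt_of_disp h
  have h2 : sincSqrt (E ^ 2 - l ^ 2) ≠ 0 := fun h3 => by simp [h3] at h1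
  have h3 : (E : ℂ) ≠ 0 := by grind
  exact div_ne_zero (mul_ne_zero (mul_ne_zero (pow_ne_zero _ h3) (sub_ne_zero.2 hl)) h2) h0

lemma deriv_deriv_disp_ne_zero (hE : 1 < E) (h : Disp E 1 = 0) : deriv (deriv (Disp E)) 1 ≠ 0 := by
  have h0 := sub_sq_ne_zero_of_disp hE h
  have h1 := sq_mul_sincSqrt_of_disp h
  have h2 : sincSqrt ((E : ℂ) ^ 2 - 1 ^ 2) ≠ 0 := fun h3 => by grind
  have h3 : (E : ℂ) ≠ 0 := by grind
  have hd1 := derivAt_disp h0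
  rw [h] at hd1
  simp at hd1
  have hev : deriv (Disp E) =ᶠ[𝓝 1] fun l => ((E : ℂ) ^ 2 * (l - 1) * sincSqrt ((E : ℂ) ^ 2 -
    l ^ 2) + l ^ 2 * Disp E l) / ((E : ℂ) ^ 2 - l ^ 2) := by
    have hc : ContinuousAt (fun l : ℂ => (E : ℂ) ^ 2 - l ^ 2) 1 := by fun_prop
    filter_upwards [hc.eventually_ne h0] with l hl
    exact (derivAt_disp hl).deriv
  rw [hev.deriv_eq]
  have hs : HasDerivAt (fun l : ℂ => (E : ℂ) ^ 2 - l ^ 2) (-(2 * 1)) 1 := by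
    simpa using (hasDerivAt_pow 2 (1 : ℂ)).const_sub ((E : ℂ) ^ 2)
  have hσ := (derivAt_sincSqrt h0).comp 1 hs
  have hnum := ((((hasDerivAt_id (1 : ℂ)).sub_const 1).const_mul ((E : ℂ) ^ 2)).mul hσ).add
    ((hasDerivAt_pow 2 (1 : ℂ)).mul hd1)
  have hq := hnum.div hs h0
  have hq' := hq.deriv
  simp at hq'
  refine ne_of_eq_of_ne (b := (E : ℂ) ^ 2 * sincSqrt ((E : ℂ) ^ 2 - 1 ^ 2)
    / ((E : ℂ) ^ 2 - 1 ^ 2)) ?_ (div_ne_zero (mul_ne_zero (pow_ne_zero _ h3) h2) h0)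
  refine Eq.trans ?_ (hq'.trans ?_)
  · rfl
  · simp [h]
    field_simp

/-- Real roots of the Disp relation at the threshold. -/
lemma real_root_disp (hN : 2 ≤ N) {l : ℝ} (h : Disp (ωₜ N) l = 0) : l = 1 ∨ ∃ j
  τ, 1 ≤ j ∧ j < N ∧ (j, τ) ≠ (1, true) ∧ l = Λ (ωₜ N) j τ := by
  set E := ωₜ N with hE
  have hE1 : 1 < E := one_lt_omegaThr hN
  have hN1 : 1 ≤ N := by omega
  have hσ := sq_mul_sincSqrt_of_disp h
  have hsr : E ^ 2 - l ^ 2 = ((E ^ 2 - l ^ 2 : ℝ) : ℂ) := by push_cast; ring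
  rw [hsr] at hσ
  have hd := h
  rw [disp_eq, hsr] at hd
  rcases lt_trichotomy (E ^ 2 - l ^ 2) 0 with hs | hs | hs
  · exfalso
    have h1 : E ^ 2 - l ^ 2 = -(Real.sqrt (-(E ^ 2 - l ^ 2)) ^ 2) := by grind
    have ht : 0 < Real.sqrt (-(E ^ 2 - l ^ 2)) := sqrt_pos.2 (by linarith)
    rw [h1, sincSqrt_neg_sq ht] at hσ
    have h2 : E ^ 2 * (Real.sinh (Real.sqrt (-(E ^ 2 - l ^ 2))) / Real.sqrt (-(E ^ 2 - l ^ 2))) ^ 2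
      = 1 := by exact_mod_cast hσ
    have h3 : 1 ≤ Real.sinh (Real.sqrt (-(E ^ 2 - l ^ 2))) / Real.sqrt (-(E ^ 2 - l ^ 2)) :=
      (one_le_div ht).2 (self_le_sinh_iff.2 ht.le)
    have h4 := one_lt_pow₀ hE1 two_ne_zero
    nlinarith [one_le_pow₀ h3 (n := 2)]
  · exfalso
    rw [hs, ofReal_zero, sincSqrt_zero] at hσ
    rw [one_pow, mul_one] at hσ
    have h1 : E ^ 2 = 1 := by exact_mod_cast hσ
    nlinarith
  · set κ := Real.sqrt (E ^ 2 - l ^ 2) with hκ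
    have hκ0 : 0 < κ := sqrt_pos.2 hs
    have h1 : E ^ 2 - l ^ 2 = κ ^ 2 := (sq_sqrt hs.le).symm
    rw [h1, sincSqrt_ofReal_sq] at hσ
    rw [h1, sincSqrt_ofReal_sq, cosSqrt_ofReal_sq] at hd
    have h2 : E ^ 2 * sinc κ ^ 2 = 1 := by exact_mod_cast hσ
    have h3 : Real.cos κ = l * sinc κ := by
      have : (Real.cos κ - l * sinc κ) = 0 := by exact_mod_cast hd
      linarith
    have h4 : |sinc κ| = E⁻¹ := by
      rw [← abs_of_pos (inv_pos.2 (by linarith : 0 < E)), ← sq_eq_sq_iff_abs_eq_abs, inv_pow]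
      field_simp
      linarith
    have h5 : sinc κ ≠ 0 := fun h0 => by simp [h0] at h2
    rcases isBranch_or_eq_kappaMax hN1 hκ0 h4 with h6 | ⟨j, τ, hj, hjN, hτ, hb⟩
    · left
      rw [h6] at h3 h5
      rw [cos_kappaMax hN1] at h3
      exact (mul_right_cancel₀ h5 (by linarith)).symm
    · right
      refine ⟨j, τ, hj, hjN, hτ, ?_⟩
      have h7 := kappaBr_spec hj hτ (omegaThr_smono hj hjN)
      rw [lambdaBranch, ← hb.unique hj h7, Real.cot_eq_cos_div_sin, h3, sinc_of_ne_zero hκ0.ne']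
      have := hb.sin_ne_zero
      field_simp

/-- Division of entire functions, across common zeros. -/
lemma ex_quotient {L d : ℂ → ℂ} (hL : Differentiable ℂ L) (hd : Differentiable ℂ d) {U : Set ℂ} (h
  : ∀ z ∈ U, d z = 0 → (L z = 0 ∧ deriv d z ≠ 0) ∨ (L z = 0 ∧ deriv L z = 0 ∧ deriv d z = 0 ∧ deriv
  (deriv d) z ≠ 0)) : ∃ g : ℂ → ℂ, (∀ z ∈ U, DifferentiableAt ℂ g z) ∧ ∀ z, d z ≠ 0 → g z = L z / d
  z := by
  have hds : ∀ {f : ℂ → ℂ} c, Differentiable ℂ f → Differentiable ℂ (dslope f c) := by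
    intro f c hf
    rw [← differentiableOn_univ]
    exact (differentiableOn_dslope univ_mem).2 hf.differentiableOn
  have hfac : ∀ {f : ℂ → ℂ} {c : ℂ} z, f c = 0 → f z = (z - c) * dslope f c z := by
    intro f c z hc
    have := sub_smul_dslope f c z
    rw [hc, sub_zero, smul_eq_mul] at this
    exact this.symm
  let g : ℂ → ℂ := fun z => limUnder (𝓝[≠] z) fun w => L w / d w
  have hg : ∀ z, d z ≠ 0 → g z = L z / d z := by
    intro z hz
    refine Tendsto.limUnder_eq ?_
    have := hL.continuous.continuousAt.div hd.continuous.continuousAt hz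
    exact this.tendsto.mono_left nhdsWithin_le_nhds
  have key : ∀ z, ∀ l e : ℂ → ℂ, Differentiable ℂ l → Differentiable ℂ e → e z ≠ 0 → (∀ w, w ≠ z → e
    w ≠ 0 → d w ≠ 0 ∧ L w / d w = l w / e w) → DifferentiableAt ℂ g z := by
    intro z l e hl he hez hq
    have hev := he.continuous.continuousAt.eventually_ne hez
    have hcont := hl.continuous.continuousAt.div he.continuous.continuousAt hez
    have hgz : g z = l z / e z := by
      refine Tendsto.limUnder_eq ?_
      refine (hcont.tendsto.mono_left nhdsWithin_le_nhds).congr' ?_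
      filter_upwards [nhdsWithin_le_nhds hev, self_mem_nhdsWithin] with w hw hwz
      exact (hq w hwz hw).2.symm
    refine ((hl z).div (he z) hez).congr_of_eventuallyEq ?_
    filter_upwards [hev] with w hw
    by_cases hwz : w = z
    · rw [hwz]; exact hgz
    · rw [hg w (hq w hwz hw).1, (hq w hwz hw).2]; rfl
  refine ⟨g, fun z hz => ?_, hg⟩
  by_cases hdz : d z = 0
  · rcases h z hz hdz with ⟨hL0, hd1⟩ | ⟨hL0, hL1, hd1, hd2⟩
    · refine key z (dslope L z) (dslope d z) (hds z hL) (hds z hd) (by rwa [dslope_same])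
        fun w hw he => ?_
      have hwz := sub_ne_zero.2 hw
      rw [hfac w hL0, hfac w hdz]
      exact ⟨mul_ne_zero hwz he, mul_div_mul_left _ _ hwz⟩
    · have hd1' : dslope d z z = 0 := by rwa [dslope_same]
      have hL1' : dslope L z z = 0 := by rwa [dslope_same]
      refine key z (dslope (dslope L z) z) (dslope (dslope d z) z) (hds z (hds z hL))
        (hds z (hds z hd)) ?_ fun w hw he => ?_
      · rw [dslope_same]
        set e := dslope d z with he
        have hde := hds z hd
        rw [← he] at hde
        have h1 : deriv d = fun w => e w + (w - z) * deriv e w := by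
          ext w
          have h2 : d = fun w => (w - z) * e w := funext fun w => hfac w hdz
          have h3 := (((hasDerivAt_id w).sub_const z).mul (hde w).hasDerivAt).deriv
          simp at h3
          rw [← h3]
          conv_lhs => rw [h2]
          rfl
        have hde' : Differentiable ℂ (deriv e) := by fun_prop
        have h4 := ((hde z).hasDerivAt.add
          (((hasDerivAt_id z).sub_const z).mul (hde' z).hasDerivAt)).deriv
        simp at h4
        intro h0
        refine hd2 ?_
        rw [h1]
        refine Eq.trans ?_ (h4.trans ?_)
        · rfl
        · rw [h0, add_zero]
      · have hwz := sub_ne_zero.2 hw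
        rw [hfac w hL0, hfac w hdz, hfac w hL1', hfac w hd1']
        refine ⟨mul_ne_zero hwz (mul_ne_zero hwz he), ?_⟩
        rw [mul_div_mul_left _ _ hwz, mul_div_mul_left _ _ hwz]
  · exact key z L d hL hd hdz fun w _ hw => ⟨hw, rfl⟩

/-! ### The transv boundary value problem -/

/-- `cos(√s x)`. -/
def cosK (s : ℂ) (x : ℝ) : ℂ := cosSqrt (s * (x : ℂ) ^ 2)

/-- `sin(√s x) / √s`. -/
def sinK (s : ℂ) (x : ℝ) : ℂ := x * sincSqrt (s * (x : ℂ) ^ 2)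

lemma cosK_eq {κ s : ℂ} (h : κ ^ 2 = s) (x : ℝ) : cosK s x = cos (κ * x) :=
  cosSqrt_eq (by rw [mul_pow, h])

lemma mul_sinK_eq {κ s : ℂ} (h : κ ^ 2 = s) (x : ℝ) : κ * sinK s x = sin (κ * x) := by
  rw [sinK, sincSqrt_eq (κ := κ * x) (by rw [mul_pow, h]), ← mul_csinc]
  ring

lemma derivAt_cosK (s : ℂ) (x : ℝ) : HasDerivAt (cosK s) (-(s * sinK s x)) x := by
  have hs := sqrt_sq_eq s
  have h1 := funext fun x => cosK_eq hs x
  have h2 : HasDerivAt (fun x : ℝ => sqrt s * (x : ℂ)) (sqrt s) x := by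
    simpa using (ofRealCLM.hasDerivAt).const_mul (sqrt s)
  have h3 := (hasDerivAt_cos (sqrt s * x)).comp x h2
  rw [h1]
  refine h3.congr_deriv ?_
  rw [← mul_sinK_eq hs]
  linear_combination (-sinK s x) * hs

lemma derivAt_sinK (s : ℂ) (x : ℝ) : HasDerivAt (sinK s) (cosK s x) x := by
  have hs := sqrt_sq_eq s
  by_cases h0 : sqrt s = 0
  · have hs0 : s = 0 := by grind
    subst hs0
    have h1 : sinK 0 = fun x : ℝ => (x : ℂ) := funext fun x => by simp [sinK, sincSqrt_zero]
    have h2 : cosK 0 x = 1 := by simp [cosK, cosSqrt_zero]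
    rw [h1, h2]
    exact ofRealCLM.hasDerivAt
  · have h1 : sinK s = fun x : ℝ => (sqrt s)⁻¹ * sin (sqrt s * x) :=
      funext fun x => by rw [← mul_sinK_eq hs, inv_mul_cancel_left₀ h0]
    have h2 : HasDerivAt (fun x : ℝ => sqrt s * (x : ℂ)) (sqrt s) x := by
      simpa using (ofRealCLM.hasDerivAt).const_mul (sqrt s)
    have h3 := ((hasDerivAt_sin (sqrt s * x)).comp x h2).const_mul (sqrt s)⁻¹
    rw [h1]
    refine h3.congr_deriv ?_
    rw [cosK_eq hs]
    field_simp

lemma cosK_sq_add (s : ℂ) (x : ℝ) : cosK s x ^ 2 + s * sinK s x ^ 2 = 1 := by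
  have := cosSqrt_sq_add (s * x ^ 2)
  rw [cosK, sinK]
  linear_combination this

lemma cont_cosK : Continuous fun p : ℂ × ℝ => cosK p.1 p.2 :=
  diff_cosSqrt.continuous.comp (by fun_prop)

lemma cont_sinK : Continuous fun p : ℂ × ℝ => sinK p.1 p.2 := by
  have h1 : Continuous fun p : ℂ × ℝ => sincSqrt (p.1 * p.2 ^ 2) :=
    diff_sincSqrt.continuous.comp (by fun_prop)
  have h2 : Continuous fun p : ℂ × ℝ => (p.2 : ℂ) := by fun_prop
  exact h2.mul h1

lemma diff_cosK (x : ℝ) : Differentiable ℂ fun s => cosK s x := diff_cosSqrt.comp (by fun_prop)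

lemma diff_sinK (x : ℝ) : Differentiable ℂ fun s => sinK s x :=
  (diff_sincSqrt.comp (by fun_prop : Differentiable ℂ fun s : ℂ => s * (x : ℂ) ^ 2)).const_mul x

/-- `E² - λ²`. -/
def kSq (E : ℝ) (l : ℂ) : ℂ := (E : ℂ) ^ 2 - l ^ 2

/-- The solution of the homogeneous system with value `(0, 1)` at `x = 0`. -/
def solA (E : ℝ) (l : ℂ) (x : ℝ) : ℂ² :=
  (I * E * sinK (kSq E l) x, cosK (kSq E l) x - l * sinK (kSq E l) x)

/-- The solution of the homogeneous system with value `(1, 0)` at `x = 0`. -/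
def solB (E : ℝ) (l : ℂ) (x : ℝ) : ℂ² :=
  (cosK (kSq E l) x + l * sinK (kSq E l) x, I * E * sinK (kSq E l) x)

lemma solA_zero (E : ℝ) (l : ℂ) : solA E l 0 = (0, 1) := by simp [solA, sinK, cosK, cosSqrt_zero]

lemma solB_zero (E : ℝ) (l : ℂ) : solB E l 0 = (1, 0) := by simp [solB, sinK, cosK, cosSqrt_zero]

lemma solA_one_snd (E : ℝ) (l : ℂ) : (solA E l 1).2 = Disp E l := by
  simp [solA, sinK, cosK, disp_eq, kSq]

lemma cont_kSq (E : ℝ) : Continuous (kSq E) := by unfold kSq; fun_prop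

lemma diff_kSq (E : ℝ) : Differentiable ℂ (kSq E) := by unfold kSq; fun_prop

lemma cont_solA (E : ℝ) : Continuous fun p : ℂ × ℝ => solA E p.1 p.2 := by
  have hk : Continuous fun p : ℂ × ℝ => (kSq E p.1, p.2) :=
    ((cont_kSq E).comp continuous_fst).prodMk continuous_snd
  have h1 : Continuous fun p : ℂ × ℝ => cosK (kSq E p.1) p.2 := by
    simpa only [Function.comp_def] using cont_cosK.comp hk
  have h2 : Continuous fun p : ℂ × ℝ => sinK (kSq E p.1) p.2 := by
    simpa only [Function.comp_def] using cont_sinK.comp hk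
  have h3 : Continuous fun p : ℂ × ℝ => I * E * sinK (kSq E p.1) p.2 := by fun_prop
  have h4 : Continuous fun p : ℂ × ℝ => cosK (kSq E p.1) p.2 - p.1 * sinK (kSq E p.1) p.2 := by
    fun_prop
  unfold solA
  exact h3.prodMk h4

lemma cont_solB (E : ℝ) : Continuous fun p : ℂ × ℝ => solB E p.1 p.2 := by
  have hk : Continuous fun p : ℂ × ℝ => (kSq E p.1, p.2) :=
    ((cont_kSq E).comp continuous_fst).prodMk continuous_snd
  have h1 : Continuous fun p : ℂ × ℝ => cosK (kSq E p.1) p.2 := by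
    simpa only [Function.comp_def] using cont_cosK.comp hk
  have h2 : Continuous fun p : ℂ × ℝ => sinK (kSq E p.1) p.2 := by
    simpa only [Function.comp_def] using cont_sinK.comp hk
  have h3 : Continuous fun p : ℂ × ℝ => I * E * sinK (kSq E p.1) p.2 := by fun_prop
  have h4 : Continuous fun p : ℂ × ℝ => cosK (kSq E p.1) p.2 + p.1 * sinK (kSq E p.1) p.2 := by
    fun_prop
  unfold solB
  exact h4.prodMk h3

lemma diff_solA (E : ℝ) (x : ℝ) : Differentiable ℂ fun l => solA E l x := by
  have h1 := (diff_cosK x).comp (diff_kSq E)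
  have h2 := (diff_sinK x).comp (diff_kSq E)
  exact (h2.const_mul _).prodMk (h1.sub (differentiable_id.mul h2))

lemma diff_solB (E : ℝ) (x : ℝ) : Differentiable ℂ fun l => solB E l x := by
  have h1 := (diff_cosK x).comp (diff_kSq E)
  have h2 := (diff_sinK x).comp (diff_kSq E)
  exact (h1.add (differentiable_id.mul h2)).prodMk (h2.const_mul _)

lemma derivAt_solA_fst (E : ℝ) (l : ℂ) (x : ℝ) : HasDerivAt (fun x => (solA E l x).1) (l * (solA E
  l x).1 + I * E * (solA E l x).2) x := by
  refine ((derivAt_sinK (kSq E l) x).const_mul (I * E)).congr_deriv ?_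
  simp only [solA]; ring

lemma derivAt_solA_snd (E : ℝ) (l : ℂ) (x : ℝ) : HasDerivAt (fun x => (solA E l x).2) (-l * (solA
  E l x).2 + I * E * (solA E l x).1) x := by
  refine ((derivAt_cosK (kSq E l) x).sub ((derivAt_sinK (kSq E l) x).const_mul l)).congr_deriv ?_
  simp only [solA, kSq]; linear_combination (-E ^ 2 * sinK (E ^ 2 - l ^ 2) x) * I_sq

lemma derivAt_solB_fst (E : ℝ) (l : ℂ) (x : ℝ) : HasDerivAt (fun x => (solB E l x).1) (l * (solB E
  l x).1 + I * E * (solB E l x).2) x := by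
  refine ((derivAt_cosK (kSq E l) x).add ((derivAt_sinK (kSq E l) x).const_mul l)).congr_deriv ?_
  simp only [solB, kSq]; linear_combination (-E ^ 2 * sinK (E ^ 2 - l ^ 2) x) * I_sq

lemma derivAt_solB_snd (E : ℝ) (l : ℂ) (x : ℝ) : HasDerivAt (fun x => (solB E l x).2) (-l * (solB
  E l x).2 + I * E * (solB E l x).1) x := by
  refine ((derivAt_sinK (kSq E l) x).const_mul (I * E)).congr_deriv ?_
  simp only [solB]; ring

lemma wronskian_solA_solB (E : ℝ) (l : ℂ) (x : ℝ) : (solA E l x).1 * (solB E l x).2 - (solA E l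
  x).2 * (solB E l x).1 = -1 := by
  have h := cosK_sq_add (kSq E l) x
  simp only [solA, solB, kSq] at h ⊢
  linear_combination E ^ 2 * sinK (E ^ 2 - l ^ 2) x ^ 2 * I_sq - h

/-- The boundary value problem for the Fourier transform of `(𝒟 - E) w = F`. -/
structure IsSol (E : ℝ) (l : ℂ) (F w : ℝ → ℂ²) : Prop where
  fst : ∀ x, HasDerivAt (fun x => (w x).1) (l * (w x).1 + I * E * (w x).2 + I * (F x).2) x
  snd : ∀ x, HasDerivAt (fun x => (w x).2) (-l * (w x).2 + I * E * (w x).1 + I * (F x).1) x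
  left : (w 0).1 = 0
  right : (w 1).2 = 0

/-- `∫₀¹ (F₁ Φ₁ - F₂ Φ₂) dx`: its vanishing is the solv condition at a root. -/
def solv (E : ℝ) (l : ℂ) (F : ℝ → ℂ²) : ℂ :=
  ∫ x in 0..1, ((F x).1 * (solA E l x).1 - (F x).2 * (solA E l x).2)

/-- `i ∫₀ˣ (F₁ X₁ - F₂ X₂)`. -/
def coeffA (E : ℝ) (l : ℂ) (F : ℝ → ℂ²) (x : ℝ) : ℂ :=
  I * ∫ t in (0 : ℝ)..x, ((F t).1 * (solB E l t).1 - (F t).2 * (solB E l t).2)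

/-- `i ∫₀ˣ (F₂ Φ₂ - F₁ Φ₁)`. -/
def coeffB (E : ℝ) (l : ℂ) (F : ℝ → ℂ²) (x : ℝ) : ℂ :=
  -I * ∫ t in (0 : ℝ)..x, ((F t).1 * (solA E l t).1 - (F t).2 * (solA E l t).2)

/-- Variation of constants. The number `q` stands for `solv / Disp`. -/
def transv (E : ℝ) (l q : ℂ) (F : ℝ → ℂ²) (x : ℝ) : ℂ² :=
  (I * (I * E * sinK (kSq E l) 1) * q - coeffA E l F 1 + coeffA E l F x) • solA E l x
    + coeffB E l F x • solB E l x

lemma derivAt_primitive {f : ℝ → ℂ} (hf : Continuous f) (x : ℝ) : HasDerivAt (fun x => ∫ t in (0 :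
  ℝ)..x, f t) (f x) x :=
  integral_hasDerivAt_right (hf.intervalIntegrable _ _)
    (hf.stronglyMeasurableAtFilter _ _) hf.continuousAt

lemma isSol_transv {q : ℂ} (hF : Continuous F) (hq : Disp E l * q = solv E l F) : IsSol E l
  F (transv E l q F) := by
  have cA : Continuous (solA E l) := by
    simpa only [Function.comp_def] using (cont_solA E).comp (Continuous.prodMk_right l)
  have cB : Continuous (solB E l) := by
    simpa only [Function.comp_def] using (cont_solB E).comp (Continuous.prodMk_right l)
  have hA : ∀ x, HasDerivAt (coeffA E l F) (I * ((F x).1 * (solB E l x).1 - (F x).2 * (solB E l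
    x).2)) x := fun x =>
    (derivAt_primitive ((hF.fst.mul cB.fst).sub (hF.snd.mul cB.snd)) x).const_mul _
  have hB : ∀ x, HasDerivAt (coeffB E l F) (-I * ((F x).1 * (solA E l x).1 - (F x).2 * (solA E l
    x).2)) x := fun x =>
    (derivAt_primitive ((hF.fst.mul cA.fst).sub (hF.snd.mul cA.snd)) x).const_mul _
  refine ⟨fun x => ?_, fun x => ?_, ?_, ?_⟩
  · have h := (((hA x).const_add (I * (I * E * sinK (kSq E l) 1) * q
      - coeffA E l F 1)).mul (derivAt_solA_fst E l x)).add
      ((hB x).mul (derivAt_solB_fst E l x))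
    refine h.congr_deriv ?_
    have hw := wronskian_solA_solB E l x
    unfold transv
    generalize I * (I * E * sinK (kSq E l) 1) * q - coeffA E l F 1 = k
    simp only [fst_add, snd_add, smul_fst, smul_snd, smul_eq_mul, Pi.mul_apply]
    linear_combination (-I * (F x).2) * hw
  · have h := (((hA x).const_add (I * (I * E * sinK (kSq E l) 1) * q
      - coeffA E l F 1)).mul (derivAt_solA_snd E l x)).add
      ((hB x).mul (derivAt_solB_snd E l x))
    refine h.congr_deriv ?_
    have hw := wronskian_solA_solB E l x
    unfold transv
    generalize I * (I * E * sinK (kSq E l) 1) * q - coeffA E l F 1 = k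
    simp only [fst_add, snd_add, smul_fst, smul_snd, smul_eq_mul]
    linear_combination (-I * (F x).1) * hw
  · simp [transv, solA_zero, solB_zero, coeffB]
  · have h1 : coeffB E l F 1 = -I * solv E l F := rfl
    simp only [transv, snd_add, smul_snd, smul_eq_mul, solA_one_snd, h1]
    rw [← hq]
    simp only [solB]
    ring

/-! ### A priori estimates -/

lemma sq_norm_sub_sq_norm {y h : ℝ → ℂ} {ν : ℂ} (hh : Continuous h) (hy : ∀ x, HasDerivAt y (ν * y
  x + h x) x) : ‖y 1‖ ^ 2 - ‖y 0‖ ^ 2 = 2 * ν.re * (∫ x in 0..1, ‖y x‖ ^ 2) + 2 * ∫ x in 0..1, (y x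
  * conj (h x)).re := by
  have hyc := continuous_iff_continuousAt.2 fun x => (hy x).continuousAt
  have hd : ∀ x, HasDerivAt (fun x => ‖y x‖ ^ 2) (2 * ν.re * ‖y x‖ ^ 2 + 2 * (y x * conj (h x)).re)
    x := by
    intro x
    refine (hy x).norm_sq.congr_deriv ?_
    rw [real_inner_comm, Complex.inner, ← normSq_eq_norm_sq, normSq_apply]
    simp
    ring
  have hi1 : IntervalIntegrable (fun x => 2 * ν.re * ‖y x‖ ^ 2) volume 0 1 := by
    apply Continuous.intervalIntegrable; fun_prop
  have hi2 : IntervalIntegrable (fun x => 2 * (y x * conj (h x)).re) volume 0 1 := by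
    apply Continuous.intervalIntegrable; fun_prop
  rw [← integral_eq_sub_of_hasDerivAt (fun x _ => hd x) (hi1.add hi2),
    iint_add hi1 hi2, iint_const_mul,
    iint_const_mul]

lemma energy_aux {y h : ℝ → ℂ} {ξ : ℝ} (hξ : 0 < ξ) (hyc : Continuous y) (hh : Continuous h) : 2 *
  |∫ x in 0..1, (y x * conj (h x)).re| ≤ ξ * (∫ x in 0..1, ‖y x‖ ^ 2) + ξ⁻¹ * ∫ x in 0..1, ‖h x‖ ^ 2
  := by
  have h1 : |∫ x in 0..1, (y x * conj (h x)).re| ≤ ∫ x in 0..1, (ξ / 2 * ‖y x‖ ^ 2 + ξ⁻¹ / 2 * ‖h x‖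
    ^ 2) := by
    rw [← norm_eq_abs]
    refine norm_iint_le
      zero_le_one
      (.of_forall fun x _ => ?_) cont_int
    have h2 : ‖(y x * conj (h x)).re‖ ≤ ‖y x‖ * ‖h x‖ := by
      refine (abs_re_le_norm _).trans ?_
      rw [norm_mul, RCLike.norm_conj]
    refine h2.trans ?_
    have h3 : ξ / 2 * ‖y x‖ ^ 2 + ξ⁻¹ / 2 * ‖h x‖ ^ 2 - ‖y x‖ * ‖h x‖ = (ξ * ‖y x‖ - ‖h x‖) ^ 2 / (2
      * ξ) := by grind
    have h4 : 0 ≤ (ξ * ‖y x‖ - ‖h x‖) ^ 2 / (2 * ξ) := by positivity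
    linarith
  rw [iint_add cont_int cont_int, iint_const_mul, iint_const_mul] at h1
  linarith

lemma energy_right {y h : ℝ → ℂ} {ν : ℂ} (hν : 0 < ν.re) (hh : Continuous h) (hy : ∀ x, HasDerivAt
  y (ν * y x + h x) x) (h1 : y 1 = 0) : ‖y 0‖ ^ 2 + ν.re * (∫ x in 0..1, ‖y x‖ ^ 2) ≤ ν.re⁻¹ * ∫ x
  in 0..1, ‖h x‖ ^ 2 := by
  have hyc := continuous_iff_continuousAt.2 fun x => (hy x).continuousAt
  have e := sq_norm_sub_sq_norm hh hy
  have a := energy_aux hν hyc hh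
  rw [h1, norm_zero] at e
  have := neg_abs_le (∫ x in 0..1, (y x * conj (h x)).re)
  linarith

lemma energy_left {y h : ℝ → ℂ} {ν : ℂ} (hν : 0 < ν.re) (hh : Continuous h) (hy : ∀ x, HasDerivAt
  y (-ν * y x + h x) x) (h0 : y 0 = 0) : ‖y 1‖ ^ 2 + ν.re * (∫ x in 0..1, ‖y x‖ ^ 2) ≤ ν.re⁻¹ * ∫ x
  in 0..1, ‖h x‖ ^ 2 := by
  have hyc := continuous_iff_continuousAt.2 fun x => (hy x).continuousAt
  have e := sq_norm_sub_sq_norm hh hy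
  have a := energy_aux hν hyc hh
  rw [h0, norm_zero, neg_re] at e
  have := le_abs_self (∫ x in 0..1, (y x * conj (h x)).re)
  linarith

lemma norm_add₃_sq_le (a b c : ℂ) : ‖a + b + c‖ ^ 2 ≤ 3 * (‖a‖ ^ 2 + ‖b‖ ^ 2 + ‖c‖ ^ 2) := by
  have h : ‖a + b + c‖ ≤ ‖a‖ + ‖b‖ + ‖c‖ := norm_add₃_le
  have h2 := pow_le_pow_left₀ (norm_nonneg _) h 2
  nlinarith [sq_nonneg (‖a‖ - ‖b‖), sq_nonneg (‖b‖ - ‖c‖), sq_nonneg (‖a‖ - ‖c‖)]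

lemma int_norm_add₃_sq_le {f g h : ℝ → ℂ} (hf : Continuous f) (hg : Continuous g) (hh : Continuous
  h) : ∫ x in 0..1, ‖f x + g x + h x‖ ^ 2 ≤ 3 * ((∫ x in 0..1, ‖f x‖ ^ 2) + (∫ x in 0..1, ‖g x‖ ^ 2)
  + ∫ x in 0..1, ‖h x‖ ^ 2) := by
  rw [← iint_add cont_int cont_int, ← iint_add cont_int cont_int, ← iint_const_mul]
  exact integral_mono_on zero_le_one
    cont_int
    cont_int fun x _ => norm_add₃_sq_le _ _ _

lemma int_norm_const_mul_sq (c : ℂ) (f : ℝ → ℂ) : ∫ x in 0..1, ‖c * f x‖ ^ 2 = ‖c‖ ^ 2 * ∫ x in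
  0..1, ‖f x‖ ^ 2 := by
  rw [← iint_const_mul]
  simp only [norm_mul, mul_pow]

lemma IsSol.continuous {w : ℝ → ℂ²} (h : IsSol E l F w) : Continuous w :=
  (continuous_iff_continuousAt.2 fun x => (h.fst x).continuousAt).prodMk
    (continuous_iff_continuousAt.2 fun x => (h.snd x).continuousAt)

/-- `∫₀¹ (|u|² + |v|²) dx`. -/
def sqInt (w : ℝ → ℂ²) : ℝ := (∫ x in 0..1, ‖(w x).1‖ ^ 2) + ∫ x in 0..1, ‖(w x).2‖ ^ 2

lemma int_sq_nonneg (f : ℝ → ℂ) : 0 ≤ ∫ x in 0..1, ‖f x‖ ^ 2 :=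
  iint_nonneg zero_le_one fun x _ => by positivity

lemma IsSol.sqInt_le_of_neg {w : ℝ → ℂ²} (h : IsSol E l F w) (hF : Continuous F) (hE : 1 ≤ E) (hl
  : l.re ≤ -(10 * E ^ 2)) : sqInt w ≤ sqInt F := by
  have hw := h.continuous
  have hν : 0 < (-l).re := by rw [neg_re]; nlinarith
  have e1 := energy_left (y := fun x => (w x).1)
    (h := fun x => 0 + I * E * (w x).2 + I * (F x).2) hν (by fun_prop)
    (fun x => (h.fst x).congr_deriv (by ring)) h.left
  have e2 := energy_right (y := fun x => (w x).2)
    (h := fun x => 0 + I * E * (w x).1 + I * (F x).1) hν (by fun_prop)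
    (fun x => (h.snd x).congr_deriv (by ring)) h.right
  have a1 := int_norm_add₃_sq_le (f := fun _ => 0) (g := fun x => I * E * (w x).2)
    (h := fun x => I * (F x).2) (by fun_prop) (by fun_prop) (by fun_prop)
  have a2 := int_norm_add₃_sq_le (f := fun _ => 0) (g := fun x => I * E * (w x).1)
    (h := fun x => I * (F x).1) (by fun_prop) (by fun_prop) (by fun_prop)
  simp only [int_norm_const_mul_sq] at a1 a2
  simp only [norm_mul, norm_I, one_mul, one_pow, norm_real, norm_eq_abs, sq_abs, norm_zero] at a1 a2
  simp at a1 a2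
  set ξ := (-l).re with hξ
  have hξ' : 10 * E ^ 2 ≤ ξ := by rw [hξ, neg_re]; linarith
  have hinv : ξ * ξ⁻¹ = 1 := mul_inv_cancel₀ hν.ne'
  have b1 : ξ * (ξ * ∫ x in 0..1, ‖(w x).1‖ ^ 2) ≤ 3 * (E ^ 2 * (∫ x in 0..1, ‖(w x).2‖ ^ 2) + ∫ x
    in 0..1, ‖(F x).2‖ ^ 2) := by
    have := mul_le_mul_of_nonneg_left e1 hν.le
    simp at this
    rw [← mul_assoc ξ ξ⁻¹, hinv, one_mul] at this
    nlinarith [sq_nonneg ‖(w 1).1‖]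
  have b2 : ξ * (ξ * ∫ x in 0..1, ‖(w x).2‖ ^ 2) ≤ 3 * (E ^ 2 * (∫ x in 0..1, ‖(w x).1‖ ^ 2) + ∫ x
    in 0..1, ‖(F x).1‖ ^ 2) := by
    have := mul_le_mul_of_nonneg_left e2 hν.le
    simp at this
    rw [← mul_assoc ξ ξ⁻¹, hinv, one_mul] at this
    nlinarith [sq_nonneg ‖(w 0).2‖]
  have n1 := int_sq_nonneg fun x => (w x).1
  have n2 := int_sq_nonneg fun x => (w x).2
  simp only [sqInt]
  have hE2 : 1 ≤ E ^ 2 := one_le_pow₀ hE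
  have hξ2 : 3 * E ^ 2 + 3 ≤ ξ * ξ := by nlinarith
  nlinarith

lemma derivAt_cexp_mul (ν c : ℂ) (x : ℝ) : HasDerivAt (fun x : ℝ => exp (ν * (x - c))) (ν * exp (ν
  * (x - c))) x := by
  have h := (((ofRealCLM.hasDerivAt (x := x)).sub_const c).const_mul ν).cexp
  refine h.congr_deriv ?_
  simp; ring

lemma int_norm_cexp_left_le {ν : ℂ} (hν : 0 < ν.re) : ∫ x in 0..1, ‖exp (-ν * (x - 0))‖ ^ 2 ≤ (2 *
  ν.re)⁻¹ := by
  have e := sq_norm_sub_sq_norm (h := fun _ => 0) (ν := -ν) continuous_const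
    (fun x => (derivAt_cexp_mul (-ν) 0 x).congr_deriv (by ring))
  simp only [map_zero, mul_zero, zero_re, intervalIntegral.integral_zero, add_zero, neg_re] at e
  have h0 : ‖exp (-ν * ((0 : ℝ) - 0))‖ = 1 := by simp
  rw [h0] at e
  rw [inv_eq_one_div, le_div_iff₀ (by positivity)]
  nlinarith [sq_nonneg ‖exp (-ν * ((1 : ℝ) - 0))‖]

lemma int_norm_cexp_right_le {ν : ℂ} (hν : 0 < ν.re) : ∫ x in 0..1, ‖exp (ν * (x - 1))‖ ^ 2 ≤ (2 *
  ν.re)⁻¹ := by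
  have e := sq_norm_sub_sq_norm (h := fun _ => 0) (ν := ν) continuous_const
    (fun x => (derivAt_cexp_mul ν 1 x).congr_deriv (by ring))
  simp only [map_zero, mul_zero, zero_re, intervalIntegral.integral_zero, add_zero] at e
  have h0 : ‖exp (ν * ((1 : ℝ) - 1))‖ = 1 := by simp
  rw [h0] at e
  rw [inv_eq_one_div, le_div_iff₀ (by positivity)]
  nlinarith [sq_nonneg ‖exp (ν * ((0 : ℝ) - 1))‖]

lemma edge_arith {ξ A Z y F : ℝ} (hE : 1 ≤ E) (hξ : 10 * E ^ 2 ≤ ξ) (hA : 0 ≤ A) (hZ : 0 ≤ Z) (hF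
  : 0 ≤ F) (hy : 0 ≤ y) (h1 : y + ξ * Z ≤ ξ⁻¹ * (3 * (E ^ 4 * A / (8 * ξ ^ 3) + E ^ 2 * Z + F))) (h2
  : E ^ 2 * A / (8 * ξ ^ 2) ≤ 2 * (3 / 2 * A / ξ ^ 4 + y)) : 3 * (2 * A / (2 * ξ) + Z) ≤ 300 * F :=
  by
  have hE2 : 1 ≤ E ^ 2 := one_le_pow₀ hE
  have hξ10 : 10 ≤ ξ := by linarith
  have hξ0 : 0 < ξ := by linarith
  set B := A / ξ with hB
  have hB0 : 0 ≤ B := by positivity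
  have hA' : A = B * ξ := by rw [hB]; field_simp
  rw [hA'] at h1 h2 ⊢
  have e1 : E ^ 4 * (B * ξ) / (8 * ξ ^ 3) ≤ B / 800 := by
    rw [div_le_div_iff₀ (by positivity) (by norm_num)]
    have : (10 * E ^ 2) ^ 2 ≤ ξ ^ 2 := pow_le_pow_left₀ (by positivity) hξ 2
    nlinarith [mul_le_mul_of_nonneg_left this (by positivity : 0 ≤ B * ξ)]
  have h1' : ξ * y + ξ ^ 2 * Z ≤ 3 * (B / 800 + E ^ 2 * Z + F) := by
    have := mul_le_mul_of_nonneg_left h1 hξ0.le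
    rw [← mul_assoc, mul_inv_cancel₀ hξ0.ne', one_mul] at this
    nlinarith
  have h1'' : ξ * y + 50 * Z ≤ 3 * (B / 800 + F) := by
    have h3 : 50 + 3 * E ^ 2 ≤ ξ ^ 2 := by nlinarith
    have := mul_le_mul_of_nonneg_right h3 hZ
    linarith
  have h2' : E ^ 2 * B / 8 ≤ 2 * (3 / 200 * B + ξ * y) := by
    have := mul_le_mul_of_nonneg_left h2 hξ0.le
    have e3 : ξ * (E ^ 2 * (B * ξ) / (8 * ξ ^ 2)) = E ^ 2 * B / 8 := by field_simp
    have e4 : ξ * (3 / 2 * (B * ξ) / ξ ^ 4) ≤ 3 / 200 * B := by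
      have : ξ * (3 / 2 * (B * ξ) / ξ ^ 4) = 3 / 2 * B / ξ ^ 2 := by field_simp
      rw [this, div_le_iff₀ (by positivity)]
      have : 100 ≤ ξ ^ 2 := by nlinarith
      nlinarith
    rw [e3] at this
    linarith
  have e5 : 2 * (B * ξ) / (2 * ξ) = B := by field_simp
  rw [e5]
  nlinarith

/-- The two edge amplitudes and the remainder. -/
lemma ex_edge_split {w : ℝ → ℂ²} (h : IsSol E l F w) (hE : 1 ≤ E) (hl : 10 * E ^ 2 ≤ l.re) : ∃ (α
  β : ℂ) (Y X : ℝ → ℂ), (∀ x, (w x).1 = α * exp (l * (x - 1)) + -(I * E / (2 * l)) * β * exp (-l *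
  (x - 0)) + Y x) ∧ (∀ x, (w x).2 = β * exp (-l * (x - 0)) + I * E / (2 * l) * α * exp (l * (x - 1))
  + X x) ∧ (∀ x, HasDerivAt Y (l * Y x + (-(E ^ 2 / (2 * l)) * α * exp (l * (x - 1)) + I * E * X x +
  I * (F x).2)) x) ∧ (∀ x, HasDerivAt X (-l * X x + (E ^ 2 / (2 * l) * β * exp (-l * (x - 0)) + I *
  E * Y x + I * (F x).1)) x) ∧ Y 1 = 0 ∧ X 0 = 0 ∧ I * E / (2 * l) * β = α * exp (-l) + Y 0 ∧ I * E
  / (2 * l) * α = -β * exp (-l) - X 1 := by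
  have hl0 : l ≠ 0 := by
    rintro rfl
    rw [zero_re] at hl
    nlinarith
  set c : ℂ := I * E / (2 * l) with hc
  have hcl : 2 * l * c = I * E := by rw [hc]; field_simp
  have hcE : I * E * c = -(E ^ 2 / (2 * l)) := by rw [hc]; field_simp; rw [I_sq]; ring
  set r : ℂ := c * exp (-l) with hr
  have hcn : ‖c‖ ≤ 1 / 2 := by
    have h1 : ‖c‖ = E / (2 * ‖l‖) := by
      rw [hc, norm_div, norm_mul, norm_mul, norm_I, norm_real, Real.norm_of_nonneg (by linarith)]
      simp
    have h2 : 10 * E ^ 2 ≤ ‖l‖ := hl.trans (re_le_norm l)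
    rw [h1, div_le_iff₀ (by nlinarith)]
    nlinarith
  have hrn : ‖r‖ < 1 := by
    have : ‖exp (-l)‖ ≤ 1 := by
      rw [norm_exp, neg_re]
      exact exp_le_one_iff.2 (by nlinarith)
    calc ‖r‖ = ‖c‖ * ‖exp (-l)‖ := norm_mul _ _
      _ ≤ 1 / 2 * 1 := by gcongr
      _ < 1 := by norm_num
  have hr1 : 1 + r ^ 2 ≠ 0 := by
    intro h0
    have h1 : r ^ 2 = -1 := by linear_combination h0
    have h2 : ‖r‖ ^ 2 = 1 := by rw [← norm_pow, h1]; simp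
    nlinarith [norm_nonneg r]
  set α := ((w 1).1 + r * (w 0).2) / (1 + r ^ 2) with hα
  set β := ((w 0).2 - r * (w 1).1) / (1 + r ^ 2) with hβ
  have e1 : α - r * β = (w 1).1 := by rw [hα, hβ]; field_simp; ring
  have e2 : β + r * α = (w 0).2 := by rw [hα, hβ]; field_simp; ring
  refine ⟨α, β, fun x => (w x).1 - α * exp (l * (x - 1))
      + c * β * exp (-l * (x - 0)), fun x => (w x).2 - β * exp (-l * (x - 0))
      - c * α * exp (l * (x - 1)), fun x => by ring, fun x => by ring,
      fun x => ?_, fun x => ?_, ?_, ?_, ?_, ?_⟩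
  · refine (((h.fst x).sub ((derivAt_cexp_mul l 1 x).const_mul α)).add
      ((derivAt_cexp_mul (-l) 0 x).const_mul (c * β))).congr_deriv ?_
    linear_combination (-β * exp (-l * (x - 0))) * hcl + (α * exp (l * (x - 1))) * hcE
  · refine (((h.snd x).sub ((derivAt_cexp_mul (-l) 0 x).const_mul β)).sub
      ((derivAt_cexp_mul l 1 x).const_mul (c * α))).congr_deriv ?_
    linear_combination (-α * exp (l * (x - 1))) * hcl - (β * exp (-l * (x - 0))) * hcE
  · dsimp only; rw [← e1, hr]; simp; ring
  · dsimp only; rw [← e2, hr]; simp; ring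
  · have h0 := h.left
    simp [h0]
  · have h0 := h.right
    simp [h0]

lemma inv_mul_le_of_sum {ξ a b : ℝ} (hξ : 0 < ξ) (h : a ≤ b) : ξ⁻¹ * a ≤ ξ⁻¹ * b :=
  mul_le_mul_of_nonneg_left h (by positivity)

lemma exp_neg_sq_le {ξ : ℝ} (hξ : 0 < ξ) : rexp (-ξ) ^ 2 ≤ 3 / 2 / ξ ^ 4 := by
  have h := pow_div_factorial_le_exp (2 * ξ) (by positivity) 4
  have h2 : rexp (-ξ) ^ 2 = (rexp (2 * ξ))⁻¹ := by
    rw [← Real.exp_nat_mul, ← Real.exp_neg]; congr 1; push_cast; ring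
  rw [h2, inv_le_comm₀ (by positivity) (by positivity)]
  refine le_trans (le_of_eq ?_) h
  norm_num [Nat.factorial]
  field_simp
  norm_num

set_option maxHeartbeats 1000000 in
lemma IsSol.sqInt_le_of_pos {w : ℝ → ℂ²} (h : IsSol E l F w) (hF : Continuous F) (hE : 1 ≤ E) (hl
  : 10 * E ^ 2 ≤ l.re) (him : |l.im| ≤ l.re) : sqInt w ≤ 300 * sqInt F := by
  obtain ⟨α, β, Y, X, hU, hV, hY, hX, hY1, hX0, hβ, hα⟩ := ex_edge_split h hE hl
  have hξ : 0 < l.re := by nlinarith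
  have hYc : Continuous Y := continuous_iff_continuousAt.2 fun x => (hY x).continuousAt
  have hXc : Continuous X := continuous_iff_continuousAt.2 fun x => (hX x).continuousAt
  have hl1 : l.re ≤ ‖l‖ := re_le_norm l
  have hl2 : ‖l‖ ^ 2 ≤ 2 * l.re ^ 2 := by
    rw [← normSq_eq_norm_sq, normSq_apply]
    have := sq_le_sq' (by linarith [neg_abs_le l.im, abs_nonneg l.im]) (le_of_abs_le him)
    nlinarith
  have hE0 : 0 ≤ E := by linarith
  have nc : ‖I * E / (2 * l)‖ ^ 2 = E ^ 2 / (4 * ‖l‖ ^ 2) := by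
    rw [norm_div, norm_mul, norm_mul, norm_I, norm_real, Real.norm_of_nonneg hE0, div_pow]
    simp; ring
  have nc2 : ‖(E : ℂ) ^ 2 / (2 * l)‖ ^ 2 = E ^ 4 / (4 * ‖l‖ ^ 2) := by
    rw [norm_div, norm_mul, norm_pow, norm_real, Real.norm_of_nonneg hE0, div_pow]
    simp; ring
  set c : ℂ := I * E / (2 * l) with hc
  set d : ℂ := (E : ℂ) ^ 2 / (2 * l) with hd
  have i1 := int_norm_cexp_right_le hξ
  have i2 := int_norm_cexp_left_le hξ
  have E1 := energy_right hξ (by fun_prop) hY hY1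
  have E2 := energy_left hξ (by fun_prop) hX hX0
  have a1 := int_norm_add₃_sq_le (f := fun x : ℝ => -d * α * exp (l * (x - 1)))
    (g := fun x => I * E * X x) (h := fun x => I * (F x).2)
    (by fun_prop) (by fun_prop) (by fun_prop)
  have a2 := int_norm_add₃_sq_le (f := fun x : ℝ => d * β * exp (-l * (x - 0)))
    (g := fun x => I * E * Y x) (h := fun x => I * (F x).1)
    (by fun_prop) (by fun_prop) (by fun_prop)
  have a3 := int_norm_add₃_sq_le (f := fun x : ℝ => α * exp (l * (x - 1)))
    (g := fun x => -c * β * exp (-l * (x - 0))) (h := Y)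
    (by fun_prop) (by fun_prop) (by fun_prop)
  have a4 := int_norm_add₃_sq_le (f := fun x : ℝ => β * exp (-l * (x - 0)))
    (g := fun x => c * α * exp (l * (x - 1))) (h := X)
    (by fun_prop) (by fun_prop) (by fun_prop)
  simp only [← hU, ← hV] at a3 a4
  simp only [int_norm_const_mul_sq] at a1 a2 a3 a4
  simp only [norm_mul, mul_pow, norm_neg, norm_I, one_pow, one_mul, norm_real,
    norm_eq_abs, sq_abs, nc, nc2] at a1 a2 a3 a4
  have n1 := int_sq_nonneg X
  have n2 := int_sq_nonneg Y
  have n3 := int_sq_nonneg fun x => (F x).1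
  have n4 := int_sq_nonneg fun x => (F x).2
  set e1 := ∫ x in 0..1, ‖exp (l * (x - 1))‖ ^ 2
  set e2 := ∫ x in 0..1, ‖exp (-l * (x - 0))‖ ^ 2
  have ne1 : 0 ≤ e1 := int_sq_nonneg _
  have ne2 : 0 ≤ e2 := int_sq_nonneg _
  set IX := ∫ x in 0..1, ‖X x‖ ^ 2
  set IY := ∫ x in 0..1, ‖Y x‖ ^ 2
  set F1 := ∫ x in 0..1, ‖(F x).1‖ ^ 2
  set F2 := ∫ x in 0..1, ‖(F x).2‖ ^ 2
  have E1' := E1.trans (inv_mul_le_of_sum hξ a1)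
  have E2' := E2.trans (inv_mul_le_of_sum hξ a2)
  set ξ := l.re
  have hn0 : 0 < ‖l‖ := by linarith
  have k1 : E ^ 4 / (4 * ‖l‖ ^ 2) ≤ E ^ 4 / (4 * ξ ^ 2) := by gcongr
  have k2 : E ^ 2 / (8 * ξ ^ 2) ≤ E ^ 2 / (4 * ‖l‖ ^ 2) := by
    apply div_le_div_of_nonneg_left (by positivity) (by positivity); linarith
  have k3 : E ^ 2 / (4 * ‖l‖ ^ 2) ≤ 1 := by
    rw [div_le_one (by positivity)]
    have : E ≤ ‖l‖ := by nlinarith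
    nlinarith
  have m1 : E ^ 4 / (4 * ‖l‖ ^ 2) * ‖α‖ ^ 2 * e1 ≤ E ^ 4 * ‖α‖ ^ 2 / (8 * ξ ^ 3) := by
    calc _ ≤ E ^ 4 / (4 * ξ ^ 2) * ‖α‖ ^ 2 * (2 * ξ)⁻¹ := by gcongr
      _ = _ := by field_simp; ring
  have m2 : E ^ 4 / (4 * ‖l‖ ^ 2) * ‖β‖ ^ 2 * e2 ≤ E ^ 4 * ‖β‖ ^ 2 / (8 * ξ ^ 3) := by
    calc _ ≤ E ^ 4 / (4 * ξ ^ 2) * ‖β‖ ^ 2 * (2 * ξ)⁻¹ := by gcongr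
      _ = _ := by field_simp; ring
  have key : ∀ p q s : ℂ, c * p = q * exp (-l) + s → E ^ 2 / (8 * ξ ^ 2) * ‖p‖ ^ 2 ≤ 2 * (3 / 2 / ξ
    ^ 4 * ‖q‖ ^ 2 + ‖s‖ ^ 2) := by
    intro p q s hp
    have h1 : ‖c * p‖ ≤ ‖q‖ * rexp (-ξ) + ‖s‖ := by
      rw [hp]
      refine (norm_add_le _ _).trans (le_of_eq ?_)
      rw [norm_mul, norm_exp, neg_re]
    have h2 := pow_le_pow_left₀ (norm_nonneg _) h1 2
    rw [norm_mul, mul_pow, nc] at h2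
    have h3 := exp_neg_sq_le hξ
    have h4 : (‖q‖ * rexp (-ξ) + ‖s‖) ^ 2 ≤ 2 * (‖q‖ ^ 2 * rexp (-ξ) ^ 2 + ‖s‖ ^ 2) := by
      nlinarith [sq_nonneg (‖q‖ * rexp (-ξ) - ‖s‖)]
    have h5 := mul_le_mul_of_nonneg_left h3 (sq_nonneg ‖q‖)
    have h6 := mul_le_mul_of_nonneg_right k2 (sq_nonneg ‖p‖)
    linarith
  have c1 := key β α (Y 0) hβ
  have c2 := key α (-β) (-X 1) (by rw [hα]; ring)
  rw [norm_neg, norm_neg] at c2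
  have hA := edge_arith (A := ‖α‖ ^ 2 + ‖β‖ ^ 2) (Z := IX + IY) (y := ‖Y 0‖ ^ 2 + ‖X 1‖ ^ 2)
    (F := F1 + F2) hE hl (by positivity) (by positivity) (by positivity) (by positivity)
    (by
      have t : E ^ 4 * (‖α‖ ^ 2 + ‖β‖ ^ 2) / (8 * ξ ^ 3) = E ^ 4 * ‖α‖ ^ 2 / (8 * ξ ^ 3)
        + E ^ 4 * ‖β‖ ^ 2 / (8 * ξ ^ 3) := by ring
      have u1 := inv_mul_le_of_sum hξ (show 3 * (E ^ 4 / (4 * ‖l‖ ^ 2) * ‖α‖ ^ 2 * e1 + E ^ 2 * IX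
        + F2) ≤ 3 * (E ^ 4 * ‖α‖ ^ 2 / (8 * ξ ^ 3) + E ^ 2 * IX + F2) by linarith)
      have u2 := inv_mul_le_of_sum hξ (show 3 * (E ^ 4 / (4 * ‖l‖ ^ 2) * ‖β‖ ^ 2 * e2 + E ^ 2 * IY
        + F1) ≤ 3 * (E ^ 4 * ‖β‖ ^ 2 / (8 * ξ ^ 3) + E ^ 2 * IY + F1) by linarith)
      rw [t]
      linarith)
    (by
      have t1 : E ^ 2 * (‖α‖ ^ 2 + ‖β‖ ^ 2) / (8 * ξ ^ 2) = E ^ 2 / (8 * ξ ^ 2) * ‖β‖ ^ 2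
        + E ^ 2 / (8 * ξ ^ 2) * ‖α‖ ^ 2 := by ring
      have t2 : 3 / 2 * (‖α‖ ^ 2 + ‖β‖ ^ 2) / ξ ^ 4 = 3 / 2 / ξ ^ 4 * ‖α‖ ^ 2
        + 3 / 2 / ξ ^ 4 * ‖β‖ ^ 2 := by ring
      rw [t1, t2]
      linarith)
  have v1 : ‖α‖ ^ 2 * e1 ≤ ‖α‖ ^ 2 * (2 * ξ)⁻¹ := by gcongr
  have v2 : ‖β‖ ^ 2 * e2 ≤ ‖β‖ ^ 2 * (2 * ξ)⁻¹ := by gcongr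
  have v3 : E ^ 2 / (4 * ‖l‖ ^ 2) * ‖α‖ ^ 2 * e1 ≤ 1 * ‖α‖ ^ 2 * (2 * ξ)⁻¹ := by gcongr
  have v4 : E ^ 2 / (4 * ‖l‖ ^ 2) * ‖β‖ ^ 2 * e2 ≤ 1 * ‖β‖ ^ 2 * (2 * ξ)⁻¹ := by gcongr
  have t3 : 2 * (‖α‖ ^ 2 + ‖β‖ ^ 2) / (2 * ξ) = 2 * (‖α‖ ^ 2 * (2 * ξ)⁻¹)
    + 2 * (‖β‖ ^ 2 * (2 * ξ)⁻¹) := by field_simp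
  rw [t3] at hA
  show _ + _ ≤ 300 * (F1 + F2)
  linarith

lemma isSol_solA (h : Disp E l = 0) : IsSol E l (fun _ => 0) (solA E l) :=
  ⟨fun x => (derivAt_solA_fst E l x).congr_deriv (by simp),
    fun x => (derivAt_solA_snd E l x).congr_deriv (by simp), by simp [solA_zero],
    by rw [solA_one_snd, h]⟩

lemma sqInt_zero : sqInt (fun _ => 0) = 0 := by simp [sqInt]

lemma cont_solA_right (E : ℝ) (l : ℂ) : Continuous (solA E l) := by
  simpa only [Function.comp_def] using (cont_solA E).comp (Continuous.prodMk_right l)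

lemma cont_solB_right (E : ℝ) (l : ℂ) : Continuous (solB E l) := by
  simpa only [Function.comp_def] using (cont_solB E).comp (Continuous.prodMk_right l)

lemma sqInt_solA_pos (E : ℝ) (l : ℂ) : 0 < sqInt (solA E l) := by
  have hc := ((cont_solA_right E l).snd.norm).pow 2
  have h2 : 0 < ∫ x in 0..1, ‖(solA E l x).2‖ ^ 2 :=
    intervalIntegral.integral_pos zero_lt_one hc.continuousOn (fun _ _ => by positivity)
      ⟨0, by simp, by simp [solA_zero]⟩
  have h1 := int_sq_nonneg fun x => (solA E l x).1
  unfold sqInt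
  linarith

lemma IsSol.sqInt_le {w : ℝ → ℂ²} (h : IsSol E l F w) (hF : Continuous F) (hE : 1 ≤ E) (hl : 10 *
  E ^ 2 ≤ |l.re|) (him : |l.im| ≤ |l.re|) : sqInt w ≤ 300 * sqInt F := by
  have hF0 : 0 ≤ sqInt F := add_nonneg (int_sq_nonneg _) (int_sq_nonneg _)
  rcases le_total 0 l.re with h0 | h0
  · rw [abs_of_nonneg h0] at hl him
    exact h.sqInt_le_of_pos hF hE hl him
  · rw [abs_of_nonpos h0] at hl
    have := h.sqInt_le_of_neg hF hE (by linarith)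
    linarith

lemma abs_re_lt_of_disp (hE : 1 ≤ E) (him : |l.im| ≤ 10 * E ^ 2) (h : Disp E l = 0) : |l.re|
  < 10 * E ^ 2 := by
  by_contra! hc
  have := (isSol_solA h).sqInt_le continuous_const hE hc (him.trans hc)
  rw [sqInt_zero] at this
  linarith [sqInt_solA_pos E l]

lemma finite_zeros {f : ℂ → ℂ} (hf : Differentiable ℂ f) {z₀ : ℂ} (h0 : f z₀ ≠ 0) {K : Set ℂ} (hK
  : IsCompact K) : (K ∩ {z | f z = 0}).Finite := by
  by_contra hinf
  obtain ⟨z, -, hz⟩ := Infinite.exists_accPt_of_subset_isCompact hinf hK inter_subset_left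
  have ha : AnalyticOnNhd ℂ f univ := fun z _ => hf.analyticAt z
  have hfr := (accPt_iff_frequently_nhdsNE.1 hz).mono fun w hw => hw.2
  exact h0 (ha.eqOn_zero_of_preconnected_of_frequently_eq_zero isPreconnected_univ (mem_univ z) hfr
    (mem_univ z₀))

lemma disp_self (E : ℝ) : Disp E E = 1 - E := by rw [disp_eq]; simp [cosSqrt_zero, sincSqrt_zero]

lemma exists_admissibleWeight (hN : 2 ≤ N) : ∃ γ, AdmissibleWeight N γ := by
  have hE : 1 < ωₜ N := one_lt_omegaThr hN
  set E := ωₜ N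
  have h0 : Disp E E ≠ 0 := by
    rw [disp_self]
    intro h
    have : E = (1 : ℂ) := by grind
    exact hE.ne' (ofReal_injective this)
  have hfin := finite_zeros (diff_disp E) h0 (isCompact_closedBall 0 (20 * E ^ 2))
  set Z := closedBall 0 (20 * E ^ 2) ∩ {z | Disp E z = 0} with hZ
  have hfin2 : ((fun z => |z.im|) '' (Z ∩ {z | z.im ≠ 0})).Finite :=
    (hfin.subset inter_subset_left).image _
  have hex : ∃ γ, 0 < γ ∧ γ ≤ 1 ∧ ∀ z ∈ Z, |z.im| ≤ γ → z.im = 0 := by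
    have hopen : IsOpen ((fun z => |z.im|) '' (Z ∩ {z | z.im ≠ 0}))ᶜ := hfin2.isClosed.isOpen_compl
    have hmem : 0 ∈ ((fun z => |z.im|) '' (Z ∩ {z | z.im ≠ 0}))ᶜ := by simp
    obtain ⟨r, hr, hsub⟩ := isOpen_iff.1 hopen 0 hmem
    refine ⟨min (r / 2) 1, by positivity, min_le_right _ _, fun z hz hle => ?_⟩
    by_contra hne
    have h1 := hle.trans (min_le_left _ _)
    exact hsub (by simp; linarith) ⟨z, ⟨hz, hne⟩, rfl⟩
  obtain ⟨γ, hγ, hγ1, hz⟩ := hex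
  refine ⟨γ, hγ, fun l hl him => hz l ⟨?_, hl⟩ him⟩
  have hE2 : 1 ≤ E ^ 2 := one_le_pow₀ hE.le
  have h1 := abs_re_lt_of_disp hE.le (by linarith) hl
  rw [mem_closedBall_zero_iff]
  linarith [norm_le_abs_re_add_abs_im l]

lemma omega_zero (N : ℕ) : omega N 0 = ωₜ N := by simp [omega]

lemma exists_admissibleRadius (hN : 2 ≤ N) : ∃ a, AdmissibleRadius N a := by
  have hE := one_lt_omegaThr hN
  have hg : gap N 0 = fun l => sincSqrt ((ωₜ N) ^ 2 - l ^ 2) - ((parity N / ωₜ N : ℝ) : ℂ) := by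
    funext l; rw [gap_eq, omega_zero]
  set E := ωₜ N
  have hd : Differentiable ℂ (gap N 0) := by
    rw [hg]
    exact (diff_sincSqrt.comp (by fun_prop)).sub_const _
  have h0 : gap N 0 E ≠ 0 := by
    rw [hg]
    simp only [sub_self, sincSqrt_zero]
    intro h
    have h1 : (parity N / E) = 1 := by
      have : ((parity N / E : ℝ) : ℂ) = ((1 : ℝ) : ℂ) := by push_cast at h ⊢; linear_combination -h
      exact ofReal_injective this
    have h2 : |parity N / E| < 1 := by
      rw [abs_div, abs_parity, abs_of_pos (by linarith), div_lt_one (by linarith)]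
      exact hE
    rw [h1] at h2
    simp at h2
  have hfin := finite_zeros hd h0 (isCompact_closedBall 1 1)
  have hfin2 := hfin.subset (inter_subset_left (t := {z : ℂ | z ≠ 1}))
  have hopen := hfin2.isClosed.isOpen_compl
  obtain ⟨r, hr, hsub⟩ := isOpen_iff.1 hopen 1 (fun h => h.2 rfl)
  refine ⟨min (min (r / 2) 1) ((E - 1) / 2), ?_, ?_, fun l hl hgl => ?_⟩
  · have : 0 < E - 1 := by linarith
    positivity
  · exact (min_le_right _ _).trans_lt (by linarith)
  · by_contra hne
    have h1 := hl.trans ((min_le_left _ _).trans (min_le_left _ _))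
    have h2 := hl.trans ((min_le_left _ _).trans (min_le_right _ _))
    exact hsub (by rw [mem_ball, dist_eq_norm]; linarith)
      ⟨⟨by rw [mem_closedBall, dist_eq_norm]; exact h2, hgl⟩, hne⟩

/-! ### Bounds for the transversal solution -/

lemma norm_intvl_sub_mul_le {G : ℝ → ℂ²} (hF : Continuous F) (hGK : ∀ x ∈ 𝕀, ‖G x‖ ≤ K) {x : ℝ}
  (hx : x ∈ 𝕀) : ‖∫ t in (0 : ℝ)..x, ((F t).1 * (G t).1 - (F t).2 * (G t).2)‖ ≤ 2 * K * ∫ t in 0..1,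
  ‖F t‖ := by
  have hK : 0 ≤ K := (norm_nonneg _).trans (hGK x hx)
  have hi : ∀ a b, IntervalIntegrable (fun t => 2 * K * ‖F t‖) volume a b := fun a b => by
    apply Continuous.intervalIntegrable; fun_prop
  have h1 : ‖∫ t in 0..x, ((F t).1 * (G t).1 - (F t).2 * (G t).2)‖ ≤ ∫ t in 0..x, 2 * K * ‖F t‖ :=
    by
    refine norm_iint_le hx.1 (.of_forall fun t ht => ?_) (hi _ _)
    have hG := hGK t ⟨ht.1.le, ht.2.trans hx.2⟩
    refine (norm_sub_le _ _).trans ?_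
    rw [norm_mul, norm_mul]
    have a1 := mul_le_mul (norm_fst_le (F t)) ((norm_fst_le (G t)).trans hG) (norm_nonneg _)
      (norm_nonneg _)
    have a2 := mul_le_mul (norm_snd_le (F t)) ((norm_snd_le (G t)).trans hG) (norm_nonneg _)
      (norm_nonneg _)
    linarith
  rw [← iint_const_mul]
  refine h1.trans ?_
  rw [← intervalIntegral.integral_add_adjacent_intervals (hi 0 x) (hi x 1)]
  have : 0 ≤ ∫ t in x..1, 2 * K * ‖F t‖ := iint_nonneg hx.2 fun t _ => by positivity
  linarith

lemma int_norm_sq_le_sqInt (hF : Continuous F) : (∫ t in 0..1, ‖F t‖) ^ 2 ≤ sqInt F := by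
  set m := ∫ t in 0..1, ‖F t‖ with hm
  have h1 : 0 ≤ ∫ t in 0..1, (‖F t‖ - m) ^ 2 := iint_nonneg zero_le_one fun t _ => by positivity
  have h2 : ∫ t in 0..1, (‖F t‖ - m) ^ 2 = (∫ t in 0..1, ‖F t‖ ^ 2) - m ^ 2 := by
    have : ∀ t, (‖F t‖ - m) ^ 2 = ‖F t‖ ^ 2 + (-2 * m * ‖F t‖ + m ^ 2) := fun t => by ring
    simp only [this]
    rw [iint_add cont_int cont_int, iint_add cont_int cont_int, iint_const_mul, ← hm]
    simp; ring
  have h3 : ∫ t in 0..1, ‖F t‖ ^ 2 ≤ sqInt F := by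
    unfold sqInt
    rw [← iint_add cont_int cont_int]
    refine integral_mono_on zero_le_one
      cont_int
      cont_int fun x _ => ?_
    rw [Prod.norm_def]
    rcases max_choice ‖(F x).1‖ ‖(F x).2‖ with h | h <;> rw [h]
    · nlinarith [sq_nonneg ‖(F x).2‖]
    · nlinarith [sq_nonneg ‖(F x).1‖]
  linarith

/-- The solution of the boundary value problem away from the roots of the Disp relation. -/
def resSol (E : ℝ) (l : ℂ) (F : ℝ → ℂ²) : ℝ → ℂ² := transv E l (solv E l F / Disp E l) F

lemma isSol_resSol (hF : Continuous F) (h : Disp E l ≠ 0) : IsSol E l F (resSol E l F) :=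
  isSol_transv hF (mul_div_cancel₀ _ h)

/-- The resolvent of the transversal problem is bounded by `K` in the sense of `sqInt`. -/
def ResBound (E K : ℝ) (l : ℂ) : Prop :=
  ∀ F : ℝ → ℂ², Continuous F → sqInt (resSol E l F) ≤ K * sqInt F

lemma ex_sqInt_bd_of_isCompact {Z : Set ℂ} (hZ : IsCompact Z) (hd : ∀ l ∈ Z, Disp E l ≠ 0) :
  ∃ K, ∀ l ∈ Z, ResBound E K l := by
  have hZ1 : IsCompact (Z ×ˢ 𝕀) := hZ.prod isCompact_Icc
  obtain ⟨KA, hKA⟩ := hZ1.exists_bound_of_continuousOn (cont_solA E).continuousOn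
  obtain ⟨KB, hKB⟩ := hZ1.exists_bound_of_continuousOn (cont_solB E).continuousOn
  obtain ⟨KD, hKD⟩ := hZ.exists_bound_of_continuousOn (f := fun l => (Disp E l)⁻¹)
    ((diff_disp E).continuous.continuousOn.inv₀ hd)
  set K := max 0 (max KA (max KB KD)) with hK
  have hK0 : 0 ≤ K := le_max_left _ _
  have hA : ∀ l ∈ Z, ∀ x ∈ 𝕀, ‖solA E l x‖ ≤ K := fun l hl x hx =>
    (hKA (l, x) ⟨hl, hx⟩).trans ((le_max_left _ _).trans (le_max_right _ _))
  have hB : ∀ l ∈ Z, ∀ x ∈ 𝕀, ‖solB E l x‖ ≤ K := fun l hl x hx =>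
    (hKB (l, x) ⟨hl, hx⟩).trans ((le_max_left _ _).trans ((le_max_right _ _).trans
      (le_max_right _ _)))
  have hD : ∀ l ∈ Z, ‖(Disp E l)⁻¹‖ ≤ K := fun l hl =>
    (hKD l hl).trans ((le_max_right _ _).trans ((le_max_right _ _).trans (le_max_right _ _)))
  refine ⟨2 * ((K * (2 * K * K) + 4 * K) * K + 2 * K * K) ^ 2, fun l hl F hF => ?_⟩
  have hm0 : 0 ≤ ∫ t in 0..1, ‖F t‖ := iint_nonneg zero_le_one fun t _ => norm_nonneg _
  have hm := int_norm_sq_le_sqInt hF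
  set m := ∫ t in 0..1, ‖F t‖
  have one_mem : 1 ∈ 𝕀 := by simp
  have bS := norm_intvl_sub_mul_le hF (hA l hl) one_mem
  have bq : ‖solv E l F / Disp E l‖ ≤ 2 * K * m * K := by
    rw [div_eq_mul_inv, norm_mul]
    exact mul_le_mul bS (hD l hl) (norm_nonneg _) (by positivity)
  have bA : ∀ x ∈ 𝕀, ‖coeffA E l F x‖ ≤ 2 * K * m := fun x hx => by
    rw [coeffA, norm_mul, norm_I, one_mul]
    exact norm_intvl_sub_mul_le hF (hB l hl) hx
  have bB : ∀ x ∈ 𝕀, ‖coeffB E l F x‖ ≤ 2 * K * m := fun x hx => by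
    rw [coeffB, norm_mul, norm_neg, norm_I, one_mul]
    exact norm_intvl_sub_mul_le hF (hA l hl) hx
  have bw : ∀ x ∈ 𝕀, ‖resSol E l F x‖ ≤ ((K * (2 * K * K) + 4 * K) * K + 2 * K * K) * m := by
    intro x hx
    rw [resSol, transv]
    refine (norm_add_le _ _).trans ?_
    rw [norm_smul, norm_smul]
    have t1 : ‖I * (I * E * sinK (kSq E l) 1) * (solv E l F / Disp E l)‖ ≤ K * (2 * K * m * K) := by
      rw [norm_mul, norm_mul, norm_I, one_mul]
      refine mul_le_mul ?_ bq (norm_nonneg _) hK0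
      exact (norm_fst_le (solA E l 1)).trans (hA l hl 1 one_mem)
    have t2 := (norm_add_le _ _).trans (add_le_add ((norm_sub_le _ _).trans (add_le_add t1 (bA 1 one_mem)))
        (bA x hx))
    have t3 := mul_le_mul t2 (hA l hl x hx) (norm_nonneg _) (by positivity)
    have t4 := mul_le_mul (bB x hx) (hB l hl x hx) (norm_nonneg _) (by positivity)
    calc _ ≤ _ := add_le_add t3 t4
      _ = _ := by ring
  have key : ∀ f : ℝ → ℂ, (∀ x ∈ 𝕀, ‖f x‖ ≤ ((K * (2 * K * K) + 4 * K) * K + 2 * K * K) * m) → ∫ x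
    in 0..1, ‖f x‖ ^ 2 ≤ (((K * (2 * K * K) + 4 * K) * K + 2 * K * K) * m) ^ 2 := by
    intro f hf
    have := norm_integral_le_of_norm_le_const
      (f := fun x => ‖f x‖ ^ 2) (C := (((K * (2 * K * K) + 4 * K) * K + 2 * K * K) * m) ^ 2)
      (fun x hx => by
        rw [uIoc_of_le zero_le_one] at hx
        rw [norm_pow, norm_norm]
        exact pow_le_pow_left₀ (norm_nonneg _) (hf x ⟨hx.1.le, hx.2⟩) 2)
    rw [sub_zero, abs_one, mul_one] at this
    exact (le_abs_self _).trans this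
  have k1 := key _ fun x hx => (norm_fst_le _).trans (bw x hx)
  have k2 := key _ fun x hx => (norm_snd_le _).trans (bw x hx)
  unfold sqInt at hm ⊢
  have := mul_le_mul_of_nonneg_left hm (sq_nonneg ((K * (2 * K * K) + 4 * K) * K + 2 * K * K))
  rw [mul_pow] at k1 k2
  linarith

lemma ex_sqInt_bd (hE : 1 ≤ E) (hγ : 0 ≤ γ) (hd : ∀ l : ℂ, |l.im| = γ → Disp E l ≠ 0) : ∃ K,
  0 ≤ K ∧ ∀ l : ℂ, |l.im| = γ → ResBound E K l := by
  have hZ : IsCompact {l : ℂ | |l.im| = γ ∧ |l.re| ≤ 10 * E ^ 2 + γ} := by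
    refine isCompact_of_isClosed_isBounded ?_ ?_
    · exact (isClosed_eq (by fun_prop) continuous_const).inter
        (isClosed_le (f := fun l : ℂ => |l.re|) (g := fun _ => 10 * E ^ 2 + γ) (by fun_prop) continuous_const)
    · refine (isBounded_closedBall (x := 0) (r := 10 * E ^ 2 + γ + γ)).subset ?_
      rintro l ⟨h1, h2⟩
      rw [mem_closedBall_zero_iff]
      linarith [norm_le_abs_re_add_abs_im l]
  obtain ⟨K, hK⟩ := ex_sqInt_bd_of_isCompact hZ fun l hl => hd l hl.1
  refine ⟨max K 300, by positivity, fun l hl F hF => ?_⟩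
  have hF0 : 0 ≤ sqInt F := add_nonneg (int_sq_nonneg _) (int_sq_nonneg _)
  rcases le_total |l.re| (10 * E ^ 2 + γ) with h | h
  · exact (hK l ⟨hl, h⟩ F hF).trans (mul_le_mul_of_nonneg_right (le_max_left _ _) hF0)
  · refine ((isSol_resSol hF (hd l hl)).sqInt_le hF hE (by linarith)
      (by rw [hl]; nlinarith)).trans (mul_le_mul_of_nonneg_right (le_max_right _ _) hF0)

lemma IsSol.norm_le {w : ℝ → ℂ²} (h : IsSol E l F w) (hF : Continuous F) (hE : 0 ≤ E) {x : ℝ} (hx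
  : x ∈ 𝕀) : ‖w x‖ ≤ (‖l‖ + E) * √(sqInt w) + √(sqInt F) := by
  have hw := h.continuous
  have i1 : ∀ G : ℝ → ℂ², Continuous G → ∫ t in 0..1, ‖G t‖ ≤ √(sqInt G) := fun G hG =>
    le_sqrt_of_sq_le (int_norm_sq_le_sqInt hG)
  have hm : ∫ t in 0..1, ((‖l‖ + E) * ‖w t‖ + ‖F t‖) ≤ (‖l‖ + E) * √(sqInt w) + √(sqInt F) := by
    rw [iint_add cont_int cont_int, iint_const_mul]
    gcongr
    · exact i1 w hw
    · exact i1 F hF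
  have hi : ∀ a b, IntervalIntegrable (fun t => (‖l‖ + E) * ‖w t‖ + ‖F t‖) volume a b :=
    fun a b => by apply Continuous.intervalIntegrable; fun_prop
  have hsplit := intervalIntegral.integral_add_adjacent_intervals (hi 0 x) (hi x 1)
  have p1 : 0 ≤ ∫ t in 0..x, ((‖l‖ + E) * ‖w t‖ + ‖F t‖) :=
    iint_nonneg hx.1 fun t _ => by positivity
  have p2 : 0 ≤ ∫ t in x..1, ((‖l‖ + E) * ‖w t‖ + ‖F t‖) :=
    iint_nonneg hx.2 fun t _ => by positivity
  have bd : ∀ (c : ℂ) (p q r) t, ‖c‖ = ‖l‖ → ‖p‖ ≤ ‖w t‖ → ‖q‖ ≤ ‖w t‖ → ‖r‖ ≤ ‖F t‖ → ‖c * p + I *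
    E * q + I * r‖ ≤ (‖l‖ + E) * ‖w t‖ + ‖F t‖ := by
    intro c p q r t hc hp hq hr
    refine norm_add₃_le.trans ?_
    rw [norm_mul, norm_mul, norm_mul, norm_mul, norm_I, norm_real, norm_of_nonneg hE, hc]
    have := mul_le_mul_of_nonneg_left hp (norm_nonneg l)
    have := mul_le_mul_of_nonneg_left hq hE
    linarith
  rw [Prod.norm_def]
  refine max_le ?_ ?_
  · have e := integral_eq_sub_of_hasDerivAt (a := 0) (b := x) (fun t _ => h.fst t) cont_int
    rw [h.left, sub_zero] at e
    rw [← e]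
    refine (norm_iint_le hx.1
      (.of_forall fun t _ => bd l _ _ _ t rfl (norm_fst_le _) (norm_snd_le _)
        (norm_snd_le _)) (hi _ _)).trans (by linarith)
  · have e := integral_eq_sub_of_hasDerivAt (a := x) (b := 1) (fun t _ => h.snd t) cont_int
    rw [h.right, zero_sub] at e
    rw [← norm_neg, ← e]
    refine (norm_iint_le hx.2
      (.of_forall fun t _ => bd (-l) _ _ _ t (norm_neg l) (norm_snd_le _) (norm_fst_le _)
        (norm_fst_le _)) (hi _ _)).trans (by linarith)

section Spaces

/-! ### Test functions -/

lemma IsTest.fderiv_apply (h : IsTest φ) (v : ℝ²) : IsTest fun p => fderiv ℝ φ p v :=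
  ⟨(h.1.fderiv_right (m := ∞) (by simp)).clm_apply contDiff_const, h.2.fderiv_apply (𝕜 := ℝ) v⟩

lemma IsTest.dX (h : IsTest φ) : IsTest (dX φ) := h.fderiv_apply _

lemma IsTest.dY (h : IsTest φ) : IsTest (dY φ) := h.fderiv_apply _

lemma IsTest.continuous (h : IsTest φ) : Continuous φ := h.1.continuous

lemma IsTest.differentiable (h : IsTest φ) : Differentiable ℝ φ := h.1.differentiable (by simp)

lemma IsTest.add {ψ : ℝ² → ℂ} (h : IsTest φ) (h' : IsTest ψ) : IsTest fun p => φ p + ψ p := ⟨h.1.add h'.1, h.2.add h'.2⟩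

lemma IsTest.const_mul (h : IsTest φ) (c : ℂ) : IsTest fun p => c * φ p := ⟨contDiff_const.mul h.1, h.2.mul_left⟩

lemma IsTest.conj (h : IsTest φ) : IsTest fun p => conj (φ p) :=
  ⟨conjCLE.contDiff.comp h.1, h.2.comp_left (map_zero _)⟩

lemma isTest_zero : IsTest fun _ => 0 := ⟨contDiff_const, HasCompactSupport.zero⟩

lemma fderiv_conj_apply (h : IsTest φ) (v p : ℝ²) : fderiv ℝ (fun p => conj (φ p)) p v = conj
  (fderiv ℝ φ p v) := by
  have h1 := (conjCLE.toContinuousLinearMap.hasFDerivAt).comp p (h.differentiable p).hasFDerivAt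
  have h2 : HasFDerivAt (fun p => conj (φ p)) _ p := h1
  rw [h2.fderiv]
  rfl

instance : IsFiniteMeasureOnCompacts μₛ := by unfold stripMeasure; infer_instance

lemma measSet_strip : MeasurableSet strip := measurableSet_Ioo.prod MeasurableSet.univ

lemma int_fderiv_mul {ψ : ℝ² → ℂ} (hφ : IsTest φ) (hψ : IsTest ψ) (v : ℝ²) (hs : tsupport φ ∩
  tsupport ψ ⊆ strip) : ∫ p, fderiv ℝ φ p v * ψ p ∂μₛ = -∫ p, φ p * fderiv ℝ ψ p v ∂μₛ := by
  have hφ' := hφ.fderiv_apply v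
  have hψ' := hψ.fderiv_apply v
  have h0 : ∀ p, p ∉ strip → φ p = 0 ∧ fderiv ℝ φ p v = 0 ∨ ψ p = 0 ∧ fderiv ℝ ψ p v = 0 := by
    intro p hp
    by_cases h : p ∈ tsupport φ
    · have h2 : p ∉ tsupport ψ := fun h2 => hp (hs ⟨h, h2⟩)
      right
      refine ⟨image_eq_zero_of_notMem_tsupport h2, ?_⟩
      rw [image_eq_zero_of_notMem_tsupport fun h3 => h2 (tsupport_fderiv_subset ℝ h3)]; rfl
    · left
      refine ⟨image_eq_zero_of_notMem_tsupport h, ?_⟩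
      rw [image_eq_zero_of_notMem_tsupport fun h3 => h (tsupport_fderiv_subset ℝ h3)]; rfl
  unfold stripMeasure
  rw [setIntegral_eq_integral_of_forall_compl_eq_zero fun p hp => by
      rcases h0 p hp with h | h <;> simp [h.1, h.2],
    setIntegral_eq_integral_of_forall_compl_eq_zero fun p hp => by grind]
  rw [integral_mul_fderiv_eq_neg_fderiv_mul_of_integrable, neg_neg]
  · exact (hφ'.continuous.mul hψ.continuous).integrable_of_hasCompactSupport hφ'.2.mul_right
  · exact (hφ.continuous.mul hψ'.continuous).integrable_of_hasCompactSupport hφ.2.mul_right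
  · exact (hφ.continuous.mul hψ.continuous).integrable_of_hasCompactSupport hφ.2.mul_right
  · exact fun p _ => hφ.differentiable p
  · exact fun p _ => hψ.differentiable p

lemma int_dirac {u ux uy : ℝ² → ℂ} (σ : ℂ) (hu : Continuous u) (hx : Continuous ux) (hy :
  Continuous uy) (hφ : IsTest φ) (e1 : ∫ p, ux p * φ p ∂μₛ = -∫ p, u p * dX φ p ∂μₛ) (e2 : ∫ p, uy p
  * φ p ∂μₛ = -∫ p, u p * dY φ p ∂μₛ) : ∫ p, (-I * ux p - σ * uy p) * φ p ∂μₛ = ∫ p, u p * (I * dX φ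
  p + σ * dY φ p) ∂μₛ := by
  have i : ∀ {f g : ℝ² → ℂ} (c : ℂ), Continuous f → IsTest g → Integrable (fun p => c * (f p * g p))
    μₛ := fun c hf hg =>
    ((hf.mul hg.continuous).integrable_of_hasCompactSupport hg.2.mul_left).const_mul c
  have r1 : ∀ p, (-I * ux p - σ * uy p) * φ p = -I * (ux p * φ p) - σ * (uy p * φ p) := fun p => by
    ring
  have r2 : ∀ p, u p * (I * dX φ p + σ * dY φ p) = I * (u p * dX φ p) + σ * (u p * dY φ p) :=
    fun p => by ring
  simp only [r1, r2]
  rw [integral_sub (i _ hx hφ) (i _ hy hφ), integral_add (i _ hu hφ.dX) (i _ hu hφ.dY)]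
  simp only [integral_const_mul, e1, e2]
  ring

lemma hasDirac_snd_of_isTest (hφ : IsTest φ) (hs : tsupport φ ⊆ {p | p.1 < 1}) : HasDirac (fun p
  => (0, φ p)) (fun p => (-I * dX φ p + dY φ p, 0)) := by
  refine ⟨fun ψ _ _ => by simp, fun ψ hψ hψs => ?_⟩
  have hst : tsupport φ ∩ tsupport ψ ⊆ strip := fun p hp => ⟨⟨hψs hp.2, hs hp.1⟩, mem_univ _⟩
  simpa [← sub_eq_add_neg] using int_dirac (-1) hφ.continuous hφ.dX.continuous hφ.dY.continuous hψ
    (int_fderiv_mul hφ hψ (1, 0) hst) (int_fderiv_mul hφ hψ (0, 1) hst)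

lemma hasDirac_fst_of_isTest (hφ : IsTest φ) (hs : tsupport φ ⊆ {p | 0 < p.1}) : HasDirac (fun p
  => (φ p, 0)) (fun p => (0, -I * dX φ p - dY φ p)) := by
  refine ⟨fun ψ hψ hψs => ?_, fun ψ _ _ => by simp⟩
  have hst : tsupport φ ∩ tsupport ψ ⊆ strip := fun p hp => ⟨⟨hs hp.1, hψs hp.2⟩, mem_univ _⟩
  simpa using int_dirac 1 hφ.continuous hφ.dX.continuous hφ.dY.continuous hψ
    (int_fderiv_mul hφ hψ (1, 0) hst) (int_fderiv_mul hφ hψ (0, 1) hst)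

/-! ### The weighted spaces as copies of one Hilbert space -/

/-- Square-integrable spinor fields on the strip. -/
abbrev StripL2 : Type := Lp (WithLp 2 ℂ²) 2 μₛ

/-- `e^{s|y|}`. -/
def weight (s : ℝ) (p : ℝ²) : ℝ := rexp (s * |p.2|)

lemma cont_wt (s : ℝ) : Continuous (weight s) := by unfold weight; fun_prop

lemma wt_pos (s : ℝ) (p : ℝ²) : 0 < weight s p := exp_pos _

lemma wt_mul (s t : ℝ) (p : ℝ²) : weight s p * weight t p = weight (s + t) p := by
  rw [weight, weight, ← Real.exp_add, weight]; ring_nf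

lemma wt_zero (p : ℝ²) : weight 0 p = 1 := by simp [weight]

lemma wt_mul_neg (s : ℝ) (p : ℝ²) : weight s p * weight (-s) p = 1 := by
  rw [wt_mul, add_neg_cancel, wt_zero]

lemma wt_neg_mul (s : ℝ) (p : ℝ²) : weight (-s) p * weight s p = 1 := by
  rw [wt_mul, neg_add_cancel, wt_zero]

lemma memL_iff : MemL s w ↔ MemLp (fun p => weight s p • w p) 2 μₛ := Iff.rfl

lemma memLp_toLp_iff : MemLp (fun p => WithLp.toLp 2 (w p)) 2 μₛ ↔ MemLp w 2 μₛ :=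
  ⟨fun h => (WithLp.prodContinuousLinearEquiv 2 ℂ ℂ ℂ).toContinuousLinearMap.comp_memLp' h,
    fun h => (WithLp.prodContinuousLinearEquiv 2 ℂ ℂ ℂ).symm.toContinuousLinearMap.comp_memLp' h⟩

open Classical in
/-- The field `e^{s|y|} w` as an element of the Hilbert space. -/
def toL (s : ℝ) (w : 𝓦) : StripL2 := if h : MemL s w then (memLp_toLp_iff.2 h).toLp _ else 0

/-- The field `e^{-s|y|} h`. -/
def ofL (s : ℝ) (h : StripL2) (p : ℝ²) : ℂ² := weight (-s) p • WithLp.ofLp (h p)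

lemma coeFn_toL (h : MemL s w) : toL s w =ᵐ[μₛ] fun p => WithLp.toLp 2 (weight s p • w p) := by
  rw [toL, dif_pos h]
  exact MemLp.coeFn_toLp _

lemma ofL_toL (h : MemL s w) : ofL s (toL s w) =ᵐ[μₛ] w := by
  filter_upwards [coeFn_toL h] with p hp
  rw [ofL, hp, smul_smul, wt_neg_mul, one_smul]

lemma memL_ofL (s : ℝ) (h : StripL2) : MemL s (ofL s h) := by
  have h1 := (memLp_toLp_iff (w := fun p => WithLp.ofLp (h p))).1 (Lp.memLp h)
  rw [memL_iff]
  refine (memLp_congr_ae (.of_forall fun p => ?_)).2 h1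
  simp only [ofL, smul_smul, wt_mul_neg, one_smul]

lemma toL_ofL (s : ℝ) (h : StripL2) : toL s (ofL s h) = h := by
  refine Lp.ext ?_
  filter_upwards [coeFn_toL (memL_ofL s h)] with p hp
  rw [hp, ofL, smul_smul, wt_mul_neg, one_smul]

lemma MemL.congr (h : MemL s w) (he : w =ᵐ[μₛ] w') : MemL s w' :=
  (memLp_congr_ae (he.mono fun p hp => by simp only [hp])).1 h

lemma toL_congr (h : MemL s w) (he : w =ᵐ[μₛ] w') : toL s w = toL s w' := by
  refine Lp.ext ?_
  filter_upwards [coeFn_toL h, coeFn_toL (h.congr he), he] with p h1 h2 h3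
  rw [h1, h2, h3]

lemma toL_eq_of_ofL {h : StripL2} (he : ofL s h =ᵐ[μₛ] w) : h = toL s w := by
  rw [← toL_congr (memL_ofL s h) he, toL_ofL]

lemma ofL_add (s : ℝ) (h h' : StripL2) : ofL s (h + h') =ᵐ[μₛ] fun p => ofL s h p + ofL s h' p :=
  by
  filter_upwards [Lp.coeFn_add h h'] with p hp
  simp only [ofL, hp, Pi.add_apply, WithLp.ofLp_add, smul_add]

lemma ofL_smul (s : ℝ) (c : ℂ) (h : StripL2) : ofL s (c • h) =ᵐ[μₛ] fun p => c • ofL s h p := by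
  filter_upwards [Lp.coeFn_smul c h] with p hp
  simp only [ofL, hp, Pi.smul_apply, WithLp.ofLp_smul]
  rw [smul_comm]

lemma ofL_zero (s : ℝ) : ofL s 0 =ᵐ[μₛ] fun _ => 0 := by
  filter_upwards [Lp.coeFn_zero (E := WithLp 2 ℂ²) (p := 2) (μ := μₛ)] with p hp
  rw [ofL, hp]
  simp

lemma ofL_sum (s : ℝ) {ι : Type*} (t : Finset ι) (h : ι → StripL2) : ofL s (∑ i ∈ t, h i) =ᵐ[μₛ]
  fun p => ∑ i ∈ t, ofL s (h i) p := by
  classical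
  induction t using Finset.induction_on with
  | empty => simpa using ofL_zero s
  | insert i t hi ih =>
    rw [Finset.sum_insert hi]
    filter_upwards [ofL_add s (h i) (∑ i ∈ t, h i), ih] with p h1 h2
    rw [h1, h2, Finset.sum_insert hi]

lemma MemL.add (h : MemL s w) (h' : MemL s w') : MemL s fun p => w p + w' p := by
  have := MemLp.add h h'
  rw [memL_iff]
  convert this using 2 with p
  simp [weight]

lemma MemL.const_smul (h : MemL s w) (c : ℂ) : MemL s fun p => c • w p := by
  have := MemLp.const_smul h c
  refine (memLp_congr_ae (.of_forall fun p => ?_)).1 this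
  simp
  rw [smul_comm]

lemma toL_add (h : MemL s w) (h' : MemL s w') : toL s (fun p => w p + w' p) = toL s w + toL s w'
  := by
  refine (toL_eq_of_ofL ?_).symm
  filter_upwards [ofL_add s (toL s w) (toL s w'), ofL_toL h, ofL_toL h'] with p h1 h2 h3
  rw [h1, h2, h3]

lemma toL_const_smul (h : MemL s w) (c : ℂ) : toL s (fun p => c • w p) = c • toL s w := by
  refine (toL_eq_of_ofL ?_).symm
  filter_upwards [ofL_smul s c (toL s w), ofL_toL h] with p h1 h2
  rw [h1, h2]

/-- `∫ (u' \bar u + v' \bar v)`. -/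
lemma inner_eq_int (s : ℝ) (a b : StripL2) : ⟪a, b⟫_ℂ = ∫ p, (conj (ofL s a p).1 * (ofL (-s) b
  p).1 + conj (ofL s a p).2 * (ofL (-s) b p).2) ∂μₛ := by
  rw [L2.inner_def]
  refine integral_congr_ae (.of_forall fun p => ?_)
  have hw : (weight (-s) p) * ((weight s p) : ℂ) = 1 := by exact_mod_cast wt_neg_mul s p
  simp only [WithLp.prod_inner_apply, RCLike.inner_apply, ofL, neg_neg, smul_fst,
    smul_snd, real_smul, map_mul, conj_ofReal]
  change _ * conj (WithLp.ofLp (a p)).1 + _ * conj (WithLp.ofLp (a p)).2 = _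
  linear_combination (-(conj (WithLp.ofLp (a p)).1 * (WithLp.ofLp (b p)).1
    + conj (WithLp.ofLp (a p)).2 * (WithLp.ofLp (b p)).2)) * hw

lemma inner_toL (h : MemL s w) (h' : MemL (-s) w') : ⟪toL s w, toL (-s) w'⟫_ℂ = ∫ p, (conj (w p).1
  * (w' p).1 + conj (w p).2 * (w' p).2) ∂μₛ := by
  rw [inner_eq_int s]
  refine integral_congr_ae ?_
  filter_upwards [ofL_toL h, ofL_toL h'] with p h1 h2
  rw [h1, h2]

/-! ### Integrability against test functions -/

lemma MemL.memLp_fst (h : MemL s w) : MemLp (fun p => weight s p • (w p).1) 2 μₛ :=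
  (ContinuousLinearMap.fst ℂ ℂ ℂ).comp_memLp' h

lemma MemL.memLp_snd (h : MemL s w) : MemLp (fun p => weight s p • (w p).2) 2 μₛ :=
  (ContinuousLinearMap.snd ℂ ℂ ℂ).comp_memLp' h

lemma intble_mul_of_wt {f g : ℝ² → ℂ} (hf : MemLp (fun p => weight s p • f p) 2 μₛ) (hg : MemLp
  (fun p => weight (-s) p • g p) 2 μₛ) : Integrable (fun p => f p * g p) μₛ := by
  refine (hf.integrable_mul hg).congr (.of_forall fun p => ?_)
  have hw : (weight s p) * ((weight (-s) p) : ℂ) = 1 := by exact_mod_cast wt_mul_neg s p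
  simp
  linear_combination (f p * g p) * hw

lemma memLp_wt_of_compact {g : ℝ² → ℂ} (hg : Continuous g) (hc : HasCompactSupport g) (s : ℝ) :
  MemLp (fun p => weight s p • g p) 2 μₛ :=
  ((cont_wt s).smul hg).memLp_of_hasCompactSupport hc.smul_left

lemma MemL.intble_fst_mul (h : MemL s w) {g : ℝ² → ℂ} (hg : Continuous g) (hc : HasCompactSupport
  g) : Integrable (fun p => (w p).1 * g p) μₛ :=
  intble_mul_of_wt h.memLp_fst (memLp_wt_of_compact hg hc _)

lemma MemL.intble_snd_mul (h : MemL s w) {g : ℝ² → ℂ} (hg : Continuous g) (hc : HasCompactSupport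
  g) : Integrable (fun p => (w p).2 * g p) μₛ :=
  intble_mul_of_wt h.memLp_snd (memLp_wt_of_compact hg hc _)

lemma HasDirac.congr {f f' : 𝓦} (h : HasDirac w f) (hw : w =ᵐ[μₛ] w') (hf : f =ᵐ[μₛ] f') :
  HasDirac w' f' := by
  refine ⟨fun φ hφ hs => ?_, fun φ hφ hs => ?_⟩
  · rw [← integral_congr_ae (hf.mono fun p hp => show (f p).2 * φ p = (f' p).2 * φ p by rw [hp]),
      h.1 φ hφ hs]
    exact integral_congr_ae (hw.mono fun p hp => by simp only [hp])
  · rw [← integral_congr_ae (hf.mono fun p hp => show (f p).1 * φ p = (f' p).1 * φ p by rw [hp]),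
      h.2 φ hφ hs]
    exact integral_congr_ae (hw.mono fun p hp => by simp only [hp])

lemma IsTest.dirac_add (h : IsTest φ) : IsTest fun p => I * ZigzagRibbon.dX φ p + ZigzagRibbon.dY
  φ p :=
  (h.dX.const_mul _).add h.dY

lemma IsTest.dirac_sub (h : IsTest φ) : IsTest fun p => I * ZigzagRibbon.dX φ p - ZigzagRibbon.dY
  φ p := by
  have := (h.dX.const_mul I).add (h.dY.const_mul (-1))
  convert this using 2 with p
  ring

lemma HasDirac.add {f f' : 𝓦} (h : HasDirac w f) (h' : HasDirac w' f') (mw : MemL s w) (mw' : MemL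
  s w') (mf : MemL s f) (mf' : MemL s f') : HasDirac (fun p => w p + w' p) (fun p => f p + f' p) :=
  by
  refine ⟨fun φ hφ hs => ?_, fun φ hφ hs => ?_⟩
  · simp only [fst_add, snd_add, add_mul]
    rw [integral_add (mf.intble_snd_mul hφ.continuous hφ.2) (mf'.intble_snd_mul hφ.continuous hφ.2),
      h.1 φ hφ hs, h'.1 φ hφ hs, integral_add (mw.intble_fst_mul hφ.dirac_add.continuous
      hφ.dirac_add.2) (mw'.intble_fst_mul hφ.dirac_add.continuous hφ.dirac_add.2)]
  · simp only [fst_add, snd_add, add_mul]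
    rw [integral_add (mf.intble_fst_mul hφ.continuous hφ.2) (mf'.intble_fst_mul hφ.continuous hφ.2),
      h.2 φ hφ hs, h'.2 φ hφ hs, integral_add (mw.intble_snd_mul hφ.dirac_sub.continuous
      hφ.dirac_sub.2) (mw'.intble_snd_mul hφ.dirac_sub.continuous hφ.dirac_sub.2)]

lemma HasDirac.const_smul {f : 𝓦} (h : HasDirac w f) (c : ℂ) : HasDirac (fun p => c • w p) (fun p
  => c • f p) := by
  refine ⟨fun φ hφ hs => ?_, fun φ hφ hs => ?_⟩
  · simp only [smul_fst, smul_snd, smul_eq_mul, mul_assoc]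
    rw [integral_const_mul, integral_const_mul, h.1 φ hφ hs]
  · simp only [smul_fst, smul_snd, smul_eq_mul, mul_assoc]
    rw [integral_const_mul, integral_const_mul, h.2 φ hφ hs]

/-- The graph of the Dirac operator in `𝓛_{-γ}`. -/
def diracRel (γ : ℝ) : Submodule ℂ (StripL2 × StripL2) where
  carrier := {x | HasDirac (ofL (-γ) x.1) (ofL (-γ) x.2)}
  add_mem' {x y} hx hy := (HasDirac.add hx hy (memL_ofL _ _) (memL_ofL _ _) (memL_ofL _ _)
    (memL_ofL _ _)).congr (ofL_add _ _ _).symm (ofL_add _ _ _).symm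
  zero_mem' := by
    have : HasDirac (fun _ => 0) (fun _ => 0) := ⟨fun _ _ _ => by simp, fun _ _ _ => by simp⟩
    exact this.congr (ofL_zero _).symm (ofL_zero _).symm
  smul_mem' c x hx := (HasDirac.const_smul hx c).congr (ofL_smul _ _ _).symm (ofL_smul _ _ _).symm

lemma toL_mem_diracRel {f : 𝓦} (hw : MemL (-γ) w) (hf : MemL (-γ) f) : (toL (-γ) w, toL (-γ) f) ∈
  diracRel γ ↔ HasDirac w f :=
  ⟨fun h => HasDirac.congr h (ofL_toL hw) (ofL_toL hf),
    fun h => HasDirac.congr h (ofL_toL hw).symm (ofL_toL hf).symm⟩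

lemma memL_of_compact (hw : Continuous w) (hc : HasCompactSupport w) (s : ℝ) : MemL s w :=
  ((cont_wt s).smul hw).memLp_of_hasCompactSupport hc.smul_left

lemma IsTest.memL_pair {ψ : ℝ² → ℂ} (hφ : IsTest φ) (hψ : IsTest ψ) (s : ℝ) : MemL s fun p => (φ
  p, ψ p) :=
  memL_of_compact (hφ.continuous.prodMk hψ.continuous)
    (HasCompactSupport.intro (hφ.2.isCompact.union hψ.2.isCompact) fun p hp => by
      rw [mem_union, not_or] at hp
      rw [image_eq_zero_of_notMem_tsupport hp.1, image_eq_zero_of_notMem_tsupport hp.2]; rfl) s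

lemma tsupp_conj (φ : ℝ² → ℂ) : tsupport (fun p => conj (φ p)) = tsupport φ := by
  simp only [tsupport]
  congr 1
  ext p
  simp

lemma HasDirac.of_adjointRel {p q : StripL2} (h : AdjointRel (diracRel γ) p q) : HasDirac (ofL γ
  p) (ofL γ q) := by
  refine ⟨fun φ hφ hs => ?_, fun φ hφ hs => ?_⟩
  · have hc := hφ.conj
    have ma : MemL (-γ) fun p => (0, conj (φ p)) := isTest_zero.memL_pair hc _
    have mb : MemL (-γ) fun p => (-I * dX (fun p => conj (φ p)) p + dY (fun p => conj (φ p)) p, 0)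
      :=
      ((hc.dX.const_mul _).add hc.dY).memL_pair isTest_zero _
    have key := h _ _ ((toL_mem_diracRel ma mb).2 (hasDirac_snd_of_isTest hc (by rwa [tsupp_conj])))
    rw [inner_eq_int (-γ), inner_eq_int (-γ), neg_neg] at key
    have e1 := ofL_toL ma
    have e2 := ofL_toL mb
    rw [eq_comm] at key
    refine Eq.trans (integral_congr_ae ?_) (key.trans (integral_congr_ae ?_))
    · filter_upwards [e1] with x hx
      rw [hx]; simp; ring
    · filter_upwards [e2] with x hx
      rw [hx]
      simp only [dX, dY, fderiv_conj_apply hφ]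
      simp; ring
  · have hc := hφ.conj
    have ma : MemL (-γ) fun p => (conj (φ p), 0) := hc.memL_pair isTest_zero _
    have mb : MemL (-γ) fun p => (0, -I * dX (fun p => conj (φ p)) p - dY (fun p => conj (φ p)) p)
      := by
      have := isTest_zero.memL_pair ((hc.dX.const_mul (-I)).add (hc.dY.const_mul (-1))) (-γ)
      convert this using 3 with p
      ring
    have key := h _ _ ((toL_mem_diracRel ma mb).2 (hasDirac_fst_of_isTest hc (by rwa [tsupp_conj])))
    rw [inner_eq_int (-γ), inner_eq_int (-γ), neg_neg] at key
    have e1 := ofL_toL ma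
    have e2 := ofL_toL mb
    rw [eq_comm] at key
    refine Eq.trans (integral_congr_ae ?_) (key.trans (integral_congr_ae ?_))
    · filter_upwards [e1] with x hx
      rw [hx]; simp; ring
    · filter_upwards [e2] with x hx
      rw [hx]
      simp only [dX, dY, fderiv_conj_apply hφ]
      simp; ring

/-! ### Multiplication operators -/

lemma ex_mulOp {m : ℝ² → ℝ} (hm : AEStronglyMeasurable m μₛ) (hC : ∀ᵐ p ∂μₛ, |m p| ≤ C) (hC0 : 0 ≤
  C) : ∃ M : StripL2 →L[ℂ] StripL2, ‖M‖ ≤ C ∧ ∀ h : StripL2, M h =ᵐ[μₛ] fun p => m p • h p := by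
  have hmem : ∀ h : StripL2, MemLp (fun p => m p • h p) 2 μₛ := fun h =>
    (Lp.memLp h).of_le_mul (hm.smul (Lp.aestronglyMeasurable h)) (by
      filter_upwards [hC] with p hp
      rw [norm_smul, norm_eq_abs]
      gcongr)
  let M₀ : StripL2 →ₗ[ℂ] StripL2 :=
    { toFun := fun h => (hmem h).toLp _
      map_add' := fun h h' => by
        refine Lp.ext ?_
        filter_upwards [(hmem (h + h')).coeFn_toLp, (hmem h).coeFn_toLp, (hmem h').coeFn_toLp,
          Lp.coeFn_add h h', Lp.coeFn_add ((hmem h).toLp _) ((hmem h').toLp _)] with p h1 h2 h3 h4 h5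
        rw [h1, h5, Pi.add_apply, h2, h3, h4, Pi.add_apply, smul_add]
      map_smul' := fun c h => by
        refine Lp.ext ?_
        filter_upwards [(hmem (c • h)).coeFn_toLp, (hmem h).coeFn_toLp, Lp.coeFn_smul c h,
          Lp.coeFn_smul c ((hmem h).toLp _)] with p h1 h2 h3 h4
        rw [h1, RingHom.id_apply, h4, Pi.smul_apply, h2, h3, Pi.smul_apply, smul_comm] }
  refine ⟨M₀.mkContinuous C fun h => ?_, M₀.mkContinuous_norm_le hC0 _, fun h =>
    (hmem h).coeFn_toLp⟩
  refine Lp.norm_le_mul_norm_of_ae_le_mul ?_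
  filter_upwards [(hmem h).coeFn_toLp, hC] with p h1 h2
  change ‖(hmem h).toLp _ p‖ ≤ _
  rw [h1, norm_smul, norm_eq_abs]
  gcongr

/-- The embedding of `𝓛_γ` in `𝓛_{-γ}`. -/
lemma ex_embedding (hγ : 0 ≤ γ) : ∃ J : StripL2 →L[ℂ] StripL2, ∀ h : StripL2, ofL (-γ) (J h)
  =ᵐ[μₛ] ofL γ h := by
  obtain ⟨J, -, hJ⟩ := ex_mulOp (m := weight (-(2 * γ))) (C := 1)
    (cont_wt _).aestronglyMeasurable (.of_forall fun p => by
      rw [abs_of_pos (wt_pos _ _), weight, exp_le_one_iff]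
      nlinarith [abs_nonneg p.2]) zero_le_one
  refine ⟨J, fun h => ?_⟩
  filter_upwards [hJ h] with p hp
  simp only [ofL, hp, WithLp.ofLp_smul, smul_smul, wt_mul]
  ring_nf

/-- Multiplication by a potential, from `𝓛_{-γ}` to `𝓛_γ`. -/
lemma ex_potentialOp {R₀ : ℝ} {P : ℝ² → ℝ} (hγ : 0 ≤ γ) (hP : IsPotential R₀ P) : ∃ M : StripL2
  →L[ℂ] StripL2, ‖M‖ ≤ rexp (2 * γ * |R₀|) ∧ ∀ h : StripL2, ofL γ (M h) =ᵐ[μₛ] fun p => P p •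
  ofL (-γ) h p := by
  have hsub : strip ⊆ Icc 0 1 ×ˢ univ := prod_mono Ioo_subset_Icc_self subset_rfl
  have hmeas : AEStronglyMeasurable P μₛ := (hP.1.mono hsub).aestronglyMeasurable measSet_strip
  obtain ⟨M, hM, hM'⟩ := ex_mulOp (m := fun p => weight (2 * γ) p * P p)
    (C := rexp (2 * γ * |R₀|)) ((cont_wt _).aestronglyMeasurable.mul hmeas) (by
      filter_upwards [ae_restrict_mem measSet_strip] with p hp
      obtain ⟨h1, h2⟩ := hP.2 p (hsub hp)
      rw [abs_mul, abs_of_pos (wt_pos _ _)]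
      rcases lt_or_ge R₀ |p.2| with h | h
      · rw [h2 h]; simp; positivity
      · calc weight (2 * γ) p * |P p| ≤ rexp (2 * γ * |R₀|) * 1 := by
              refine mul_le_mul (exp_le_exp.2 (mul_le_mul_of_nonneg_left
                (h.trans (le_abs_self _)) (by positivity))) h1 (abs_nonneg _) (by positivity)
          _ = _ := mul_one _) (by positivity)
  refine ⟨M, hM, fun h => ?_⟩
  filter_upwards [hM' h] with p hp
  simp only [ofL, hp, WithLp.ofLp_smul, smul_smul, neg_neg]
  congr 1
  rw [← mul_assoc, wt_mul, mul_comm]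
  ring_nf

/-! ### Density of test fields -/

/-- Pairs of test functions. -/
def testF : Submodule ℂ (𝓦) where
  carrier := {f | IsTest (fun p => (f p).1) ∧ IsTest (fun p => (f p).2)}
  add_mem' hf hg := ⟨hf.1.add hg.1, hf.2.add hg.2⟩
  zero_mem' := ⟨isTest_zero, isTest_zero⟩
  smul_mem' c _ hf := ⟨hf.1.const_mul c, hf.2.const_mul c⟩

lemma memL_testF (s : ℝ) (f : testF) : MemL s f := f.2.1.memL_pair f.2.2 s

def testToL (s : ℝ) : testF →ₗ[ℂ] StripL2 where
  toFun f := toL s f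
  map_add' f g := toL_add (memL_testF s f) (memL_testF s g)
  map_smul' c f := toL_const_smul (memL_testF s f) c

lemma denseRange_testToL (s : ℝ) : DenseRange (testToL s) := by
  rw [DenseRange, ← LinearMap.coe_range, Submodule.dense_iff_topologicalClosure_eq_top,
    Submodule.topologicalClosure_eq_top_iff, Submodule.eq_bot_iff]
  intro h hh
  have hz : ∀ f : testF, ⟪toL s f, h⟫_ℂ = 0 := fun f =>
    (Submodule.mem_orthogonal _ _).1 hh _ ⟨f, rfl⟩
  have mh := memL_ofL (-s) h
  have loc : ∀ {g : ℝ² → ℂ}, MemLp (fun p => weight (-s) p • g p) 2 μₛ → LocallyIntegrable g μₛ :=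
    by
    intro g hg
    have h1 := (hg.locallyIntegrable (by norm_num))
    have h2 := (locallyIntegrableOn_univ.2 h1).continuousOn_smul isOpen_univ.isLocallyClosed
      (cont_wt s).continuousOn
    rw [locallyIntegrableOn_univ] at h2
    refine h2.congr (.of_forall fun p => ?_)
    simp only [smul_smul, wt_mul_neg, one_smul]
  have realTest : ∀ g : ℝ² → ℝ, ContDiff ℝ ∞ g → HasCompactSupport g → IsTest fun p => (g p : ℂ) :=
    fun g h1 h2 =>
    ⟨ofRealCLM.contDiff.comp h1, h2.comp_left (g := ((↑) : ℝ → ℂ)) rfl⟩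
  have z1 := ae_eq_zero_of_integral_contDiff_smul_eq_zero (loc mh.memLp_fst) fun g h1 h2 => by
    have := hz ⟨fun p => ((g p), 0), realTest g h1 h2, isTest_zero⟩
    rw [inner_eq_int s] at this
    rw [← this]
    refine integral_congr_ae ?_
    filter_upwards [ofL_toL (memL_testF s ⟨fun p => ((g p), 0), realTest g h1 h2,
      isTest_zero⟩)] with p hp
    rw [hp]; simp
  have z2 := ae_eq_zero_of_integral_contDiff_smul_eq_zero (loc mh.memLp_snd) fun g h1 h2 => by
    have := hz ⟨fun p => (0, (g p)), isTest_zero, realTest g h1 h2⟩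
    rw [inner_eq_int s] at this
    rw [← this]
    refine integral_congr_ae ?_
    filter_upwards [ofL_toL (memL_testF s ⟨fun p => (0, (g p)), isTest_zero,
      realTest g h1 h2⟩)] with p hp
    rw [hp]; simp
  have e : ofL (-s) h =ᵐ[μₛ] ofL (-s) 0 := by
    filter_upwards [z1, z2, ofL_zero (-s)] with p h1 h2 h3
    rw [h3]
    exact Prod.ext h1 h2
  rw [toL_eq_of_ofL e, toL_ofL]

end Spaces

section FourierTransform

open scoped FourierTransform ENNReal

/-- The Fourier transform in `y` at a complex frequency. -/
def ft (φ : ℝ² → ℂ) (x : ℝ) (l : ℂ) : ℂ := ∫ y : ℝ, φ (x, y) * exp (I * l * y)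

lemma IsTest.ex_supp_bd (h : IsTest φ) : ∃ T : ℝ, 0 ≤ T ∧ ∀ x y : ℝ, T < |y| → φ (x, y) = 0 := by
  obtain ⟨T, hT⟩ := h.2.isCompact.isBounded.exists_norm_le
  refine ⟨max T 0, le_max_right _ _, fun x y hy => image_eq_zero_of_notMem_tsupport fun hm => ?_⟩
  have h1 := hT _ hm
  have h2 : |y| ≤ ‖(x, y)‖ := norm_snd_le (x, y)
  linarith [le_max_left T 0]

lemma IsTest.ex_norm_le (h : IsTest φ) : ∃ B : ℝ, ∀ p, ‖φ p‖ ≤ B :=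
  h.continuous.bounded_above_of_compact_support h.2

lemma ft_eq_setIntegral (hT : ∀ x y : ℝ, T < |y| → φ (x, y) = 0) (x : ℝ) (l : ℂ) : ft φ x l = ∫ y
  in Icc (-T) T, φ (x, y) * exp (I * l * y) := by
  refine (setIntegral_eq_integral_of_forall_compl_eq_zero fun y hy => ?_).symm
  rw [hT x y, zero_mul]
  by_contra hc
  exact hy (abs_le.1 (not_lt.1 hc))

lemma cont_ft (h : IsTest φ) : Continuous fun p : ℂ × ℝ => ft φ p.2 p.1 := by
  obtain ⟨T, -, hT⟩ := h.ex_supp_bd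
  simp only [ft_eq_setIntegral hT]
  refine continuous_parametric_integral_of_continuous
    ?_
    isCompact_Icc
  have := h.continuous
  simp only [Function.uncurry_def]
  fun_prop

lemma norm_exp_I_mul (l : ℂ) (y : ℝ) : ‖exp (I * l * y)‖ = rexp (-l.im * y) := by
  rw [norm_exp]; simp

lemma norm_exp_neg_I_mul (l : ℂ) (y : ℝ) : ‖exp (-I * l * y)‖ = rexp (l.im * y) := by
  rw [norm_exp]; simp

lemma exp_neg_mul_le {y : ℝ} (ht : |t| ≤ γ) (hy : |y| ≤ T) : rexp (t * y) ≤ rexp (γ * T) := by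
  refine exp_le_exp.2 ((le_abs_self _).trans ?_)
  rw [abs_mul]
  exact mul_le_mul ht hy (abs_nonneg _) ((abs_nonneg _).trans ht)

lemma norm_ft_le (h : IsTest φ) (γ : ℝ) : ∃ C, 0 ≤ C ∧ ∀ x l, |l.im| ≤ γ → ‖ft φ x l‖ ≤ C := by
  obtain ⟨T, hT0, hT⟩ := h.ex_supp_bd
  obtain ⟨B, hB⟩ := h.ex_norm_le
  have hB0 := (norm_nonneg _).trans (hB 0)
  refine ⟨B * rexp (γ * T) * volume.real (Icc (-T) T), by positivity, fun x l hl => ?_⟩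
  rw [ft_eq_setIntegral hT]
  refine norm_setIntegral_le_of_norm_le_const (by simp) fun y hy => ?_
  rw [norm_mul, norm_exp_I_mul]
  exact mul_le_mul (hB _) (exp_neg_mul_le (by rwa [abs_neg]) (abs_le.2 hy)) (by positivity) hB0

lemma diff_ft (h : IsTest φ) (x : ℝ) : Differentiable ℂ (ft φ x) := by
  obtain ⟨T, hT0, hT⟩ := h.ex_supp_bd
  obtain ⟨B, hB⟩ := h.ex_norm_le
  have hB0 := (norm_nonneg _).trans (hB 0)
  have hc := h.continuous
  intro l
  have hd : DifferentiableOn ℂ (ft φ x) (ball l 1) := by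
    have := funext (ft_eq_setIntegral hT x)
    rw [this]
    refine diffOn_int isOpen_ball (bound := fun _ => B * rexp ((|l.im| + 1) * T))
      (fun z _ => ?_) (ae_of_all _ fun y => ?_) ?_ ?_
    · exact Continuous.aestronglyMeasurable (by fun_prop)
    · exact Differentiable.differentiableOn (by fun_prop)
    · filter_upwards [ae_restrict_mem measurableSet_Icc] with y hy z hz
      rw [norm_mul, norm_exp_I_mul]
      refine mul_le_mul (hB _) (exp_neg_mul_le ?_ (abs_le.2 hy)) (by positivity) hB0
      have h1 : |z.im - l.im| ≤ ‖z - l‖ := by rw [← sub_im]; exact abs_im_le_norm _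
      have h2 := mem_ball_iff_norm.1 hz
      rw [abs_neg]
      have := abs_sub_abs_le_abs_sub z.im l.im
      linarith
    · exact integrableOn_const (by simp) 
  exact hd.differentiableAt (isOpen_ball.mem_nhds (mem_ball_self one_pos))

lemma derivAt_snd (h : IsTest φ) (x y : ℝ) : HasDerivAt (fun y => φ (x, y)) (dY φ (x, y)) y := by
  have h1 := (hasDerivAt_const y x).prodMk (hasDerivAt_id y)
  exact (h.differentiable (x, y)).hasFDerivAt.comp_hasDerivAt y h1

lemma hcs_slice (h : IsTest φ) (x : ℝ) : HasCompactSupport fun y => φ (x, y) := by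
  obtain ⟨T, -, hT⟩ := h.ex_supp_bd
  refine HasCompactSupport.intro (isCompact_Icc (a := -T) (b := T)) fun y hy => hT x y ?_
  by_contra hc
  exact hy (abs_le.1 (not_lt.1 hc))

lemma ft_dY (h : IsTest φ) (x : ℝ) (l : ℂ) : ft (dY φ) x l = -(I * l * ft φ x l) := by
  have hE : ∀ y : ℝ, HasDerivAt (fun y : ℝ => exp (I * l * y)) (exp (I * l * y) * (I * l)) y := fun
    y => by
    have := ((ofRealCLM.hasDerivAt (x := y)).const_mul (I * l)).cexp
    simpa using this
  have hc := h.continuous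
  have hc' := h.dY.continuous
  have hcE : Continuous fun y : ℝ => exp (I * l * y) := by fun_prop
  have c1 : Continuous fun y => φ (x, y) := by fun_prop
  have c2 : Continuous fun y => dY φ (x, y) := by fun_prop
  have s1 := hcs_slice h x
  have s2 := hcs_slice h.dY x
  have key := integral_mul_deriv_eq_deriv_mul_of_integrable
   
    (fun y _ => derivAt_snd h x y) (fun y _ => hE y)
    ((c1.mul (hcE.mul continuous_const)).integrable_of_hasCompactSupport s1.mul_right)
    ((c2.mul hcE).integrable_of_hasCompactSupport s2.mul_right)
    ((c1.mul hcE).integrable_of_hasCompactSupport s1.mul_right)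
  rw [ft, ft, ← integral_const_mul, ← integral_neg]
  have e : ∫ y, φ (x, y) * (exp (I * l * y) * (I * l)) = ∫ y, I * l * (φ (x, y) * exp (I * l * y))
    :=
    integral_congr_ae (ae_of_all _ fun y => by ring)
  rw [e] at key
  rw [integral_neg, key, neg_neg]

lemma ex_ft_decay (γ : ℝ) (k : ℕ) : ∀ {φ : ℝ² → ℂ}, IsTest φ → ∃ C, 0 ≤ C ∧ ∀ x l, |l.im| ≤ γ → (1
  + ‖l‖) ^ k * ‖ft φ x l‖ ≤ C := by
  induction k with
  | zero => intro φ h; simpa using norm_ft_le h γ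
  | succ k ih =>
    intro φ h
    obtain ⟨C1, h1, H1⟩ := ih h
    obtain ⟨C2, h2, H2⟩ := ih h.dY
    refine ⟨C1 + C2, by positivity, fun x l hl => ?_⟩
    have e : ‖ft (dY φ) x l‖ = ‖l‖ * ‖ft φ x l‖ := by
      rw [ft_dY h, norm_neg, norm_mul, norm_mul, norm_I, one_mul]
    have := H2 x l hl
    rw [e] at this
    have := H1 x l hl
    rw [pow_succ]
    linarith

/-! ### Plancherel and inversion -/

lemma lint_comp_div {g : ℝ → ℝ≥0∞} (hg : Measurable g) {a : ℝ} (ha : 0 < a) : ∫⁻ y, g (y / a) =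
  ENNReal.ofReal a * ∫⁻ y, g y := by
  have h := smul_map_volume_mul_left (a := a⁻¹) (by positivity)
  have e : ∫⁻ y, g y = ENNReal.ofReal |a⁻¹| * ∫⁻ y, g (a⁻¹ * y) := by
    conv_lhs => rw [← h]
    rw [lintegral_smul_measure, lintegral_map hg (by fun_prop), smul_eq_mul]
  rw [e, ← mul_assoc, ← ENNReal.ofReal_mul ha.le, abs_of_pos (by positivity),
    mul_inv_cancel₀ ha.ne', ENNReal.ofReal_one, one_mul]
  simp only [div_eq_inv_mul]

lemma fourier_div_two_pi (g : ℝ → ℂ) (y : ℝ) : 𝓕 g (y / (2 * π)) = ∫ ξ : ℝ, exp (-I * ξ * y) * g ξ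
  := by
  rw [fourier_real_eq_integral_exp_smul]
  refine integral_congr_ae (ae_of_all _ fun ξ => ?_)
  simp only [smul_eq_mul]
  congr 2
  push_cast
  have : π ≠ 0 := by positivity
  field_simp

lemma lint_enorm_sq_eq {g h : ℝ → ℂ} (e : eLpNorm g 2 volume = eLpNorm h 2 volume) : ∫⁻ y, ‖g y‖ₑ
  ^ 2 = ∫⁻ y, ‖h y‖ₑ ^ 2 := by
  have k : ∀ f : ℝ → ℂ, ∫⁻ y, ‖f y‖ₑ ^ 2 = eLpNorm f 2 volume ^ 2 := fun f => by
    have := eLpNorm_nnreal_pow_eq_lintegral (f := f) (μ := volume) (p := 2) (by norm_num)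
    simp at this
    exact this.symm
  rw [k, k, e]

/-- Plancherel's theorem, for the kernel `e^{-iξy}`. -/
lemma lint_fourier_sq {g : ℝ → ℂ} (h1 : Integrable g) (h2 : MemLp g 2) : ∫⁻ y : ℝ, ‖∫ ξ : ℝ, exp
  (-I * ξ * y) * g ξ‖ₑ ^ 2 = ENNReal.ofReal (2 * π) * ∫⁻ ξ, ‖g ξ‖ₑ ^ 2 := by
  have hcont : Continuous (𝓕 g) :=
    VectorFourier.fourierIntegral_continuous continuous_fourierChar (by fun_prop) h1
  simp only [← fourier_div_two_pi]
  rw [lint_comp_div (hcont.enorm.measurable.pow_const 2)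
    (by positivity), lint_enorm_sq_eq (eLpNorm_fourier_eq h1 h2)]

/-- The point `ξ + iη`. -/
def lineMk (η ξ : ℝ) : ℂ := ⟨ξ, η⟩

lemma lineMk_eq (η ξ : ℝ) : lineMk η ξ = ξ + η * I := by apply Complex.ext <;> simp [lineMk]

lemma cont_line (η : ℝ) : Continuous (lineMk η) := by
  simp only [lineMk_eq, funext (lineMk_eq η)]; fun_prop

lemma exp_lineMk (η ξ y : ℝ) : exp (-I * lineMk η ξ * y) = exp (η * y) * exp (-I * ξ * y) := by
  rw [← exp_add, lineMk_eq]
  congr 1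
  linear_combination (-η * y) * I_sq

lemma ft_lineMk (φ : ℝ² → ℂ) (x η ξ : ℝ) : ft φ x (lineMk η ξ) = ∫ y : ℝ, exp (-I * y * ((-ξ : ℝ)
  : ℂ)) * (φ (x, y) * exp (-η * y)) := by
  rw [ft]
  refine integral_congr_ae (ae_of_all _ fun y => ?_)
  have e : exp (I * lineMk η ξ * y) = exp (-η * y) * exp (-I * y * ((-ξ : ℝ) : ℂ)) := by
    rw [← exp_add, lineMk_eq]
    congr 1
    push_cast
    linear_combination (η * y) * I_sq
  simp only [e]
  ring

lemma one_add_sq_le (η ξ : ℝ) : 1 + ξ ^ 2 ≤ (1 + ‖lineMk η ξ‖) ^ 2 := by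
  have h : |ξ| ≤ ‖lineMk η ξ‖ := abs_re_le_norm (lineMk η ξ)
  nlinarith [abs_nonneg ξ, sq_abs ξ]

lemma le_inv_of_decay {ξ : ℝ} (ht : 0 ≤ t) (h : (1 + ‖lineMk η ξ‖) ^ 2 * t ≤ C) : t ≤ C * (1 + ξ ^
  2)⁻¹ := by
  rw [← div_eq_mul_inv, le_div_iff₀ (by positivity), mul_comm]
  exact (mul_le_mul_of_nonneg_right (one_add_sq_le η ξ) ht).trans h

lemma intble_of_decay {g : ℝ → ℂ} (hg : Continuous g) (h : ∀ ξ, ‖g ξ‖ ≤ C * (1 + ξ ^ 2)⁻¹) :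
  Integrable g :=
  (integrable_inv_one_add_sq.const_mul C).mono' hg.aestronglyMeasurable (ae_of_all _ h)

lemma memLp_two_of_decay {g : ℝ → ℂ} (hg : Continuous g) (h : ∀ ξ, ‖g ξ‖ ≤ C * (1 + ξ ^ 2)⁻¹) :
  MemLp g 2 := by
  rw [memLp_two_iff_integrable_sq_norm hg.aestronglyMeasurable]
  refine (integrable_inv_one_add_sq.const_mul (C ^ 2)).mono'
    ((hg.norm.pow 2).aestronglyMeasurable) (ae_of_all _ fun ξ => ?_)
  have h1 : (1 + ξ ^ 2)⁻¹ ≤ 1 := inv_le_one_of_one_le₀ (by nlinarith [sq_nonneg ξ])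
  have h0 : 0 ≤ (1 + ξ ^ 2)⁻¹ := by positivity
  rw [norm_pow, norm_norm]
  calc ‖g ξ‖ ^ 2 ≤ (C * (1 + ξ ^ 2)⁻¹) ^ 2 := pow_le_pow_left₀ (norm_nonneg _) (h ξ) 2
    _ = C ^ 2 * ((1 + ξ ^ 2)⁻¹ * (1 + ξ ^ 2)⁻¹) := by ring
    _ ≤ C ^ 2 * ((1 + ξ ^ 2)⁻¹ * 1) := by gcongr
    _ = _ := by ring

lemma cont_ft_line (h : IsTest φ) (x η : ℝ) : Continuous fun ξ => ft φ x (lineMk η ξ) :=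
  (cont_ft h).comp ((cont_line η).prodMk continuous_const)

lemma lint_ft_sq (h : IsTest φ) (x η : ℝ) : ∫⁻ ξ : ℝ, ‖ft φ x (lineMk η ξ)‖ₑ ^ 2 = ENNReal.ofReal
  (2 * π) * ∫⁻ y : ℝ, ‖φ (x, y) * exp (-η * y)‖ₑ ^ 2 := by
  have hc := h.continuous
  have c : Continuous fun y => φ (x, y) * exp (-η * y) := by fun_prop
  have s : HasCompactSupport fun y => φ (x, y) * exp (-η * y) := (hcs_slice h x).mul_right
  rw [← lint_fourier_sq (c.integrable_of_hasCompactSupport s) (c.memLp_of_hasCompactSupport s)]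
  simp only [ft_lineMk]
  exact lintegral_neg_eq_self (fun ξ => ‖∫ y : ℝ, exp
    (-I * y * ((ξ : ℝ) : ℂ)) * (φ (x, y) * exp (-η * y))‖ₑ ^ 2)

lemma ft_inversion (h : IsTest φ) (x y η : ℝ) : φ (x, y) = (2 * π : ℂ)⁻¹ * ∫ ξ : ℝ, exp (-I *
  lineMk η ξ * y) * ft φ x (lineMk η ξ) := by
  have hc := h.continuous
  have hpi : π ≠ 0 := by positivity
  set k : ℝ → ℂ := fun y => φ (x, y) * exp (-η * y) with hk
  have c : Continuous k := by fun_prop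
  have s : HasCompactSupport k := (hcs_slice h x).mul_right
  have hint := c.integrable_of_hasCompactSupport s (μ := volume)
  obtain ⟨C, hC0, hC⟩ := ex_ft_decay |η| 2 h
  have cF := cont_ft_line h x η
  have iF := intble_of_decay cF fun ξ => le_inv_of_decay (norm_nonneg _) (hC x _ le_rfl)
  have e1 : ∀ ξ, ft φ x (lineMk η ξ) = 𝓕 k (-ξ / (2 * π)) := fun ξ => by
    rw [fourier_div_two_pi, ft_lineMk]
  have e2 : ∀ v, 𝓕⁻ k v = ft φ x (lineMk η (v * (2 * π))) := fun v => by
    rw [e1, fourierInv_eq_fourier_neg]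
    congr 1
    field_simp
  have e3 := funext e2
  have i4 : Integrable (𝓕⁻ k) := by rw [e3]; exact iF.comp_mul_right' (by positivity)
  have i5 : Integrable (𝓕 k) := by
    have : 𝓕 k = fun v => 𝓕⁻ k (-v) := funext fun v => by grind
    rw [this]; exact i4.comp_neg
  have inv := congrFun (c.fourier_fourierInv_eq hint i5) y
  rw [fourier_real_eq_integral_exp_smul] at inv
  have e6 := Measure.integral_comp_mul_right (fun ξ => exp (-I * ξ * y)
    * ft φ x (lineMk η ξ)) (2 * π)
  have e7 : ∫ v : ℝ, exp (((-2 * π * v * y : ℝ) : ℂ) * I) • 𝓕⁻ k v = ∫ v, exp (-I * ((v * (2 * π) :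
    ℝ) : ℂ) * y) * ft φ x (lineMk η (v * (2 * π))) := by
    refine integral_congr_ae (ae_of_all _ fun v => ?_)
    simp only [e2, smul_eq_mul]
    congr 2
    push_cast
    ring
  rw [e7, e6] at inv
  have e9 : ∀ ξ, exp (-I * lineMk η ξ * y) * ft φ x (lineMk η ξ) = exp (η * y) * (exp (-I * ξ * y) *
    ft φ x (lineMk η ξ)) := fun ξ => by
    rw [exp_lineMk, mul_assoc]
  simp only [e9]
  rw [integral_const_mul]
  rw [abs_of_pos (by positivity), real_smul, hk] at inv
  push_cast at inv
  have e8 : φ (x, y) = exp (η * y) * (φ (x, y) * exp (-η * y)) := by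
    rw [mul_comm, mul_assoc, ← exp_add]; simp
  rw [e8, ← inv]
  ring

end FourierTransform

section ResolventField

open scoped ENNReal

/-! ### Dependence of the transversal solution on parameters -/

lemma cont_transv {c q : ℝ → ℂ} {F : ℝ → ℝ → ℂ²} (hc : Continuous c) (hq : Continuous q) (hF :
  Continuous fun p : ℝ² => F p.1 p.2) : Continuous fun p : ℝ² => transv E (c p.1) (q p.1) (F p.1)
  p.2 := by
  have hk : Continuous fun p : ℝ² => (c p.1, p.2) := by fun_prop
  have hA : Continuous fun p : ℝ² => solA E (c p.1) p.2 := by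
    simpa only [Function.comp_def] using (cont_solA E).comp hk
  have hB : Continuous fun p : ℝ² => solB E (c p.1) p.2 := by
    simpa only [Function.comp_def] using (cont_solB E).comp hk
  have iA : Continuous fun p : ℝ² => coeffA E (c p.1) (F p.1) p.2 :=
    continuous_const.mul (intervalIntegral.continuous_parametric_primitive_of_continuous
      (f := fun ξ t => (F ξ t).1 * (solB E (c ξ) t).1 - (F ξ t).2 * (solB E (c ξ) t).2)
      ((hF.fst.mul hB.fst).sub (hF.snd.mul hB.snd)))
  have iB : Continuous fun p : ℝ² => coeffB E (c p.1) (F p.1) p.2 :=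
    continuous_const.mul (intervalIntegral.continuous_parametric_primitive_of_continuous
      (f := fun ξ t => (F ξ t).1 * (solA E (c ξ) t).1 - (F ξ t).2 * (solA E (c ξ) t).2)
      ((hF.fst.mul hA.fst).sub (hF.snd.mul hA.snd)))
  have h1 : Continuous fun p : ℝ² => (p.1, (1 : ℝ)) := by fun_prop
  have iA1 : Continuous fun p : ℝ² => coeffA E (c p.1) (F p.1) 1 := by
    simpa only [Function.comp_def] using iA.comp h1
  have s1 : Continuous fun p : ℝ² => I * E * sinK (kSq E (c p.1)) 1 := by
    simpa only [Function.comp_def, solA] using (hA.comp h1).fst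
  unfold transv
  exact ((((continuous_const.mul s1).mul (hq.comp continuous_fst)).sub iA1).add iA).smul hA |>.add
    (iB.smul hB)

lemma diff_intvl {G : ℂ → ℝ → ℂ} (hG : Continuous fun p : ℂ × ℝ => G p.1 p.2) (hd : ∀ t,
  Differentiable ℂ fun l => G l t) {a b : ℝ} (hab : a ≤ b) : Differentiable ℂ fun l => ∫ t in a..b,
  G l t := by
  intro l
  obtain ⟨B, hB⟩ := ((isCompact_closedBall l 1).prod (isCompact_Icc (b := b))
    ).exists_bound_of_continuousOn hG.continuousOn
  have h : DifferentiableOn ℂ (fun l => ∫ t in a..b, G l t) (ball l 1) := by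
    simp only [integral_of_le hab]
    refine diffOn_int isOpen_ball (bound := fun _ => B) (fun z _ => ?_)
      (ae_of_all _ fun t => (hd t).differentiableOn) ?_ (integrableOn_const (by simp))
    · exact (hG.comp (Continuous.prodMk_right z)).aestronglyMeasurable
    · filter_upwards [ae_restrict_mem measurableSet_Ioc] with t ht z hz
      exact hB (z, t) ⟨ball_subset_closedBall hz, Ioc_subset_Icc_self ht⟩
  exact h.differentiableAt (isOpen_ball.mem_nhds (mem_ball_self one_pos))

/-! ### Fourier transforms of test fields -/

/-- The Fourier transform of a field. -/
def ftField (f : 𝓦) (l : ℂ) (x : ℝ) : ℂ² := (ft (fun p => (f p).1) x l, ft (fun p => (f p).2) x l)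

lemma cont_ftField (f : testF) : Continuous fun p : ℂ × ℝ => ftField f p.1 p.2 :=
  (cont_ft f.2.1).prodMk (cont_ft f.2.2)

lemma cont_ftField_right (f : testF) (l : ℂ) : Continuous (ftField f l) :=
  (cont_ftField f).comp (Continuous.prodMk_right l)

lemma ex_ftField_decay (f : testF) (γ : ℝ) (k : ℕ) : ∃ C, 0 ≤ C ∧ ∀ x l, |l.im| ≤ γ → (1 + ‖l‖) ^
  k * ‖ftField f l x‖ ≤ C := by
  obtain ⟨C1, h1, H1⟩ := ex_ft_decay γ k f.2.1
  obtain ⟨C2, h2, H2⟩ := ex_ft_decay γ k f.2.2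
  refine ⟨max C1 C2, h1.trans (le_max_left _ _), fun x l hl => ?_⟩
  rw [ftField, Prod.norm_def]
  rcases max_choice ‖(ft (fun p => ((f : 𝓦) p).1) x l,
    ft (fun p => ((f : 𝓦) p).2) x l).1‖ ‖(ft (fun p => ((f : 𝓦) p).1) x l,
    ft (fun p => ((f : 𝓦) p).2) x l).2‖ with h | h <;> rw [h]
  · exact (H1 x l hl).trans (le_max_left _ _)
  · exact (H2 x l hl).trans (le_max_right _ _)

lemma sqInt_le_of_norm_le {M : ℝ} (h : ∀ x ∈ 𝕀, ‖F x‖ ≤ M) : sqInt F ≤ 2 * M ^ 2 := by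
  have key : ∀ f : ℝ → ℂ, (∀ x ∈ 𝕀, ‖f x‖ ≤ M) → ∫ x in 0..1, ‖f x‖ ^ 2 ≤ M ^ 2 := by
    intro f hf
    have := norm_integral_le_of_norm_le_const (a := 0)
      (f := fun x => ‖f x‖ ^ 2) (C := M ^ 2) (fun x hx => by
        rw [uIoc_of_le zero_le_one] at hx
        rw [norm_pow, norm_norm]
        exact pow_le_pow_left₀ (norm_nonneg _) (hf x ⟨hx.1.le, hx.2⟩) 2)
    rw [sub_zero, abs_one, mul_one] at this
    exact (le_abs_self _).trans this
  have k1 := key _ fun x hx => (norm_fst_le _).trans (h x hx)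
  have k2 := key _ fun x hx => (norm_snd_le _).trans (h x hx)
  unfold sqInt
  linarith

lemma ex_solution_decay (f : testF) (hE : 1 ≤ E) (hK : 0 ≤ K) : ∃ C, 0 ≤ C ∧ ∀ l : ℂ, |l.im| ≤ γ →
  ∀ w, IsSol E l (ftField f l) w → sqInt w ≤ K * sqInt (ftField f l) → ∀ x ∈ 𝕀, (1 + ‖l‖) ^ 2 * ‖w
  x‖ ≤ C := by
  obtain ⟨C, hC0, hC⟩ := ex_ftField_decay f γ 3
  refine ⟨(E * √(K * 2) + √2) * C, by positivity, fun l hl w hw hs x hx => ?_⟩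
  have hn : 0 < 1 + ‖l‖ := by positivity
  set M := C / (1 + ‖l‖) ^ 3 with hM
  have hM0 : 0 ≤ M := by positivity
  have hF : ∀ x ∈ 𝕀, ‖ftField f l x‖ ≤ M := fun x _ => by
    rw [hM, le_div_iff₀ (by positivity), mul_comm]; exact hC x l hl
  have h1 := sqInt_le_of_norm_le hF
  have h2 := hw.norm_le (cont_ftField_right f l) (by linarith) hx
  have h3 : √(sqInt w) ≤ √(K * 2) * M := by
    rw [← sqrt_sq hM0, ← sqrt_mul (by positivity)]
    refine sqrt_le_sqrt (hs.trans ?_)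
    rw [mul_assoc]
    gcongr
  have h4 : √(sqInt (ftField f l)) ≤ √2 * M := by
    rw [← sqrt_sq hM0, ← sqrt_mul (by positivity)]
    exact sqrt_le_sqrt h1
  have h5 : ‖w x‖ ≤ (1 + ‖l‖) * ((E * √(K * 2) + √2) * M) := by
    have a1 : ‖l‖ + E ≤ (1 + ‖l‖) * E := by nlinarith [norm_nonneg l]
    have a2 := mul_le_mul a1 h3 (by positivity) (by positivity)
    have a3 : √2 * M ≤ (1 + ‖l‖) * (√2 * M) :=
      le_mul_of_one_le_left (by positivity) (by linarith [norm_nonneg l])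
    linarith
  calc (1 + ‖l‖) ^ 2 * ‖w x‖ ≤ (1 + ‖l‖) ^ 2 * ((1 + ‖l‖) * ((E * √(K * 2) + √2) * M)) := by gcongr
    _ = (E * √(K * 2) + √2) * C := by rw [hM]; field_simp

/-! ### The resolvent field on a line `Im λ = η` -/

/-- The transversal solution at `λ = ξ + iη`. -/
def lineSol (E η : ℝ) (f : 𝓦) (x ξ : ℝ) : ℂ² := resSol E (lineMk η ξ) (ftField f (lineMk η ξ)) x

/-- `(2π)⁻¹ ∫ e^{-iλy} g(x, λ) dλ` along the line `Im λ = η`. -/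
def invFt (η : ℝ) (g : ℝ → ℝ → ℂ) (p : ℝ²) : ℂ :=
  (2 * π : ℂ)⁻¹ * ∫ ξ : ℝ, exp (-I * lineMk η ξ * p.2) * g p.1 ξ

/-- The solution of `(𝒟 - E) w = f` obtained by the Fourier transform along `Im λ = η`. -/
def lineF (E η : ℝ) (f : 𝓦) (p : ℝ²) : ℂ² :=
  (invFt η (fun x ξ => (lineSol E η f x ξ).1) p, invFt η (fun x ξ => (lineSol E η f x ξ).2) p)

lemma cont_solvability (E : ℝ) (f : testF) : Continuous fun l => solv E l (ftField f l) := by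
  have hF := cont_ftField f
  have hA := cont_solA E
  unfold solv
  exact intervalIntegral.continuous_parametric_intervalIntegral_of_continuous'
   
    ((hF.fst.mul hA.fst).sub (hF.snd.mul hA.snd)) 0 1

lemma cont_lineSol (f : testF) (hd : ∀ l : ℂ, l.im = η → Disp E l ≠ 0) : Continuous fun p :
  ℝ² => lineSol E η f p.1 p.2 := by
  have hl := cont_line η
  have hq : Continuous fun ξ => solv E (lineMk η ξ) (ftField f (lineMk η ξ)) / Disp E (lineMk
    η ξ) :=
    ((cont_solvability E f).comp hl).div ((diff_disp E).continuous.comp hl) fun ξ => hd _ rfl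
  have hF : Continuous fun p : ℝ² => ftField f (lineMk η p.1) p.2 :=
    (cont_ftField f).comp ((hl.comp continuous_fst).prodMk continuous_snd)
  simpa only [Function.comp_def, lineSol, resSol, Prod.fst_swap, Prod.snd_swap] using
    (cont_transv (E := E) (F := fun ξ => ftField f (lineMk η ξ)) hl hq hF).comp continuous_swap

lemma sm_invFt {g : ℝ → ℝ → ℂ} (hg : Continuous fun p : ℝ² => g p.1 p.2) : StronglyMeasurable
  (invFt η g) := by
  have hl := cont_line η
  refine stronglyMeasurable_const.mul (StronglyMeasurable.integral_prod_right' (ν := volume)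
    (f := fun z : ℝ² × ℝ => exp (-I * lineMk η z.2 * z.1.2) * g z.1.1 z.2)
    (Continuous.stronglyMeasurable ?_))
  have h1 : Continuous fun z : ℝ² × ℝ => g z.1.1 z.2 :=
    hg.comp ((continuous_fst.comp continuous_fst).prodMk continuous_snd)
  fun_prop

lemma lint_invFt_sq {g : ℝ → ℝ → ℂ} {x : ℝ} (h1 : Integrable (g x)) (h2 : MemLp (g x) 2) : ∫⁻ y :
  ℝ, ‖exp (-η * y) * invFt η g (x, y)‖ₑ ^ 2 = ENNReal.ofReal (2 * π)⁻¹ * ∫⁻ ξ, ‖g x ξ‖ₑ ^ 2 := by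
  have e : ∀ y : ℝ, exp (-η * y) * invFt η g (x, y) = (2 * π : ℂ)⁻¹ * ∫ ξ : ℝ, exp (-I * ξ * y) * g
    x ξ := by
    intro y
    have e9 : ∀ ξ : ℝ, exp (-I * lineMk η ξ * y) * g x ξ = exp (η * y) * (exp (-I * ξ * y) * g x ξ)
      := fun ξ => by
      rw [exp_lineMk, mul_assoc]
    simp only [invFt, e9]
    rw [integral_const_mul]
    have e8 : exp (-η * y) * exp (η * y) = 1 := by rw [← exp_add]; simp
    linear_combination ((2 * π : ℂ)⁻¹ * ∫ ξ : ℝ, exp (-I * ξ * y) * g x ξ) * e8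
  have n : ‖(2 * π : ℂ)⁻¹‖ₑ = ENNReal.ofReal (2 * π)⁻¹ := by
    rw [← ofReal_norm]
    congr 1
    rw [norm_inv, norm_mul, norm_real, norm_of_nonneg pi_pos.le]
    simp
  simp only [e, enorm_mul, mul_pow, n]
  rw [lintegral_const_mul' _ _ (by finiteness), lint_fourier_sq h1 h2, ← mul_assoc]
  congr 1
  rw [← ENNReal.ofReal_pow (by positivity), ← ENNReal.ofReal_mul (by positivity)]
  congr 1
  field_simp

lemma lint_sq_eq_ofReal {f : ℝ → ℂ} (hf : Continuous f) : ∫⁻ x in 𝕁, ‖f x‖ₑ ^ 2 = ENNReal.ofReal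
  (∫ x in 0..1, ‖f x‖ ^ 2) := by
  rw [integral_of_le zero_le_one, integral_Ioc_eq_integral_Ioo, ofReal_integral_eq_lintegral_ofReal]
  · refine lintegral_congr fun x => ?_
    rw [← ofReal_norm, ENNReal.ofReal_pow (norm_nonneg _)]
  · exact ((hf.norm.pow 2).integrableOn_Icc).mono_set Ioo_subset_Icc_self
  · exact ae_of_all _ fun x => by positivity

lemma lint_sqInt {w : ℝ → ℂ²} (hw : Continuous w) : ∫⁻ x in 𝕁, (‖(w x).1‖ₑ ^ 2 + ‖(w x).2‖ₑ ^ 2) =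
  ENNReal.ofReal (sqInt w) := by
  rw [lintegral_add_left (hw.fst.enorm.measurable.pow_const 2), lint_sq_eq_ofReal hw.fst,
    lint_sq_eq_ofReal hw.snd, sqInt, ENNReal.ofReal_add (int_sq_nonneg _) (int_sq_nonneg _)]

lemma ex_lineSol_decay (f : testF) (hE : 1 ≤ E) (hK : 0 ≤ K) (hd : ∀ l : ℂ, l.im = η → Disp
  E l ≠ 0) (hb : ∀ l : ℂ, l.im = η → ResBound E K l) : ∃ C, 0 ≤ C ∧ ∀ x ∈ 𝕀, ∀ ξ, ‖lineSol E η f x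
  ξ‖ ≤ C * (1 + ξ ^ 2)⁻¹ := by
  obtain ⟨C, hC0, hC⟩ := ex_solution_decay f (γ := |η|) hE hK
  exact ⟨C, hC0, fun x hx ξ => le_inv_of_decay (norm_nonneg _) (hC (lineMk η ξ) le_rfl _
    (isSol_resSol (cont_ftField_right f _) (hd _ rfl))
    (hb _ rfl _ (cont_ftField_right f _)) x hx)⟩

lemma lint_invFt_le (f : testF) (hK : 0 ≤ K) {g : ℝ → ℝ → ℂ²} (hc : Continuous fun p : ℝ² => g p.1
  p.2) (hC : ∀ x ∈ 𝕀, ∀ ξ, ‖g x ξ‖ ≤ C * (1 + ξ ^ 2)⁻¹) (hb : ∀ ξ, sqInt (fun x => g x ξ) ≤ K *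
  sqInt (ftField f (lineMk η ξ))) : ∫⁻ x in 𝕁, ∫⁻ y : ℝ, (‖exp (-η * y) * invFt η (fun x ξ => (g x
  ξ).1) (x, y)‖ₑ ^ 2 + ‖exp (-η * y) * invFt η (fun x ξ => (g x ξ).2) (x, y)‖ₑ ^ 2) ≤ ENNReal.ofReal
  K * ∫⁻ x in 𝕁, ∫⁻ y : ℝ, (‖((f : 𝓦) (x, y)).1 * exp (-η * y)‖ₑ ^ 2 + ‖((f : 𝓦) (x, y)).2 * exp (-η
  * y)‖ₑ ^ 2) := by
  have c1 := hc.fst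
  have c2 := hc.snd
  have hF := (cont_ftField f).comp (((cont_line η).comp continuous_snd).prodMk continuous_fst)
  have hcx : ∀ x, Continuous fun ξ => g x ξ := fun x => hc.comp (Continuous.prodMk_right x)
  have hpi : (0 : ℝ) < 2 * π := by positivity
  have s1 : ∀ x ∈ 𝕁, ∫⁻ y : ℝ, (‖exp (-η * y) * invFt η (fun x ξ => (g x ξ).1) (x, y)‖ₑ ^ 2 + ‖exp
    (-η * y) * invFt η (fun x ξ => (g x ξ).2) (x, y)‖ₑ ^ 2) = ENNReal.ofReal (2 * π)⁻¹ * ∫⁻ ξ, (‖(g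
    x ξ).1‖ₑ ^ 2 + ‖(g x ξ).2‖ₑ ^ 2) := by
    intro x hx
    have d1 : ∀ ξ, ‖(g x ξ).1‖ ≤ C * (1 + ξ ^ 2)⁻¹ := fun ξ =>
      (norm_fst_le _).trans (hC x ⟨hx.1.le, hx.2.le⟩ ξ)
    have d2 : ∀ ξ, ‖(g x ξ).2‖ ≤ C * (1 + ξ ^ 2)⁻¹ := fun ξ =>
      (norm_snd_le _).trans (hC x ⟨hx.1.le, hx.2.le⟩ ξ)
    have m1 : Measurable fun y : ℝ => ‖exp (-η * y) * invFt η (fun x ξ => (g x ξ).1) (x, y)‖ₑ ^ 2 := by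
      have h1 : Measurable fun y => invFt η (fun x ξ => (g x ξ).1) (x, y) :=
        (sm_invFt c1).measurable.comp measurable_prodMk_left
      have h2 : Measurable fun y : ℝ => exp (-η * y) := by fun_prop
      exact (h2.mul h1).enorm.pow_const 2
    rw [lintegral_add_left m1, lintegral_add_left ((hcx x).fst.enorm.measurable.pow_const 2), mul_add]
    congr 1
    · exact lint_invFt_sq (intble_of_decay (hcx x).fst d1) (memLp_two_of_decay (hcx x).fst d1)
    · exact lint_invFt_sq (intble_of_decay (hcx x).snd d2) (memLp_two_of_decay (hcx x).snd d2)
  have s2 : ∀ x, ∫⁻ y : ℝ, (‖((f : 𝓦) (x, y)).1 * exp (-η * y)‖ₑ ^ 2 + ‖((f : 𝓦) (x, y)).2 * exp (-η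
    * y)‖ₑ ^ 2) = ENNReal.ofReal (2 * π)⁻¹ * ∫⁻ ξ, (‖(ftField f (lineMk η ξ) x).1‖ₑ ^ 2 + ‖(ftField
    f (lineMk η ξ) x).2‖ₑ ^ 2) := by
    intro x
    have k1 := f.2.1.continuous
    have k2 := f.2.2.continuous
    have m1 : Measurable fun y => ‖((f : 𝓦) (x, y)).1 * exp (-η * y)‖ₑ ^ 2 := by
      have h1 := k1.comp (Continuous.prodMk_right x)
      have h2 : Continuous fun y : ℝ => exp (-η * y) := by fun_prop
      exact (h1.mul h2).enorm.measurable.pow_const 2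
    have m2 : Measurable fun ξ => ‖(ftField f (lineMk η ξ) x).1‖ₑ ^ 2 :=
      (cont_ft_line f.2.1 x η).enorm.measurable.pow_const 2
    rw [lintegral_add_left m1, lintegral_add_left m2]
    simp only [ftField]
    rw [lint_ft_sq f.2.1 x η, lint_ft_sq f.2.2 x η, ← mul_add, ← mul_assoc,
      ← ENNReal.ofReal_mul (by positivity), inv_mul_cancel₀ hpi.ne', ENNReal.ofReal_one, one_mul]
  rw [setLIntegral_congr_fun measurableSet_Ioo s1]
  simp only [s2]
  rw [lintegral_const_mul' _ _ (by finiteness), lintegral_const_mul' _ _ (by finiteness),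
    ← mul_assoc, mul_comm (ENNReal.ofReal K), mul_assoc]
  gcongr
  rw [lintegral_lintegral_swap, lintegral_lintegral_swap (f := fun x ξ =>
    ‖(ftField f (lineMk η ξ) x).1‖ₑ ^ 2 + ‖(ftField f (lineMk η ξ) x).2‖ₑ ^ 2),
    ← lintegral_const_mul' _ _ (by finiteness)]
  · refine lintegral_mono fun ξ => ?_
    have cw : Continuous fun x => g x ξ := hc.comp (Continuous.prodMk_left ξ)
    have cF := cont_ftField_right f (lineMk η ξ)
    rw [lint_sqInt cw, lint_sqInt cF, ← ENNReal.ofReal_mul hK]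
    exact ENNReal.ofReal_le_ofReal (hb ξ)
  · exact ((hF.fst.enorm.measurable.pow_const 2).add
      (hF.snd.enorm.measurable.pow_const 2)).aemeasurable
  · exact ((c1.enorm.measurable.pow_const 2).add (c2.enorm.measurable.pow_const 2)).aemeasurable

lemma lint_lineField_le (f : testF) (hE : 1 ≤ E) (hK : 0 ≤ K) (hd : ∀ l : ℂ, l.im = η → Disp
  E l ≠ 0) (hb : ∀ l : ℂ, l.im = η → ResBound E K l) : ∫⁻ x in 𝕁, ∫⁻ y : ℝ, (‖exp (-η * y) *
  (lineF E η f (x, y)).1‖ₑ ^ 2 + ‖exp (-η * y) * (lineF E η f (x, y)).2‖ₑ ^ 2) ≤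
  ENNReal.ofReal K * ∫⁻ x in 𝕁, ∫⁻ y : ℝ, (‖((f : 𝓦) (x, y)).1 * exp (-η * y)‖ₑ ^ 2 + ‖((f : 𝓦) (x,
  y)).2 * exp (-η * y)‖ₑ ^ 2) := by
  obtain ⟨C, hC0, hC⟩ := ex_lineSol_decay f hE hK hd hb
  exact lint_invFt_le f hK (cont_lineSol f hd) hC fun ξ => hb _ rfl _ (cont_ftField_right f _)

/-! ### Norms in the weighted space -/

lemma stripMeasure_eq : μₛ = ((volume : Measure ℝ).restrict (Ioo 0 1)).prod volume := by
  rw [stripMeasure, strip, Measure.volume_eq_prod, ← Measure.prod_restrict, Measure.restrict_univ]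

lemma lint_strip {g : ℝ² → ℝ≥0∞} (hg : Measurable g) : ∫⁻ p, g p ∂μₛ = ∫⁻ x in 𝕁, ∫⁻ y : ℝ, g (x,
  y) := by
  rw [stripMeasure_eq]
  exact lintegral_prod _ hg.aemeasurable

lemma enorm_toLp_sq (z : ℂ²) : ‖WithLp.toLp 2 z‖ₑ ^ 2 = ‖z.1‖ₑ ^ 2 + ‖z.2‖ₑ ^ 2 := by
  rw [← ofReal_norm, ← ofReal_norm, ← ofReal_norm, ← ENNReal.ofReal_pow (norm_nonneg _),
    ← ENNReal.ofReal_pow (norm_nonneg _), ← ENNReal.ofReal_pow (norm_nonneg _),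
    ← ENNReal.ofReal_add (by positivity) (by positivity), WithLp.prod_norm_sq_eq_of_L2]
  rfl

lemma eLpNorm_toLp_sq (w : 𝓦) : eLpNorm (fun p => WithLp.toLp 2 (w p)) 2 μₛ ^ 2 = ∫⁻ p, (‖(w
  p).1‖ₑ ^ 2 + ‖(w p).2‖ₑ ^ 2) ∂μₛ := by
  have := eLpNorm_nnreal_pow_eq_lintegral (f := fun p => WithLp.toLp 2 (w p)) (μ := μₛ)
    (p := 2) (by norm_num)
  simp only [NNReal.coe_ofNat, ENNReal.coe_ofNat, ENNReal.rpow_ofNat, enorm_toLp_sq] at this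
  exact this

lemma memL_of_lint (hw : AEStronglyMeasurable w μₛ) (h : ∫⁻ p, (‖(weight s p • w p).1‖ₑ ^ 2 +
  ‖(weight s p • w p).2‖ₑ ^ 2) ∂μₛ < ⊤) : MemL s w := by
  rw [memL_iff, ← memLp_toLp_iff]
  refine ⟨(WithLp.prodContinuousLinearEquiv 2 ℂ ℂ ℂ).symm.continuous.comp_aestronglyMeasurable
    ((cont_wt s).aestronglyMeasurable.smul hw), ?_⟩
  rw [← eLpNorm_toLp_sq] at h
  by_contra hc
  rw [not_lt, top_le_iff] at hc
  rw [hc] at h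
  simp at h

lemma enorm_toL_sq (h : MemL s w) : ‖toL s w‖ₑ ^ 2 = ∫⁻ p, (‖(weight s p • w p).1‖ₑ ^ 2 + ‖(weight
  s p • w p).2‖ₑ ^ 2) ∂μₛ := by
  rw [← eLpNorm_toLp_sq, Lp.enorm_def, eLpNorm_congr_ae (coeFn_toL h)]

lemma enorm_sq_eq_ofReal (z : ℂ) : ‖z‖ₑ ^ 2 = ENNReal.ofReal (‖z‖ ^ 2) := by
  rw [← ofReal_norm, ENNReal.ofReal_pow (norm_nonneg _)]

lemma enorm_wt_smul_sq_le (γ : ℝ) (p : ℝ²) (z : ℂ) : ‖weight γ p • z‖ₑ ^ 2 ≤ ‖exp (-(γ : ℝ) * p.2)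
  * z‖ₑ ^ 2 + ‖exp (-((-γ : ℝ) : ℂ) * p.2) * z‖ₑ ^ 2 := by
  simp only [enorm_sq_eq_ofReal]
  rw [← ENNReal.ofReal_add (by positivity) (by positivity)]
  refine ENNReal.ofReal_le_ofReal ?_
  rw [norm_smul, norm_mul, norm_mul, norm_exp, norm_exp, norm_of_nonneg
    (wt_pos _ _).le, mul_pow, mul_pow, mul_pow, ← add_mul]
  refine mul_le_mul_of_nonneg_right ?_ (by positivity)
  simp only [re_mul_ofReal, neg_re, ofReal_re, neg_neg, weight]
  rcases abs_choice p.2 with h | h <;> rw [h]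
  · nlinarith [sq_nonneg (rexp (-γ * p.2))]
  · rw [mul_neg, ← neg_mul]
    nlinarith [sq_nonneg (rexp (γ * p.2))]

lemma enorm_exp_mul_sq_le (h : |η| = γ) (p : ℝ²) (z : ℂ) : ‖z * exp (-(η : ℝ) * p.2)‖ₑ ^ 2 ≤
  ‖weight γ p • z‖ₑ ^ 2 := by
  simp only [enorm_sq_eq_ofReal]
  refine ENNReal.ofReal_le_ofReal ?_
  rw [norm_smul, norm_mul, norm_exp, norm_of_nonneg (wt_pos _ _).le, mul_comm]
  refine pow_le_pow_left₀ (by positivity) (mul_le_mul_of_nonneg_right ?_ (norm_nonneg z)) 2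
  simp only [re_mul_ofReal, neg_re, ofReal_re, weight]
  refine exp_le_exp.2 ((le_abs_self _).trans ?_)
  rw [abs_mul, abs_neg, h]

lemma memL_lineF (f : testF) (hE : 1 ≤ E) (hK : 0 ≤ K) (hγ : 0 ≤ γ) (hd : ∀ l : ℂ, |l.im| = γ
  → Disp E l ≠ 0) (hb : ∀ l : ℂ, |l.im| = γ → ResBound E K l) (hs : ∀ p ∈ strip, lineF E γ
  f p = lineF E (-γ) f p) : MemL γ (lineF E γ f) ∧ ‖toL γ (lineF E γ f)‖ ≤ √(2 * K) *
  ‖toL γ (f : 𝓦)‖ := by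
  have hp := abs_of_nonneg hγ
  have hn : |-γ| = γ := by rw [abs_neg, hp]
  have hd1 : ∀ l : ℂ, l.im = γ → Disp E l ≠ 0 := fun l hl => hd l (by rw [hl, hp])
  have hd2 : ∀ l : ℂ, l.im = -γ → Disp E l ≠ 0 := fun l hl => hd l (by rw [hl, hn])
  have b1 := lint_lineField_le f hE hK hd1 fun l hl => hb l (by rw [hl, hp])
  have b2 := lint_lineField_le f hE hK hd2 fun l hl => hb l (by rw [hl, hn])
  have hc1 := cont_lineSol f hd1
  have hc2 := cont_lineSol f hd2
  have mz : ∀ {η : ℝ}, (Continuous fun p : ℝ² => lineSol E η f p.1 p.2) → Measurable (fun p => ‖exp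
    (-η * p.2) * (lineF E η f p).1‖ₑ ^ 2 + ‖exp (-η * p.2) * (lineF E η f p).2‖ₑ ^ 2) := by
    intro η h
    have h0 : Measurable fun p : ℝ² => exp (-(η : ℝ) * p.2) := by fun_prop
    exact ((h0.mul (sm_invFt h.fst).measurable).enorm.pow_const 2).add
      ((h0.mul (sm_invFt h.snd).measurable).enorm.pow_const 2)
  have mf : ∀ η : ℝ, Measurable (fun p : ℝ² => ‖((f : 𝓦) p).1 * exp (-(η : ℝ) * p.2)‖ₑ ^ 2 + ‖((f :
    𝓦) p).2 * exp (-(η : ℝ) * p.2)‖ₑ ^ 2) := by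
    intro η
    have h0 : Measurable fun p : ℝ² => exp (-(η : ℝ) * p.2) := by fun_prop
    exact ((f.2.1.continuous.measurable.mul h0).enorm.pow_const 2).add
      ((f.2.2.continuous.measurable.mul h0).enorm.pow_const 2)
  have hfin : ∀ η, |η| = γ → ∫⁻ x in 𝕁, ∫⁻ y, (‖((f : 𝓦) (x, y)).1 * exp (-η * y)‖ₑ ^ 2 + ‖((f : 𝓦)
    (x, y)).2 * exp (-η * y)‖ₑ ^ 2) ≤ ‖toL γ f‖ₑ ^ 2 := by
    intro η hη
    rw [enorm_toL_sq (memL_testF γ f), ← lint_strip (mf η)]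
    exact lintegral_mono fun p => add_le_add (enorm_exp_mul_sq_le hη p _)
      (enorm_exp_mul_sq_le hη p _)
  have key : ∫⁻ p, (‖(weight γ p • lineF E γ f p).1‖ₑ ^ 2 + ‖(weight γ p • lineF E γ f
    p).2‖ₑ ^ 2) ∂μₛ ≤ ENNReal.ofReal (2 * K) * ‖toL γ f‖ₑ ^ 2 := by
    have step : ∫⁻ p, (‖(weight γ p • lineF E γ f p).1‖ₑ ^ 2 + ‖(weight γ p • lineF E γ f
      p).2‖ₑ ^ 2) ∂μₛ ≤ ∫⁻ p, ((‖exp (-γ * p.2) * (lineF E γ f p).1‖ₑ ^ 2 + ‖exp (-γ * p.2) *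
      (lineF E γ f p).2‖ₑ ^ 2) + (‖exp (-((-γ : ℝ) : ℂ) * p.2) * (lineF E (-γ) f p).1‖ₑ ^ 2
      + ‖exp (-((-γ : ℝ) : ℂ) * p.2) * (lineF E (-γ) f p).2‖ₑ ^ 2)) ∂μₛ := by
      refine setLIntegral_mono' measSet_strip fun p hp => ?_
      rw [← hs p hp, add_add_add_comm]
      exact add_le_add (enorm_wt_smul_sq_le γ p _) (enorm_wt_smul_sq_le γ p _)
    refine step.trans ?_
    rw [lintegral_add_left (mz hc1), lint_strip (mz hc1), lint_strip (mz hc2), ENNReal.ofReal_mul (by norm_num), ENNReal.ofReal_ofNat,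
      mul_assoc, two_mul]
    exact add_le_add (b1.trans (mul_le_mul_right (hfin γ hp) _))
      (b2.trans (mul_le_mul_right (hfin (-γ) hn) _))
  have hmem : MemL γ (lineF E γ f) := by
    refine memL_of_lint ?_ (key.trans_lt (by finiteness))
    exact ((sm_invFt hc1.fst).prodMk (sm_invFt hc1.snd)).aestronglyMeasurable
  refine ⟨hmem, ?_⟩
  rw [← enorm_toL_sq hmem, ← ofReal_norm, ← ofReal_norm, ← ENNReal.ofReal_pow (norm_nonneg _),
    ← ENNReal.ofReal_pow (norm_nonneg _), ← ENNReal.ofReal_mul (by positivity),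
    ENNReal.ofReal_le_ofReal_iff (by positivity)] at key
  rw [← sqrt_sq (norm_nonneg (toL γ (lineF E γ f))),
    ← sqrt_sq (norm_nonneg (toL γ f)), ← sqrt_mul (by positivity)]
  exact sqrt_le_sqrt key

end ResolventField

section ContourShift

attribute [local irreducible] lineSol

/-- The solv functional of a test field, an entire function of `λ`. -/
def solvFn (E : ℝ) (f : 𝓦) (l : ℂ) : ℂ := solv E l (ftField f l)

lemma diff_ftField_fst (f : testF) (x : ℝ) : Differentiable ℂ fun l => (ftField f l x).1 := diff_ft f.2.1 x

lemma diff_ftField_snd (f : testF) (x : ℝ) : Differentiable ℂ fun l => (ftField f l x).2 := diff_ft f.2.2 x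

lemma diff_primitive (f : testF) {S : ℂ → ℝ → ℂ²} (hS : Continuous fun p : ℂ × ℝ => S p.1 p.2) (hd
  : ∀ x, Differentiable ℂ fun l => S l x) {x : ℝ} (hx : 0 ≤ x) : Differentiable ℂ fun l => ∫ t in (0
  : ℝ)..x, ((ftField f l t).1 * (S l t).1 - (ftField f l t).2 * (S l t).2) := by
  have hF := cont_ftField f
  refine diff_intvl
   
    ((hF.fst.mul hS.fst).sub (hF.snd.mul hS.snd)) (fun t => ?_) hx
  exact ((diff_ftField_fst f t).mul (hd t).fst).sub ((diff_ftField_snd f t).mul (hd t).snd)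

lemma diff_solvFn (E : ℝ) (f : testF) : Differentiable ℂ (solvFn E f) :=
  diff_primitive f (cont_solA E) (diff_solA E) zero_le_one

lemma diffAt_transv (f : testF) {q : ℂ → ℂ} (hq : DifferentiableAt ℂ q l) {x : ℝ} (hx : 0 ≤ x) :
  DifferentiableAt ℂ (fun l => transv E l (q l) (ftField f l) x) l := by
  have a1 : ∀ {x : ℝ}, 0 ≤ x → Differentiable ℂ fun l => coeffA E l (ftField f l) x := fun hx =>
    (diff_primitive f (cont_solB E) (diff_solB E) hx).const_mul _
  have a2 : ∀ {x : ℝ}, 0 ≤ x → Differentiable ℂ fun l => coeffB E l (ftField f l) x := fun hx =>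
    (diff_primitive f (cont_solA E) (diff_solA E) hx).const_mul _
  have s1 : Differentiable ℂ fun l => I * E * sinK (kSq E l) 1 := by
    simpa only [solA] using (diff_solA E 1).fst
  unfold transv
  exact (((((s1 l).const_mul _).mul hq).sub (a1 zero_le_one l)).add (a1 hx l)).smul
    (diff_solA E x l) |>.add ((a2 hx l).smul (diff_solB E x l))

/-- Cauchy's theorem for a strip. -/
lemma int_line_eq {h : ℂ → ℂ} {R₀ : ℝ} (hγ : 0 < γ) (hd : ∀ l : ℂ, |l.im| ≤ γ → DifferentiableAt ℂ
  h l) (hC : ∀ l : ℂ, |l.im| ≤ γ → R₀ ≤ |l.re| → (1 + ‖l‖) ^ 2 * ‖h l‖ ≤ C) (hp : Integrable fun ξ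
  => h (lineMk γ ξ)) (hn : Integrable fun ξ => h (lineMk (-γ) ξ)) : ∫ ξ, h (lineMk γ ξ) = ∫ ξ, h
  (lineMk (-γ) ξ) := by
  have rect : ∀ R : ℝ, (∫ x : ℝ in -R..R, h (lineMk (-γ) x)) - (∫ x : ℝ in -R..R, h (lineMk γ x)) +
    I • (∫ y : ℝ in -γ..γ, h (lineMk y R)) - I • (∫ y : ℝ in -γ..γ, h (lineMk y (-R))) = 0 := by
    intro R
    have := integral_boundary_rect_eq_zero_of_differentiableOn h (lineMk (-γ) (-R))
      (lineMk γ R) (fun l hl => (hd l ?_).differentiableWithinAt)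
    · simp only [lineMk_eq]
      exact this
    · have h2 : l.im ∈ [[-γ, γ]] := hl.2
      rw [uIcc_of_le (by linarith)] at h2
      exact abs_le.2 h2
  have side : ∀ c : ℝ → ℝ, (∀ R, |c R| = |R|) → Tendsto (fun R => ∫ y : ℝ in -γ..γ, h (lineMk y (c
    R))) atTop (𝓝 0) := by
    intro c hc
    have h1 : Tendsto (fun R => C * (1 + R ^ 2)⁻¹ * |γ - -γ|) atTop (𝓝 0) := by
      have : Tendsto (fun R : ℝ => (1 + R ^ 2)⁻¹) atTop (𝓝 0) :=
        tendsto_inv_atTop_zero.comp (tendsto_atTop_add_const_left _ _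
          (tendsto_pow_atTop two_ne_zero))
      simpa using (this.const_mul C).mul_const |γ - -γ|
    refine squeeze_zero_norm' ?_ h1
    filter_upwards [eventually_ge_atTop (max R₀ 0)] with R hR
    have hR0 := (le_max_right _ _).trans hR
    refine norm_integral_le_of_norm_le_const fun y hy => ?_
    rw [uIoc_of_le (by linarith)] at hy
    have := le_inv_of_decay (norm_nonneg _) (hC (lineMk y (c R)) (abs_le.2 ⟨hy.1.le, hy.2⟩)
      (by change _ ≤ |c R|; rw [hc, abs_of_nonneg hR0]; exact (le_max_left _ _).trans hR))
    have h2 : c R ^ 2 = R ^ 2 := by grind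
    rwa [h2] at this
  have t1 := intervalIntegral_tendsto_integral hn tendsto_neg_atTop_atBot tendsto_id
  have t2 := intervalIntegral_tendsto_integral hp tendsto_neg_atTop_atBot tendsto_id
  have t3 := (side (fun R => R) fun _ => rfl).const_smul I
  have t4 := (side (fun R => -R) fun _ => abs_neg _).const_smul I
  have t := ((t1.sub t2).add t3).sub t4
  simp only [id] at t
  have h0 := tendsto_nhds_unique t ((tendsto_const_nhds).congr fun R => (rect R).symm)
  simp only [smul_zero, add_zero, sub_zero] at h0
  exact (sub_eq_zero.1 h0).symm

lemma disp_ne_zero_of_re (hE : 1 ≤ E) (hγ : 0 ≤ γ) (him : |l.im| ≤ γ) (hre : 10 * E ^ 2 + γ ≤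
  |l.re|) : Disp E l ≠ 0 := fun h => by
  have := (isSol_solA h).sqInt_le continuous_const hE (by linarith) (by nlinarith)
  rw [sqInt_zero] at this
  linarith [sqInt_solA_pos E l]

lemma lineF_eq (f : testF) (hE : 1 ≤ E) (hK : 0 ≤ K) (hγ : 0 < γ) (hd : ∀ l : ℂ, |l.im| = γ →
  Disp E l ≠ 0) (hb : ∀ l : ℂ, |l.im| = γ → ResBound E K l) (hz : ∀ l : ℂ, |l.im| ≤ γ →
  Disp E l = 0 → (solvFn E f l = 0 ∧ deriv (Disp E) l ≠ 0) ∨ (solvFn E f l = 0 ∧ deriv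
  (solvFn E f) l = 0 ∧ deriv (Disp E) l = 0 ∧ deriv (deriv (Disp E)) l ≠ 0)) {p : ℝ²}
  (hp : p.1 ∈ 𝕀) : lineF E γ f p = lineF E (-γ) f p := by
  obtain ⟨q, hq, hq'⟩ := ex_quotient (diff_solvFn E f) (diff_disp E) hz
  have hg := abs_of_pos hγ
  have hn : |-γ| = γ := by grind
  obtain ⟨C, hC0, hC⟩ := ex_solution_decay f (γ := γ) (K := 300) hE (by norm_num)
  set w : ℂ → ℂ² := fun l => transv E l (q l) (ftField f l) p.1 with hw
  have hwd : ∀ l : ℂ, |l.im| ≤ γ → DifferentiableAt ℂ w l := fun l hl =>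
    diffAt_transv f (hq l hl) hp.1
  have hwl : ∀ {η : ℝ}, |η| = γ → ∀ ξ, w (lineMk η ξ) = lineSol E η f p.1 ξ := fun hη ξ => by
    rw [lineSol, resSol]
    change transv E _ (q (lineMk _ ξ)) _ _ = _
    rw [hq' _ (hd _ hη)]
    rfl
  have hwC : ∀ l, |l.im| ≤ γ → 10 * E ^ 2 + γ ≤ |l.re| → (1 + ‖l‖) ^ 2 * ‖w l‖ ≤ C := by
    intro l him hre
    have hne := disp_ne_zero_of_re hE hγ.le him hre
    have hsol : IsSol E l (ftField f l) (transv E l (q l) (ftField f l)) := by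
      refine isSol_transv (cont_ftField_right f l) ?_
      rw [hq' _ hne, mul_div_cancel₀ _ hne]
      rfl
    exact hC l him _ hsol (hsol.sqInt_le (cont_ftField_right f l) hE (by linarith)
      (by nlinarith)) _ hp
  have hint : ∀ {η : ℝ}, |η| = γ → ∀ T : ℂ² → ℂ, Continuous T → (∀ z, ‖T z‖ ≤ ‖z‖) → Integrable fun
    ξ => exp (-I * lineMk η ξ * p.2) * T (lineSol E η f p.1 ξ) := by
    intro η hη T hT hTn
    have hd' : ∀ l, l.im = η → Disp E l ≠ 0 := fun l hl => hd l (by rw [hl, hη])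
    have hb' : ∀ l, l.im = η → ResBound E K l := fun l hl => hb l (by rw [hl, hη])
    obtain ⟨C', -, hC'⟩ := ex_lineSol_decay f hE hK hd' hb'
    have c1 := (cont_lineSol f hd').comp (Continuous.prodMk_right p.1)
    have c2 := cont_line η
    have c3 := hT.comp c1
    refine intble_of_decay (C := rexp (η * p.2) * C') (by fun_prop) fun ξ => ?_
    rw [norm_mul, norm_exp_neg_I_mul, mul_assoc]
    exact mul_le_mul_of_nonneg_left ((hTn _).trans (hC' _ hp ξ)) (exp_pos _).le
  have main : ∀ T : ℂ² → ℂ, Differentiable ℂ T → (∀ z, ‖T z‖ ≤ ‖z‖) → ∫ ξ, exp (-I * lineMk γ ξ *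
    p.2) * T (lineSol E γ f p.1 ξ) = ∫ ξ, exp (-I * lineMk (-γ) ξ * p.2) * T (lineSol E (-γ) f p.1
    ξ) := by
    intro T hT hTn
    have i1 := hint hg T hT.continuous hTn
    have i2 := hint hn T hT.continuous hTn
    simp only [← hwl hg] at i1 ⊢
    simp only [← hwl hn] at i2 ⊢
    refine int_line_eq (h := fun l => exp (-I * l * p.2) * T (w l)) hγ
      (C := rexp (γ * |p.2|) * C) (R₀ := 10 * E ^ 2 + γ)
      (fun l hl => ?_) (fun l him hre => ?_) i1 i2
    · have e1 : Differentiable ℂ fun l => exp (-I * l * p.2) := by fun_prop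
      exact (e1 l).mul ((hT (w l)).comp l (hwd l hl))
    · rw [norm_mul, norm_exp_neg_I_mul]
      have e2 := exp_neg_mul_le him (le_refl |p.2|)
      have e3 := hwC l him hre
      have e4 := hTn (w l)
      calc (1 + ‖l‖) ^ 2 * (rexp (l.im * p.2) * ‖T (w l)‖)
          ≤ (1 + ‖l‖) ^ 2 * (rexp (γ * |p.2|) * ‖w l‖) := by gcongr
        _ = rexp (γ * |p.2|) * ((1 + ‖l‖) ^ 2 * ‖w l‖) := by ring
        _ ≤ _ := by gcongr
  refine Prod.ext ?_ ?_
  · exact congrArg (fun t => (2 * π : ℂ)⁻¹ * t) (main Prod.fst differentiable_fst norm_fst_le)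
  · exact congrArg (fun t => (2 * π : ℂ)⁻¹ * t) (main Prod.snd differentiable_snd norm_snd_le)

/-! ### Linearity -/

lemma intble_ft (h : IsTest φ) (x : ℝ) (l : ℂ) : Integrable fun y : ℝ => φ (x, y) * exp (I * l *
  y) := by
  have hc := h.continuous
  exact Continuous.integrable_of_hasCompactSupport (by fun_prop) (hcs_slice h x).mul_right

lemma ftField_add (f g : testF) (l : ℂ) : ftField (f + g : testF) l = fun x => ftField f l x +
  ftField g l x := by
  funext x
  have i1 := integral_add (intble_ft f.2.1 x l) (intble_ft g.2.1 x l)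
  have i2 := integral_add (intble_ft f.2.2 x l) (intble_ft g.2.2 x l)
  simp only [← add_mul] at i1 i2
  exact Prod.ext i1 i2

lemma ftField_smul (c : ℂ) (f : testF) (l : ℂ) : ftField (c • f : testF) l = fun x => c • ftField
  f l x := by
  funext x
  refine Prod.ext ?_ ?_ <;>
  · simp only [ftField, ft, Submodule.coe_smul, Pi.smul_apply, smul_fst, smul_snd,
      smul_eq_mul, mul_assoc]
    rw [integral_const_mul]

lemma pairing_add {G S : ℝ → ℂ²} (hF : Continuous F) (hG : Continuous G) (hS : Continuous S) (x :
  ℝ) : ∫ t in (0 : ℝ)..x, ((F t + G t).1 * (S t).1 - (F t + G t).2 * (S t).2) = (∫ t in (0 : ℝ)..x,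
  ((F t).1 * (S t).1 - (F t).2 * (S t).2)) + ∫ t in (0 : ℝ)..x, ((G t).1 * (S t).1 - (G t).2 * (S
  t).2) := by
  rw [← iint_add cont_int cont_int]
  congr 1
  funext t
  simp
  ring

lemma pairing_smul (c : ℂ) (F S : ℝ → ℂ²) (x : ℝ) : ∫ t in (0 : ℝ)..x, ((c • F t).1 * (S t).1 - (c
  • F t).2 * (S t).2) = c * ∫ t in (0 : ℝ)..x, ((F t).1 * (S t).1 - (F t).2 * (S t).2) := by
  rw [← iint_const_mul]
  congr 1
  funext t
  simp
  ring

lemma resSol_add {G : ℝ → ℂ²} (hF : Continuous F) (hG : Continuous G) (E : ℝ) (l : ℂ) (x : ℝ) :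
  resSol E l (fun x => F x + G x) x = resSol E l F x + resSol E l G x := by
  have a := pairing_add hF hG (cont_solA_right E l)
  have b := pairing_add hF hG (cont_solB_right E l)
  simp only [resSol, transv, solv, coeffA, coeffB, a, b]
  module

lemma resSol_smul (c : ℂ) (F : ℝ → ℂ²) (E : ℝ) (l : ℂ) (x : ℝ) : resSol E l (fun x => c • F x) x =
  c • resSol E l F x := by
  simp only [resSol, transv, solv, coeffA, coeffB, pairing_smul]
  module

lemma solvFn_add (E : ℝ) (f g : testF) (l : ℂ) : solvFn E (f + g : testF) l = solvFn E f l +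
  solvFn E g l := by
  rw [solvFn, ftField_add]
  exact pairing_add (cont_ftField_right f l) (cont_ftField_right g l) (cont_solA_right E l) 1

lemma solvFn_smul (E : ℝ) (c : ℂ) (f : testF) (l : ℂ) : solvFn E (c • f : testF) l = c * solvFn E
  f l := by
  rw [solvFn, ftField_smul]
  exact pairing_smul c _ _ 1

lemma lineSol_add (E η : ℝ) (f g : testF) (x ξ : ℝ) : lineSol E η (f + g : testF) x ξ = lineSol E
  η f x ξ + lineSol E η g x ξ := by
  rw [lineSol, lineSol, lineSol, ftField_add]
  exact resSol_add (cont_ftField_right f _) (cont_ftField_right g _) _ _ _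

lemma lineSol_smul (E η : ℝ) (c : ℂ) (f : testF) (x ξ : ℝ) : lineSol E η (c • f : testF) x ξ = c •
  lineSol E η f x ξ := by
  rw [lineSol, lineSol, ftField_smul]
  exact resSol_smul _ _ _ _ _

lemma intble_lineSol (f : testF) (hE : 1 ≤ E) (hK : 0 ≤ K) (hd : ∀ l : ℂ, l.im = η → Disp E
  l ≠ 0) (hb : ∀ l : ℂ, l.im = η → ResBound E K l) {x : ℝ} (hx : x ∈ 𝕀) (y : ℝ) : Integrable fun ξ
  => exp (-I * lineMk η ξ * y) • lineSol E η f x ξ := by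
  obtain ⟨C', -, hC'⟩ := ex_lineSol_decay f hE hK hd hb
  have c1 := (cont_lineSol f hd).comp (Continuous.prodMk_right x)
  have c2 := cont_line η
  have c3 : Continuous fun ξ => exp (-I * lineMk η ξ * y) • lineSol E η f x ξ := by fun_prop
  refine (integrable_inv_one_add_sq.const_mul (rexp (η * y) * C')).mono'
    c3.aestronglyMeasurable (ae_of_all _ fun ξ => ?_)
  rw [norm_smul, norm_exp_neg_I_mul, mul_assoc]
  exact mul_le_mul_of_nonneg_left (hC' _ hx ξ) (exp_pos _).le

lemma lineField_add (f g : testF) (hE : 1 ≤ E) (hK : 0 ≤ K) (hd : ∀ l : ℂ, l.im = η → Disp E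
  l ≠ 0) (hb : ∀ l : ℂ, l.im = η → ResBound E K l) {p : ℝ²} (hp : p.1 ∈ 𝕀) : lineF E η (f + g :
  testF) p = lineF E η f p + lineF E η g p := by
  have i1 := intble_lineSol f hE hK hd hb hp p.2
  have i2 := intble_lineSol g hE hK hd hb hp p.2
  have e1 := integral_add i1.fst i2.fst
  have e2 := integral_add i1.snd i2.snd
  simp only [smul_fst, smul_snd, smul_eq_mul, ← mul_add] at e1 e2
  refine Prod.ext ?_ ?_
  · simp only [lineF, invFt, lineSol_add, fst_add, e1]
    ring
  · simp only [lineF, invFt, lineSol_add, snd_add, e2]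
    ring

lemma lineF_smul (c : ℂ) (f : testF) (E η : ℝ) (p : ℝ²) : lineF E η (c • f : testF) p = c
  • lineF E η f p := by
  simp only [lineF, invFt, lineSol_smul, smul_fst, smul_snd, smul_eq_mul,
    Prod.smul_mk, mul_left_comm _ c, integral_const_mul]

end ContourShift

section TestExtension

attribute [local irreducible] lineSol

/-! ### Continuously differentiable test functions -/

/-- The endpoint `e` of `(0, 1)` can be separated by `U` from the compact subsets of `(0, 1)`. -/
def IsEdge (e : ℝ) (U : Set ℝ) : Prop := (e = 0 ∨ e = 1) ∧ ∀ K ⊆ 𝕁, IsCompact K →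
  ∃ Z ⊆ U, IsClosed Z ∧ ∀ x ∉ Z, Disjoint (Ι e x) K

lemma isEdge_one : IsEdge 1 {x | x < 1} := by
  refine ⟨.inr rfl, fun K h hK => ?_⟩
  rcases K.eq_empty_or_nonempty with rfl | h0
  · exact ⟨∅, by simp⟩
  obtain ⟨c, hc, hm⟩ := hK.exists_isGreatest h0
  exact ⟨Iic c, fun x hx => lt_of_le_of_lt hx (h hc).2, isClosed_Iic, fun x hx =>
    disjoint_left.2 fun t ht h' => absurd (ht.1.trans_le (hm h')) (lt_min (h hc).2 (not_le.1 hx)).not_gt⟩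

lemma isEdge_zero : IsEdge 0 {x | 0 < x} := by
  refine ⟨.inl rfl, fun K h hK => ?_⟩
  rcases K.eq_empty_or_nonempty with rfl | h0
  · exact ⟨∅, by simp⟩
  obtain ⟨c, hc, hm⟩ := hK.exists_isLeast h0
  exact ⟨Ici c, fun x hx => (h hc).1.trans_le hx, isClosed_Ici, fun x hx =>
    disjoint_left.2 fun t ht h' => absurd ((hm h').trans ht.2) (max_lt (h hc).1 (not_le.1 hx)).not_ge⟩

/-- If `h' = -k` weakly on `(0, 1)`, with test functions that vanish only near an endpoint, then the
same identity holds for continuously differentiable functions that vanish at this endpoint. -/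
lemma IsEdge.int_mul_deriv_eq {e : ℝ} {U : Set ℝ} (hU : IsEdge e U) {h k : ℝ → ℂ} (hh :
  IntegrableOn h (Ioo 0 1)) (hk : IntegrableOn k (Ioo 0 1)) (H : ∀ a : ℝ → ℂ, ContDiff ℝ ∞ a →
  HasCompactSupport a → tsupport a ⊆ U → ∫ x in 𝕁, h x * deriv a x = ∫ x in 𝕁, k x * a x)
  {a a' : ℝ → ℂ} (ha : ∀ x, HasDerivAt a (a' x) x) (hc : Continuous a') (h1 : a e = 0) :
  ∫ x in 𝕁, h x * a' x = ∫ x in 𝕁, k x * a x := by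
  obtain ⟨he, hU⟩ := hU
  have he' : e ∈ 𝕀 := by rcases he with rfl | rfl <;> simp
  obtain ⟨σ, hσ⟩ : ∃ σ : ℝ, ∀ x ∈ 𝕁, (if e ≤ x then 1 else -1) = σ := by
    rcases he with rfl | rfl
    exacts [⟨1, fun x hx => if_pos hx.1.le⟩, ⟨-1, fun x hx => if_neg hx.2.not_ge⟩]
  set μ : Measure ℝ := volume.restrict 𝕁 with hμ
  have hJ : ∀ᵐ x ∂μ, x ∈ 𝕁 := ae_restrict_mem measurableSet_Ioo
  set S : Set ℝ² := {p | p.2 ∈ Ι e p.1}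
  have hS : MeasurableSet S := (measurableSet_lt (by fun_prop) measurable_snd).inter
    (measurableSet_le measurable_snd (by fun_prop))
  have ik := (hk.integrable.comp_fst μ).indicator hS
  set K : ℝ → ℂ := fun t => ∫ x, S.indicator (fun p => k p.1) (x, t) ∂μ with hK
  have iK := ik.integral_prod_right.const_mul (σ : ℂ)
  have bdd : ∀ {f : ℝ → ℂ}, Continuous f → ∀ᵐ x ∂μ, ‖f x‖ ≤ sSup ((fun x => ‖f x‖) '' 𝕀) := by
    intro f hf
    filter_upwards [hJ] with x hx
    exact le_csSup (isCompact_Icc.image hf.norm).bddAbove ⟨x, Ioo_subset_Icc_self hx, rfl⟩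
  have ibd : ∀ {f g : ℝ → ℂ}, Integrable g μ → Continuous f → Integrable (fun x => g x * f x) μ :=
    fun hg hf => hg.mul_bdd hf.aestronglyMeasurable (bdd hf)
  have parts : ∀ {f : ℝ → ℂ}, Continuous f → ∫ x, k x * (∫ t in e..x, f t) ∂μ = ∫ t, σ * K t * f t
    ∂μ := by
    intro f hf
    have i2 := ((hk.integrable.mul_prod (g := f) (by simpa using ibd (integrable_const 1) hf)).indicator hS)
    have sw := integral_integral_swap (f := fun x t => S.indicator (fun p => k p.1 * f p.2) (x, t)) i2
    have e1 : ∀ t, ∫ x, S.indicator (fun p => k p.1 * f p.2) (x, t) ∂μ = K t * f t := fun t => by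
      rw [hK, ← integral_mul_const]
      congr 1
      funext x
      by_cases hxt : (x, t) ∈ S <;> simp [hxt]
    simp only [mul_assoc]
    rw [integral_const_mul, ← sw.trans (integral_congr_ae (.of_forall e1)), ← integral_const_mul]
    refine integral_congr_ae ?_
    filter_upwards [hJ] with x hx
    have e2 : ∫ t, S.indicator (fun p => k p.1 * f p.2) (x, t) ∂μ = k x * ∫ t in Ι e x, f t := by
      rw [← integral_const_mul, hμ, restrict_Ioo_eq_restrict_Ioc,
        show (fun t => S.indicator (fun p => k p.1 * f p.2) (x, t)) = (Ι e x).indicator fun t => k x * f t from rfl,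
        setIntegral_indicator measurableSet_uIoc, inter_eq_right.2]
      exact Ioc_subset_Ioc (le_min he'.1 hx.1.le) (max_le he'.2 hx.2.le)
    rw [e2, intervalIntegral.intervalIntegral_eq_integral_uIoc, hσ x hx, real_smul]
    ring
  let θ : ContDiffBump (0 : ℝ) := ⟨2, 3, by norm_num, by norm_num⟩
  have prim : ∀ {f : ℝ → ℂ}, Continuous f → ∀ x, HasDerivAt (fun x => ∫ t in e..x, f t) (f x) x :=
    fun hf x => integral_hasDerivAt_right (hf.intervalIntegrable _ _)
      (hf.stronglyMeasurableAtFilter _ _) hf.continuousAt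
  have hz : ∀ᵐ x, x ∈ 𝕁 → h x - σ * K x = 0 := by
    have iu := IntegrableOn.locallyIntegrableOn (hh.integrable.sub iK)
    refine isOpen_Ioo.ae_eq_zero_of_integral_contDiff_smul_eq_zero iu fun g hg hgc hgs => ?_
    have cg : Continuous fun t => (g t : ℂ) := by have := hg.continuous; fun_prop
    set J : ℝ → ℂ := fun x => ∫ t in e..x, (g t : ℂ)
    have dJ : ∀ x, HasDerivAt J (g x) x := prim cg
    have sJ : ContDiff ℝ ∞ J := by
      rw [contDiff_infty_iff_deriv, show deriv J = fun x => (g x : ℂ) from funext fun x => (dJ x).deriv]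
      exact ⟨fun x => (dJ x).differentiableAt, ofRealCLM.contDiff.comp hg⟩
    obtain ⟨Z, hZ, hZc, hd⟩ := hU _ hgs hgc
    set A : ℝ → ℂ := fun x => θ x * J x with hA
    have key := H A ((ofRealCLM.contDiff.comp θ.contDiff).mul sJ)
      (θ.hasCompactSupport.comp_left ofReal_zero).mul_right ((closure_minimal (fun x hx => ?_) hZc).trans hZ)
    · have e1 : ∀ x ∈ 𝕁, A =ᶠ[𝓝 x] J := fun x hx => by
        filter_upwards [ball_mem_nhds x one_pos] with y hy
        rw [hA]
        simp only
        rw [θ.one_of_mem_closedBall, ofReal_one, one_mul]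
        rw [mem_ball, Real.dist_eq, abs_lt] at hy
        rw [mem_closedBall, dist_zero_right, norm_eq_abs, abs_le]
        constructor <;> linarith [hx.1, hx.2]
      have k1 : ∫ x, h x * deriv A x ∂μ = ∫ x, h x * g x ∂μ := by
        refine integral_congr_ae ?_
        filter_upwards [hJ] with x hx
        rw [(e1 x hx).deriv_eq, (dJ x).deriv]
      have k2 : ∫ x, k x * A x ∂μ = ∫ x, k x * J x ∂μ := by
        refine integral_congr_ae ?_
        filter_upwards [hJ] with x hx
        rw [(e1 x hx).eq_of_nhds]
      rw [k1, k2, parts cg, ← sub_eq_zero, ← integral_sub (ibd hh.integrable cg) (ibd iK cg)] at key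
      rw [← setIntegral_eq_integral_of_forall_compl_eq_zero fun x hx => by
        rw [image_eq_zero_of_notMem_tsupport fun h => hx (hgs h), zero_smul], ← key]
      congr 1
      funext x
      simp
      ring
    · by_contra hn
      refine hx ?_
      simp only [hA]
      rw [show J x = 0 from integral_zero_ae (.of_forall fun t ht => by
        rw [image_eq_zero_of_notMem_tsupport (disjoint_left.1 (hd x hn) ht), ofReal_zero]), mul_zero]
  have hp := parts hc
  have e1 : ∀ x, ∫ t in e..x, a' t = a x := fun x => by
    rw [integral_eq_sub_of_hasDerivAt (fun t _ => ha t) (hc.intervalIntegrable _ _), h1, sub_zero]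
  simp only [e1] at hp
  rw [hp]
  refine integral_congr_ae ?_
  filter_upwards [hJ, ae_restrict_of_ae hz] with x hx hx0
  linear_combination a' x * hx0 hx

end TestExtension

section AdjointRelation

attribute [local irreducible] lineSol

lemma ex_strip_cutoff {g : ℝ² → ℂ} (hg : Continuous g) (hT : ∀ p : ℝ², T < |p.2| → g p = 0) : ∃ g'
  : ℝ² → ℂ, Continuous g' ∧ HasCompactSupport g' ∧ g' =ᵐ[μₛ] g := by
  refine ⟨fun p => ((min 1 (max 0 (3 - |p.1|)) : ℝ) : ℂ) * g p, by fun_prop, ?_, ?_⟩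
  · refine HasCompactSupport.intro ((isCompact_Icc (a := (-3 : ℝ)) (b := 3)).prod
      (isCompact_Icc (a := -T) (b := T))) fun p hp => ?_
    by_cases h2 : T < |p.2|
    · rw [hT p h2, mul_zero]
    · have h1 : 3 < |p.1| := by
        by_contra h1
        exact hp ⟨abs_le.1 (not_lt.1 h1), abs_le.1 (not_lt.1 h2)⟩
      rw [max_eq_left (by linarith), min_eq_right zero_le_one, ofReal_zero, zero_mul]
  · filter_upwards [ae_restrict_mem measSet_strip] with p hp
    have h1 : |p.1| ≤ 1 := by rw [abs_of_pos hp.1.1]; exact hp.1.2.le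
    rw [max_eq_right (by linarith), min_eq_left (by linarith), ofReal_one, one_mul]

lemma MemL.intble_fst_mul_of_bd (h : MemL s w) {g : ℝ² → ℂ} (hg : Continuous g) (hT : ∀ p : ℝ², T
  < |p.2| → g p = 0) : Integrable (fun p => (w p).1 * g p) μₛ := by
  obtain ⟨g', h1, h2, h3⟩ := ex_strip_cutoff hg hT
  exact (h.intble_fst_mul h1 h2).congr (h3.mono fun p hp => by simp only [hp])

lemma MemL.intble_snd_mul_of_bd (h : MemL s w) {g : ℝ² → ℂ} (hg : Continuous g) (hT : ∀ p : ℝ², T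
  < |p.2| → g p = 0) : Integrable (fun p => (w p).2 * g p) μₛ := by
  obtain ⟨g', h1, h2, h3⟩ := ex_strip_cutoff hg hT
  exact (h.intble_snd_mul h1 h2).congr (h3.mono fun p hp => by simp only [hp])

lemma int_strip_mul {b : ℝ² → ℂ} {β : ℝ → ℂ} (hb : Integrable (fun p => b p * β p.2) μₛ) {a : ℝ →
  ℂ} (ha : Continuous a) : Integrable (fun p => b p * (a p.1 * β p.2)) μₛ ∧ ∫ p, b p * (a p.1 * β
  p.2) ∂μₛ = ∫ x in 𝕁, (∫ y, b (x, y) * β y) * a x := by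
  have hbd : ∀ᵐ p ∂μₛ, ‖a p.1‖ ≤ sSup ((fun x => ‖a x‖) '' Icc 0 1) := by
    filter_upwards [ae_restrict_mem measSet_strip] with p hp
    exact le_csSup (isCompact_Icc.image ha.norm).bddAbove ⟨p.1, Ioo_subset_Icc_self hp.1, rfl⟩
  have h1 := hb.mul_bdd (by fun_prop : Continuous fun p : ℝ² => a p.1).aestronglyMeasurable hbd
  have e : ∀ p, b p * β p.2 * a p.1 = b p * (a p.1 * β p.2) := fun p => by ring
  simp only [e] at h1
  refine ⟨h1, ?_⟩
  rw [stripMeasure_eq] at h1 ⊢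
  rw [integral_prod _ h1]
  congr 1
  funext x
  rw [← integral_mul_const]
  congr 1
  funext y
  ring

lemma intble_slice_int {b : ℝ² → ℂ} {β : ℝ → ℂ} (hb : Integrable (fun p => b p * β p.2) μₛ) :
  IntegrableOn (fun x => ∫ y, b (x, y) * β y) (Ioo 0 1) := by
  rw [stripMeasure_eq] at hb
  exact hb.integral_prod_left

/-- A product of a function of `x` and a function of `y`. -/
lemma isTest_mul {a β : ℝ → ℂ} (ha : ContDiff ℝ ∞ a) (hac : HasCompactSupport a) (hβ : ContDiff ℝ
  ∞ β) (hβc : HasCompactSupport β) : IsTest (fun p => a p.1 * β p.2) ∧ (∀ p, dX (fun p => a p.1 * β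
  p.2) p = deriv a p.1 * β p.2) ∧ ∀ p, dY (fun p => a p.1 * β p.2) p = a p.1 * deriv β p.2 := by
  refine ⟨⟨(ha.comp contDiff_fst).mul (hβ.comp contDiff_snd), ?_⟩, ?_, ?_⟩
  · refine HasCompactSupport.intro (hac.isCompact.prod hβc.isCompact) fun p hp => ?_
    by_cases h : p.1 ∈ tsupport a
    · rw [image_eq_zero_of_notMem_tsupport fun h2 => hp ⟨h, h2⟩, mul_zero]
    · rw [image_eq_zero_of_notMem_tsupport h, zero_mul]
  all_goals
    intro p
    have h1 := (ha.differentiable (by simp) p.1).hasDerivAt.hasFDerivAt.comp p (hasFDerivAt_fst)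
    have h2 := (hβ.differentiable (by simp) p.2).hasDerivAt.hasFDerivAt.comp p (hasFDerivAt_snd)
    have h3 : HasFDerivAt (fun p => a p.1 * β p.2) _ p := h1.mul h2
    simp only [dX, dY, h3.fderiv]
    simp [mul_comm]

lemma tsupp_mul_fst_sub {a β : ℝ → ℂ} : tsupport (fun p : ℝ² => a p.1 * β p.2) ⊆ Prod.fst ⁻¹'
  tsupport a := by
  refine closure_minimal (fun p hp => subset_tsupport a ?_)
    ((isClosed_tsupport a).preimage continuous_fst)
  exact fun h => hp (by simp [h])

lemma deriv_supp_bd {β : ℝ → ℂ} (hT : ∀ y, T < |y| → β y = 0) (y : ℝ) (hy : T < |y|) : deriv β y =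
  0 := by
  have : β =ᶠ[𝓝 y] fun _ => 0 := by
    filter_upwards [(isOpen_lt continuous_const continuous_abs).mem_nhds hy] with z hz
    exact hT z hz
  rw [this.deriv_eq, deriv_const]

lemma hcs_of_bd {β : ℝ → ℂ} (hT : ∀ y, T < |y| → β y = 0) : HasCompactSupport β :=
  HasCompactSupport.intro (isCompact_Icc) fun y hy => hT y (by
    by_contra h; exact hy (abs_le.1 (not_lt.1 h)))

/-- A weak identity for test functions that vanish near an edge extends to products `a(x) β(y)`,
if `a` vanishes at this edge. -/
lemma int_mul_of_test {e : ℝ} {U : Set ℝ} (hU : IsEdge e U) {f b : ℝ² → ℂ} {σ : ℂ} {a a' β : ℝ → ℂ}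
  (ha : ∀ x, HasDerivAt a (a' x) x) (hc : Continuous a') (h0 : a e = 0) (hβ : ContDiff ℝ ∞ β) (hT :
  ∀ y, T < |y| → β y = 0) (i1 : Integrable (fun p => b p * β p.2) μₛ) (i2 : Integrable (fun p => f p
  * β p.2) μₛ) (i3 : Integrable (fun p => f p * deriv β p.2) μₛ) (H : ∀ φ, IsTest φ → tsupport φ ⊆
  Prod.fst ⁻¹' U → ∫ p, b p * φ p ∂μₛ = ∫ p, f p * (I * dX φ p + σ * dY φ p) ∂μₛ) : ∫ p, b p * (a
  p.1 * β p.2) ∂μₛ = ∫ p, f p * (I * (a' p.1 * β p.2) + σ * (a p.1 * deriv β p.2)) ∂μₛ := by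
  have expand : ∀ {a a' : ℝ → ℂ}, Continuous a → Continuous a' → ∫ p, f p * (I * (a' p.1 * β p.2) +
    σ * (a p.1 * deriv β p.2)) ∂μₛ = I * (∫ x in 𝕁, (∫ y, f (x, y) * β y) * a' x) + σ * ∫ x in 𝕁, (∫
    y, f (x, y) * deriv β y) * a x := by
    intro a a' ca ca'
    obtain ⟨j1, e1⟩ := int_strip_mul i2 ca'
    obtain ⟨j2, e2⟩ := int_strip_mul i3 ca
    rw [← e1, ← e2, ← integral_const_mul, ← integral_const_mul,
      ← integral_add (j1.const_mul _) (j2.const_mul _)]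
    congr 1
    funext p
    ring
  have s1 := intble_slice_int i1
  have s3 := (intble_slice_int i3).const_mul σ
  have split : ∀ {a : ℝ → ℂ}, Continuous a → ∫ x in 𝕁, ((∫ y, b (x, y) * β y) - σ * ∫ y, f (x, y) *
    deriv β y) * a x = (∫ x in 𝕁, (∫ y, b (x, y) * β y) * a x) - σ * ∫ x in 𝕁, (∫ y, f (x, y) *
    deriv β y) * a x := by
    intro a ca
    have bd : ∀ᵐ x ∂(volume : Measure ℝ).restrict 𝕁, ‖a x‖ ≤ sSup ((fun x => ‖a x‖) '' Icc 0 1) :=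
      by
      filter_upwards [ae_restrict_mem measurableSet_Ioo] with x hx
      exact le_csSup (isCompact_Icc.image ca.norm).bddAbove ⟨x, Ioo_subset_Icc_self hx, rfl⟩
    simp only [sub_mul]
    rw [integral_sub (s1.mul_bdd ca.aestronglyMeasurable bd)
      (s3.mul_bdd ca.aestronglyMeasurable bd), ← integral_const_mul]
    simp only [mul_assoc]
  have ca := continuous_iff_continuousAt.2 fun x => (ha x).continuousAt
  have key := hU.int_mul_deriv_eq (h := fun x => I * ∫ y, f (x, y) * β y)
    ((intble_slice_int i2).const_mul _) (s1.sub s3) (fun a hs hcs ht => ?_) ha hc h0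
  · rw [expand ca hc, (int_strip_mul i1 ca).2, ← integral_const_mul]
    simp only [mul_assoc I, Pi.sub_apply] at key ⊢
    rw [key, split ca]
    ring
  · obtain ⟨t1, t2, t3⟩ := isTest_mul hs hcs hβ (hcs_of_bd hT)
    have := H _ t1 (tsupp_mul_fst_sub.trans fun p hp => ht hp)
    simp only [t2, t3] at this
    rw [expand hs.continuous (hs.continuous_deriv (by simp)),
      (int_strip_mul i1 hs.continuous).2] at this
    simp only [mul_assoc I, Pi.sub_apply]
    rw [split hs.continuous, this, integral_const_mul]
    ring

lemma HasDirac.int_snd_mul {A B : 𝓦} (h : HasDirac A B) (mA : MemL s A) (mB : MemL s B) {a a' β :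
  ℝ → ℂ} (ha : ∀ x, HasDerivAt a (a' x) x) (hc : Continuous a') (h1 : a 1 = 0) (hβ : ContDiff ℝ ∞ β)
  (hT : ∀ y, T < |y| → β y = 0) : ∫ p, (B p).2 * (a p.1 * β p.2) ∂μₛ = ∫ p, (A p).1 * (I * (a' p.1 *
  β p.2) + a p.1 * deriv β p.2) ∂μₛ := by
  have cβ := hβ.continuous
  have cβ' := hβ.continuous_deriv (by simp)
  have := int_mul_of_test (σ := 1) isEdge_one ha hc h1 hβ hT
    (mB.intble_snd_mul_of_bd (by fun_prop) fun p hp => hT _ hp)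
    (mA.intble_fst_mul_of_bd (by fun_prop) fun p hp => hT _ hp)
    (mA.intble_fst_mul_of_bd (by fun_prop) fun p hp => deriv_supp_bd hT _ hp)
    fun φ h1 h2 => by simpa using h.1 φ h1 h2
  simpa using this

lemma HasDirac.int_fst_mul {A B : 𝓦} (h : HasDirac A B) (mA : MemL s A) (mB : MemL s B) {a a' β :
  ℝ → ℂ} (ha : ∀ x, HasDerivAt a (a' x) x) (hc : Continuous a') (h0 : a 0 = 0) (hβ : ContDiff ℝ ∞ β)
  (hT : ∀ y, T < |y| → β y = 0) : ∫ p, (B p).1 * (a p.1 * β p.2) ∂μₛ = ∫ p, (A p).2 * (I * (a' p.1 *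
  β p.2) - a p.1 * deriv β p.2) ∂μₛ := by
  have cβ := hβ.continuous
  have cβ' := hβ.continuous_deriv (by simp)
  have := int_mul_of_test (σ := -1) isEdge_zero ha hc h0 hβ hT
    (mB.intble_fst_mul_of_bd (by fun_prop) fun p hp => hT _ hp)
    (mA.intble_snd_mul_of_bd (by fun_prop) fun p hp => hT _ hp)
    (mA.intble_snd_mul_of_bd (by fun_prop) fun p hp => deriv_supp_bd hT _ hp)
    fun φ h1 h2 => by simpa only [neg_one_mul, ← sub_eq_add_neg] using h.2 φ h1 h2
  simpa only [neg_one_mul, ← sub_eq_add_neg] using this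

/-! ### Integration in the spectral parameter -/

local notation:max "𝔢" k:max ξ:max p:max => conj (exp (-I * lineMk η ξ * Prod.snd p) * k (Prod.fst p) ξ)

lemma int_conj_invFt {b : ℝ² → ℂ} {k : ℝ → ℝ → ℂ} (hb : Integrable (fun p => b p * rexp (η * p.2))
  μₛ) (hk : Continuous fun p : ℝ² => k p.1 p.2) (hC : ∀ x ∈ 𝕀, ∀ ξ, ‖k x ξ‖ ≤ C * (1 + ξ ^ 2)⁻¹) :
  (∀ᵐ ξ : ℝ, Integrable (fun p => b p * 𝔢 k ξ p) μₛ) ∧ Integrable (fun ξ : ℝ => ∫ p, b p * 𝔢 k ξ p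
  ∂μₛ) ∧ ∫ p, b p * conj (invFt η k p) ∂μₛ = (2 * π : ℂ)⁻¹ * ∫ ξ : ℝ, ∫ p, b p * 𝔢 k ξ p ∂μₛ := by
  have hl := cont_line η
  have hint : Integrable (fun q : ℝ² × ℝ => b q.1 * conj (exp (-I * lineMk η q.2 * q.1.2) * k q.1.1
    q.2)) (stripMeasure.prod volume) := by
    have hbm : AEStronglyMeasurable b μₛ := by
      have c : Continuous fun p : ℝ² => ((rexp (-(η * p.2)) : ℝ) : ℂ) := by fun_prop
      refine (hb.aestronglyMeasurable.mul c.aestronglyMeasurable).congr (.of_forall fun p => ?_)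
      simp only [Pi.mul_apply, mul_assoc, ← ofReal_mul, ← Real.exp_add]
      simp
    have h1 := Integrable.mul_prod hb.norm (integrable_inv_one_add_sq.const_mul C)
    have hkc : Continuous fun q : ℝ² × ℝ => k q.1.1 q.2 :=
      hk.comp ((continuous_fst.comp continuous_fst).prodMk continuous_snd)
    have c2 : Continuous fun q : ℝ² × ℝ => conj (exp (-I * lineMk η q.2 * q.1.2) * k q.1.1 q.2) :=
      by fun_prop
    refine h1.mono' (hbm.comp_fst.mul c2.aestronglyMeasurable) ?_
    filter_upwards [Measure.quasiMeasurePreserving_fst.ae (ae_restrict_mem measSet_strip)] with q hq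
    rw [norm_mul, RCLike.norm_conj, norm_mul, norm_exp_neg_I_mul, norm_mul, norm_real,
      norm_eq_abs, abs_of_pos (exp_pos _)]
    calc _ = ‖b q.1‖ * rexp (η * q.1.2) * ‖k q.1.1 q.2‖ := by
          rw [mul_assoc]; rfl
      _ ≤ _ := by
          gcongr
          exact hC _ (Ioo_subset_Icc_self hq.1) _
  refine ⟨hint.prod_left_ae, hint.integral_prod_right, ?_⟩
  rw [← integral_integral_swap hint, ← integral_const_mul]
  congr 1
  funext p
  rw [invFt, map_mul, ← integral_conj, integral_const_mul]
  simp only [map_mul, map_inv₀, map_ofNat, conj_ofReal]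
  ring

lemma int_add_add {α : Type*} [MeasurableSpace α] {μ : Measure α} {f g h : α → ℂ} (hf : Integrable
  f μ) (hg : Integrable g μ) (hh : Integrable h μ) (c d : ℂ) : ∫ x, (c * f x + g x + d * h x) ∂μ = c
  * ∫ x, f x ∂μ + ∫ x, g x ∂μ + d * ∫ x, h x ∂μ := by
  have h1 : Integrable (fun x => c * f x + g x) μ := (hf.const_mul c).add hg
  rw [integral_add h1 (hh.const_mul d), integral_add (hf.const_mul c) hg, integral_const_mul,
    integral_const_mul]

/-- The weak form of `k' = …`, integrated along the line `Im λ = η`. -/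
lemma int_conj_invFt_eq {X Y : ℝ² → ℂ} {k k₁ k₂ : ℝ → ℝ → ℂ} {χ : ℝ → ℂ} {σ E : ℂ} (hX :
  Integrable (fun p => X p * χ p.2 * rexp (η * p.2)) μₛ) (hY : Integrable (fun p => Y p * χ p.2
  * rexp (η * p.2)) μₛ) (hY' : Integrable (fun p => Y p * deriv χ p.2 * rexp (η * p.2)) μₛ)
  (hk : Continuous fun p : ℝ² => k p.1 p.2) (hk₁ : Continuous fun p : ℝ² => k₁ p.1 p.2) (hk₂ :
  Continuous fun p : ℝ² => k₂ p.1 p.2) (hC : ∀ x ∈ 𝕀, ∀ ξ, ‖k x ξ‖ ≤ C * (1 + ξ ^ 2)⁻¹) (hC₁ : ∀ x ∈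
  𝕀, ∀ ξ, ‖k₁ x ξ‖ ≤ C * (1 + ξ ^ 2)⁻¹) (hC₂ : ∀ x ∈ 𝕀, ∀ ξ, ‖k₂ x ξ‖ ≤ C * (1 + ξ ^ 2)⁻¹) (H : ∀ ξ
  : ℝ, ∫ p, X p * χ p.2 * 𝔢 k ξ p ∂μₛ = ∫ p, (E * (Y p * χ p.2
  * 𝔢 k₁ ξ p) + Y p * χ p.2 * 𝔢 k₂ ξ p + σ * (Y p * deriv χ p.2 * 𝔢 k ξ p)) ∂μₛ) : ∫ p,
  X p * χ p.2 * conj (invFt η k p) ∂μₛ = E * ∫ p, Y p * χ p.2 * conj (invFt η k₁ p) ∂μₛ + ∫ p, Y p *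
  χ p.2 * conj (invFt η k₂ p) ∂μₛ + σ * ∫ p, Y p * deriv χ p.2 * conj (invFt η k p) ∂μₛ := by
  obtain ⟨-, -, e0⟩ := int_conj_invFt hX hk hC
  obtain ⟨a1, i1, e1⟩ := int_conj_invFt hY hk₁ hC₁
  obtain ⟨a2, i2, e2⟩ := int_conj_invFt hY hk₂ hC₂
  obtain ⟨a3, i3, e3⟩ := int_conj_invFt hY' hk hC
  rw [e0, e1, e2, e3]
  have : (∫ ξ, ∫ p, X p * χ p.2 * 𝔢 k ξ p ∂μₛ) = ∫ ξ, (E * (∫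
    p, Y p * χ p.2 * 𝔢 k₁ ξ p ∂μₛ) + (∫ p, Y p * χ p.2 * 𝔢 k₂ ξ p ∂μₛ) + σ * ∫ p, Y p * deriv χ p.2 * 𝔢 k ξ p ∂μₛ) := by
    refine integral_congr_ae ?_
    filter_upwards [a1, a2, a3] with ξ h1 h2 h3
    simp only [H ξ]
    exact int_add_add h1 h2 h3 _ _
  rw [this, int_add_add i1 i2 i3]
  ring

lemma lim_int_cutoff {G : ℝ² → ℂ} (hG : Integrable G μₛ) {χ : ℝ → ℂ} (hχ : Continuous χ) {M : ℝ}
  (hM : ∀ y, ‖χ y‖ ≤ M) : Tendsto (fun n : ℕ => ∫ p, G p * χ (p.2 * ((n : ℝ) + 1)⁻¹) ∂μₛ) atTop (𝓝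
  (∫ p, G p * χ 0 ∂μₛ)) := by
  refine tendsto_integral_of_dominated_convergence (fun p => ‖G p‖ * M) (fun n => ?_)
    (hG.norm.mul_const M) (fun n => Eventually.of_forall fun p => ?_)
    (.of_forall fun p => ?_)
  · have c : Continuous fun p : ℝ² => χ (p.2 * ((n : ℝ) + 1)⁻¹) := by fun_prop
    exact hG.aestronglyMeasurable.mul c.aestronglyMeasurable
  · rw [norm_mul]
    exact mul_le_mul_of_nonneg_left (hM _) (norm_nonneg _)
  · have h1 : Tendsto (fun n : ℕ => p.2 * ((n : ℝ) + 1)⁻¹) atTop (𝓝 (p.2 * 0)) :=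
      (tendsto_one_div_add_atTop_nhds_zero_nat.congr fun n => one_div _).const_mul _
    rw [mul_zero] at h1
    exact ((hχ.tendsto 0).comp h1).const_mul _

lemma ex_lineCutoff : ∃ χ : ℝ → ℂ, ContDiff ℝ ∞ χ ∧ χ 0 = 1 ∧ (∀ y, 2 < |y| → χ y = 0) ∧ (∀ y, ‖χ
  y‖ ≤ 1) ∧ ∃ M, ∀ y, ‖deriv χ y‖ ≤ M := by
  let b : ContDiffBump (0 : ℝ) := ⟨1, 2, by norm_num, by norm_num⟩
  have hs : ContDiff ℝ ∞ fun y => (b y : ℂ) := ofRealCLM.contDiff.comp b.contDiff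
  have hT : ∀ y, 2 < |y| → (b y : ℂ) = 0 := fun y hy => by
    rw [b.zero_of_le_dist (by rw [dist_zero_right, norm_eq_abs]; exact hy.le), ofReal_zero]
  refine ⟨fun y => (b y : ℂ), hs, ?_, hT, fun y => ?_, ?_⟩
  · simp only [b.one_of_mem_closedBall (mem_closedBall_self zero_le_one), ofReal_one]
  · rw [norm_real, norm_eq_abs, abs_of_nonneg b.nonneg]
    exact b.le_one
  · exact (hs.continuous_deriv (by simp)).bounded_above_of_compact_support
      (hcs_of_bd (deriv_supp_bd hT))

lemma derivAt_conj {a : ℝ → ℂ} {a' : ℂ} {x : ℝ} (h : HasDerivAt a a' x) : HasDerivAt (fun x =>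
  conj (a x)) (conj a') x :=
  (conjCLE.toContinuousLinearMap.hasFDerivAt.comp_hasDerivAt x h :)

lemma exp_wt_deriv (l : ℂ) {χ : ℝ → ℂ} (hχ : ContDiff ℝ ∞ χ) : ContDiff ℝ ∞ (fun y : ℝ => conj
  (exp (-I * l * y)) * χ y) ∧ ∀ y : ℝ, deriv (fun y : ℝ => conj (exp (-I * l * y)) * χ y) y = conj
  (exp (-I * l * y)) * (I * conj l * χ y + deriv χ y) := by
  have e : ∀ y : ℝ, conj (exp (-I * l * y)) = exp (I * conj l * y) := fun y => by
    rw [← exp_conj]; simp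
  simp only [e]
  have hs : ContDiff ℝ ∞ fun y : ℝ => exp (I * conj l * y) :=
    (contDiff_const.mul ofRealCLM.contDiff).cexp
  refine ⟨hs.mul hχ, fun y => ?_⟩
  have h1 : HasDerivAt (fun y : ℝ => I * conj l * (y : ℂ)) (I * conj l) y := by
    simpa using (ofRealCLM.hasDerivAt).const_mul (I * conj l)
  have h2 : HasDerivAt (fun y : ℝ => exp (I * conj l * y) * χ y) _ y :=
    h1.cexp.mul ((hχ.differentiable (by simp) y).hasDerivAt)
  rw [h2.deriv]
  ring

/-- Green's identity for a transversal solution multiplied by `e^{-iλy}` and a cutoff. -/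
lemma HasDirac.transv_identity {A B : 𝓦} (h : HasDirac A B) (mA : MemL s A) (mB : MemL s B) {w : ℝ
  → ℂ²} (hF : Continuous F) (hw : IsSol E l F w) {χ : ℝ → ℂ} (hχ : ContDiff ℝ ∞ χ) (hT : ∀ y, T <
  |y| → χ y = 0) : (∫ p, (B p).2 * χ p.2 * conj (exp (-I * l * p.2) * (w p.1).2) ∂μₛ = ∫ p, (E * ((A
  p).1 * χ p.2 * conj (exp (-I * l * p.2) * (w p.1).1)) + (A p).1 * χ p.2 * conj (exp (-I * l * p.2)
  * (F p.1).1) + 1 * ((A p).1 * deriv χ p.2 * conj (exp (-I * l * p.2) * (w p.1).2))) ∂μₛ) ∧ (∫ p,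
  (B p).1 * χ p.2 * conj (exp (-I * l * p.2) * (w p.1).1) ∂μₛ = ∫ p, (E * ((A p).2 * χ p.2 * conj
  (exp (-I * l * p.2) * (w p.1).2)) + (A p).2 * χ p.2 * conj (exp (-I * l * p.2) * (F p.1).2) + -1 *
  ((A p).2 * deriv χ p.2 * conj (exp (-I * l * p.2) * (w p.1).1))) ∂μₛ) := by
  have cw1 := continuous_iff_continuousAt.2 fun x => (hw.fst x).continuousAt
  have cw2 := continuous_iff_continuousAt.2 fun x => (hw.snd x).continuousAt
  obtain ⟨hs, hd⟩ := exp_wt_deriv l hχ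
  have hT' : ∀ y, T < |y| → (fun y : ℝ => conj (exp (-I * l * y)) * χ y) y = 0 :=
    fun y hy => by simp only [hT y hy, mul_zero]
  have e2 := h.int_snd_mul mA mB (fun x => derivAt_conj (hw.snd x)) (by fun_prop)
    (by rw [hw.right, map_zero]) hs hT'
  have e1 := h.int_fst_mul mA mB (fun x => derivAt_conj (hw.fst x)) (by fun_prop)
    (by rw [hw.left, map_zero]) hs hT'
  simp only [hd] at e1 e2
  constructor
  · refine Eq.trans ?_ (e2.trans ?_)
    · congr 1; funext p; simp only [map_mul]; ring
    · congr 1; funext p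
      simp only [map_mul, map_add, map_neg, conj_I, conj_ofReal]
      linear_combination ((A p).1 * conj (exp (-I * l * p.2)) * χ p.2 *
        (-E * conj (w p.1).1 - conj (F p.1).1)) * I_sq
  · refine Eq.trans ?_ (e1.trans ?_)
    · congr 1; funext p; simp only [map_mul]; ring
    · congr 1; funext p
      simp only [map_mul, map_add, map_neg, conj_I, conj_ofReal]
      linear_combination ((A p).2 * conj (exp (-I * l * p.2)) * χ p.2 *
        (-E * conj (w p.1).2 - conj (F p.1).2)) * I_sq

lemma intble_cutoff_exp {A : 𝓦} (mA : MemL s A) {χ : ℝ → ℂ} (hχ : Continuous χ) (hT : ∀ y, T < |y|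
  → χ y = 0) (η : ℝ) : Integrable (fun p => (A p).1 * χ p.2 * rexp (η * p.2)) μₛ ∧ Integrable
  (fun p => (A p).2 * χ p.2 * rexp (η * p.2)) μₛ := by
  have c : Continuous fun p : ℝ² => χ p.2 * rexp (η * p.2) := by fun_prop
  have z : ∀ p : ℝ², T < |p.2| → χ p.2 * (rexp (η * p.2) : ℂ) = 0 := fun p hp => by
    rw [hT _ hp, zero_mul]
  simp only [mul_assoc]
  exact ⟨mA.intble_fst_mul_of_bd c z, mA.intble_snd_mul_of_bd c z⟩

lemma adjointRel_lineF (f : testF) (hE : 1 ≤ E) (hK : 0 ≤ K) (hd : ∀ l : ℂ, l.im = γ → Disp E l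
  ≠ 0) (hb : ∀ l : ℂ, l.im = γ → ResBound E K l) (mψ : MemL γ (lineF E γ f)) : AdjointRel
  (diracRel γ) (toL γ (lineF E γ f)) (toL γ (f : 𝓦) + (E : ℂ) • toL γ (lineF E γ f)) := by
  intro a b hab
  obtain ⟨C₁, -, hC₁⟩ := ex_lineSol_decay f hE hK hd hb
  obtain ⟨C₂, -, hC₂⟩ := ex_ftField_decay f |γ| 2
  have cw := cont_lineSol f hd
  have cF : Continuous fun p : ℝ² => ftField f (lineMk γ p.2) p.1 :=
    (cont_ftField f).comp (((cont_line γ).comp continuous_snd).prodMk continuous_fst)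
  have bw : ∀ x ∈ 𝕀, ∀ ξ, ‖lineSol E γ f x ξ‖ ≤ max C₁ C₂ * (1 + ξ ^ 2)⁻¹ :=
    fun x hx ξ => (hC₁ x hx ξ).trans (by gcongr; exact le_max_left _ _)
  have bF : ∀ x ∈ 𝕀, ∀ ξ, ‖ftField f (lineMk γ ξ) x‖ ≤ max C₁ C₂ * (1 + ξ ^ 2)⁻¹ :=
    fun x _ ξ => (le_inv_of_decay (norm_nonneg _) (hC₂ x _ le_rfl)).trans
      (by gcongr; exact le_max_right _ _)
  have inv1 : ∀ p, invFt γ (fun x ξ => (ftField f (lineMk γ ξ) x).1) p = ((f : 𝓦) p).1 := fun p => (ft_inversion f.2.1 p.1 p.2 γ).symm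
  have inv2 : ∀ p, invFt γ (fun x ξ => (ftField f (lineMk γ ξ) x).2) p = ((f : 𝓦) p).2 := fun p => (ft_inversion f.2.2 p.1 p.2 γ).symm
  set A := ofL (-γ) a with hA
  set B := ofL (-γ) b with hB
  have mA : MemL (-γ) A := memL_ofL _ _
  have mB : MemL (-γ) B := memL_ofL _ _
  have hAB := hab
  obtain ⟨χ, sχ, χ0, χT, χ1, M, χM⟩ := ex_lineCutoff
  set ψ := lineF E γ f with hψ
  have sol : ∀ ξ, IsSol E (lineMk γ ξ) (ftField f (lineMk γ ξ)) (fun x => lineSol E γ f x ξ) := fun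
    ξ => by
    have : (fun x => lineSol E γ f x ξ) = resSol E (lineMk γ ξ) (ftField f (lineMk γ ξ)) := by
      funext x; rw [lineSol]
    rw [this]
    exact isSol_resSol (cont_ftField_right f _) (hd _ rfl)
  have limit : ∀ {X Y g h f₀ : ℝ² → ℂ} {σ : ℂ}, Integrable (fun p => X p * conj (g p)) μₛ →
    Integrable (fun p => Y p * conj (h p)) μₛ → Integrable (fun p => Y p * conj (g p)) μₛ →
    Integrable (fun p => Y p * conj (f₀ p)) μₛ → (∀ (T : ℝ) (χ : ℝ → ℂ), ContDiff ℝ ∞ χ → (∀ y, T <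
    |y| → χ y = 0) → ∫ p, X p * χ p.2 * conj (g p) ∂μₛ = E * ∫ p, Y p * χ p.2 * conj (h p) ∂μₛ + ∫
    p, Y p * χ p.2 * conj (f₀ p) ∂μₛ + σ * ∫ p, Y p * deriv χ p.2 * conj (g p) ∂μₛ) → ∫ p, X p *
    conj (g p) ∂μₛ = E * ∫ p, Y p * conj (h p) ∂μₛ + ∫ p, Y p * conj (f₀ p) ∂μₛ := by
    intro X Y g h f₀ σ i1 i2 i3 i4 H
    have cχ := sχ.continuous
    have t1 := lim_int_cutoff i1 cχ χ1
    have t2 := lim_int_cutoff i2 cχ χ1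
    have t4 := lim_int_cutoff i4 cχ χ1
    have t3 := (lim_int_cutoff i3 (sχ.continuous_deriv (by simp)) χM).mul
      ((continuous_ofReal.tendsto 0).comp (tendsto_one_div_add_atTop_nhds_zero_nat))
    have t := ((t2.const_mul (E : ℂ)).add t4).add (t3.const_mul σ)
    simp only [χ0, mul_one, ofReal_zero, mul_zero, add_zero] at t t1
    refine tendsto_nhds_unique t1 (t.congr fun n => ?_)
    have hn : (0 : ℝ) < (n : ℝ) + 1 := by positivity
    have h2 : ∀ y, deriv (fun y => χ (y * ((n : ℝ) + 1)⁻¹)) y = deriv χ (y * ((n : ℝ) + 1)⁻¹) * ((n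
      : ℝ) + 1)⁻¹ := fun y => by
      simpa [mul_comm] using deriv_comp_mul_left ((n : ℝ) + 1)⁻¹ χ y
    have := H (2 * ((n : ℝ) + 1)) (fun y => χ (y * ((n : ℝ) + 1)⁻¹))
      (sχ.comp (contDiff_id.mul contDiff_const)) fun y hy => χT _ (by
        rwa [abs_mul, abs_of_pos (inv_pos.2 hn), ← div_eq_mul_inv, lt_div_iff₀ hn])
    have e3 : ∫ p, Y p * (deriv χ (p.2 * ((n : ℝ) + 1)⁻¹) * ((n : ℝ) + 1)⁻¹) * conj (g p) ∂μₛ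
        = (∫ p, Y p * conj (g p) * deriv χ (p.2 * ((n : ℝ) + 1)⁻¹) ∂μₛ) * ((1 / ((n : ℝ) + 1) : ℝ) : ℂ) := by
      rw [← integral_mul_const]
      congr 1
      funext p
      push_cast
      ring
    have r : ∀ (Z k : ℝ² → ℂ) (p : ℝ²), Z p * χ (p.2 * ((n : ℝ) + 1)⁻¹) * conj (k p) = Z p * conj (k
      p) * χ (p.2 * ((n : ℝ) + 1)⁻¹) := fun Z k p => by ring
    simp only [h2, e3, r] at this
    rw [this]
    simp
  have mf := memL_testF γ f
  have conjMem : ∀ {g : ℝ² → ℂ}, MemLp (fun p => weight γ p • g p) 2 μₛ → MemLp (fun p => weight γ p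
    • conj (g p)) 2 μₛ := fun {g} hg => by
    refine (hg.star).ae_eq (.of_forall fun p => ?_)
    simp
  have prodInt : ∀ {X g : ℝ² → ℂ}, MemLp (fun p => weight (-γ) p • X p) 2 μₛ → MemLp (fun p =>
    weight γ p • g p) 2 μₛ → Integrable (fun p => X p * conj (g p)) μₛ := fun {X g} hX hg =>
    intble_mul_of_wt hX (by rw [neg_neg]; exact conjMem hg)
  have j := fun {T : ℝ} {χn : ℝ → ℂ} (h3 : ContDiff ℝ ∞ χn) (h4 : ∀ y, T < |y| → χn y = 0) =>
    intble_cutoff_exp mA h3.continuous h4 γ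
  have j' := fun {T : ℝ} {χn : ℝ → ℂ} (h3 : ContDiff ℝ ∞ χn) (h4 : ∀ y, T < |y| → χn y = 0) =>
    intble_cutoff_exp mA (h3.continuous_deriv (by simp)) (deriv_supp_bd h4) γ
  have jB := fun {T : ℝ} {χn : ℝ → ℂ} (h3 : ContDiff ℝ ∞ χn) (h4 : ∀ y, T < |y| → χn y = 0) =>
    intble_cutoff_exp mB h3.continuous h4 γ
  have L2 := limit
    (prodInt mB.memLp_snd mψ.memLp_snd)
    (prodInt mA.memLp_fst mψ.memLp_fst) (prodInt mA.memLp_fst mψ.memLp_snd)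
    (prodInt mA.memLp_fst mf.memLp_fst)
    (fun _ χn h3 h4 => by
      have := int_conj_invFt_eq (jB h3 h4).2 (j h3 h4).1 (j' h3 h4).1 cw.snd cw.fst
        cF.fst (fun x hx ξ => (norm_snd_le _).trans (bw x hx ξ))
        (fun x hx ξ => (norm_fst_le _).trans (bw x hx ξ))
        (fun x hx ξ => (norm_fst_le _).trans (bF x hx ξ))
        (fun ξ => (hAB.transv_identity mA mB (cont_ftField_right f _) (sol ξ) h3 h4).1)
      simp only [inv1] at this
      exact this)
  have L1 := limit
    (prodInt mB.memLp_fst mψ.memLp_fst)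
    (prodInt mA.memLp_snd mψ.memLp_snd) (prodInt mA.memLp_snd mψ.memLp_fst)
    (prodInt mA.memLp_snd mf.memLp_snd)
    (fun _ χn h3 h4 => by
      have := int_conj_invFt_eq (jB h3 h4).1 (j h3 h4).2 (j' h3 h4).2 cw.fst cw.snd
        cF.snd (fun x hx ξ => (norm_fst_le _).trans (bw x hx ξ))
        (fun x hx ξ => (norm_snd_le _).trans (bw x hx ξ))
        (fun x hx ξ => (norm_snd_le _).trans (bF x hx ξ))
        (fun ξ => (hAB.transv_identity mA mB (cont_ftField_right f _) (sol ξ) h3 h4).2)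
      simp only [inv2] at this
      exact this)
  rw [← inner_conj_symm, ← inner_conj_symm a]
  congr 1
  rw [inner_add_left, inner_smul_left, conj_ofReal]
  have pair : ∀ {w : 𝓦} (c : StripL2), MemL γ w → ⟪toL γ w, c⟫_ℂ = ∫ p, (ofL (-γ) c p).1 * conj (w
    p).1 ∂μₛ + ∫ p, (ofL (-γ) c p).2 * conj (w p).2 ∂μₛ := by
    intro w c hw
    rw [inner_eq_int γ, ← integral_add (prodInt (memL_ofL (-γ) c).memLp_fst hw.memLp_fst) (prodInt
      (memL_ofL (-γ) c).memLp_snd hw.memLp_snd)]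
    refine integral_congr_ae ?_
    filter_upwards [ofL_toL hw] with p hp
    rw [hp]; ring
  rw [pair b mψ, pair a mψ, pair a mf, ← hA, ← hB, L1, L2]
  ring

end AdjointRelation

lemma mem_channels : (j, τ) ∈ channels N ↔ (1 ≤ j ∧ j ≤ N) ∧ (j, τ) ≠ (1, true) := by
  simp [channels]
  tauto

/-- The functionals whose common kernel consists of the fields for which the resolvent has no
poles in the strip `|Im λ| ≤ γ` at the threshold. -/
def poleFn (N : ℕ) : testF →ₗ[ℂ] (Channel N → ℂ) where
  toFun f k := if k.1.1 < N then
      solvFn (ωₜ N) f (Λ (ωₜ N) k.1.1 k.1.2)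
    else if k.1.2 then solvFn (ωₜ N) f 1 else deriv (solvFn (ωₜ N) f) 1
  map_add' f g := by
    funext k
    have e : solvFn (ωₜ N) (f + g : testF)
        = solvFn (ωₜ N) f + solvFn (ωₜ N) g :=
      funext fun l => solvFn_add _ f g l
    simp only [Pi.add_apply, e]
    rw [deriv_add (diff_solvFn _ f _) (diff_solvFn _ g _)]
    split_ifs <;> rfl
  map_smul' c f := by
    funext k
    have e : solvFn (ωₜ N) (c • f : testF)
        = fun l => c * solvFn (ωₜ N) f l :=
      funext fun l => solvFn_smul _ c f l
    simp only [Pi.smul_apply, e, RingHom.id_apply, smul_eq_mul]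
    rw [deriv_const_mul _ (diff_solvFn _ f _)]
    split_ifs <;> rfl

lemma ex_param_thr (hN : 2 ≤ N) (hγ : AdmissibleWeight N γ) : ∃ Q F : StripL2 →L[ℂ] StripL2,
  FiniteDimensional ℂ F.range ∧ Module.finrank ℂ F.range ≤ Fintype.card (Channel N) ∧ ∀ h,
  AdjointRel (diracRel γ) (Q h) (h - F h + (ωₜ N : ℂ) • Q h) := by
  set E := ωₜ N with hEdef
  have hE1 := one_lt_omegaThr hN
  have hg0 := hγ.1
  have hd : ∀ l : ℂ, |l.im| = γ → Disp E l ≠ 0 := fun l hl h => by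
    have := hγ.2 l h hl.le
    rw [this, abs_zero] at hl
    exact hg0.ne hl
  obtain ⟨K, hK, hb⟩ := ex_sqInt_bd hE1.le hg0.le hd
  have hd1 : ∀ l, l.im = γ → Disp E l ≠ 0 := fun l hl => hd l (by rw [hl, abs_of_pos hg0])
  have hb1 : ∀ l, l.im = γ → ResBound E K l := fun l hl => hb l (by rw [hl, abs_of_pos hg0])
  have hz : ∀ f ∈ LinearMap.ker (poleFn N), ∀ l, |l.im| ≤ γ → Disp E l = 0 → (solvFn E f l = 0
    ∧ deriv (Disp E) l ≠ 0) ∨ (solvFn E f l = 0 ∧ deriv (solvFn E f) l = 0 ∧ deriv (Disp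
    E) l = 0 ∧ deriv (deriv (Disp E)) l ≠ 0) := by
    intro f hf l hl h0
    have hk : ∀ k, poleFn N f k = 0 := fun k => congrFun (LinearMap.mem_ker.1 hf) k
    obtain ⟨x, rfl⟩ : ∃ x : ℝ, l = x := ⟨l.re, by apply Complex.ext <;> simp [hγ.2 l h0 hl]⟩
    by_cases hx : x = 1
    · subst hx
      right
      have m1 : ((N, true) : ℕ × Bool) ∈ channels N := mem_channels.2 ⟨⟨by omega, le_rfl⟩, by
        intro h; have := congrArg Prod.fst h; simp at this; omega⟩
      have m2 : ((N, false) : ℕ × Bool) ∈ channels N := mem_channels.2 ⟨⟨by omega, le_rfl⟩, by simp⟩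
      have k1 := hk ⟨_, m1⟩
      have k2 := hk ⟨_, m2⟩
      simp only [poleFn, LinearMap.coe_mk, AddHom.coe_mk, lt_irrefl, if_false, if_true] at k1 k2
      rw [ofReal_one] at h0 ⊢
      refine ⟨k1, by simpa using k2, ?_, deriv_deriv_disp_ne_zero hE1 h0⟩
      rw [(derivAt_disp (sub_sq_ne_zero_of_disp hE1 h0)).deriv, h0]
      simp
    · left
      refine ⟨?_, deriv_disp_ne_zero hE1 h0 (by exact_mod_cast hx)⟩
      rcases real_root_disp hN h0 with h1 | ⟨j, τ, hj1, hjN, hne, hj⟩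
      · exact absurd h1 hx
      · have k1 := hk ⟨(j, τ), mem_channels.2 ⟨⟨hj1, hjN.le⟩, hne⟩⟩
        simp only [poleFn, LinearMap.coe_mk, AddHom.coe_mk, hjN, if_true] at k1
        rw [hj]
        exact k1
  have heq : ∀ f ∈ LinearMap.ker (poleFn N), ∀ p ∈ strip, lineF E γ f p = lineF E (-γ) f p
    := fun f hf p hp =>
    lineF_eq f hE1.le hK hg0 hd hb (hz f hf) (Ioo_subset_Icc_self hp.1)
  have hmem : ∀ f ∈ LinearMap.ker (poleFn N), MemL γ (lineF E γ f) ∧ ‖toL γ (lineF E γ f)‖ ≤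
    √(2 * K) * ‖toL γ f‖ := fun f hf =>
    memL_lineF f hE1.le hK hg0.le hd hb (heq f hf)
  let T : LinearMap.ker (poleFn N) →ₗ[ℂ] StripL2 :=
    { toFun := fun f => toL γ (lineF E γ (f : testF))
      map_add' := fun f g => by
        rw [← toL_add (hmem f f.2).1 (hmem g g.2).1]
        refine toL_congr (hmem _ (f + g).2).1 ?_
        filter_upwards [ae_restrict_mem measSet_strip] with p hp
        exact lineField_add (f : testF) (g : testF) hE1.le hK hd1 hb1 (Ioo_subset_Icc_self hp.1)
      map_smul' := fun c f => by
        rw [RingHom.id_apply, ← toL_const_smul (hmem f f.2).1]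
        refine toL_congr (hmem _ (c • f).2).1 (.of_forall fun p => ?_)
        exact lineF_smul c (f : testF) E γ p }
  exact ex_param (diracRel γ) (testToL γ) (denseRange_testToL γ) (poleFn N) T _
    (fun f => (hmem f f.2).2) _ fun f => adjointRel_lineF (f : testF) hE1.le hK hd1 hb1
      (hmem f f.2).1

/-! ### Cutoffs -/

lemma mul_cutoff_isTest {χ : ℝ → ℝ} (hχ : ContDiff ℝ ∞ χ) (hφ : IsTest φ) : IsTest (fun p => (χ
  p.2 : ℂ) * φ p) ∧ (∀ p, dX (fun p => (χ p.2 : ℂ) * φ p) p = χ p.2 * dX φ p) ∧ (∀ p, dY (fun p =>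
  (χ p.2 : ℂ) * φ p) p = deriv χ p.2 * φ p + χ p.2 * dY φ p) ∧ tsupport (fun p => (χ p.2 : ℂ) * φ p)
  ⊆ tsupport φ := by
  refine ⟨⟨((ofRealCLM.contDiff.comp hχ).comp contDiff_snd).mul hφ.1, hφ.2.mul_left⟩, ?_, ?_,
    tsupport_mul_subset_right⟩
  all_goals
    intro p
    have h1 := (((hχ.differentiable (by simp) p.2).hasDerivAt.ofReal_comp).hasFDerivAt.comp p
      (hasFDerivAt_snd))
    have h3 : HasFDerivAt (fun p => (χ p.2) * φ p) _ p := h1.mul (hφ.differentiable p).hasFDerivAt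
    simp only [dX, dY, h3.fderiv]
    simp
  ring

/-- `𝒟 (χ w) = χ 𝒟 w + χ' (v, -u)`. -/
lemma HasDirac.cutoff {f : 𝓦} (h : HasDirac w f) (mw : MemL s w) (mf : MemL s f) {χ : ℝ → ℝ} (hχ :
  ContDiff ℝ ∞ χ) : HasDirac (fun p => χ p.2 • w p) (fun p => χ p.2 • f p + deriv χ p.2 • ((w p).2,
  -(w p).1)) := by
  have cχ' := hχ.continuous_deriv (by simp)
  have cχ := hχ.continuous
  refine ⟨fun φ hφ hs => ?_, fun φ hφ hs => ?_⟩
  · obtain ⟨t1, t2, t3, t4⟩ := mul_cutoff_isTest hχ hφ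
    have key := h.1 _ t1 (t4.trans hs)
    simp only [t2, t3] at key
    have cφ := hφ.continuous
    have i1 := mf.intble_snd_mul t1.continuous t1.2
    have i2 := mw.intble_fst_mul (g := fun p => ((deriv χ p.2 : ℝ) : ℂ) * φ p) (by fun_prop)
      hφ.2.mul_left
    have e1 : ∀ p, (χ p.2 • f p + deriv χ p.2 • ((w p).2, -(w p).1)).2 * φ p = (f p).2 * (χ p.2 * φ
      p) - (w p).1 * (deriv χ p.2 * φ p) := fun p => by
      simp; ring
    simp only [e1]
    have d1 := hφ.dX.continuous
    have d2 := hφ.dY.continuous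
    have i3 := mw.intble_fst_mul (g := fun p => I * (χ p.2 * dX φ p)
      + (deriv χ p.2 * φ p + χ p.2 * dY φ p)) (by fun_prop)
      ((hφ.dX.2.mul_left.mul_left).add (hφ.2.mul_left.add hφ.dY.2.mul_left))
    rw [integral_sub i1 i2, key, ← integral_sub i3 i2]
    congr 1
    funext p
    simp; ring
  · obtain ⟨t1, t2, t3, t4⟩ := mul_cutoff_isTest hχ hφ
    have key := h.2 _ t1 (t4.trans hs)
    simp only [t2, t3] at key
    have cφ := hφ.continuous
    have i1 := mf.intble_fst_mul t1.continuous t1.2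
    have i2 := mw.intble_snd_mul (g := fun p => ((deriv χ p.2 : ℝ) : ℂ) * φ p) (by fun_prop)
      hφ.2.mul_left
    have e1 : ∀ p, (χ p.2 • f p + deriv χ p.2 • ((w p).2, -(w p).1)).1 * φ p = (f p).1 * (χ p.2 * φ
      p) + (w p).2 * (deriv χ p.2 * φ p) := fun p => by
      simp; ring
    simp only [e1]
    have d1 := hφ.dX.continuous
    have d2 := hφ.dY.continuous
    have i3 := mw.intble_snd_mul (g := fun p => I * (χ p.2 * dX φ p)
      - (deriv χ p.2 * φ p + χ p.2 * dY φ p)) (by fun_prop)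
      ((hφ.dX.2.mul_left.mul_left).sub (hφ.2.mul_left.add hφ.dY.2.mul_left))
    rw [integral_add i1 i2, key, ← integral_add i3 i2]
    congr 1
    funext p
    simp; ring

lemma MemL.cutoff {s' : ℝ} (h : MemL s w) {m : ℝ → ℝ} (hm : Continuous m) (hC : ∀ y, |m y| *
  rexp ((s' - s) * |y|) ≤ C) : MemL s' fun p => m p.2 • w p := by
  have c : Continuous fun p => m p.2 * weight (s' - s) p := by have := cont_wt (s' - s); fun_prop
  have e : ∀ p, weight s' p • m p.2 • w p = (m p.2 * weight (s' - s) p) • weight s p • w p := by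
    intro p
    rw [smul_smul, smul_smul, mul_assoc, wt_mul, sub_add_cancel, mul_comm]
  rw [memL_iff]
  simp only [e]
  refine h.of_le_mul (c := C) (c.aestronglyMeasurable.smul h.aestronglyMeasurable)
    (.of_forall fun p => ?_)
  rw [norm_smul, norm_mul, norm_eq_abs, norm_eq_abs, abs_of_pos (wt_pos _ _)]
  exact mul_le_mul_of_nonneg_right (hC p.2) (norm_nonneg _)

lemma bd_of_supp {m : ℝ → ℝ} (hm : Continuous m) {R : ℝ} (hR : ∀ y, R < |y| → m y = 0) (s : ℝ) : ∃
  C, ∀ y, |m y| * rexp (s * |y|) ≤ C := by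
  have hc : HasCompactSupport fun y => |m y| * rexp (s * |y|) :=
    HasCompactSupport.intro (isCompact_Icc) fun y hy => by
      rw [hR y (by by_contra h; exact hy (abs_le.1 (not_lt.1 h)))]; simp
  obtain ⟨C, hC⟩ := hc.exists_bound_of_continuous (by fun_prop)
  exact ⟨C, fun y => (le_abs_self _).trans (hC y)⟩

/-- `(u, v) ↦ (v, -u)`. -/
def turn (z : ℂ²) : ℂ² := (z.2, -z.1)

lemma norm_turn (z : ℂ²) : ‖turn z‖ = ‖z‖ := by simp [turn, Prod.norm_def, max_comm]

lemma cont_turn : Continuous turn := by unfold turn; fun_prop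

lemma MemL.turn (h : MemL s w) : MemL s fun p => turn (w p) := by
  have e : ∀ p, weight s p • ZigzagRibbon.turn (w p) = ZigzagRibbon.turn (weight s p • w p) :=
    fun p => by simp [ZigzagRibbon.turn]
  rw [memL_iff]
  simp only [e]
  exact h.of_le (cont_turn.comp_aestronglyMeasurable h.aestronglyMeasurable)
    (.of_forall fun p => (norm_turn _).le)

/-- Multiplication by a function of `y`, followed by a rotation, as a bounded operator. -/
lemma ex_cutoffOp {s' : ℝ} {m : ℝ → ℝ} (hm : Continuous m) (hC : ∀ y, |m y| * rexp ((s' - s) *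
  |y|) ≤ C) : ∃ M : StripL2 →L[ℂ] StripL2, ∀ w, MemL s w → M (toL s w) = toL s' fun p => m p.2 • w p
  := by
  have c : Continuous fun p => m p.2 * weight (s' - s) p := by have := cont_wt (s' - s); fun_prop
  obtain ⟨M, -, hM⟩ := ex_mulOp
    c.aestronglyMeasurable (.of_forall fun p => by
      rw [abs_mul, abs_of_pos (wt_pos _ _)]; exact hC p.2)
    ((mul_nonneg (abs_nonneg _) (exp_pos _).le).trans (hC 0))
  refine ⟨M, fun w hw => toL_eq_of_ofL ?_⟩
  filter_upwards [hM (toL s w), coeFn_toL hw] with p h1 h2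
  have e : weight (-s') p * (m p.2 * weight (s' - s) p) * weight s p = m p.2 := by
    have : weight (-s') p * weight (s' - s) p * weight s p = 1 := by
      rw [wt_mul, wt_mul]; ring_nf; exact wt_zero p
    linear_combination m p.2 * this
  rw [ofL, h1, h2, WithLp.ofLp_smul, smul_smul, smul_smul, e]

lemma ex_turnOp (s : ℝ) : ∃ M : StripL2 →L[ℂ] StripL2, ∀ w, MemL s w → M (toL s w) = toL s fun p
  => turn (w p) := by
  let L₀ : ℂ² →L[ℂ] ℂ² := (ContinuousLinearMap.snd ℂ ℂ ℂ).prod (-ContinuousLinearMap.fst ℂ ℂ ℂ)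
  let e := WithLp.prodContinuousLinearEquiv 2 ℂ ℂ ℂ
  let L : WithLp 2 ℂ² →L[ℂ] WithLp 2 ℂ² :=
    e.symm.toContinuousLinearMap.comp (L₀.comp e.toContinuousLinearMap)
  refine ⟨L.compLpL 2 μₛ, fun w hw => toL_eq_of_ofL ?_⟩
  filter_upwards [L.coeFn_compLpL (toL s w), coeFn_toL hw] with p h1 h2
  rw [ofL, h1, h2]
  change weight (-s) p • turn (weight s p • w p) = turn (w p)
  have : turn (weight s p • w p) = weight s p • turn (w p) := by simp [turn]
  rw [this, smul_smul, wt_neg_mul, one_smul]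

/-! ### The flux form -/

lemma qForm_eq_setIntegral (b : ℝ) (w w' : 𝓦) : qForm b w w' = ∫ x in 𝕁, ((turn (w (x, b))).1 *
  conj (w' (x, b)).1 + (turn (w (x, b))).2 * conj (w' (x, b)).2) := by
  rw [qForm, integral_of_le zero_le_one, integral_Ioc_eq_integral_Ioo, ← integral_neg]
  congr 1
  funext x
  simp [turn]; ring

lemma intble_inner (hw : MemL (-s) w) (hw' : MemL s w') : Integrable (fun p => (w p).1 * conj (w'
  p).1 + (w p).2 * conj (w' p).2) μₛ := by
  have conjMem : ∀ {g : ℝ² → ℂ}, MemLp (fun p => weight s p • g p) 2 μₛ → MemLp (fun p => weight s p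
    • conj (g p)) 2 μₛ := fun {g} hg => by
    refine (hg.star).ae_eq (.of_forall fun p => ?_)
    simp
  exact (intble_mul_of_wt hw.memLp_fst (by rw [neg_neg]; exact conjMem hw'.memLp_fst)).add
    (intble_mul_of_wt hw.memLp_snd (by rw [neg_neg]; exact conjMem hw'.memLp_snd))

lemma int_cutoff_turn {m : ℝ → ℝ} (hw : MemL (-s) fun p => m p.2 • turn (w p)) (hw' : MemL s w') :
  Integrable (fun y => (m y : ℂ) * qForm y w w') ∧ ∫ p, ((m p.2 • turn (w p)).1 * conj (w' p).1 + (m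
  p.2 • turn (w p)).2 * conj (w' p).2) ∂μₛ = ∫ y, (m y : ℂ) * qForm y w w' := by
  have i := intble_inner hw hw'
  rw [stripMeasure_eq] at i ⊢
  have e : ∀ y, ∫ x in 𝕁, ((m y • turn (w (x, y))).1 * conj (w' (x, y)).1 + (m y • turn (w (x,
    y))).2 * conj (w' (x, y)).2) = (m y) * qForm y w w' := by
    intro y
    rw [qForm_eq_setIntegral, ← integral_const_mul]
    congr 1
    funext x
    simp; ring
  rw [integral_prod_symm _ i]
  refine ⟨?_, ?_⟩
  · have := i.integral_prod_right
    simpa only [e] using this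
  · simp only [e]

lemma int_deriv_cutoff {m : ℝ → ℝ} (hm : ContDiff ℝ ∞ m) {R c d : ℝ} (h1 : ∀ y, R < y → m y = d)
  (h2 : ∀ y, y < -R → m y = c) : ∫ y, deriv m y = d - c := by
  have z : ∀ y, R < |y| → deriv m y = 0 := by
    intro y hy
    rcases lt_abs.1 hy with h | h
    · have : m =ᶠ[𝓝 y] fun _ => d := by filter_upwards [lt_mem_nhds h] with z hz using h1 z hz
      rw [this.deriv_eq, deriv_const]
    · have : m =ᶠ[𝓝 y] fun _ => c := by
        filter_upwards [gt_mem_nhds (show y < -R by linarith)] with z hz using h2 z hz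
      rw [this.deriv_eq, deriv_const]
  have hc := HasCompactSupport.intro (isCompact_Icc) fun y hy => z y (by
      by_contra h; exact hy (abs_le.1 (not_lt.1 h)))
  refine integral_of_hasDerivAt_of_tendsto (fun y => (hm.differentiable (by simp) y).hasDerivAt)
    ((hm.continuous_deriv (by simp)).integrable_of_hasCompactSupport hc)
    (tendsto_const_nhds.congr' ?_) (tendsto_const_nhds.congr' ?_)
  · filter_upwards [eventually_lt_atBot (-R)] with y hy using (h2 y hy).symm
  · filter_upwards [eventually_gt_atTop R] with y hy using (h1 y hy).symm

section Assembly

/-- The properties of the waves on which the construction of the scattering matrix relies. -/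
structure IsWaveSystem (N : ℕ) (a γ r : ℝ) : Prop where
  cont : ∀ t ∈ Ioo (-r) r, ∀ k, Continuous (wave N a t k)
  mem : ∀ t ∈ Ioo (-r) r, ∀ k, MemL (-γ) (wave N a t k)
  dirac : ∀ t ∈ Ico 0 r, ∀ k, HasDirac (wave N a t k) fun p => omega N t • wave N a t k p
  flux : ∀ t ∈ Ico 0 r, ∀ j k b, qForm b (wave N a t j) (wave N a t k)
    = if j = k then (if j.1.2 then I else -I) else 0
  analytic : ∀ k, AnalyticAt ℝ (fun t => toL (-γ) (wave N a t k)) 0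

variable {N : ℕ} {a γ r R₀ : ℝ} {χ : Bool → ℝ → ℝ}

local notation:max "𝔱" => toL (-γ)
local notation:max "𝔬" => ofL (-γ)
local notation:max "𝔴" => wave N a
local notation:max "𝔲" => inWave N χ a
local notation:max "𝔳" => outWave N χ a

lemma IsCutoff.bounded (hχ : IsCutoff R₀ χ) (τ : Bool) : ∃ C, ∀ y, |χ τ y| ≤ C := by
  obtain ⟨C, hC⟩ := (isCompact_Icc).exists_bound_of_continuousOn (hχ.1 τ).continuous.continuousOn
  refine ⟨max C 1, fun y => ?_⟩
  rcases lt_or_ge R₀ y with h | h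
  · have := hχ.2.1 y h
    cases τ <;> simp [this]
  rcases lt_or_ge y (-R₀) with h' | h'
  · have := hχ.2.2 y h'
    cases τ <;> simp [this]
  · exact (hC y ⟨h', h⟩).trans (le_max_left _ _)

lemma IsCutoff.deriv_eq_zero (hχ : IsCutoff R₀ χ) (τ : Bool) (y : ℝ) (hy : R₀ < |y|) : deriv (χ τ)
  y = 0 := by
  rcases lt_abs.1 hy with h | h
  · have : χ τ =ᶠ[𝓝 y] fun _ => χ τ y := by
      filter_upwards [lt_mem_nhds h] with z hz
      have e1 := hχ.2.1 z hz
      have e2 := hχ.2.1 y h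
      cases τ <;> simp [e1, e2]
    rw [this.deriv_eq, deriv_const]
  · have : χ τ =ᶠ[𝓝 y] fun _ => χ τ y := by
      filter_upwards [gt_mem_nhds (show y < -R₀ by linarith)] with z hz
      have e1 := hχ.2.2 z hz
      have e2 := hχ.2.2 y (by linarith)
      cases τ <;> simp [e1, e2]
    rw [this.deriv_eq, deriv_const]

lemma IsCutoff.int_deriv (hχ : IsCutoff R₀ χ) (τ : Bool) : ∫ y, deriv (χ τ) y = if τ then 1 else
  -1 := by
  cases τ
  · rw [int_deriv_cutoff (hχ.1 false) (fun y hy => (hχ.2.1 y hy).2)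
      fun y hy => (hχ.2.2 y hy).2]; simp
  · rw [int_deriv_cutoff (hχ.1 true) (fun y hy => (hχ.2.1 y hy).1)
      fun y hy => (hχ.2.2 y hy).1]; simp

/-- Waves are independent modulo decaying fields, near each of the two ends of the strip. -/
lemma IsWaveSystem.eq_zero_of_memL (h : IsWaveSystem N a γ r) (ht : t ∈ Ico 0 r) {c : Channel N →
  ℂ} {A : Set ℝ} (hI : MeasurableSet A) (hv : volume A = ⊤) (hm : MemL γ (fun p => A.indicator (fun
  _ => (1 : ℝ)) p.2 • ∑ k, c k • 𝔴 t k p)) (k : Channel N) : c k = 0 := by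
  have ht' : t ∈ Ioo (-r) r := ⟨by linarith [ht.1, ht.2], ht.2⟩
  have hq : ∀ y, qForm y (fun p => ∑ k, c k • 𝔴 t k p) (𝔴 t k) = c k * (if k.1.2 then
    I else -I) := by
    intro y
    have cw : ∀ k, Continuous fun x : ℝ => 𝔴 t k (x, y) := fun k =>
      (h.cont t ht' k).comp (Continuous.prodMk_left y)
    have e : qForm y (fun p => ∑ k, c k • 𝔴 t k p) (𝔴 t k) = ∑ j, c j * qForm y (𝔴 t j) (𝔴 t k) := by
      simp only [qForm, mul_neg, Finset.sum_neg_distrib]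
      rw [neg_inj]
      simp only [← iint_const_mul]
      rw [← intervalIntegral.integral_finset_sum fun j _ => by
        have := cw j
        have := cw k
        apply Continuous.intervalIntegrable
        fun_prop]
      congr 1
      funext x
      simp only [Prod.fst_sum, Prod.snd_sum, smul_fst, smul_snd, smul_eq_mul,
        Finset.sum_mul, mul_sub, Finset.sum_sub_distrib, mul_assoc]
    rw [e]
    simp only [h.flux t ht]
    simp
  have e1 := (int_cutoff_turn (s := -γ)
    (w := fun p => ∑ k, c k • 𝔴 t k p) (m := A.indicator fun _ => (1 : ℝ)) (by
      rw [neg_neg]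
      refine hm.turn.congr (.of_forall fun p => ?_)
      simp [turn]) (h.mem t ht' k)).1
  simp only [hq] at e1
  by_contra hc
  have e2 : IntegrableOn (fun _ : ℝ => c k * (if k.1.2 then I else -I)) A := by
    rw [← integrable_indicator_iff hI]
    refine e1.congr (.of_forall fun y => ?_)
    by_cases hy : y ∈ A <;> simp [hy]
  rw [integrableOn_const_iff] at e2
  rcases e2 with e2 | e2
  · split_ifs at e2 <;> simp [hc] at e2
  · simp [hv] at e2

lemma MemL.indicator (h : MemL s w) {A : Set ℝ} (hI : MeasurableSet A) : MemL s fun p =>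
  A.indicator (fun _ => (1 : ℝ)) p.2 • w p := by
  refine (memLp_congr_ae (.of_forall fun p => ?_)).1
    (MemLp.indicator (hI.preimage measurable_snd) (memL_iff.1 h))
  by_cases hp : p.2 ∈ A <;> simp [hp, indicator, weight]

/-- Incoming and outgoing waves are independent modulo decaying fields. -/
lemma IsWaveSystem.in_out_indep (h : IsWaveSystem N a γ r) (hχ : IsCutoff R₀ χ) (ht : t ∈ Ico 0 r)
  {α β : Channel N → ℂ} (hm : MemL γ fun p => ∑ k, (α k • 𝔲 t k p + β k • 𝔳 t
  k p)) (k : Channel N) : α k = 0 ∧ β k = 0 := by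
  have e1 := h.eq_zero_of_memL ht (c := fun k => if k.1.2 then α k else β k)
    (measurableSet_Ioi (a := R₀)) volume_Ioi ((hm.indicator (A := Ioi R₀) measurableSet_Ioi).congr
      (.of_forall fun p => by
        by_cases hp : p.2 ∈ Ioi R₀
        · simp only [indicator_of_mem hp, one_smul]
          refine congrArg (Finset.sum Finset.univ) (funext fun k => ?_)
          obtain ⟨c1, c2⟩ := hχ.2.1 p.2 hp
          rcases hk : k.1.2 <;> simp [inWave, outWave, hk, c1, c2]
        · simp only [indicator_of_notMem hp, zero_smul])) k
  have e2 := h.eq_zero_of_memL ht (c := fun k => if k.1.2 then β k else α k)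
    (measurableSet_Iio (a := -R₀)) volume_Iio ((hm.indicator (A := Iio (-R₀)) measurableSet_Iio).congr
      (.of_forall fun p => by
        by_cases hp : p.2 ∈ Iio (-R₀)
        · simp only [indicator_of_mem hp, one_smul]
          refine congrArg (Finset.sum Finset.univ) (funext fun k => ?_)
          obtain ⟨c1, c2⟩ := hχ.2.2 p.2 hp
          rcases hk : k.1.2 <;> simp [inWave, outWave, hk, c1, c2]
        · simp only [indicator_of_notMem hp, zero_smul])) k
  rcases hk : k.1.2 <;> simp only [hk] at e1 e2 <;> simp_all

lemma MemH.congr (h : MemH s w) (he : w =ᵐ[μₛ] w') : MemH s w' :=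
  ⟨h.1.congr he, h.2.imp fun _ hf => ⟨hf.1, hf.2.congr he (ae_eq_refl _)⟩⟩

lemma MemH.add (h : MemH s w) (h' : MemH s w') : MemH s fun p => w p + w' p := by
  obtain ⟨m, f, mf, hf⟩ := h
  obtain ⟨m', f', mf', hf'⟩ := h'
  exact ⟨m.add m', _, mf.add mf', hf.add hf' m m' mf mf'⟩

lemma MemL.sum {ι : Type*} {f : ι → 𝓦} (t : Finset ι) (h : ∀ i ∈ t, MemL s (f i)) : MemL s fun p
  => ∑ i ∈ t, f i p := by
  have := memLp_finset_sum t (fun i hi => memL_iff.1 (h i hi))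
  rw [memL_iff]
  simpa only [Finset.smul_sum] using this

lemma sum_rearrange {ι V : Type*} [Fintype ι] [DecidableEq ι] [AddCommGroup V] [Module ℂ V] (v w z
  : ι → V) (c s' : ι → ℂ) (s : ι → ι → ℂ) (k : ι) : (-1 : ℂ) • (∑ l, c l • z l - (v k + ∑ j, s' j •
  w j)) + ∑ l, c l • (z l - (v l + ∑ j, s l j • w j)) = ∑ l, (((if l = k then 1 else 0) - c l) • v l
  + (s' l - ∑ i, c i * s i l) • w l) := by
  simp only [sub_smul, Finset.sum_add_distrib, Finset.sum_sub_distrib, ite_smul, one_smul,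
    zero_smul, Finset.sum_ite_eq', Finset.mem_univ, if_true, smul_sub, smul_add,
    Finset.smul_sum, Finset.sum_smul, smul_smul, neg_smul, one_smul]
  rw [Finset.sum_comm]
  simp
  abel

/-- The source of the outgoing wave `W_j`. -/
def source (N : ℕ) (χ : Bool → ℝ → ℝ) (a t : ℝ) (k : Channel N) (p : ℝ²) : ℂ² :=
  I • deriv (χ (!k.1.2)) p.2 • turn (wave N a t k p)

local notation:max "𝔰" => source N χ a

set_option maxHeartbeats 1000000 in
lemma exists_scattering_of_waves (hN : 2 ≤ N) (hγ : AdmissibleWeight N γ) (hr : 0 < r) (h :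
  IsWaveSystem N a γ r) (hR : 0 < R₀) (hχ : IsCutoff R₀ χ) : ∃ ε₀ > 0, ∃ δ₀ > 0, ∃ C : ℝ, ∀ P : ℝ² →
  ℝ, IsPotential R₀ P → ∃ S : ℝ → ℝ → Matrix (Channel N) (Channel N) ℂ, (∀ ε ∈ Icc 0 ε₀, ∀ δ ∈ Icc
  (-δ₀) δ₀, IsScatteringMatrix N χ γ a ε δ P (S ε δ) ∧ ∀ S', IsScatteringMatrix N χ γ a ε δ P S' →
  S' = S ε δ) ∧ (∀ j k, AnalyticOn ℝ (fun q : ℝ² => S q.1 q.2 j k) (Icc 0 ε₀ ×ˢ Icc (-δ₀) δ₀)) ∧ ∀ ε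
  ∈ Icc 0 ε₀, ∀ δ ∈ Icc (-δ₀) δ₀, ∀ j k, ‖(S ε δ - 1) j k - -I * δ * pairing P (𝔴 ε j) (𝔴 ε k)‖ ≤ C * δ ^ 2 := by
  have hg := hγ.1
  have sub : Icc 0 (r / 2) ⊆ Ico 0 r := fun t ht => ⟨ht.1, by linarith [ht.2]⟩
  have sub' : Icc 0 (r / 2) ⊆ Ioo (-r) r := fun t ht => ⟨by linarith [ht.1], by linarith [ht.2]⟩
  have nh : ∀ᶠ t in 𝓝 (0 : ℝ), t ∈ Ioo (-r) r := Ioo_mem_nhds (by linarith) hr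
  obtain ⟨J, hJ⟩ := ex_embedding hg.le
  obtain ⟨Q, F, hfin, hrank, hQ⟩ := ex_param_thr hN hγ
  have bχ : ∀ τ, ∃ C, ∀ y, |χ τ y| * rexp ((-γ - -γ) * |y|) ≤ C := fun τ => by
    obtain ⟨C, hC⟩ := hχ.bounded τ
    exact ⟨C, fun y => by simpa using hC y⟩
  have cχ : ∀ τ, Continuous (χ τ) := fun τ => (hχ.1 τ).continuous
  have cχ' : ∀ τ, Continuous (deriv (χ τ)) := fun τ => (hχ.1 τ).continuous_deriv (by simp)
  have bχ' : ∀ τ, ∃ C, ∀ y, |deriv (χ τ) y| * rexp ((γ - -γ) * |y|) ≤ C := fun τ =>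
    bd_of_supp (cχ' τ) (hχ.deriv_eq_zero τ) _
  have mW : ∀ τ, ∀ t ∈ Ioo (-r) r, ∀ k, MemL (-γ) fun p => χ τ p.2 • 𝔴 t k p :=
    fun τ t ht k => (h.mem t ht k).cutoff (cχ τ) (bχ τ).choose_spec
  have mg' : ∀ τ, ∀ t ∈ Ioo (-r) r, ∀ k, MemL γ fun p => deriv (χ τ) p.2 • turn (𝔴 t k p) :=
    fun τ t ht k => (h.mem t ht k).turn.cutoff (cχ' τ) (bχ' τ).choose_spec
  have mg : ∀ t ∈ Ioo (-r) r, ∀ k, MemL γ (𝔰 t k) := fun t ht k => (mg' _ t ht k).const_smul I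
  have mE : ∀ t ∈ Ioo (-r) r, ∀ k, MemL (-γ) fun p => omega N t • 𝔴 t k p :=
    fun t ht k => (h.mem t ht k).const_smul (omega N t : ℂ)
  have hwa := h.analytic
  have hWa : ∀ j, AnalyticAt ℝ (fun t => 𝔱 (𝔳 t j)) 0 := fun j => by
    obtain ⟨M, hM⟩ := ex_cutoffOp (cχ (!j.1.2)) (bχ (!j.1.2)).choose_spec
    refine (((M.restrictScalars ℝ).analyticAt _).comp' (hwa j)).congr ?_
    filter_upwards [nh] with t ht
    exact hM _ (h.mem t ht j)
  have hga : ∀ j, AnalyticAt ℝ (fun t => toL γ (𝔰 t j)) 0 := fun j => by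
    obtain ⟨M, hM⟩ := ex_cutoffOp (cχ' (!j.1.2)) (bχ' (!j.1.2)).choose_spec
    obtain ⟨T, hT⟩ := ex_turnOp (-γ)
    refine ((((I • M ∘L T).restrictScalars ℝ).analyticAt _).comp' (hwa j)).congr ?_
    filter_upwards [nh] with t ht
    change I • M (T (𝔱 (𝔴 t j))) = _
    rw [hT _ (h.mem t ht j), hM _ (h.mem t ht j).turn, ← toL_const_smul (mg' _ t ht j)]
    rfl
  have hEa : AnalyticAt ℝ (omega N) 0 := by
    unfold omega
    refine (analyticAt_const.add analyticAt_id).inv ?_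
    simpa using (omegaThr_pos (j := N) (by omega)).ne'
  have dW : ∀ t ∈ Ico 0 r, ∀ τ k, HasDirac (fun p => χ τ p.2 • 𝔴 t k p) (fun p => χ τ p.2 •
    omega N t • 𝔴 t k p + deriv (χ τ) p.2 • turn (𝔴 t k p)) :=
    fun t ht τ k => (h.dirac t ht k).cutoff (h.mem t ⟨by linarith [ht.1], ht.2⟩ k)
      (mE t ⟨by linarith [ht.1], ht.2⟩ k) (hχ.1 τ)
  have hJD : ∀ p q, AdjointRel (diracRel γ) p q → (J p, J q) ∈ diracRel γ := fun p q hpq =>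
    (HasDirac.of_adjointRel hpq).congr (hJ p).symm (hJ q).symm
  have hw : ∀ t ∈ Icc 0 (r / 2), ∀ j, (𝔱 (𝔴 t j), (omega N t : ℂ) • 𝔱 (𝔴 t j)) ∈
    diracRel γ := fun t ht j => by
    rw [← toL_const_smul (h.mem t (sub' ht) j)]
    exact (toL_mem_diracRel (h.mem t (sub' ht) j) (mE t (sub' ht) j)).2 (h.dirac t (sub ht) j)
  have hwg : ∀ t ∈ Icc 0 (r / 2), ∀ i j, ⟪𝔱 (𝔴 t i), toL γ (𝔰 t j)⟫_ℂ = if i = j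
    then 1 else 0 := fun t ht i j => by
    have e := inner_toL (h.mem t (sub' ht) i) (by rw [neg_neg]; exact mg t (sub' ht) j)
    rw [neg_neg] at e
    have e1 := (int_cutoff_turn (s := -γ) (w' := 𝔴 t i) (w := 𝔴 t j)
      (m := deriv (χ (!j.1.2))) (by rw [neg_neg]; exact mg' _ t (sub' ht) j) (h.mem t (sub' ht) i)).2
    rw [e]
    have e2 : ∀ p, conj (𝔴 t i p).1 * (𝔰 t j p).1 + conj (𝔴 t i p).2 *
      (𝔰 t j p).2 = I * ((deriv (χ (!j.1.2)) p.2 • turn (𝔴 t j p)).1 * conj (𝔴 t i p).1 + (deriv (χ (!j.1.2)) p.2 • turn (𝔴 t j p)).2 * conj (𝔴 t i p).2)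
      := fun p => by
      simp only [source, smul_fst, smul_snd, smul_eq_mul]; ring
    simp only [e2]
    rw [integral_const_mul, e1]
    simp only [h.flux t (sub ht)]
    rw [integral_mul_const, integral_complex_ofReal, hχ.int_deriv]
    by_cases hij : i = j
    · subst hij
      cases i.1.2 <;> simp
    · simp [hij, Ne.symm hij]
  have hWD : ∀ t ∈ Icc 0 (r / 2), ∀ j, (𝔱 (𝔳 t j), (omega N t : ℂ) • 𝔱 (𝔳 t
    j) - I • J (toL γ (𝔰 t j))) ∈ diracRel γ := fun t ht j => by
    refine (dW t (sub ht) (!j.1.2) j).congr (ofL_toL (mW _ t (sub' ht) j)).symm ?_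
    rw [sub_eq_add_neg, ← neg_smul]
    filter_upwards [ofL_add (-γ) ((omega N t : ℂ) • 𝔱 (𝔳 t j)) (-I • J (toL γ (𝔰 t j))), ofL_smul (-γ) (omega N t : ℂ) (𝔱 (𝔳 t j)), ofL_smul (-γ) (-I) (J (toL
      γ (𝔰 t j))), hJ (toL γ (𝔰 t j)), ofL_toL (mg t (sub' ht) j), ofL_toL (mW
      (!j.1.2) t (sub' ht) j)]
      with p h1 h2 h3 h4 h5 h6
    change 𝔬 (𝔱 (𝔳 t j)) p = _ at h6
    have e : ∀ z : ℂ², -I • I • z = z := fun z => by rw [smul_smul]; simp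
    rw [h1, h2, h3, h4, h5, h6, source, e, smul_comm, coe_smul]
  obtain ⟨ε₀, hε₀, hε₀r, δ₀, hδ₀, C, hC⟩ := ex_scattering_matrix hJD hfin hrank hQ hEa
    (omega_zero N) hwa hWa hga (half_pos hr) hw hwg hWD (rexp (2 * γ * |R₀|))
  refine ⟨ε₀, hε₀, δ₀, hδ₀, C, fun P hP => ?_⟩
  obtain ⟨M, hMn, hM⟩ := ex_potentialOp hg.le hP
  obtain ⟨S, hS, hSa, hSb⟩ := hC M hMn
  have hle : Icc 0 ε₀ ⊆ Icc 0 (r / 2) := Icc_subset_Icc_right hε₀r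
  refine ⟨S, fun ε hε δ hδ => ?_, hSa, fun ε hε δ hδ j k => ?_⟩
  · have kerIff : ∀ b : StripL2, 𝔬 ((omega N ε : ℂ) • b - (δ : ℂ) • J (M b)) =ᵐ[μₛ] fun p => (omega
      N ε - δ * P p) • 𝔬 b p := fun b => by
      rw [sub_eq_add_neg, ← neg_smul]
      filter_upwards [ofL_add (-γ) ((omega N ε : ℂ) • b) (-(δ : ℂ) • J (M b)),
        ofL_smul (-γ) (omega N ε : ℂ) b, ofL_smul (-γ) (-(δ : ℂ)) (J (M b)), hJ (M b), hM b]
        with p h1 h2 h3 h4 h5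
      rw [h1, h2, h3, h4, h5, sub_smul, mul_smul, neg_smul, sub_eq_add_neg, coe_smul, coe_smul]
    obtain ⟨z, hz1, hz2, hz3⟩ := hS ε hε δ hδ
    have ht := sub (hle hε)
    have ht' := sub' (hle hε)
    have toKer : ∀ b : StripL2, (b, (omega N ε : ℂ) • b - (δ : ℂ) • J (M b)) ∈ diracRel γ → 𝔬 b ∈
      diracKernel γ (omega N ε) δ P := fun b hb =>
      ⟨⟨memL_ofL _ _, _, memL_ofL _ _, hb⟩, HasDirac.congr hb (ae_eq_refl _) (kerIff b)⟩
    have ofKer : ∀ w ∈ diracKernel γ (omega N ε) δ P, (𝔱 w, (omega N ε : ℂ) • 𝔱 w - (δ : ℂ) • J (M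
      (𝔱 w))) ∈ diracRel γ := fun w hw => by
      refine HasDirac.congr hw.2 (ofL_toL hw.1.1).symm ?_
      filter_upwards [kerIff (𝔱 w), ofL_toL hw.1.1] with p h1 h2
      rw [h1, h2]
    have sumIff : ∀ {w}, MemL (-γ) w → ∀ c : Channel N → ℂ, 𝔱 w = ∑ k, c k • z k ↔ w =ᵐ[μₛ] fun p =>
      ∑ k, c k • 𝔬 (z k) p := by
      intro w hw c
      have e : 𝔬 (∑ k, c k • z k) =ᵐ[μₛ] fun p => ∑ k, c k • 𝔬 (z k) p := by
        filter_upwards [ofL_sum (-γ) Finset.univ (fun k => c k • z k),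
          ae_all_iff.2 fun k => ofL_smul (-γ) (c k) (z k)] with p h1 h2
        rw [h1]
        exact Finset.sum_congr rfl fun k _ => h2 k
      constructor
      · intro hc
        exact (ofL_toL hw).symm.trans ((by rw [hc]) : 𝔬 (𝔱 w) =ᵐ[μₛ] 𝔬 (∑ k, c k • z k)) |>.trans e
      · intro hc
        exact (toL_eq_of_ofL (e.trans hc.symm)).symm
    have basis : ∀ w ∈ diracKernel γ (omega N ε) δ P, ∃! c : Channel N → ℂ, w =ᵐ[μₛ] fun p => ∑ k, c
      k • 𝔬 (z k) p := by
      intro w hw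
      simpa only [sumIff hw.1.1] using hz2 _ (ofKer w hw)
    set ψ : ℝ → ℝ := fun y => 1 - χ true y - χ false y with hψ
    have sψ : ContDiff ℝ ∞ ψ := (contDiff_const.sub (hχ.1 true)).sub (hχ.1 false)
    have zψ : ∀ y, R₀ < |y| → ψ y = 0 := by
      intro y hy
      rcases lt_abs.1 hy with h' | h'
      · have := hχ.2.1 y h'; simp [hψ, this]
      · have := hχ.2.2 y (by linarith); simp [hψ, this]
    have zψ' : ∀ y, R₀ < |y| → deriv ψ y = 0 := by
      intro y hy
      have : ψ =ᶠ[𝓝 y] fun _ => 0 := by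
        filter_upwards [(isOpen_lt continuous_const continuous_abs).mem_nhds hy] with z hz using zψ z hz
      rw [this.deriv_eq, deriv_const]
    have middle : ∀ k, MemH γ fun p => ψ p.2 • 𝔴 ε k p := fun k => by
      have hw := h.mem ε ht' k
      obtain ⟨C1, hC1⟩ := bd_of_supp sψ.continuous zψ (γ - -γ)
      obtain ⟨C2, hC2⟩ := bd_of_supp (sψ.continuous_deriv (by simp)) zψ' (γ - -γ)
      exact ⟨hw.cutoff sψ.continuous hC1, _, ((mE ε ht' k).cutoff sψ.continuous hC1).add
        (hw.turn.cutoff (sψ.continuous_deriv (by simp)) hC2),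
        (h.dirac ε ht k).cutoff hw (mE ε ht' k) sψ⟩
    have rem : ∀ k, MemH γ fun p => 𝔬 (z k) p - (𝔲 ε k p + ∑ j, S ε δ k j • 𝔳 ε j p) := fun k => by
      obtain ⟨p, q, hpq, hzk⟩ := hz3 k
      refine (MemH.add ⟨memL_ofL γ p, _, memL_ofL γ q, HasDirac.of_adjointRel hpq⟩
        (middle k)).congr ?_
      rw [hzk]
      filter_upwards [ofL_add (-γ) (𝔱 (𝔴 ε k) + J p)
          (∑ j, ((S ε δ - 1) k j) • 𝔱 (𝔳 ε j)),
        ofL_add (-γ) (𝔱 (𝔴 ε k)) (J p), hJ p, ofL_toL (h.mem ε ht' k),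
        ofL_sum (-γ) Finset.univ (fun j => ((S ε δ - 1) k j) • 𝔱 (𝔳 ε j)),
        ae_all_iff.2 fun j => ofL_smul (-γ) ((S ε δ - 1) k j) (𝔱 (𝔳 ε j)),
        ae_all_iff.2 fun j => ofL_toL (mW (!j.1.2) ε ht' j)] with x h1 h2 h3 h4 h5 h6 h7
      change ∀ j, 𝔬 (𝔱 (𝔳 ε j)) x = 𝔳 ε j x at h7
      rw [h1, h2, h3, h4, h5]
      have e7 : ∑ j, 𝔬 (((S ε δ - 1) k j) • 𝔱 (𝔳 ε j)) x = ∑ j, S ε δ k j • 𝔳 ε j x - 𝔳 ε k x := by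
        simp only [h6, h7]
        simp only [Matrix.sub_apply, sub_smul, Finset.sum_sub_distrib, Matrix.one_apply,
          ite_smul, one_smul, zero_smul, Finset.sum_ite_eq, Finset.mem_univ, if_true]
      rw [e7]
      have e : ψ x.2 • 𝔴 ε k x = 𝔴 ε k x - 𝔲 ε k x - 𝔳 ε k x := by
        simp only [hψ, inWave, outWave]
        rcases k.1.2 <;> simp <;> module
      rw [e]
      abel
    refine ⟨⟨fun k => 𝔬 (z k), fun k => toKer _ (hz1 k), basis, rem⟩, fun S' hS' => ?_⟩
    obtain ⟨z', k1, -, k3⟩ := hS'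
    ext k j
    obtain ⟨c, hc, -⟩ := basis (z' k) (k1 k)
    have key := h.in_out_indep hχ ht
      (by
        have m1 := ((k3 k).1.const_smul (-1)).add
          (MemL.sum Finset.univ fun l _ => (rem l).1.const_smul (c l))
        refine m1.congr ?_
        filter_upwards [hc] with p hp
        rw [hp]
        exact sum_rearrange (fun l => 𝔲 ε l p) (fun l => 𝔳 ε l p)
          (fun l => 𝔬 (z l) p) c (S' k) (S ε δ) k)
    have hcl : ∀ l, c l = if l = k then 1 else 0 := fun l => (sub_eq_zero.1 (key l).1).symm
    have := sub_eq_zero.1 (key j).2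
    simpa [hcl] using this
  · have e : pairing P (𝔴 ε j) (𝔴 ε k) = ⟪𝔱 (𝔴 ε k), M (𝔱 (𝔴 ε j))⟫_ℂ :=
      by
      rw [inner_eq_int (-γ), neg_neg, pairing]
      refine integral_congr_ae ?_
      filter_upwards [ofL_toL (h.mem ε (sub' (hle hε)) k), ofL_toL (h.mem ε (sub' (hle hε)) j),
        hM (𝔱 (𝔴 ε j))] with p h1 h2 h3
      rw [h1, h3, h2]
      simp; ring
    rw [e]
    exact hSb ε hε δ hδ j k

end Assembly

/-! ### Classical solutions -/

lemma int_mul_dX {u ux : ℝ² → ℂ} (hu : Continuous u) (hux : Continuous ux) (hd : ∀ x y, HasDerivAt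
  (fun x => u (x, y)) (ux (x, y)) x) (hφ : IsTest φ) (h0 : ∀ y, u (0, y) * φ (0, y) = 0) (h1 : ∀ y,
  u (1, y) * φ (1, y) = 0) : ∫ p, u p * dX φ p ∂μₛ = -∫ p, ux p * φ p ∂μₛ := by
  have cφ := hφ.continuous
  have cφ' := hφ.dX.continuous
  have i1 : Integrable (fun p => u p * dX φ p) μₛ :=
    (hu.mul cφ').integrable_of_hasCompactSupport hφ.dX.2.mul_left
  have i2 : Integrable (fun p => ux p * φ p) μₛ :=
    (hux.mul cφ).integrable_of_hasCompactSupport hφ.2.mul_left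
  rw [stripMeasure_eq] at i1 i2 ⊢
  rw [integral_prod_symm _ i1, integral_prod_symm _ i2, ← integral_neg]
  congr 1
  funext y
  rw [← integral_Ioc_eq_integral_Ioo, ← integral_Ioc_eq_integral_Ioo,
    ← integral_of_le zero_le_one, ← integral_of_le zero_le_one]
  have dφ : ∀ x, HasDerivAt (fun x => φ (x, y)) (dX φ (x, y)) x := fun x => by
    have e1 := (hasDerivAt_id x).prodMk (hasDerivAt_const x y)
    exact (hφ.differentiable (x, y)).hasFDerivAt.comp_hasDerivAt x e1
  have key := intervalIntegral.integral_mul_deriv_eq_deriv_mul (a := 0) (b := 1)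
    (fun x _ => hd x y) (fun x _ => dφ x)
    cont_int
    cont_int
  rw [h0, h1] at key
  simpa using key

lemma int_mul_dY {u uy : ℝ² → ℂ} (hu : Continuous u) (huy : Continuous uy) (hd : ∀ x y, HasDerivAt
  (fun y => u (x, y)) (uy (x, y)) y) (hφ : IsTest φ) : ∫ p, u p * dY φ p ∂μₛ = -∫ p, uy p * φ p ∂μₛ
  := by
  have cφ := hφ.continuous
  have cφ' := hφ.dY.continuous
  have i1 : Integrable (fun p => u p * dY φ p) μₛ :=
    (hu.mul cφ').integrable_of_hasCompactSupport hφ.dY.2.mul_left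
  have i2 : Integrable (fun p => uy p * φ p) μₛ :=
    (huy.mul cφ).integrable_of_hasCompactSupport hφ.2.mul_left
  rw [stripMeasure_eq] at i1 i2 ⊢
  rw [integral_prod _ i1, integral_prod _ i2, ← integral_neg]
  congr 1
  funext x
  have dφ : ∀ y, HasDerivAt (fun y => φ (x, y)) (dY φ (x, y)) y := fun y => by
    have e1 := (hasDerivAt_const y x).prodMk (hasDerivAt_id y)
    exact (hφ.differentiable (x, y)).hasFDerivAt.comp_hasDerivAt y e1
  have s1 := hcs_slice hφ x
  have s2 := hcs_slice hφ.dY x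
  exact integral_mul_deriv_eq_deriv_mul_of_integrable (fun y _ => hd x y) (fun y _ => dφ y)
    (Continuous.integrable_of_hasCompactSupport (by fun_prop) s2.mul_left)
    (Continuous.integrable_of_hasCompactSupport (by fun_prop) s1.mul_left)
    (Continuous.integrable_of_hasCompactSupport (by fun_prop) s1.mul_left)

/-- A continuously differentiable field that satisfies the boundary conditions. -/
lemma hasDirac_of_derivAt {wx wy : 𝓦} (cw : Continuous w) (cx : Continuous wx) (cy : Continuous
  wy) (hx : ∀ x y, HasDerivAt (fun x => w (x, y)) (wx (x, y)) x) (hy : ∀ x y, HasDerivAt (fun y => w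
  (x, y)) (wy (x, y)) y) (h0 : ∀ y, (w (0, y)).1 = 0) (h1 : ∀ y, (w (1, y)).2 = 0) : HasDirac w fun
  p => (-I * (wx p).2 + (wy p).2, -I * (wx p).1 - (wy p).1) := by
  refine ⟨fun φ hφ hs => ?_, fun φ hφ hs => ?_⟩
  · have z : ∀ y, φ (1, y) = 0 := fun y => image_eq_zero_of_notMem_tsupport fun h =>
      lt_irrefl (1 : ℝ) (hs h)
    have e1 := int_mul_dX cw.fst cx.fst (fun x y => (hx x y).fst) hφ
      (fun y => by rw [h0, zero_mul]) (fun y => by rw [z, mul_zero])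
    have e2 := int_mul_dY cw.fst cy.fst (fun x y => (hy x y).fst) hφ
    simpa using int_dirac 1 cw.fst cx.fst cy.fst hφ (neg_eq_iff_eq_neg.1 e1.symm)
      (neg_eq_iff_eq_neg.1 e2.symm)
  · have z : ∀ y, φ (0, y) = 0 := fun y => image_eq_zero_of_notMem_tsupport fun h =>
      lt_irrefl (0 : ℝ) (hs h)
    have e1 := int_mul_dX cw.snd cx.snd (fun x y => (hx x y).snd) hφ
      (fun y => by rw [z, mul_zero]) (fun y => by rw [h1, zero_mul])
    have e2 := int_mul_dY cw.snd cy.snd (fun x y => (hy x y).snd) hφ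
    simpa [← sub_eq_add_neg] using int_dirac (-1) cw.snd cx.snd cy.snd hφ
      (neg_eq_iff_eq_neg.1 e1.symm) (neg_eq_iff_eq_neg.1 e2.symm)

/-- `𝒟` applied to `planeWave`. -/
def planeImage (s : ℝ) (κ l : ℂ) (p : ℝ²) : ℂ² := exp (-I * l * p.2) •
    (s * (κ * cos (κ * (p.1 - 1)) + l * sin (κ * (p.1 - 1))),
      -I * κ * cos (κ * p.1) + I * l * sin (κ * p.1))

lemma derivAt_mul_ofReal (c : ℂ) (x : ℝ) : HasDerivAt (fun x : ℝ => c * (x : ℂ)) c x := by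
  simpa using (ofRealCLM.hasDerivAt).const_mul c

lemma hasDirac_plane (s : ℝ) (κ l : ℂ) : HasDirac (planeWave s κ l) (planeImage s κ l) := by
  have dx1 : ∀ x : ℝ, HasDerivAt (fun x : ℝ => sin (κ * x)) (κ * cos (κ * x)) x :=
    fun x => by
      have := (hasDerivAt_sin (κ * x)).comp x (derivAt_mul_ofReal κ x)
      exact this.congr_deriv (by ring)
  have dx2 : ∀ x : ℝ, HasDerivAt (fun x : ℝ => sin (κ * (x - 1))) (κ * cos (κ * (x - 1))) x := fun x
    => by
    have h1 : HasDerivAt (fun x : ℝ => κ * ((x : ℂ) - 1)) κ x :=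
      ((derivAt_mul_ofReal κ x).sub_const κ).congr_of_eventuallyEq
        (.of_forall fun x => by simp only; ring)
    have := (hasDerivAt_sin (κ * (x - 1))).comp x h1
    exact this.congr_deriv (by ring)
  have dy : ∀ y : ℝ, HasDerivAt (fun y : ℝ => exp (-I * l * y)) (-I * l * exp (-I * l * y)) y := fun
    y =>
    (derivAt_mul_ofReal (-I * l) y).cexp.congr_deriv (by ring)
  have key := hasDirac_of_derivAt (w := planeWave s κ l)
    (wx := fun p => exp (-I * l * p.2) • (κ * cos (κ * p.1), s * I * (κ * cos (κ * (p.1 - 1)))))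
    (wy := fun p => (-I * l * exp (-I * l * p.2)) • (sin (κ * p.1), s * I * sin (κ * (p.1 - 1))))
    (by unfold planeWave; fun_prop) (by fun_prop) (by fun_prop)
    (fun x y => ((dx1 x).prodMk ((dx2 x).const_mul (s * I))).const_smul (exp (-I * l * y)))
    (fun x y => (dy y).smul_const (sin (κ * x), s * I * sin (κ * (x - 1))))
    (fun y => by simp [planeWave]) (fun y => by simp [planeWave])
  convert key using 2 with p
  refine Prod.ext ?_ ?_
  · simp only [planeImage, smul_fst, smul_snd, smul_eq_mul]
    linear_combination (s * exp (-I * l * p.2) *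
      (κ * cos (κ * (p.1 - 1)) + l * sin (κ * (p.1 - 1)))) * I_sq
  · simp only [planeImage, smul_fst, smul_snd, smul_eq_mul]
    ring

/-! ### Superpositions -/

lemma int_intvl_swap {F : ℝ → ℝ² → ℂ} (hF : Continuous fun q : ℝ × ℝ² => F q.1 q.2) {K : Set ℝ²}
  (hK : IsCompact K) (h0 : ∀ θ, ∀ p ∉ K, F θ p = 0) {b : ℝ} (hb : 0 ≤ b) : ∫ p, (∫ θ in (0 : ℝ)..b,
  F θ p) ∂μₛ = ∫ θ in (0 : ℝ)..b, ∫ p, F θ p ∂μₛ := by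
  simp only [integral_of_le hb]
  have i : Integrable (fun q : ℝ × ℝ² => F q.1 q.2) ((volume.restrict (Ioc 0 b)).prod μₛ) := by
    obtain ⟨C, hC⟩ := ((isCompact_Icc (a := 0) (b := b)).prod hK).exists_bound_of_continuousOn
      hF.continuousOn
    have i1 : Integrable (K.indicator fun _ => C) μₛ :=
      (integrable_indicator_iff hK.measurableSet).2 (integrableOn_const hK.measure_lt_top.ne)
    have i2 := Integrable.mul_prod (integrable_const (μ := volume.restrict (Ioc 0 b)) 1) i1
    refine i2.mono' hF.aestronglyMeasurable ?_
    filter_upwards [Measure.quasiMeasurePreserving_fst.ae (ae_restrict_mem measurableSet_Ioc)]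
      with q hq
    by_cases hqK : q.2 ∈ K
    · rw [one_mul, indicator_of_mem hqK]
      exact hC q ⟨Ioc_subset_Icc_self hq, hqK⟩
    · rw [h0 _ _ hqK, indicator_of_notMem hqK]; simp
  exact (integral_integral_swap i).symm

lemma intvl_fst {f : ℝ → ℂ²} (hf : Continuous f) (a b : ℝ) : (∫ θ in a..b, f θ).1 = ∫ θ in a..b,
  (f θ).1 :=
  ((ContinuousLinearMap.fst ℂ ℂ ℂ).intervalIntegral_comp_comm (hf.intervalIntegrable a b)).symm

lemma intvl_snd {f : ℝ → ℂ²} (hf : Continuous f) (a b : ℝ) : (∫ θ in a..b, f θ).2 = ∫ θ in a..b,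
  (f θ).2 :=
  ((ContinuousLinearMap.snd ℂ ℂ ℂ).intervalIntegral_comp_comm (hf.intervalIntegrable a b)).symm

lemma HasDirac.intervalIntegral {f g : ℝ → 𝓦} (hf : Continuous fun q : ℝ × ℝ² => f q.1 q.2) (hg :
  Continuous fun q : ℝ × ℝ² => g q.1 q.2) (h : ∀ θ, HasDirac (f θ) (g θ)) {b : ℝ} (hb : 0 ≤ b) :
  HasDirac (fun p => ∫ θ in (0 : ℝ)..b, f θ p) (fun p => ∫ θ in (0 : ℝ)..b, g θ p) := by
  have cf : ∀ p, Continuous fun θ => f θ p := fun p => hf.comp (Continuous.prodMk_left p)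
  have cg : ∀ p, Continuous fun θ => g θ p := fun p => hg.comp (Continuous.prodMk_left p)
  refine ⟨fun φ hφ hs => ?_, fun φ hφ hs => ?_⟩
  · have c1 := hφ.continuous
    have c2 := hφ.dirac_add.continuous
    simp only [intvl_fst (cf _), intvl_snd (cg _), ← iint_mul_const]
    rw [int_intvl_swap
        (hg.snd.mul (c1.comp continuous_snd)) hφ.2.isCompact
        (fun θ p hp => by rw [image_eq_zero_of_notMem_tsupport hp, mul_zero]) hb,
      int_intvl_swap
       
        (hf.fst.mul (c2.comp continuous_snd)) hφ.dirac_add.2.isCompact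
        (fun θ p hp => by
          rw [show _ = (0 : ℂ) from image_eq_zero_of_notMem_tsupport hp, mul_zero]) hb]
    congr 1
    funext θ
    exact (h θ).1 φ hφ hs
  · have c1 := hφ.continuous
    have c2 := hφ.dirac_sub.continuous
    simp only [intvl_fst (cg _), intvl_snd (cf _), ← iint_mul_const]
    rw [int_intvl_swap
        (hg.fst.mul (c1.comp continuous_snd)) hφ.2.isCompact
        (fun θ p hp => by rw [image_eq_zero_of_notMem_tsupport hp, mul_zero]) hb,
      int_intvl_swap
       
        (hf.snd.mul (c2.comp continuous_snd)) hφ.dirac_sub.2.isCompact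
        (fun θ p hp => by
          rw [show _ = (0 : ℂ) from image_eq_zero_of_notMem_tsupport hp, mul_zero]) hb]
    congr 1
    funext θ
    exact (h θ).2 φ hφ hs

lemma HasDirac.circleIntegral {f g : ℂ → 𝓦} {c : ℂ} (hr : 0 ≤ r) (hf : ContinuousOn (fun q : ℂ ×
  ℝ² => f q.1 q.2) (sphere c r ×ˢ univ)) (hg : ContinuousOn (fun q : ℂ × ℝ² => g q.1 q.2) (sphere c
  r ×ˢ univ)) (h : ∀ l ∈ sphere c r, HasDirac (f l) (g l)) : HasDirac (fun p => ∮ l in C(c, r), f l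
  p) (fun p => ∮ l in C(c, r), g l p) := by
  have cont : ∀ {f : ℂ → 𝓦}, ContinuousOn (fun q => f q.1 q.2) (sphere c r ×ˢ univ) → Continuous fun
    q : ℝ × ℝ² => deriv (circleMap c r) q.1 • f (circleMap c r q.1) q.2 := by
    intro f hf
    have h1 := hf.comp_continuous (f := fun q : ℝ × ℝ² => (circleMap c r q.1, q.2)) (by fun_prop)
        fun q => ⟨circleMap_mem_sphere c hr _, mem_univ _⟩
    simp only [deriv_circleMap]
    exact (((continuous_circleMap 0 r).comp continuous_fst).mul continuous_const).smul h1
  exact HasDirac.intervalIntegral (cont hf) (cont hg)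
    (fun θ => (h _ (circleMap_mem_sphere c hr θ)).const_smul _) two_pi_pos.le

/-! ### Fluxes -/

lemma sub_mul_int_sin (κ ν : ℂ) : (κ ^ 2 - ν ^ 2) * ∫ x in 0..1, sin (κ * x) * sin (ν * (x - 1)) =
  ν * sin κ - κ * sin ν := by
  rw [← iint_const_mul]
  have d1 := derivAt_mul_ofReal κ
  have d2 : ∀ x, HasDerivAt (fun x : ℝ => ν * ((x : ℂ) - 1)) ν x := fun x =>
    ((derivAt_mul_ofReal ν x).sub_const ν).congr_of_eventuallyEq
      (.of_forall fun x => by simp only; ring)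
  have d : ∀ x : ℝ, HasDerivAt (fun x : ℝ => ν * (sin (κ * x) * cos (ν * (x - 1))) - κ * (cos (κ *
    x) * sin (ν * (x - 1)))) ((κ ^ 2 - ν ^ 2) * (sin (κ * x) * sin (ν * (x - 1)))) x := fun x => by
    have e1 := (((hasDerivAt_sin _).comp x (d1 x)).mul
      ((hasDerivAt_cos _).comp x (d2 x))).const_mul ν
    have e2 := (((hasDerivAt_cos _).comp x (d1 x)).mul
      ((hasDerivAt_sin _).comp x (d2 x))).const_mul κ
    exact (e1.sub e2).congr_deriv (by simp; ring)
  rw [integral_eq_sub_of_hasDerivAt (fun x _ => d x) cont_int]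
  simp

lemma int_sin_self {κ : ℂ} (hκ : κ ≠ 0) : ∫ x in 0..1, sin (κ * x) * sin (κ * (x - 1)) = (cos κ -
  sin κ / κ) / 2 := by
  have d1 : ∀ x, HasDerivAt (fun x : ℝ => κ * (2 * (x : ℂ) - 1)) (2 * κ) x := fun x =>
    ((derivAt_mul_ofReal (2 * κ) x).sub_const κ).congr_of_eventuallyEq
      (.of_forall fun x => by simp only; ring)
  have d : ∀ x : ℝ, HasDerivAt (fun x : ℝ => cos κ / 2 * (x : ℂ) - (4 * κ)⁻¹ * sin (κ * (2 * x -
    1))) (sin (κ * x) * sin (κ * (x - 1))) x := fun x => by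
    refine ((derivAt_mul_ofReal _ x).sub (((hasDerivAt_sin _).comp x
      (d1 x)).const_mul (4 * κ)⁻¹)).congr_deriv ?_
    have e1 : cos (κ * (2 * x - 1)) = cos (κ * x + κ * (x - 1)) := by ring_nf
    have e2 : cos κ = cos (κ * x - κ * (x - 1)) := by ring_nf
    rw [e1, e2, cos_add, cos_sub]
    field_simp
    ring
  rw [integral_eq_sub_of_hasDerivAt (fun x _ => d x) cont_int]
  simp
  ring

lemma qForm_planeWave (s s' : ℝ) (κ κ' l l' : ℂ) (b : ℝ) : qForm b (planeWave s κ l) (planeWave s'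
  κ' l') = I * (s + s') * exp (-I * (l - conj l') * b) * ∫ x in 0..1, sin (κ * x) * sin (conj κ' *
  (x - 1)) := by
  have e0 : exp (-I * (l - conj l') * b) = exp (-I * l * b) * conj (exp (-I * l' * b)) := by
    rw [← exp_conj, ← exp_add]
    simp only [map_mul, map_neg, conj_I, conj_ofReal]
    ring_nf
  have e1 : ∫ x in 0..1, sin (κ * (x - 1)) * sin (conj κ' * x) = ∫ x in 0..1, sin (κ * x) * sin
    (conj κ' * (x - 1)) := by
    have := intervalIntegral.integral_comp_sub_left (a := 0) (b := 1)
      (fun x : ℝ => sin (κ * x) * sin (conj κ' * (x - 1))) 1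
    simp only [sub_self, sub_zero] at this
    rw [← this]
    congr 1
    funext x
    have a1 : κ * ((x : ℂ) - 1) = -(κ * ((1 - x : ℝ) : ℂ)) := by push_cast; ring
    have a2 : conj κ' * (((1 - x : ℝ) : ℂ) - 1) = -(conj κ' * x) := by push_cast; ring
    rw [a1, a2, sin_neg, sin_neg]
    ring
  have e2 : ∀ x, (planeWave s κ l (x, b)).1 * conj (planeWave s' κ' l' (x, b)).2 - (planeWave s κ l
    (x, b)).2 * conj (planeWave s' κ' l' (x, b)).1 = -I * s' * exp (-I * (l - conj l') * b) * (sin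
    (κ * x) * sin (conj κ' * (x - 1))) + -I * s * exp (-I * (l - conj l') * b) * (sin (κ * (x - 1))
    * sin (conj κ' * x)) := fun x => by
    simp only [planeWave, smul_fst, smul_snd, smul_eq_mul, map_mul, conj_I,
      conj_ofReal, e0, ← sin_conj, map_sub, map_one]
    ring
  rw [qForm]
  simp only [e2]
  rw [iint_add cont_int cont_int, iint_const_mul, iint_const_mul, e1]
  ring

lemma qForm_conj (b : ℝ) (w w' : 𝓦) : conj (qForm b w w') = -qForm b w' w := by
  rw [qForm, qForm, map_neg, neg_neg, integral_of_le zero_le_one,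
    integral_of_le zero_le_one, ← integral_conj, ← integral_neg]
  congr 1
  funext x
  simp
  ring

/-! ### Analytic families of fields -/

lemma intble_exp_mul_abs_of_neg {c : ℝ} (hc : c < 0) : Integrable fun y : ℝ => rexp (c * |y|) := by
  rw [← integrableOn_univ, ← Iic_union_Ioi]
  refine IntegrableOn.union ?_ ?_
  · refine (integrableOn_exp_mul_Iic (neg_pos.2 hc) 0).congr_fun (fun y hy => ?_) measurableSet_Iic
    simp only [abs_of_nonpos (mem_Iic.1 hy)]
    ring_nf
  · refine (integrableOn_exp_mul_Ioi hc 0).congr_fun (fun y hy => ?_) measurableSet_Ioi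
    simp only [abs_of_pos (mem_Ioi.1 hy)]

lemma memLp_exp_mul_abs {c : ℝ} (hc : c < 0) (B : ℝ) : MemLp (fun p : ℝ² => B * rexp (c *
  |p.2|)) 2 μₛ := by
  rw [memLp_two_iff_integrable_sq (by fun_prop : Continuous _).aestronglyMeasurable]
  have h := Integrable.mul_prod (integrable_const (μ := volume.restrict 𝕁) (B ^ 2))
    (intble_exp_mul_abs_of_neg (by linarith : 2 * c < 0))
  rw [← stripMeasure_eq] at h
  refine h.congr (.of_forall fun p => ?_)
  simp only [mul_pow, ← Real.exp_nat_mul]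
  push_cast
  ring_nf

/-- A family of fields in `𝓛_{-γ}` that is analytic at the parameter `0`. -/
structure IsFamily (γ : ℝ) (F : ℝ → 𝓦) : Prop where
  cont : ∀ᶠ t in 𝓝 0, Continuous (F t)
  mem : ∀ᶠ t in 𝓝 0, MemL (-γ) (F t)
  analytic : AnalyticAt ℝ (fun t => toL (-γ) (F t)) 0

lemma IsFamily.congr {F F' : ℝ → 𝓦} (h : IsFamily γ F)
    (he : ∀ᶠ t in 𝓝 0, F t = F' t) : IsFamily γ F' where
  cont := by filter_upwards [h.cont, he] with t h1 h2; rwa [← h2]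
  mem := by filter_upwards [h.mem, he] with t h1 h2; rwa [← h2]
  analytic := h.analytic.congr (he.mono fun t ht => by simp only [ht])

lemma IsFamily.add {F F' : ℝ → 𝓦} (h : IsFamily γ F) (h' : IsFamily γ F') :
    IsFamily γ fun t p => F t p + F' t p where
  cont := by filter_upwards [h.cont, h'.cont] with t h1 h2 using h1.add h2
  mem := by filter_upwards [h.mem, h'.mem] with t h1 h2 using h1.add h2
  analytic := (h.analytic.add h'.analytic).congr <| by
    filter_upwards [h.mem, h'.mem] with t h1 h2 using (toL_add h1 h2).symm

lemma IsFamily.smul {F : ℝ → 𝓦} (h : IsFamily γ F) {c : ℝ → ℝ}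
    (hc : AnalyticAt ℝ c 0) : IsFamily γ fun t p => c t • F t p where
  cont := h.cont.mono fun t h1 => h1.const_smul (c t)
  mem := h.mem.mono fun t h1 => by simpa using h1.const_smul (c t)
  analytic := by
    have h2 := (ofRealCLM.analyticAt _).comp hc
    exact (h2.smul h.analytic).congr <| h.mem.mono fun t h1 => by
      simpa using (toL_const_smul h1 (c t : ℂ)).symm

lemma fam_of_diffOn {B : ℝ} (hr : r < γ) {f : ℂ → 𝓦} {U : Set ℂ} (hU : IsOpen U) (h0 : 0 ∈ U) (hc
  : ∀ z ∈ U, Continuous (f z)) (hd : ∀ p, DifferentiableOn ℂ (fun z => f z p) U) (hb : ∀ z ∈ U, ∀ p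
  ∈ strip, ‖f z p‖ ≤ B * rexp (r * |p.2|)) : IsFamily γ fun t : ℝ => f t := by
  have ev : ∀ᶠ t : ℝ in 𝓝 0, (t : ℂ) ∈ U :=
    continuous_ofReal.continuousAt.eventually (hU.mem_nhds (by simpa using h0))
  have bd : ∀ z ∈ U, ∀ p ∈ strip, ‖weight (-γ) p • f z p‖ ≤ B * rexp ((r - γ) * |p.2|) :=
    fun z hz p hp => by
    rw [norm_smul, norm_of_nonneg (wt_pos _ _).le]
    refine (mul_le_mul_of_nonneg_left (hb z hz p hp) (wt_pos _ _).le).trans (le_of_eq ?_)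
    rw [weight, mul_left_comm, ← Real.exp_add]
    ring_nf
  have L := memLp_exp_mul_abs (sub_neg.2 hr) B
  have mem : ∀ z ∈ U, MemL (-γ) (f z) := fun z hz =>
    L.mono' ((cont_wt _).smul (hc z hz)).aestronglyMeasurable
      ((ae_restrict_mem measSet_strip).mono (bd z hz))
  refine ⟨ev.mono fun t ht => hc _ ht, ev.mono fun t ht => mem _ ht, ?_⟩
  have key : DifferentiableOn ℂ (fun z => toL (-γ) (f z)) U := by
    have L' := L.const_mul 2
    refine diffOn_toLp hU L' (.of_forall fun p => ?_) ?_ fun z hz => coeFn_toL (mem z hz)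
    · exact (WithLp.prodContinuousLinearEquiv 2 ℂ ℂ ℂ).symm.differentiable.comp_differentiableOn
        ((hd p).const_smul (weight (-γ) p))
    · filter_upwards [ae_restrict_mem measSet_strip] with p hp z hz
      have h1 := bd z hz p hp
      refine le_trans ?_ (mul_le_mul_of_nonneg_left h1 zero_le_two)
      set v := weight (-γ) p • f z p
      rw [WithLp.prod_norm_eq_of_L2]
      refine sqrt_le_iff.2 ⟨by positivity, ?_⟩
      have n1 := norm_fst_le v
      have n2 := norm_snd_le v
      change ‖v.1‖ ^ 2 + ‖v.2‖ ^ 2 ≤ _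
      nlinarith [norm_nonneg v.1, norm_nonneg v.2, norm_nonneg v]
  have h2 := (key.analyticAt (hU.mem_nhds h0)).restrictScalars (𝕜 := ℝ)
  have h3 := ofRealCLM.analyticAt 0
  exact AnalyticAt.comp_of_eq h2 h3 (by simp)

lemma norm_sin_le_exp (z : ℂ) : ‖sin z‖ ≤ rexp ‖z‖ := by
  rw [sin]
  have e1 := norm_exp_le_exp_norm (-z * I)
  have e2 := norm_exp_le_exp_norm (z * I)
  simp only [norm_mul, norm_neg, norm_I, mul_one] at e1 e2
  rw [norm_div, norm_mul, norm_I, mul_one, Complex.norm_two]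
  linarith [norm_sub_le (exp (-z * I)) (exp (z * I))]

lemma cont_plane (s : ℝ) (κ l : ℂ) : Continuous (planeWave s κ l) := by unfold planeWave; fun_prop

lemma norm_plane_le (hs : |s| = 1) (κ l : ℂ) {p : ℝ²} (hp : p ∈ strip) : ‖planeWave s κ l p‖ ≤
  rexp ‖κ‖ * rexp (|l.im| * |p.2|) := by
  have hx := hp.1
  have b1 : ∀ x : ℝ, |x| ≤ 1 → ‖sin (κ * x)‖ ≤ rexp ‖κ‖ := fun x h =>
    (norm_sin_le_exp _).trans (exp_le_exp.2 (by
      rw [norm_mul, norm_real, norm_eq_abs]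
      exact mul_le_of_le_one_right (norm_nonneg _) h))
  have b2 := b1 (p.1 - 1) (abs_le.2 ⟨by linarith [hx.1], by linarith [hx.2]⟩)
  push_cast at b2
  rw [planeWave, norm_smul, norm_exp, mul_comm]
  refine mul_le_mul ?_ (exp_le_exp.2 ?_) (exp_pos _).le (exp_pos _).le
  · refine max_le (b1 _ (abs_le.2 ⟨by linarith [hx.1], by linarith [hx.2]⟩)) ?_
    simpa [hs] using b2
  · rw [← abs_mul]
    refine le_trans (le_of_eq ?_) (le_abs_self _)
    simp

/-! ### The defect of a plane wave -/

/-- The quotient of `(𝒟 - E) planeWave` by the gap, if the Disp function is `D` times the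
gap. -/
def planeRest (s : ℝ) (E κ l D : ℂ) (p : ℝ²) : ℂ² := exp (-I * l * p.2) •
    (s * (cos (κ * p.1) * (κ * D) + sin (κ * p.1) * (E ^ 2 + l * D)),
      I * (cos (κ * p.1) * (κ * s * E) - sin (κ * p.1) * (s * E * D + l * s * E)))

lemma planeImage_eq (hs : s * s = 1) {E κ D G : ℂ} (hE : E ≠ 0) (h1 : κ ^ 2 + l ^ 2 = E ^ 2) (h2 :
  csinc κ = G + s / E) (h3 : cos κ - l * csinc κ = D * G) (p : ℝ²) : planeImage s κ l p = E •
  planeWave s κ l p + G • planeRest s E κ l D p := by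
  have hs' : (s : ℂ) * s = 1 := by exact_mod_cast hs
  have e1 : sin κ = κ * (G + s / E) := by rw [← h2, mul_csinc]
  have e2 : cos κ = D * G + l * (G + s / E) := by rw [← h2, ← h3]; ring
  have e3 : E * (s / E : ℂ) = s := by field_simp
  simp only [planeImage, planeWave, planeRest, mul_sub, mul_one, sin_sub, cos_sub, e1, e2]
  generalize (s / E : ℂ) = σ at *
  refine Prod.ext ?_ ?_
  · simp only [smul_fst, fst_add, smul_eq_mul]
    have : κ ^ 2 = E ^ 2 - l ^ 2 := by linear_combination h1
    linear_combination (exp (-I * l * p.2)) * (s * (G + σ)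
      * sin (κ * p.1) * this + s * E * sin (κ * p.1) * e3
      + E * sin (κ * p.1) * hs')
  · simp only [smul_snd, snd_add, smul_eq_mul]
    linear_combination (exp (-I * l * p.2)) * I * (s * (κ * cos (κ * p.1) - l * sin (κ * p.1)) * e3
      + (κ * cos (κ * p.1) - l * sin (κ * p.1)) * hs')

/-! ### The oscillatory waves -/

lemma lim_omega (hN : 1 ≤ N) : Tendsto (omega N) (𝓝 0) (𝓝 (ωₜ N)) := by
  have h : ContinuousAt (omega N) 0 :=
    ContinuousAt.inv₀ (by fun_prop) (by simpa using (omegaThr_pos hN).ne')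
  simpa [ContinuousAt, omega_zero] using h

lemma anAt_omega (hN : 1 ≤ N) : AnalyticAt ℝ (omega N) 0 :=
  (analyticAt_const.add analyticAt_id).inv (by simpa using (omegaThr_pos hN).ne')

lemma csinc_conj (z : ℂ) : csinc (conj z) = conj (csinc z) := by
  by_cases h : z = 0 <;> simp [csinc, h, sin_conj]

lemma ex_branchFamily (hj : 1 ≤ j) (hjN : j < N) (hτ : (j, τ) ≠ (1, true)) : ∃ K : ℂ → ℂ,
  AnalyticAt ℂ K 0 ∧ ∀ᶠ t : ℝ in 𝓝 0, K t = kappaBranch (omega N t) j τ := by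
  have ht := omegaThr_smono hj hjN
  have hb := kappaBr_spec hj hτ ht
  set κ := kappaBranch (ωₜ N) j τ
  have h0 : (κ : ℂ) ≠ 0 := by exact_mod_cast (hb.pos hj).ne'
  have hp : (parity j : ℂ) * parity j = 1 := by exact_mod_cast parity_mul_self j
  set f : ℂ → ℂ := fun x => parity j * csinc x - ((ωₜ N)⁻¹ : ℝ) with hf
  set c : ℂ := parity j * ((cos κ - csinc κ) / κ)
  have hc : c ≠ 0 := by
    refine mul_ne_zero (by exact_mod_cast parity_ne_zero j) (div_ne_zero ?_ h0)
    have e : Real.cos κ - sinc κ = sincNum κ / κ := by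
      rw [sinc_of_ne_zero (hb.pos hj).ne', sincNum]
      field_simp [(hb.pos hj).ne']
    rw [csinc_ofReal, ← ofReal_cos, ← ofReal_sub, e, ofReal_ne_zero]
    refine div_ne_zero (fun h => ?_) (hb.pos hj).ne'
    have h3 := hb.2.2
    cases τ
    · simpa [h] using sincNum_neg_right hj (by simpa using h3) hb.1.2.le
    · simpa [h] using sincNum_pos_left hj hb.1.1.le (by simpa using h3)
  have fκ : f κ = 0 := by
    have h2 := hb.2.1
    rw [← sinc_of_ne_zero (hb.pos hj).ne'] at h2
    simp only [hf, csinc_ofReal, h2, ofReal_div, ofReal_inv]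
    rw [← mul_div_assoc, hp, one_div, sub_self]
  have cd : ContDiffAt ℂ ω f κ :=
    ((diff_csinc.analyticAt _).contDiffAt.const_smul (parity j : ℂ)).sub contDiffAt_const
  have hd := (((derivAt_csinc h0).const_mul (parity j : ℂ)).sub_const
    (((ωₜ N)⁻¹ : ℝ) : ℂ)).hasFDerivAt_equiv hc
  have hs := cd.hasStrictFDerivAt' hd (by simp)
  have left := hs.eventually_left_inverse
  have right := hs.eventually_right_inverse
  have an := (cd.to_localInverse hd (by simp)).analyticAt
  have val := hs.localInverse_apply_image
  change AnalyticAt ℂ (hs.localInverse f _ κ) (f κ) at an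
  rw [fκ] at right an val
  set K := hs.localInverse f _ κ
  refine ⟨K, an, ?_⟩
  have tK : Tendsto (fun t : ℝ => K t) (𝓝 0) (𝓝 κ) := by
    have := an.continuousAt.tendsto.comp (continuous_ofReal.tendsto' 0 0 ofReal_zero)
    rwa [val] at this
  have tK' : Tendsto (fun t : ℝ => conj (K t)) (𝓝 0) (𝓝 κ) := by
    simpa [Function.comp_def] using (continuous_conj.tendsto _).comp tK
  have tR : Tendsto (fun t : ℝ => (K t).re) (𝓝 0) (𝓝 κ) := by
    simpa [Function.comp_def] using (continuous_re.tendsto _).comp tK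
  have ev3 : ∀ᶠ x in 𝓝 κ, if τ then x < kappaMax j else kappaMax j < x := by
    have h3 := hb.2.2
    cases τ
    · simpa using eventually_gt_nhds (by simpa using h3)
    · simpa using eventually_lt_nhds (by simpa using h3)
  filter_upwards [(continuous_ofReal.tendsto' 0 0 ofReal_zero).eventually right,
    tK'.eventually left, tR.eventually (isOpen_Ioo.mem_nhds hb.1), tR.eventually ev3,
    (lim_omega (hj.trans hjN.le)).eventually (eventually_gt_nhds ht)] with t h1 h2 h3 h4 h5
  have e1 : f (conj (K t)) = conj (f (K t)) := by simp [hf, csinc_conj]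
  rw [e1, h1, conj_ofReal] at h2
  have e2 := conj_eq_iff_re.1 h2.symm
  have pos := pos_of_mem_Ioo_branch hj h3.1
  have hB : IsBranch (omega N t) j τ (K t).re := by
    refine ⟨h3, ?_, h4⟩
    rw [← e2] at h1
    simp only [hf, csinc_ofReal] at h1
    have h6 : parity j * sinc (K t).re - (ωₜ N)⁻¹ = t := by exact_mod_cast h1
    rw [← sinc_of_ne_zero pos.ne', omega, div_inv_eq_mul,
      show (ωₜ N)⁻¹ + t = parity j * sinc (K t).re by linarith]
    linear_combination (-sinc (K t).re) * parity_mul_self j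
  rw [← e2, hB.unique hj (kappaBr_spec hj hτ h5)]

lemma ex_lambdaFamily (hj : 1 ≤ j) (hjN : j < N) (hτ : (j, τ) ≠ (1, true)) : ∃ K L : ℂ → ℂ,
  AnalyticAt ℂ K 0 ∧ AnalyticAt ℂ L 0 ∧ (∀ᶠ t : ℝ in 𝓝 0, K t = kappaBranch (omega N t) j τ) ∧ ∀ᶠ t
  : ℝ in 𝓝 0, L t = Λ (omega N t) j τ := by
  obtain ⟨K, hK, he⟩ := ex_branchFamily hj hjN hτ
  have hb := kappaBr_spec hj hτ (omegaThr_smono hj hjN)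
  have h0 : K 0 = kappaBranch (ωₜ N) j τ := by simpa [omega_zero] using he.self_of_nhds
  refine ⟨K, fun t => K t * cos (K t) / sin (K t), hK, ?_, he, ?_⟩
  · refine (hK.mul ((differentiable_cos.analyticAt _).comp hK)).div
      ((differentiable_sin.analyticAt _).comp hK) ?_
    rw [h0, ← ofReal_sin]
    exact_mod_cast hb.sin_ne_zero
  · filter_upwards [he] with t ht
    rw [ht, lambdaBranch, Real.cot_eq_cos_div_sin]
    push_cast
    ring

lemma fam_oscWave (hγ : 0 < γ) (hj : 1 ≤ j) (hjN : j < N) (hτ : (j, τ) ≠ (1, true)) : IsFamily γ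
  fun t => oscWave (omega N t) j τ := by
  obtain ⟨K, L, hK, hL, eK, eL⟩ := ex_lambdaFamily hj hjN hτ
  have hb := kappaBr_spec hj hτ (omegaThr_smono hj hjN)
  have h0 : L 0 = Λ (ωₜ N) j τ := by simpa [omega_zero] using eL.self_of_nhds
  have ev : ∀ᶠ t in 𝓝 0, DifferentiableAt ℂ K t ∧ DifferentiableAt ℂ L t ∧ ‖K t‖ < ‖K 0‖ + 1 ∧ |(L
    t).im| < γ / 2 := by
    refine (hK.eventually_analyticAt.mono fun t h => h.differentiableAt).and
      ((hL.eventually_analyticAt.mono fun t h => h.differentiableAt).and ?_)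
    refine (hK.continuousAt.norm.eventually (eventually_lt_nhds (lt_add_one _))).and ?_
    have : ContinuousAt (fun t => |(L t).im|) 0 :=
      (continuous_im.continuousAt.comp hL.continuousAt).abs
    exact this.eventually (eventually_lt_nhds (by simpa [h0] using half_pos hγ))
  obtain ⟨U, hU, oU, mU⟩ := _root_.mem_nhds_iff.1 ev
  have fam : IsFamily γ fun t => planeWave (parity j) (K t) (L t) := by
    refine fam_of_diffOn (half_lt_self hγ) (B := rexp (‖K 0‖ + 1)) oU mU
      (fun z _ => cont_plane _ _ _)
      (fun p z hz => ?_) fun z hz p hp => ?_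
    · have dK := (hU hz).1
      have dL := (hU hz).2.1
      refine DifferentiableAt.differentiableWithinAt ?_
      unfold planeWave
      fun_prop
    · refine (norm_plane_le (abs_parity j) _ _ hp).trans ?_
      have h1 := (hU hz).2.2
      gcongr
      · exact h1.1.le
      · exact h1.2.le
  have aL : AnalyticAt ℝ (fun t : ℝ => (L t).re - 1) 0 :=
    (AnalyticAt.re_ofReal (by simpa using hL)).sub analyticAt_const
  have hN := hj.trans hjN.le
  have nz : (L 0).re - 1 ≠ 0 := by
    rw [h0, ofReal_re, lambdaBranch, sub_ne_zero]
    cases τ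
    · exact (hb.lambda_lt hj).ne
    · exact (hb.lambda_gt hj).ne'
  have sqrtA : ∀ {g : ℝ → ℝ}, AnalyticAt ℝ g 0 → 0 < g 0 → AnalyticAt ℝ (fun t => √(g t)) 0 :=
    fun hg h => ((contDiffAt_sqrt h.ne').analyticAt).comp hg
  have ac : AnalyticAt ℝ (fun t => √(omega N t) / √(√(((L t).re - 1) ^ 2))) 0 := by
    have p1 : 0 < √(((L (0 : ℝ)).re - 1) ^ 2) := by rw [ofReal_zero]; positivity
    refine (sqrtA (anAt_omega hN) ?_).div (sqrtA (sqrtA (aL.pow 2) ?_) p1) (sqrt_pos.2 p1).ne'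
    · rw [omega_zero]; exact omegaThr_pos hN
    · simp; positivity
  refine (fam.smul ac).congr ?_
  filter_upwards [eK, eL] with t h1 h2
  funext p
  rw [oscWave, h1, h2, ofReal_re, sqrt_sq_eq_abs]

lemma hasDirac_oscWave (hj : 1 ≤ j) (hτ : (j, τ) ≠ (1, true)) (hEn : ωₜ j < En) :
  HasDirac (oscWave En j τ) fun p => En • oscWave En j τ p := by
  have hb := kappaBr_spec hj hτ hEn
  have E0 := (omegaThr_pos hj).trans hEn
  have h := (hasDirac_plane (parity j) (kappaBranch En j τ) (Λ En j τ)).const_smul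
    ((√En / √|Λ En j τ - 1| : ℝ) : ℂ)
  have k0 := (hb.pos hj).ne'
  have e : ∀ p, planeImage (parity j) (kappaBranch En j τ) (Λ En j τ) p = (En : ℂ) •
    planeWave (parity j) (kappaBranch En j τ) (Λ En j τ) p := fun p => by
    have c1 : csinc (kappaBranch En j τ) = 0 + (parity j : ℂ) / En := by
      rw [csinc_ofReal, sinc_of_ne_zero k0, hb.2.1]; simp
    have c2 : cos (kappaBranch En j τ) - Λ En j τ * csinc (kappaBranch En j τ) = 0 * 0 :=
      by
      rw [c1, ← ofReal_cos, hb.cos_eq hj, lambdaBranch]; push_cast; ring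
    rw [planeImage_eq (parity_mul_self j) (by exact_mod_cast E0.ne')
      (by exact_mod_cast hb.sq_add_sq E0 hj) c1 c2, zero_smul, add_zero]
  have f1 : ∀ (c : ℝ) (v : ℂ²), (c : ℂ) • v = c • v := fun c v => coe_smul c v
  simp only [e, f1] at h
  refine h.congr (.of_forall fun p => rfl) (.of_forall fun p => ?_)
  exact smul_comm _ _ _

lemma qForm_smul_smul (b c c' : ℝ) (w w' : 𝓦) : qForm b (fun p => c • w p) (fun p => c' • w' p) =
  c * c' * qForm b w w' := by
  rw [qForm, qForm, mul_neg, ← iint_const_mul]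
  congr 2
  funext x
  simp
  ring

lemma qForm_plane_of_ne {s' : ℝ} {κ κ' l' : ℂ} (b : ℝ) (h : s' = -s ∨ κ ^ 2 ≠ conj κ' ^ 2 ∧ csinc
  κ = csinc (conj κ')) : qForm b (planeWave s κ l) (planeWave s' κ' l') = 0 := by
  rw [qForm_planeWave]
  rcases h with h | ⟨h1, h2⟩
  · rw [h]; push_cast; ring
  · have := sub_mul_int_sin κ (conj κ')
    rw [← mul_csinc κ, ← mul_csinc (conj κ'), h2] at this
    rw [(mul_eq_zero.1 (this.trans (by ring))).resolve_left (sub_ne_zero.2 h1), mul_zero]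

lemma qForm_oscWave_self (hj : 1 ≤ j) (hτ : (j, τ) ≠ (1, true)) (hEn : ωₜ j < En) (b : ℝ) : qForm b
  (oscWave En j τ) (oscWave En j τ) = I * ((Λ En j τ - 1) / |Λ En j τ - 1| : ℝ) := by
  have hb := kappaBr_spec hj hτ hEn
  have E0 : 0 < En := (omegaThr_pos hj).trans hEn
  have k0 := (hb.pos hj).ne'
  have expand : qForm b (oscWave En j τ) (oscWave En j τ) = _ := qForm_smul_smul b _ _ _ _
  have c2 : Real.cos (kappaBranch En j τ) = Λ En j τ * (parity j / En) := hb.cos_eq hj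
  rw [expand, qForm_planeWave, conj_ofReal, conj_ofReal,
    int_sin_self (by exact_mod_cast k0), sub_self, mul_zero, zero_mul, exp_zero,
    ← ofReal_cos, ← ofReal_sin, ← ofReal_div, hb.2.1, c2,
    ← ofReal_mul, div_mul_div_comm, mul_self_sqrt E0.le,
    mul_self_sqrt (abs_nonneg _)]
  have e : (Λ En j τ - 1) / |Λ En j τ - 1| = En / |Λ En j τ - 1| *
    (parity j + parity j) * ((Λ En j τ * (parity j / En) - parity j / En) / 2) := by
    have : (parity j + parity j) * ((Λ En j τ * (parity j / En) - parity j / En) / 2) =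
      (parity j * parity j) * (Λ En j τ - 1) / En := by ring
    rw [mul_assoc, this, parity_mul_self]
    field_simp
  rw [e]
  push_cast
  ring

lemma qForm_oscWave {i : ℕ} {σ : Bool} (hi : 1 ≤ i) (hσ : (i, σ) ≠ (1, true)) (hj : 1 ≤ j) (hτ :
  (j, τ) ≠ (1, true)) (hEi : ωₜ i < En) (hEj : ωₜ j < En) (b : ℝ) : qForm b
  (oscWave En i σ) (oscWave En j τ) = if (i, σ) = (j, τ) then (if σ then I else -I) else 0 := by
  have hb := kappaBr_spec hi hσ hEi
  have hb' := kappaBr_spec hj hτ hEj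
  have E0 : 0 < En := (omegaThr_pos hj).trans hEj
  have k0 := (hb.pos hi).ne'
  have k0' := (hb'.pos hj).ne'
  have expand : qForm b (oscWave En i σ) (oscWave En j τ) = _ := qForm_smul_smul b _ _ _ _
  split_ifs with h hs
  · obtain ⟨rfl, rfl⟩ := Prod.mk.inj h
    subst hs
    have h1 := sub_pos.2 (hb.lambda_gt hi)
    rw [qForm_oscWave_self hi hσ hEi, lambdaBranch, abs_of_pos h1, div_self h1.ne']
    simp
  · obtain ⟨rfl, rfl⟩ := Prod.mk.inj h
    obtain rfl : σ = false := by simpa using hs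
    have h1 := sub_neg.2 (hb.lambda_lt hi)
    rw [qForm_oscWave_self hi hσ hEi, lambdaBranch, abs_of_neg h1, div_neg, div_self h1.ne]
    simp
  · rw [expand, qForm_plane_of_ne, mul_zero]
    rcases parity_eq_or j i with hp | hp
    · right
      rw [conj_ofReal, csinc_ofReal, csinc_ofReal, sinc_of_ne_zero k0,
        sinc_of_ne_zero k0', hb.2.1, hb'.2.1, hp]
      refine ⟨fun e => h ?_, rfl⟩
      have e' := (pow_left_inj₀ (hb.pos hi).le (hb'.pos hj).le two_ne_zero).1 (by exact_mod_cast e)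
      rw [← e'] at hb'
      exact Prod.ext (hb.index_unique hi hb').1 (hb.index_unique hi hb').2
    · exact Or.inl hp

/-! ### Contour integrals -/

lemma diffContOnCl_of_diffAt {V : Type*} [NormedAddCommGroup V] [NormedSpace ℂ V] {f : ℂ → V} {c :
  ℂ} (h : ∀ z ∈ closedBall c r, DifferentiableAt ℂ f z) : DiffContOnCl ℂ f (ball c r) :=
  DifferentiableOn.diffContOnCl fun z hz =>
    (h z (closure_ball_subset_closedBall hz)).differentiableWithinAt

lemma diffOn_circ {V : Type*} [NormedAddCommGroup V] [NormedSpace ℂ V] [CompleteSpace V] {f : ℂ →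
  ℂ → V} {U : Set ℂ} (hU : IsOpen U) {c : ℂ} (hr : 0 ≤ r) (hf : ∀ z ∈ U, ∀ l ∈ sphere c r,
  DifferentiableAt ℂ (fun q : ℂ² => f q.1 q.2) (z, l)) : DifferentiableOn ℂ (fun z => ∮ l in C(c,
  r), f z l) U := by
  intro z₀ hz₀
  obtain ⟨ρ, hρ, hb⟩ := nhds_basis_closedBall.mem_iff.1 (hU.mem_nhds hz₀)
  obtain ⟨M, hM⟩ := ((isCompact_closedBall z₀ ρ).prod (isCompact_sphere c r)).exists_bound_of_continuousOn
    fun q hq => (hf q.1 (hb hq.1) q.2 hq.2).continuousAt.continuousWithinAt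
  have key : DifferentiableOn ℂ (fun z => ∮ l in C(c, r), f z l) (ball z₀ ρ) := by
    simp only [circleIntegral, integral_of_le two_pi_pos.le]
    have m := fun θ => circleMap_mem_sphere c hr θ
    refine diffOn_int (f := fun z θ => deriv (circleMap c r) θ • f z (circleMap c r θ))
      (bound := fun _ => r * M) isOpen_ball (fun z hz => ?_)
      (.of_forall fun θ z hz => ?_) (.of_forall fun θ z hz => ?_)
      (integrable_const _)
    · refine Continuous.aestronglyMeasurable ?_
      simp only [deriv_circleMap]
      refine Continuous.smul (by fun_prop) (continuous_iff_continuousAt.2 fun θ => ?_)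
      exact ContinuousAt.comp_of_eq (f := fun θ => (z, circleMap c r θ))
        (g := fun q => f q.1 q.2)
        (hf z (hb (ball_subset_closedBall hz)) _ (m θ)).continuousAt (by fun_prop) rfl
    · refine (DifferentiableAt.const_smul ?_ _).differentiableWithinAt
      exact DifferentiableAt.comp (f := fun z => (z, circleMap c r θ))
        (g := fun q => f q.1 q.2) z (hf z (hb (ball_subset_closedBall hz)) _ (m θ))
        (by fun_prop)
    · rw [norm_smul, deriv_circleMap]
      refine mul_le_mul (le_of_eq ?_) (hM (z, _) ⟨ball_subset_closedBall hz, m θ⟩) (norm_nonneg _) hr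
      simp [abs_of_nonneg hr]
  exact (key.differentiableAt (isOpen_ball.mem_nhds (mem_ball_self hρ))).differentiableWithinAt

lemma cont_circleMap_smul {f : ℂ → 𝓦} {c : ℂ} (hr : 0 ≤ r) (hf : ContinuousOn (fun q : ℂ × ℝ² => f
  q.1 q.2) (sphere c r ×ˢ univ)) : Continuous fun q : ℝ × ℝ² => deriv (circleMap c r) q.1 • f
  (circleMap c r q.1) q.2 := by
  have h1 := hf.comp_continuous (f := fun q : ℝ × ℝ² => (circleMap c r q.1, q.2)) (by fun_prop)
      fun q => ⟨circleMap_mem_sphere c hr _, mem_univ _⟩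
  simp only [deriv_circleMap]
  exact (((continuous_circleMap 0 r).comp continuous_fst).mul continuous_const).smul h1

lemma qForm_circ {f : ℂ → 𝓦} {c : ℂ} (hr : 0 ≤ r) (hf : ContinuousOn (fun q : ℂ × ℝ² => f q.1 q.2)
  (sphere c r ×ˢ univ)) (hw : Continuous w) (b : ℝ) : qForm b (fun p => ∮ l in C(c, r), f l p) w = ∮
  l in C(c, r), qForm b (f l) w := by
  have hF := cont_circleMap_smul hr hf
  set F := fun (θ : ℝ) p => deriv (circleMap c r) θ • f (circleMap c r θ) p with F_def
  have hF' : ∀ p, Continuous fun θ => F θ p := fun p => hF.comp (Continuous.prodMk_left p)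
  have hG : Continuous fun q : ℝ² => (F q.1 (q.2, b)).1 * conj (w (q.2, b)).2 - (F q.1 (q.2, b)).2 *
    conj (w (q.2, b)).1 := by
    have h1 : Continuous fun q : ℝ² => F q.1 (q.2, b) :=
      hF.comp (by fun_prop : Continuous fun q : ℝ² => (q.1, ((q.2, b) : ℝ²)))
    have h2 : Continuous fun q : ℝ² => w (q.2, b) := hw.comp (by fun_prop)
    exact (h1.fst.mul (continuous_conj.comp h2.snd)).sub (h1.snd.mul (continuous_conj.comp h2.fst))
  have e1 : ∀ x, (∮ l in C(c, r), f l (x, b)).1 * conj (w (x, b)).2 - (∮ l in C(c, r), f l (x, b)).2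
    * conj (w (x, b)).1 = ∫ θ in 0..2 * π, ((F θ (x, b)).1 * conj (w (x, b)).2 - (F θ (x, b)).2 *
    conj (w (x, b)).1) := fun x => by
    have d : (∮ l in C(c, r), f l (x, b)) = ∫ θ in 0..2 * π, F θ (x, b) := rfl
    rw [d, intvl_fst (hF' _), intvl_snd (hF' _), intervalIntegral.integral_sub,
      iint_mul_const, iint_mul_const]
    · exact ((hF' _).fst.mul continuous_const).intervalIntegrable _ _
    · exact ((hF' _).snd.mul continuous_const).intervalIntegrable _ _
  rw [qForm]
  simp only [e1]
  rw [circleIntegral, integral_of_le zero_le_one, ← intervalIntegral_integral_swap,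
    ← intervalIntegral.integral_neg]
  · congr 1
    funext θ
    rw [qForm, integral_of_le zero_le_one, smul_neg, ← integral_smul]
    congr 2
    funext x
    simp only [F_def, smul_fst, smul_snd, smul_eq_mul]
    ring
  · rw [Measure.prod_restrict]
    refine IntegrableOn.mono_set (t := [[0, 2 * π]] ×ˢ Icc 0 1)
      (hG.continuousOn.integrableOn_compact (isCompact_uIcc.prod isCompact_Icc)) ?_
    exact prod_mono uIoc_subset_uIcc Ioc_subset_Icc_self

/-! ### The kernel of the contour waves -/

/-- `1 / ω_ε`, for complex `ε`. -/
def invEn (N : ℕ) (t : ℂ) : ℂ := (ωₜ N : ℂ)⁻¹ + t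

/-- `κ(λ)²`. -/
def kappaSq (N : ℕ) (t l : ℂ) : ℂ := (invEn N t)⁻¹ ^ 2 - l ^ 2

/-- `gap`, for complex `ε`. -/
def gapFn (N : ℕ) (t l : ℂ) : ℂ := sincSqrt (kappaSq N t l) - parity N * invEn N t

lemma ofReal_omega (N : ℕ) (t : ℝ) : (omega N t : ℂ) = (invEn N t)⁻¹ := by simp [omega, invEn]

lemma gap_eq_gapFn (N : ℕ) (t : ℝ) (l : ℂ) : gap N t l = gapFn N t l := by
  rw [gap_eq, ofReal_div, ofReal_omega, gapFn, kappaSq, div_inv_eq_mul]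

/-- The integrand of the contour waves. -/
def kernelWave (N m : ℕ) (t l : ℂ) (p : ℝ²) : ℂ² :=
  ((l - 1) ^ m / gapFn N t l) • planeWave (parity N) (sqrt (kappaSq N t l)) l p

lemma contWave_eq (N : ℕ) (a t : ℝ) (m : ℕ) : contourWave N a t m = fun p => (2 * π * I)⁻¹ • ∮ l
  in C(1, a), kernelWave N m t l p := by
  funext p
  simp only [contourWave, kernelWave, gap_eq_gapFn, kappa, ofReal_omega, kappaSq]

/-- The point `l` is a regular point of the kernel, except for zeros of the gap. -/
structure IsRegular (N : ℕ) (t l : ℂ) : Prop where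
  inv_ne : invEn N t ≠ 0
  slit : kappaSq N t l ∈ slitPlane

lemma diffAt_kappaSq {t : ℂ} (h : invEn N t ≠ 0) : DifferentiableAt ℂ (fun q : ℂ² => kappaSq N q.1
  q.2) (t, l) := by
  have h1 : DifferentiableAt ℂ (fun q => (invEn N q.1)⁻¹) (t, l) :=
    DifferentiableAt.inv (by unfold invEn; fun_prop) h
  unfold kappaSq
  fun_prop

lemma diffAt_gapFn {t : ℂ} (h : invEn N t ≠ 0) : DifferentiableAt ℂ (fun q : ℂ² => gapFn N q.1
  q.2) (t, l) :=
  (DifferentiableAt.comp _ (diff_sincSqrt _) (diffAt_kappaSq h)).sub (by unfold invEn; fun_prop)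

lemma IsRegular.differentiableAt_sqrt {t : ℂ} (h : IsRegular N t l) : DifferentiableAt ℂ (fun q :
  ℂ² => sqrt (kappaSq N q.1 q.2)) (t, l) :=
  DifferentiableAt.comp (g := sqrt) _ (Complex.differentiableAt_sqrt h.slit)
    (diffAt_kappaSq h.inv_ne)

lemma IsRegular.diffAt_coeff {m : ℕ} {t : ℂ} (h : IsRegular N t l) (hg : gapFn N t l ≠ 0) :
  DifferentiableAt ℂ (fun q : ℂ² => (q.2 - 1) ^ m / gapFn N q.1 q.2) (t, l) := by
  have h1 : DifferentiableAt ℂ (fun q => (q.2 - 1) ^ m) (t, l) := by fun_prop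
  have h2 := diffAt_gapFn (l := l) h.inv_ne
  simp only [div_eq_mul_inv]
  exact h1.mul (DifferentiableAt.inv h2 hg)

lemma diffAt_partial {V : Type*} [NormedAddCommGroup V] [NormedSpace ℂ V] {f : ℂ → ℂ → V} {t : ℂ}
  (h : DifferentiableAt ℂ (fun q : ℂ² => f q.1 q.2) (t, l)) : DifferentiableAt ℂ (f t) l :=
  DifferentiableAt.comp (f := fun l => (t, l)) (g := fun q => f q.1 q.2) l h (by fun_prop)

lemma IsRegular.diffAt_kernel {m : ℕ} {t : ℂ} (h : IsRegular N t l) (hg : gapFn N t l ≠ 0) (p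
  : ℝ²) : DifferentiableAt ℂ (fun q : ℂ² => kernelWave N m q.1 q.2 p) (t, l) := by
  have h1 := h.differentiableAt_sqrt
  refine DifferentiableAt.smul (h.diffAt_coeff hg) ?_
  unfold planeWave
  fun_prop

lemma contOn_smul_plane (s : ℝ) {c κ : ℂ → ℂ} {Z : Set ℂ} (hc : ContinuousOn c Z) (hκ : ContinuousOn
  κ Z) : ContinuousOn (fun q : ℂ × ℝ² => c q.1 • planeWave s (κ q.1) q.1 q.2) (Z ×ˢ univ) := by
  have h1 : ContinuousOn (fun q : ℂ × ℝ² => c q.1) (Z ×ˢ univ) :=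
    hc.comp continuousOn_fst fun q hq => hq.1
  have h2 : ContinuousOn (fun q : ℂ × ℝ² => κ q.1) (Z ×ˢ univ) :=
    hκ.comp continuousOn_fst fun q hq => hq.1
  have h3 : ∀ {K : ℂ × ℝ² → ℂ} {S : Set (ℂ × ℝ²)}, ContinuousOn K S → ContinuousOn (fun q =>
    planeWave s (K q) q.1 q.2) S := fun hK => by
    unfold planeWave
    fun_prop
  exact h1.smul (h3 h2)

lemma contOn_smul_planeImage (s : ℝ) {c κ : ℂ → ℂ} {Z : Set ℂ} (hc : ContinuousOn c Z) (hκ :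
  ContinuousOn κ Z) : ContinuousOn (fun q : ℂ × ℝ² => c q.1 • planeImage s (κ q.1) q.1 q.2) (Z ×ˢ
  univ) := by
  have h1 : ContinuousOn (fun q : ℂ × ℝ² => c q.1) (Z ×ˢ univ) :=
    hc.comp continuousOn_fst fun q hq => hq.1
  have h2 : ContinuousOn (fun q : ℂ × ℝ² => κ q.1) (Z ×ˢ univ) :=
    hκ.comp continuousOn_fst fun q hq => hq.1
  have h3 : ∀ {K : ℂ × ℝ² → ℂ} {S : Set (ℂ × ℝ²)}, ContinuousOn K S → ContinuousOn (fun q =>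
    planeImage s (K q) q.1 q.2) S := fun hK => by
    unfold planeImage
    fun_prop
  exact h1.smul (h3 h2)

/-- The contour waves with parameter `t` can be taken over circles of radius between `r / 2` and
`r`, and the kernel is regular up to zeros of the gap inside. -/
structure IsContour (N : ℕ) (r : ℝ) (t : ℂ) : Prop where
  pos : 0 < r
  lt_one : r < 1
  regular : ∀ l ∈ closedBall 1 r, IsRegular N t l
  den : ∀ l ∈ closedBall 1 r, cosSqrt (kappaSq N t l) + l * sincSqrt (kappaSq N t l) ≠ 0
  gap_ne : ∀ l : ℂ, r / 2 ≤ ‖l - 1‖ → ‖l - 1‖ ≤ r → gapFn N t l ≠ 0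

lemma circ_kernel_eq {m : ℕ} {t : ℂ} {R : ℝ} (h0 : 0 < r) (hle : r ≤ R) (h1 : ∀ l ∈ closedBall
  1 R, IsRegular N t l) (h2 : ∀ l : ℂ, r ≤ ‖l - 1‖ → ‖l - 1‖ ≤ R → gapFn N t l ≠ 0) (p : ℝ²) : (∮ l
  in C(1, R), kernelWave N m t l p) = ∮ l in C(1, r), kernelWave N m t l p := by
  have d : ∀ l ∈ closedBall 1 R \ ball 1 r, DifferentiableAt ℂ (fun l => kernelWave N m t l p) l :=
    fun l hl =>
    diffAt_partial (f := fun t l => kernelWave N m t l p)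
      ((h1 l hl.1).diffAt_kernel
        (h2 l (by simpa [dist_eq_norm] using hl.2) (mem_closedBall_iff_norm.1 hl.1)) p)
  exact circleIntegral_eq_of_differentiable_on_annulus_off_countable h0 hle countable_empty
    (fun l hl => (d l hl).continuousAt.continuousWithinAt)
    fun l hl => d l ⟨ball_subset_closedBall hl.1.1, fun h => hl.1.2 (ball_subset_closedBall h)⟩

namespace IsContour

variable {N : ℕ} {r : ℝ} {t : ℂ}

lemma coeff_sphere (h : IsContour N r t) {ρ : ℝ} (h1 : r / 2 ≤ ρ) (h2 : ρ ≤ r) (hl : l ∈ sphere 1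
  ρ) : IsRegular N t l ∧ gapFn N t l ≠ 0 := by
  have e := mem_sphere_iff_norm.1 hl
  exact ⟨h.regular l (mem_closedBall_iff_norm.2 (e.trans_le h2)), h.gap_ne l (e ▸ h1) (e ▸ h2)⟩

lemma contOn_coeff (h : IsContour N r t) {ρ : ℝ} (h1 : r / 2 ≤ ρ) (h2 : ρ ≤ r) (m : ℕ) :
  ContinuousOn (fun l => (l - 1) ^ m / gapFn N t l) (sphere 1 ρ) := fun l hl => by
  obtain ⟨e1, e2⟩ := h.coeff_sphere h1 h2 hl
  have := diffAt_partial (f := fun t l => (l - 1) ^ m / gapFn N t l) (e1.diffAt_coeff e2)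
  exact this.continuousAt.continuousWithinAt

lemma contOn_sqrt (h : IsContour N r t) {ρ : ℝ} (h1 : r / 2 ≤ ρ) (h2 : ρ ≤ r) : ContinuousOn
  (fun l => sqrt (kappaSq N t l)) (sphere 1 ρ) := fun l hl => by
  have := diffAt_partial (f := fun t l => sqrt (kappaSq N t l))
    (h.coeff_sphere h1 h2 hl).1.differentiableAt_sqrt
  exact this.continuousAt.continuousWithinAt

lemma contOn_kernel (h : IsContour N r t) {ρ : ℝ} (h1 : r / 2 ≤ ρ) (h2 : ρ ≤ r) (m : ℕ)
  : ContinuousOn (fun q : ℂ × ℝ² => kernelWave N m t q.1 q.2) (sphere 1 ρ ×ˢ univ) :=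
  contOn_smul_plane (parity N) (c := fun l => (l - 1) ^ m / gapFn N t l)
    (κ := fun l => sqrt (kappaSq N t l)) (h.contOn_coeff h1 h2 m)
    (h.contOn_sqrt h1 h2)

/-- The Disp function divided by the gap. -/
def dispersionQuot (N : ℕ) (t l : ℂ) : ℂ :=
  -(invEn N t)⁻¹ ^ 2 * (sincSqrt (kappaSq N t l) + parity N * invEn N t) /
    (cosSqrt (kappaSq N t l) + l * sincSqrt (kappaSq N t l))

/-- The quotient of the defect of the plane wave by the gap. -/
def restWave (N : ℕ) (t l : ℂ) (p : ℝ²) : ℂ² :=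
  planeRest (parity N) (invEn N t)⁻¹ (sqrt (kappaSq N t l)) l (dispersionQuot N t l) p

lemma cont_circ (h : IsContour N r t) (m : ℕ) : Continuous fun p => ∮ l in C(1,
  r), kernelWave N m t l p :=
  intervalIntegral.continuous_parametric_intervalIntegral_of_continuous'
    (f := fun p θ => deriv (circleMap 1 r) θ • kernelWave N m t (circleMap 1 r θ) p)
    ((cont_circleMap_smul h.pos.le
      (h.contOn_kernel (half_le_self h.pos.le) le_rfl m)).comp continuous_swap) _ _

lemma planeImage_eq_restWave (h : IsContour N r t) (hl : l ∈ closedBall 1 r) (p : ℝ²) : planeImage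
  (parity N) (sqrt (kappaSq N t l)) l p = (invEn N t)⁻¹ • planeWave (parity N) (sqrt (kappaSq N t
  l)) l p + gapFn N t l • restWave N t l p := by
  have hI := (h.regular l hl).inv_ne
  have hk := sqrt_sq_eq (kappaSq N t l)
  have g1 : (parity N) / (invEn N t)⁻¹ = parity N * invEn N t := div_inv_eq_mul _ _
  have s2 : (parity N : ℂ) * parity N = 1 := by exact_mod_cast parity_mul_self N
  refine planeImage_eq (parity_mul_self N) (inv_ne_zero hI) ?_ ?_ ?_ p
  · rw [hk, kappaSq]; ring
  · rw [← sincSqrt_eq hk, g1, gapFn]; ring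
  · rw [← sincSqrt_eq hk, ← cosSqrt_eq hk, dispersionQuot, div_mul_eq_mul_div,
      eq_div_iff (h.den l hl), gapFn]
    have e1 := cosSqrt_sq_add (kappaSq N t l)
    have e2 : kappaSq N t l = (invEn N t)⁻¹ ^ 2 - l ^ 2 := rfl
    have e3 := inv_mul_cancel₀ hI
    generalize (invEn N t)⁻¹ = E at *
    generalize invEn N t = e at *
    linear_combination e1 - sincSqrt (kappaSq N t l) ^ 2 * e2 - s2 - parity N ^ 2 * (E * e + 1) * e3

lemma diffAt_restWave (h : IsContour N r t) (hl : l ∈ closedBall 1 r) (p : ℝ²) :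
  DifferentiableAt ℂ (fun l => restWave N t l p) l := by
  have a1 : DifferentiableAt ℂ (fun l => sqrt (kappaSq N t l)) l :=
    diffAt_partial (f := fun t l => sqrt (kappaSq N t l)) (h.regular l hl).differentiableAt_sqrt
  have a2 : DifferentiableAt ℂ (fun l => kappaSq N t l) l :=
    diffAt_partial (diffAt_kappaSq (h.regular l hl).inv_ne)
  have a3 := (diff_sincSqrt _).comp l a2
  have a4 := (diff_cosSqrt _).comp l a2
  have a5 : DifferentiableAt ℂ (fun l => dispersionQuot N t l) l := by
    unfold dispersionQuot
    exact DifferentiableAt.fun_div (by fun_prop) (by fun_prop) (h.den l hl)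
  unfold restWave planeRest
  fun_prop

lemma circ_planeImage (h : IsContour N r t) (m : ℕ) (p : ℝ²) : (∮ l in C(1, r), ((l - 1)
  ^ m / gapFn N t l) • planeImage (parity N) (sqrt (kappaSq N t l)) l p) = (invEn N t)⁻¹ • ∮ l in
  C(1, r), kernelWave N m t l p := by
  have r0 := h.pos.le
  have hr2 := half_le_self r0
  have d : ∀ l ∈ closedBall 1 r, DifferentiableAt ℂ (fun l => (l - 1) ^ m • restWave N t l p) l :=
    fun l hl => by
    have h1 : DifferentiableAt ℂ (fun l => (l - 1) ^ m) l := by fun_prop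
    exact h1.smul (h.diffAt_restWave hl p)
  have z := (diffContOnCl_of_diffAt d).circleIntegral_eq_zero r0
  have i1 : CircleIntegrable (fun l => (invEn N t)⁻¹ • kernelWave N m t l p) 1 r := by
    have c := (h.contOn_kernel hr2 le_rfl m).comp (f := fun l => (l, p))
      (s := sphere 1 r) (by fun_prop) fun l hl => ⟨hl, mem_univ _⟩
    exact (c.const_smul (invEn N t)⁻¹).circleIntegrable r0
  have i2 := ContinuousOn.circleIntegrable r0 fun l hl =>
      (d l (sphere_subset_closedBall hl)).continuousAt.continuousWithinAt
  have key := circleIntegral.integral_add i1 i2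
  rw [z, add_zero, circleIntegral.integral_smul] at key
  rw [← key]
  refine circleIntegral.integral_congr r0 fun l hl => ?_
  have e2 := (h.coeff_sphere hr2 le_rfl hl).2
  simp only [kernelWave]
  rw [h.planeImage_eq_restWave (sphere_subset_closedBall hl), smul_add, smul_smul _ (gapFn N t l),
    div_mul_cancel₀ _ e2, smul_comm ((l - 1) ^ m / gapFn N t l)]

lemma hasDirac (h : IsContour N r t) (m : ℕ) : HasDirac (fun p => ∮ l in C(1, r), kernelWave N m t
  l p) fun p => (invEn N t)⁻¹ • ∮ l in C(1, r), kernelWave N m t l p := by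
  have hr2 := half_le_self h.pos.le
  simp only [← h.circ_planeImage]
  exact HasDirac.circleIntegral h.pos.le (h.contOn_kernel hr2 le_rfl m)
    (contOn_smul_planeImage (parity N) (c := fun l => (l - 1) ^ m / gapFn N t l)
      (κ := fun l => sqrt (kappaSq N t l)) (h.contOn_coeff hr2 le_rfl m)
      (h.contOn_sqrt hr2 le_rfl))
    fun l _ => (hasDirac_plane _ _ _).const_smul ((l - 1) ^ m / gapFn N t l)

end IsContour

lemma fam_contour (hr : r < γ) (h : ∀ᶠ t in 𝓝 (0 : ℂ), IsContour N r t) (m : ℕ) : IsFamily γ fun t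
  : ℝ => contourWave N r t m := by
  obtain ⟨ρ, hρ, hU⟩ := nhds_basis_closedBall.mem_iff.1 h
  have h0 := hU (mem_closedBall_self hρ.le)
  have r0 := h0.pos.le
  have hr2 : r / 2 ≤ r := by linarith
  have reg : ∀ q : ℂ², q ∈ closedBall 0 ρ ×ˢ sphere 1 r → _ := fun q hq =>
    (hU hq.1).coeff_sphere hr2 le_rfl hq.2
  obtain ⟨M, hM⟩ := ((isCompact_closedBall 0 ρ).prod (isCompact_sphere 1 r)).exists_bound_of_continuousOn
    (f := fun q => (q.2 - 1) ^ m / gapFn N q.1 q.2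
      * rexp ‖sqrt (kappaSq N q.1 q.2)‖) fun q hq => by
      have a1 := ((reg q hq).1.diffAt_coeff (m := m) (reg q hq).2).continuousAt
      have a2 := (reg q hq).1.differentiableAt_sqrt.continuousAt
      refine ContinuousAt.continuousWithinAt (a1.mul ?_)
      exact continuous_ofReal.continuousAt.comp (continuous_exp.continuousAt.comp a2.norm)
  simp only [contWave_eq]
  refine fam_of_diffOn hr (B := r * M) isOpen_ball (mem_ball_self hρ)
    (f := fun z p => (2 * π * I)⁻¹ • ∮ l in C(1, r), kernelWave N m z l p)
    (fun z hz => ?_) (fun p => ?_) fun z hz p hp => ?_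
  · have hz' := hU (ball_subset_closedBall hz)
    exact (hz'.cont_circ m).const_smul (2 * π * I)⁻¹
  · refine DifferentiableOn.fun_const_smul ?_ _
    exact diffOn_circ isOpen_ball r0 fun z hz l hl =>
      (reg (z, l) ⟨ball_subset_closedBall hz, hl⟩).1.diffAt_kernel
        (reg (z, l) ⟨ball_subset_closedBall hz, hl⟩).2 p
  · rw [mul_assoc r]
    refine circleIntegral.norm_two_pi_i_inv_smul_integral_le_of_norm_le_const r0 fun l hl => ?_
    have hM' := hM (z, l) ⟨ball_subset_closedBall hz, hl⟩
    rw [norm_mul, norm_real, Real.norm_of_nonneg (exp_pos _).le] at hM'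
    have him : |l.im| ≤ r := by
      have := abs_im_le_norm (l - 1)
      simpa [mem_sphere_iff_norm.1 hl] using this
    rw [kernelWave, norm_smul]
    calc _ ≤ ‖(l - 1) ^ m / gapFn N z l‖ * (rexp ‖sqrt (kappaSq N z l)‖
          * rexp (|l.im| * |p.2|)) := by gcongr; exact norm_plane_le (abs_parity N) _ _ hp
      _ ≤ M * rexp (|l.im| * |p.2|) := by rw [← mul_assoc]; gcongr
      _ ≤ _ := by
        have := (by positivity : (0 : ℝ) ≤ _).trans hM'
        gcongr

/-! ### Fluxes of the contour waves -/

lemma qForm_smul_left (b : ℝ) (c : ℂ) (w w' : 𝓦) : qForm b (fun p => c • w p) w' = c * qForm b w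
  w' := by
  rw [qForm, qForm, mul_neg, ← iint_const_mul]
  congr 2
  funext x
  simp
  ring

lemma sincSqrt_conj (s : ℂ) : sincSqrt (conj s) = conj (sincSqrt s) := by
  exact (sincSqrt_eq (by rw [← map_pow, sqrt_sq_eq])).trans (csinc_conj _)

lemma kappaSq_conj (N : ℕ) (t : ℝ) (l : ℂ) : kappaSq N t (conj l) = conj (kappaSq N t l) := by
  simp [kappaSq, invEn]

lemma gapFn_conj (N : ℕ) (t : ℝ) (l : ℂ) : gapFn N t (conj l) = conj (gapFn N t l) := by
  rw [gapFn, kappaSq_conj, sincSqrt_conj]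
  simp [gapFn, invEn]

lemma sqrt_conj {s : ℂ} (h : s ∈ slitPlane) : sqrt (conj s) = conj (sqrt s) := by
  rw [sqrt, conj_cpow _ _ (mem_slitPlane_iff_arg.1 h).1]
  simp [sqrt, conj_ofNat]

lemma csinc_sqrt_eq (N : ℕ) (t l : ℂ) : csinc (sqrt (kappaSq N t l)) = gapFn N t l + parity N *
  invEn N t := by
  rw [gapFn, sub_add_cancel, sincSqrt]

/-- The Cauchy integrals that give the fluxes of the contour waves. -/
def fluxInt (N : ℕ) (r : ℝ) (k : ℕ) (t : ℂ) : ℂ :=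
  (2 * π * I)⁻¹ * ∮ l in C(1, r / 2), (l - 1) ^ k * kappaSq N t l / (l * gapFn N t l)

/-- The flux of two contour waves whose orders add up to `k`, divided by `i`. -/
def fluxCo (N : ℕ) (r : ℝ) (k : ℕ) (t : ℝ) : ℝ := -(parity N * (fluxInt N r k t).re)

/-- The part of the flux of a contour wave and a plane wave that is divisible by the gap. -/
def fluxRest (N : ℕ) (r : ℝ) (m : ℕ) (b : ℝ) (t ν : ℂ) : ℂ :=
  (2 * π * I)⁻¹ * ∮ l in C(1, r), (l - 1) ^ m / gapFn N t l * (2 * parity N * I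
    * exp (-I * (l - ν) * b) * sqrt (kappaSq N t l) / (ν ^ 2 - l ^ 2))

lemma IsRegular.diffAt_fluxInt {k : ℕ} {t : ℂ} (h : IsRegular N t l) (hl : l ≠ 0) (hg : gapFn N t
  l ≠ 0) : DifferentiableAt ℂ (fun q : ℂ² => (q.2 - 1) ^ k * kappaSq N q.1 q.2 / (q.2 * gapFn N q.1
  q.2)) (t, l) := by
  have h1 := diffAt_kappaSq (l := l) h.inv_ne
  have h2 := diffAt_gapFn (l := l) h.inv_ne
  have h3 : DifferentiableAt ℂ (fun q => (q.2 * gapFn N q.1 q.2)⁻¹) (t, l) :=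
    DifferentiableAt.inv (by fun_prop) (mul_ne_zero hl hg)
  simp only [div_eq_mul_inv]
  fun_prop

namespace IsContour

variable {N : ℕ} {r : ℝ} {t : ℝ}

lemma re_pos (h : IsContour N r t) (hl : l ∈ closedBall 1 r) : 0 < l.re := by
  have h1 := (abs_re_le_norm (l - 1)).trans (mem_closedBall_iff_norm.1 hl)
  rw [sub_re, one_re] at h1
  linarith [(abs_le.1 h1).1, h.lt_one]

lemma ne_zero (h : IsContour N r t) (hl : l ∈ closedBall 1 r) : l ≠ 0 := fun e => by
  have := h.re_pos hl
  rw [e, zero_re] at this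
  exact lt_irrefl _ this

lemma diffAt_fluxInt (h : IsContour N r t) {ρ : ℝ} (h1 : r / 2 ≤ ρ) (h2 : ρ ≤ r) (k : ℕ) (hl : l ∈
  sphere 1 ρ) : DifferentiableAt ℂ (fun l => (l - 1) ^ k * kappaSq N t l / (l * gapFn N t l)) l :=
  by
  obtain ⟨e1, e2⟩ := h.coeff_sphere h1 h2 hl
  exact diffAt_partial
    (f := fun t l => (l - 1) ^ k * kappaSq N t l / (l * gapFn N t l)) (e1.diffAt_fluxInt
      (h.ne_zero (closedBall_subset_closedBall h2 (sphere_subset_closedBall hl))) e2)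

lemma add_ne_zero {ν : ℂ} (h : IsContour N r t) (hl : l ∈ closedBall 1 r) (hν : ν ∈ closedBall 1
  r) : l + ν ≠ 0 := fun e => by
  have := congrArg re e
  rw [add_re, zero_re] at this
  linarith [h.re_pos hl, h.re_pos hν]

lemma differentiableAt_sqrt (h : IsContour N r t) (hl : l ∈ closedBall 1 r) : DifferentiableAt ℂ
  (fun l => sqrt (kappaSq N t l)) l :=
  diffAt_partial (f := fun t l => sqrt (kappaSq N t l)) (h.regular l hl).differentiableAt_sqrt

lemma qForm_kernel {κ' l' : ℂ} (m : ℕ) (b : ℝ) (hg : gapFn N t l ≠ 0) (hne : conj l' ^ 2 - l ^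
  2 ≠ 0) (hE : conj κ' ^ 2 = kappaSq N t (conj l')) : qForm b (kernelWave N m t l) (planeWave
  (parity N) κ' l') = (l - 1) ^ m / gapFn N t l * (2 * parity N * I * exp (-I * (l - conj l') * b) *
  (sqrt (kappaSq N t l) * conj κ' * (gapFn N t l - gapFn N t (conj l'))) / (conj l' ^ 2 - l ^ 2)) :=
  by
  have e1 := sub_mul_int_sin (sqrt (kappaSq N t l)) (conj κ')
  have e2 : sqrt (kappaSq N t l) ^ 2 - conj κ' ^ 2 = conj l' ^ 2 - l ^ 2 := by
    rw [sqrt_sq_eq, hE, kappaSq, kappaSq]; ring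
  have e3 : csinc (conj κ') = gapFn N t (conj l') + parity N * invEn N t := by
    rw [← sincSqrt_eq hE, gapFn, sub_add_cancel]
  rw [e2, ← mul_csinc, ← mul_csinc (conj κ'), csinc_sqrt_eq, e3] at e1
  have e4 : qForm b (kernelWave N m t l) (planeWave (parity N) κ' l') = _ := qForm_smul_left b _ _ _
  rw [e4, qForm_planeWave, eq_div_of_mul_eq hne ((mul_comm _ _).trans e1)]
  ring

lemma qForm_planeWave_eq_zero (h : IsContour N r t) (m : ℕ) (b : ℝ) {s' κ' l' : ℝ} (hs : s' =
  -parity N ∨ s' = parity N ∧ (κ' : ℂ) ^ 2 = kappaSq N t l' ∧ gapFn N t l' = 0 ∧ ∀ l ∈ closedBall (1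
  : ℂ) r, (l' : ℂ) ^ 2 - l ^ 2 ≠ 0) : qForm b (fun p => ∮ l in C(1, r), kernelWave N m t l p)
  (planeWave s' κ' l') = 0 := by
  have r0 := h.pos.le
  have hr2 := half_le_self r0
  rw [qForm_circ r0 (h.contOn_kernel hr2 le_rfl m) (cont_plane _ _ _)]
  rcases hs with rfl | ⟨rfl, h1, h2, h3⟩
  · rw [circleIntegral.integral_congr r0 (g := fun _ => 0) fun l _ => ?_]
    · simp [circleIntegral]
    · exact (qForm_smul_left b _ _ _).trans (by rw [qForm_plane_of_ne b (Or.inl rfl), mul_zero])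
  · have d : ∀ l ∈ closedBall 1 r, DifferentiableAt ℂ (fun l => (l - 1) ^ m * (2 * parity N * I *
      exp (-I * (l - l') * b) * (sqrt (kappaSq N t l) * κ') / (l' ^ 2 - l ^ 2))) l := fun l hl => by
      have h4 := h.differentiableAt_sqrt hl
      have h5 := h3 l hl
      fun_prop
    rw [← (diffContOnCl_of_diffAt d).circleIntegral_eq_zero r0]
    refine circleIntegral.integral_congr r0 fun l hl => ?_
    have hg := (h.coeff_sphere hr2 le_rfl hl).2
    have e := qForm_kernel (κ' := κ') (l' := l') m b hg
      (by simpa only [conj_ofReal] using h3 l (sphere_subset_closedBall hl))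
      (by simpa only [conj_ofReal] using h1)
    simp only [conj_ofReal, h2, sub_zero] at e
    rw [e]
    field_simp

lemma diffOn_fluxRest (h : IsContour N r t) (m : ℕ) (b : ℝ) : DifferentiableOn ℂ
  (fluxRest N r m b t) (ball 1 r) := by
  refine DifferentiableOn.const_mul (diffOn_circ isOpen_ball h.pos.le fun ν hν l hl => ?_) _
  obtain ⟨h1, h2⟩ := h.coeff_sphere (half_le_self h.pos.le) le_rfl hl
  have hl' := sphere_subset_closedBall hl
  have h3 : DifferentiableAt ℂ (fun q => (q.2 - 1) ^ m / gapFn N t q.2) (ν, l) := by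
    have := diffAt_partial (f := fun t l => (l - 1) ^ m / gapFn N t l) (h1.diffAt_coeff h2)
    exact DifferentiableAt.comp (g := fun l => (l - 1) ^ m / gapFn N t l) (ν, l)
      this differentiableAt_snd
  have h4 : DifferentiableAt ℂ (fun q => sqrt (kappaSq N t q.2)) (ν, l) :=
    DifferentiableAt.comp (ν, l) (h.differentiableAt_sqrt hl') differentiableAt_snd
  have h5 : (ν ^ 2 - l ^ 2) ≠ 0 := by
    rw [sq_sub_sq, add_comm]
    refine mul_ne_zero (h.add_ne_zero hl' (ball_subset_closedBall hν)) (sub_ne_zero.2 ?_)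
    rintro rfl
    exact absurd (mem_sphere.1 hl) (mem_ball.1 hν).ne
  have h6 : DifferentiableAt ℂ (fun q => (q.1 ^ 2 - q.2 ^ 2)⁻¹) (ν, l) :=
    DifferentiableAt.inv (by fun_prop) h5
  simp
  exact h3.mul (DifferentiableAt.mul (by fun_prop) h6)

lemma qForm_planeWave (h : IsContour N r t) (m : ℕ) (b : ℝ) {μ : ℂ} (hμ : ‖μ - 1‖ < r) : (2 * π *
  I)⁻¹ * qForm b (fun p => ∮ l in C(1, r), kernelWave N m t l p) (planeWave (parity N) (sqrt
  (kappaSq N t μ)) μ) = conj (I * parity N * (μ - 1) ^ m * kappaSq N t μ / μ) - gapFn N t (conj μ) *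
  (sqrt (kappaSq N t (conj μ)) * fluxRest N r m b t (conj μ)) := by
  have r0 := h.pos.le
  have hr2 := half_le_self r0
  have hμ' := mem_closedBall_iff_norm.2 hμ.le
  have hK := sqrt_conj (h.regular μ hμ').slit
  rw [← kappaSq_conj] at hK
  set ν := conj μ with hν
  have bν : ν ∈ ball 1 r := by rw [mem_ball_iff_norm, ← norm_conj]; simpa [hν] using hμ
  have cν := ball_subset_closedBall bν
  set K := sqrt (kappaSq N t ν) with K_def
  rw [qForm_circ r0 (h.contOn_kernel hr2 le_rfl m) (cont_plane _ _ _)]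
  set Φ : ℂ → ℂ := fun l => -((l - 1) ^ m * (2 * parity N * I) *
    exp (-I * (l - ν) * b) * (sqrt (kappaSq N t l) * K) / (l + ν)) with hΦ
  have dΦ : ∀ l ∈ closedBall 1 r, DifferentiableAt ℂ Φ l := fun l hl => by
    have h4 := h.differentiableAt_sqrt hl
    have h5 := h.add_ne_zero hl cν
    fun_prop
  set g : ℂ → ℂ := fun l => (l - 1) ^ m / gapFn N t l * (2 * parity N * I
    * exp (-I * (l - ν) * b) * sqrt (kappaSq N t l) / (ν ^ 2 - l ^ 2)) with hg
  have ne : ∀ l ∈ sphere 1 r, l - ν ≠ 0 ∧ l + ν ≠ 0 := fun l hl => by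
    refine ⟨sub_ne_zero.2 ?_, h.add_ne_zero (sphere_subset_closedBall hl) cν⟩
    rintro rfl
    exact absurd (mem_sphere.1 hl) (mem_ball.1 bν).ne
  have e1 : ∀ l ∈ sphere 1 r, qForm b (kernelWave N m t l) (planeWave (parity N) (sqrt (kappaSq N t
    μ)) μ) = (l - ν)⁻¹ • Φ l - (gapFn N t ν * K) • g l := fun l hl => by
    obtain ⟨n1, n2⟩ := ne l hl
    have hgl := (h.coeff_sphere hr2 le_rfl hl).2
    have n3 : ν ^ 2 - l ^ 2 ≠ 0 := by
      rw [sq_sub_sq, add_comm]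
      exact mul_ne_zero n2 (sub_ne_zero.2 (sub_ne_zero.1 n1).symm)
    rw [qForm_kernel m b hgl n3 (by rw [← hK, K_def, sqrt_sq_eq]), ← hK, ← hν, hΦ, hg]
    have n4 : (ν ^ 2 - l ^ 2)⁻¹ = -((l - ν)⁻¹ * (l + ν)⁻¹) := by
      rw [← mul_inv, ← inv_neg]; congr 1; ring
    have n5 := mul_inv_cancel₀ hgl
    simp only [smul_eq_mul, div_eq_mul_inv, n4]
    linear_combination (-(l - 1) ^ m * (2 * parity N * I) *
      exp (-I * (l - ν) * b) * (sqrt (kappaSq N t l) * K) * ((l - ν)⁻¹ * (l + ν)⁻¹)) * n5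
  have i1 : CircleIntegrable (fun l => (l - ν)⁻¹ • Φ l) 1 r := by
    refine ContinuousOn.circleIntegrable r0 (ContinuousOn.smul
      (ContinuousOn.inv₀ (by fun_prop) fun l hl => (ne l hl).1) fun l hl => ?_)
    exact (dΦ l (sphere_subset_closedBall hl)).continuousAt.continuousWithinAt
  have i2 : CircleIntegrable (fun l => (gapFn N t ν * K) • g l) 1 r := by
    refine ContinuousOn.circleIntegrable r0 (ContinuousOn.const_smul ?_ (gapFn N t ν * K))
    have c1 := h.contOn_coeff hr2 le_rfl m
    have c2 := h.contOn_sqrt hr2 le_rfl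
    refine c1.mul (ContinuousOn.div (by fun_prop) (by fun_prop) fun l hl => ?_)
    rw [sq_sub_sq, add_comm]
    exact mul_ne_zero (ne l hl).2 (sub_ne_zero.2 (sub_ne_zero.1 (ne l hl).1).symm)
  rw [circleIntegral.integral_congr r0 e1, circleIntegral.integral_sub i1 i2,
    circleIntegral.integral_smul, (diffContOnCl_of_diffAt dΦ).circleIntegral_sub_inv_smul bν,
    mul_sub]
  have p0 := two_pi_I_ne_zero
  have e2 : Φ ν = conj (I * parity N * (μ - 1) ^ m * kappaSq N t μ / μ) := by
    have n0 := h.ne_zero cν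
    simp only [hΦ, map_div₀, map_mul, map_pow, map_sub, map_one, conj_I,
      conj_ofReal, ← kappaSq_conj, ← hν, sub_self, mul_zero, zero_mul, exp_zero]
    rw [← K_def, ← sq, K_def, sqrt_sq_eq]
    field_simp
    ring
  rw [smul_eq_mul, inv_mul_cancel_left₀ p0, e2, fluxRest, smul_eq_mul]
  ring

lemma cont_cwave (h : IsContour N r t) (m : ℕ) : Continuous (contourWave N r t m) := by
  rw [contWave_eq]
  exact (h.cont_circ m).const_smul (2 * π * I)⁻¹

lemma qForm_eq_fluxInt (h : IsContour N r t) (m m' : ℕ) (b : ℝ) : qForm b (contourWave N r t m')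
  (contourWave N r t m) = -(I * parity N * fluxInt N r (m + m') t) := by
  have r0 := h.pos
  have hr2 : r / 2 ≤ r := half_le_self r0.le
  have r2 : 0 ≤ r / 2 := by positivity
  have dF := h.diffOn_fluxRest m b
  have e0 : contourWave N r t m' = fun p => (2 * π * I)⁻¹ • ∮ l in C(1, r / 2), kernelWave N m' t l
    p := by
    rw [contWave_eq]
    funext p
    rw [circ_kernel_eq (half_pos r0) hr2 h.regular h.gap_ne]
  have d : ∀ μ ∈ closedBall 1 (r / 2), DifferentiableAt ℂ (fun μ => (μ - 1) ^ m' * (sqrt (kappaSq N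
    t μ) * conj (fluxRest N r m b t (conj μ)))) μ := fun μ hμ => by
    have h1 := h.differentiableAt_sqrt (closedBall_subset_closedBall hr2 hμ)
    have hb : conj μ ∈ ball 1 r := by
      rw [mem_ball_iff_norm, ← norm_conj]
      simpa using (mem_closedBall_iff_norm.1 hμ).trans_lt (half_lt_self r0)
    have h2 := (dF.differentiableAt (isOpen_ball.mem_nhds hb)).conj_conj
    rw [conj_conj] at h2
    have h3 : DifferentiableAt ℂ (fun μ => (μ - 1) ^ m') μ := by fun_prop
    exact h3.mul (h1.mul h2)
  have z := (diffContOnCl_of_diffAt d).circleIntegral_eq_zero r2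
  rw [e0, qForm_smul_left, qForm_circ r2 (h.contOn_kernel le_rfl hr2 m')
    (h.cont_cwave m), fluxInt]
  have e1 : ∀ μ ∈ sphere 1 (r / 2), qForm b (kernelWave N m' t μ) (contourWave N r t m) = (-(I *
    parity N)) • ((μ - 1) ^ (m + m') * kappaSq N t μ / (μ * gapFn N t μ)) + (μ - 1) ^ m' * (sqrt
    (kappaSq N t μ) * conj (fluxRest N r m b t (conj μ))) :=
    fun μ hμ => by
    have hg := (h.coeff_sphere le_rfl hr2 hμ).2
    have hn := mem_sphere_iff_norm.1 hμ
    have e2 : qForm b (kernelWave N m' t μ) (contourWave N r t m) = _ := qForm_smul_left b _ _ _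
    have e3 := h.qForm_planeWave m b (by rw [hn]; exact half_lt_self r0)
    rw [← qForm_smul_left, ← contWave_eq] at e3
    have hs := sqrt_conj (h.regular μ (mem_closedBall_iff_norm.2 (hn.trans_le hr2))).slit
    rw [e2, ← neg_neg (qForm b _ _), ← qForm_conj, e3, kappaSq_conj, hs, gapFn_conj]
    simp only [map_sub, map_mul, conj_conj]
    rw [smul_eq_mul, pow_add]
    field_simp
    ring
  have i2 := ContinuousOn.circleIntegrable r2 fun l hl =>
    (d l (sphere_subset_closedBall hl)).continuousAt.continuousWithinAt
  have i1 : CircleIntegrable (fun μ => (-(I * parity N)) • ((μ - 1) ^ (m + m') * kappaSq N t μ / (μ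
    * gapFn N t μ))) 1 (r / 2) := by
    have c : ContinuousOn (fun μ => (μ - 1) ^ (m + m') * kappaSq N t μ / (μ * gapFn N t μ)) (sphere
      1 (r / 2)) := fun l hl =>
      (h.diffAt_fluxInt le_rfl hr2 (m + m') hl).continuousAt.continuousWithinAt
    exact (c.const_smul (-(I * parity N))).circleIntegrable r2
  rw [circleIntegral.integral_congr r2 e1, circleIntegral.integral_add i1 i2, z, add_zero,
    circleIntegral.integral_smul, smul_eq_mul]
  ring

lemma qForm_cwave (h : IsContour N r t) (m m' : ℕ) (b : ℝ) : qForm b (contourWave N r t m)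
  (contourWave N r t m') = I * fluxCo N r (m + m') t := by
  have e1 := h.qForm_eq_fluxInt m m' b
  have e2 := h.qForm_eq_fluxInt m' m b
  have e3 := qForm_conj b (contourWave N r t m) (contourWave N r t m')
  rw [e1, e2, add_comm m' m] at e3
  simp only [map_neg, map_mul, conj_I, conj_ofReal] at e3
  have s0 : (parity N : ℂ) ≠ 0 := by exact_mod_cast parity_ne_zero N
  have e4 : conj (fluxInt N r (m + m') t) = fluxInt N r (m + m') t := by
    refine mul_left_cancel₀ (mul_ne_zero I_ne_zero s0) ?_
    linear_combination e3
  rw [e2, add_comm m' m, ← conj_eq_iff_re.1 e4, fluxCo]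
  simp [mul_assoc]

end IsContour

/-! ### The fluxes at the threshold -/

lemma cosSqrt_kappaMax (hN : 1 ≤ N) : cosSqrt ((kappaMax N : ℂ) ^ 2) = parity N / ωₜ N
  ∧ sincSqrt ((kappaMax N : ℂ) ^ 2) = parity N / ωₜ N := by
  have e : sinc (kappaMax N) = parity N / ωₜ N := by
    rw [div_eq_mul_inv, inv_omegaThr hN, ← mul_assoc, parity_mul_self, one_mul]
  rw [cosSqrt_eq rfl, sincSqrt_eq rfl, csinc_ofReal, ← ofReal_cos, cos_kappaMax hN, e]
  simp

lemma ex_sincSqrt_quotient (hN : 2 ≤ N) : ∃ H : ℂ → ℂ, Differentiable ℂ H ∧ (∀ S, sincSqrt S -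
  parity N / ωₜ N = (S - (kappaMax N : ℂ) ^ 2) ^ 2 * H S) ∧ 8 * (kappaMax N : ℂ) ^ 2 * H
  ((kappaMax N : ℂ) ^ 2) = -(parity N / ωₜ N) ∧ 6 * (kappaMax N : ℂ) ^ 2 * deriv H
  ((kappaMax N : ℂ) ^ 2) = -5 * H ((kappaMax N : ℂ) ^ 2) := by
  have hN1 : 1 ≤ N := by omega
  obtain ⟨v1, v2⟩ := cosSqrt_kappaMax hN1
  have k0 : (kappaMax N : ℂ) ≠ 0 := by
    have := kappaMax_smono le_rfl hN
    rw [kappaMax_one] at this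
    exact_mod_cast this.ne'
  have z0 := pow_ne_zero 2 k0
  set z := (kappaMax N : ℂ) ^ 2
  set σ : ℂ := parity N / ωₜ N
  have dS : ∀ {f : ℂ → ℂ}, Differentiable ℂ f → Differentiable ℂ (dslope f z) := fun hf =>
    differentiableOn_univ.1 ((differentiableOn_dslope univ_mem).2 hf.differentiableOn)
  set F : ℂ → ℂ := fun S => sincSqrt S - σ with hF
  have dF := diff_sincSqrt.sub_const σ
  set H := dslope (dslope F z) z with hH
  have dH : Differentiable ℂ H := dS (dS dF)
  have F'z : deriv F z = 0 := by rw [((derivAt_sincSqrt z0).sub_const σ).deriv, v1, v2]; simp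
  have eq : ∀ S, F S = (S - z) ^ 2 * H S := fun S => by
    have e1 := sub_smul_dslope F z S
    have e2 := sub_smul_dslope (dslope F z) z S
    rw [dslope_same, F'z, sub_zero, smul_eq_mul] at e2
    rw [← e2, show F z = 0 by simp only [hF, v2, sub_self], sub_zero, smul_eq_mul] at e1
    rw [← e1]; ring
  have d1 := fun S => (dH S).hasDerivAt
  have dH1 : Differentiable ℂ (deriv H) := fun S => (dH.analyticAt S).deriv.differentiableAt
  have d2 := fun S => (dH1 S).hasDerivAt
  have d3 := fun S => (dH1.analyticAt S).deriv.differentiableAt.hasDerivAt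
  have u1 : ∀ S, HasDerivAt (fun S : ℂ => S - z) 1 S := fun S => (hasDerivAt_id S).sub_const z
  have u2 : ∀ S, HasDerivAt (fun S : ℂ => (S - z) ^ 2) (2 * (S - z)) S := fun S =>
    ((u1 S).pow 2).congr_deriv (by simp)
  have A : ∀ S, S ≠ 0 → 2 * S * (2 * (S - z) * H S + (S - z) ^ 2 * deriv H S) = cosSqrt S - sincSqrt
    S := fun S hS => by
    have e := ((u2 S).mul (d1 S)).unique ((((derivAt_sincSqrt hS).sub_const σ)).congr_of_eventuallyEq
      (.of_forall fun S => (eq S).symm))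
    rw [e]
    field_simp
  have B : ∀ S, S ≠ 0 → 2 * (2 * (S - z) * H S + (S - z) ^ 2 * deriv H S) + 2 * S * (2 * H S + 4 *
    (S - z) * deriv H S + (S - z) ^ 2 * deriv (deriv H) S) + ((S - z) ^ 2 * H S + σ) / 2 + (2 * (S -
    z) * H S + (S - z) ^ 2 * deriv H S) = 0 :=
    fun S hS => by
    have l := ((hasDerivAt_id S).const_mul 2).mul
      ((((u1 S).const_mul 2).mul (d1 S)).add ((u2 S).mul (d2 S)))
    have r := ((derivAt_cosSqrt' hS).sub (derivAt_sincSqrt hS)).congr_of_eventuallyEq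
      (mem_of_superset (isOpen_ne.mem_nhds hS) fun x hx => A x hx)
    have e := l.unique r
    rw [← A S hS, mul_comm 2 S, mul_assoc S 2, mul_div_mul_left _ _ hS] at e
    simp at e
    have eq' : sincSqrt S = (S - z) ^ 2 * H S + σ := by rw [← eq S]; simp only [hF]; ring
    rw [eq'] at e
    linear_combination e
  refine ⟨H, dH, eq, ?_, ?_⟩
  · have := B z z0
    linear_combination 2 * this
  · have l := (((((u1 z).const_mul 2).mul (d1 z)).add ((u2 z).mul (d2 z))).const_mul 2).add
      (((hasDerivAt_id z).const_mul 2).mul ((((d1 z).const_mul 2).add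
        (((u1 z).const_mul 4).mul (d2 z))).add ((u2 z).mul (d3 z)))) |>.add
      ((((u2 z).mul (d1 z)).add_const σ).div_const 2) |>.add
      ((((u1 z).const_mul 2).mul (d1 z)).add ((u2 z).mul (d2 z)))
    have r := (hasDerivAt_const z (0 : ℂ)).congr_of_eventuallyEq
      (mem_of_superset (isOpen_ne.mem_nhds z0) fun x hx => B x hx)
    have e := l.unique r
    simp at e
    linear_combination e / 2

lemma fluxCo_zero (hN : 2 ≤ N) {a : ℝ} (ha : AdmissibleRadius N a) (hra : r ≤ a) (h : IsContour
  N r (0 : ℝ)) : fluxCo N r 0 0 < 0 ∧ fluxCo N r 1 0 ≠ 0 ∧ fluxCo N r 2 0 = 0 := by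
  have hN1 : 1 ≤ N := by omega
  obtain ⟨H, dH, hH, v1, v2⟩ := ex_sincSqrt_quotient hN
  have k0 : 0 < kappaMax N := by simpa [kappaMax_one] using kappaMax_smono le_rfl hN
  have E0 := omegaThr_pos hN1
  have hz : (ωₜ N : ℂ) ^ 2 = 1 + (kappaMax N : ℂ) ^ 2 := by exact_mod_cast omegaThr_sq hN1
  set s := parity N with hs
  have s2 := parity_mul_self N
  set z := kappaMax N ^ 2 with z_def
  have z0 : 0 < z := by positivity
  have zc : (kappaMax N : ℂ) ^ 2 = (z : ℂ) := by rw [z_def]; push_cast; rfl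
  rw [zc] at hz v1 v2
  simp only [zc] at hH
  set E := ωₜ N
  have z0' : (z : ℂ) ≠ 0 := by exact_mod_cast z0.ne'
  have E0' : (E : ℂ) ≠ 0 := by exact_mod_cast E0.ne'
  have hK : ∀ l, kappaSq N (0 : ℝ) l = E ^ 2 - l ^ 2 := fun l => by simp [kappaSq, invEn, E]
  have hG : ∀ l, gapFn N (0 : ℝ) l = (l - 1) ^ 2 * ((l + 1) ^ 2 * H (E ^ 2 - l ^ 2)) := fun l => by
    have e1 : gapFn N (0 : ℝ) l = sincSqrt (E ^ 2 - l ^ 2) - s / E := by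
      rw [gapFn, hK]; simp [invEn, E, div_eq_mul_inv, hs]
    rw [e1, hH, hz]; ring
  have Hz : H z = -((s : ℂ) / (8 * z * E)) := by
    have : H z = (8 * z * H z) / (8 * z) := by field_simp
    rw [this, v1]; field_simp
  have s0 : (s : ℂ) ≠ 0 := by exact_mod_cast parity_ne_zero N
  have Hz0 : H z ≠ 0 := by grind
  have H1 : (E : ℂ) ^ 2 - 1 ^ 2 = z := by rw [hz]; ring
  set D : ℂ → ℂ := fun l => l * ((l + 1) ^ 2 * H (E ^ 2 - l ^ 2)) with hD
  set f : ℂ → ℂ := fun l => (E ^ 2 - l ^ 2) / D l with hf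
  have D0 : ∀ l ∈ ball (1 : ℂ) r, D l ≠ 0 := fun l hl => by
    have hl' := ball_subset_closedBall hl
    by_cases h1 : l = 1
    · rw [h1]; simp only [hD]; rw [H1]
      exact mul_ne_zero one_ne_zero (mul_ne_zero (by norm_num) Hz0)
    · refine mul_ne_zero (h.ne_zero hl') fun e => h1 (ha.2.2 l
        ((mem_closedBall_iff_norm.1 hl').trans hra) ?_)
      have := gap_eq_gapFn N 0 l
      rw [this, hG, e, mul_zero]
  have dD : Differentiable ℂ D := by fun_prop
  have df : DifferentiableOn ℂ f (ball 1 r) := fun l hl =>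
    (DifferentiableAt.fun_div (by fun_prop) (dD l) (D0 l hl)).differentiableWithinAt
  have hb : closedBall (1 : ℂ) (r / 2) ⊆ ball 1 r := closedBall_subset_ball (half_lt_self h.pos)
  have h1m : (1 : ℂ) ∈ ball 1 (r / 2) := mem_ball_self (half_pos h.pos)
  have r2 := (half_pos h.pos).le
  have fi : ∀ k, fluxInt N r k (0 : ℝ) = (2 * π * I)⁻¹ • ∮ l in C(1, r / 2), (l - 1) ^ k • (((l - 1)
    ^ 2)⁻¹ • f l) := fun k => by
    rw [fluxInt, smul_eq_mul]
    refine congrArg _ (circleIntegral.integral_congr r2 fun l hl => ?_)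
    simp only [hK, hG, hf, hD, smul_eq_mul]
    field_simp
  have n1 : ∀ l ∈ sphere (1 : ℂ) (r / 2), l - 1 ≠ 0 := fun l hl e => by
    have := mem_sphere_iff_norm.1 hl
    rw [e, norm_zero] at this
    linarith [h.pos]
  have f1 : f 1 = -(2 * z ^ 2 * E * s : ℝ) := by
    have s2' : (s : ℂ) * s = 1 := by exact_mod_cast s2
    simp only [hf, hD]
    rw [H1, Hz]
    push_cast
    field_simp
    linear_combination (8 : ℂ) * s2'
  have f0 : deriv f 1 = (2 * z * E * s * (2 * z + 11 / 3) : ℝ) := by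
    have s2' : (s : ℂ) * s = 1 := by exact_mod_cast s2
    have e1 : HasDerivAt (fun l : ℂ => (E : ℂ) ^ 2 - l ^ 2) (-2) 1 :=
      ((hasDerivAt_pow 2 (1 : ℂ)).const_sub ((E : ℂ) ^ 2)).congr_deriv (by norm_num)
    have e2 : HasDerivAt (fun l : ℂ => H (E ^ 2 - l ^ 2)) (deriv H z * -2) 1 := by
      refine HasDerivAt.comp 1 ?_ e1
      rw [H1]; exact (dH z).hasDerivAt
    have e3 : HasDerivAt (fun l : ℂ => (l + 1) ^ 2) 4 1 :=
      (((hasDerivAt_id (1 : ℂ)).add_const 1).pow 2).congr_deriv (by norm_num)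
    have e4 : HasDerivAt D _ 1 := (hasDerivAt_id (1 : ℂ)).mul (e3.mul e2)
    have e5 := (e1.div e4 (D0 1 (hb (ball_subset_closedBall h1m)))).deriv
    have e6 : deriv H z = -5 * H z / (6 * z) := by rw [← v2]; field_simp
    refine e5.trans ?_
    simp only [hD, id]
    rw [H1, e6, Hz]
    push_cast
    field_simp
    linear_combination (-(1152 * z + 2112) : ℂ) * s2'
  have q0 : fluxInt N r 0 (0 : ℝ) = (2 * z * E * s * (2 * z + 11 / 3) : ℝ) := by
    rw [fi, ← f0]
    simp only [pow_zero, one_smul]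
    exact two_pi_I_inv_smul_circleIntegral_sub_sq_inv_smul_of_differentiable isOpen_ball hb df h1m
  have q1 : fluxInt N r 1 (0 : ℝ) = -(2 * z ^ 2 * E * s : ℝ) := by
    rw [fi, ← f1, ← (df.diffContOnCl_ball hb).two_pi_i_inv_smul_circleIntegral_sub_inv_smul h1m]
    refine congrArg _ (circleIntegral.integral_congr r2 fun l hl => ?_)
    have := n1 l hl
    simp
    field_simp
  have q2 : fluxInt N r 2 (0 : ℝ) = 0 := by
    rw [fi, smul_eq_zero_of_right]
    rw [← (df.diffContOnCl_ball hb).circleIntegral_eq_zero r2]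
    refine circleIntegral.integral_congr r2 fun l hl => ?_
    have := n1 l hl
    simp
    field_simp
  refine ⟨?_, ?_, by simp only [fluxCo, q2]; simp⟩
  · rw [fluxCo, q0, ofReal_re, ← hs]
    have : s * (2 * z * E * s * (2 * z + 11 / 3)) = 2 * z * E * (2 * z + 11 / 3) := by grind
    rw [this]
    have : 0 < 2 * z * E * (2 * z + 11 / 3) := by positivity
    linarith
  · rw [fluxCo, q1, ← ofReal_neg, ofReal_re, ← hs]
    have : -(s * -(2 * z ^ 2 * E * s)) = 2 * z ^ 2 * E := by grind
    rw [this]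
    positivity

lemma anAt_fluxCoeff (h : ∀ᶠ t in 𝓝 (0 : ℂ), IsContour N r t) (k : ℕ) : AnalyticAt ℝ (fluxCo N
  r k) 0 := by
  obtain ⟨U, hU, oU, mU⟩ := _root_.mem_nhds_iff.1 h
  have r0 := (hU mU).pos
  have d : DifferentiableOn ℂ (fluxInt N r k) U := by
    refine DifferentiableOn.const_mul (diffOn_circ oU (half_pos r0).le fun t ht l hl => ?_) _
    obtain ⟨e1, e2⟩ := (hU ht).coeff_sphere le_rfl (half_le_self r0.le) hl
    refine e1.diffAt_fluxInt (fun e => ?_) e2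
    have := mem_sphere_iff_norm.1 hl
    rw [e] at this
    simp at this
    linarith [(hU ht).lt_one]
  have a : AnalyticAt ℝ (fun t : ℝ => (fluxInt N r k t).re) 0 :=
    AnalyticAt.re_ofReal (by simpa using d.analyticAt (oU.mem_nhds mU))
  exact (analyticAt_const.mul a).neg

/-! ### The system of waves -/

lemma lim_ofReal_zero : Tendsto (fun t : ℝ => (t : ℂ)) (𝓝 0) (𝓝 0) :=
  continuous_ofReal.tendsto' 0 0 ofReal_zero

lemma invEnergy_ne_zero (hN : 1 ≤ N) : invEn N 0 ≠ 0 := by simpa [invEn] using (omegaThr_pos hN).ne'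

lemma ev_regular (hN : 2 ≤ N) : ∀ᶠ q : ℂ² in 𝓝 (0, 1), IsRegular N q.1 q.2 ∧ cosSqrt (kappaSq N
  q.1 q.2) + q.2 * sincSqrt (kappaSq N q.1 q.2) ≠ 0 := by
  have hN1 : 1 ≤ N := by omega
  have k0 : 0 < kappaMax N := by simpa [kappaMax_one] using kappaMax_smono le_rfl hN
  have e : kappaSq N 0 1 = ((kappaMax N ^ 2 : ℝ) : ℂ) := by
    have : (ωₜ N : ℂ) ^ 2 = 1 + (kappaMax N) ^ 2 := by exact_mod_cast omegaThr_sq hN1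
    simp [kappaSq, invEn, this]
  have c := (diffAt_kappaSq (l := 1) (invEnergy_ne_zero hN1)).continuousAt
  have c1 : ContinuousAt (fun q : ℂ² => invEn N q.1) (0, 1) := by unfold invEn; fun_prop
  have c2 : ContinuousAt (fun q : ℂ² => cosSqrt (kappaSq N q.1 q.2) + q.2 * sincSqrt (kappaSq N q.1
    q.2)) (0, 1) :=
    (diff_cosSqrt.continuous.continuousAt.comp c).add
      (continuousAt_snd.mul (diff_sincSqrt.continuous.continuousAt.comp c))
  have h1 := c1.eventually_ne (invEnergy_ne_zero hN1)
  have h2 : ∀ᶠ q : ℂ² in 𝓝 (0, 1), kappaSq N q.1 q.2 ∈ slitPlane :=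
    c.eventually (isOpen_slitPlane.mem_nhds (by
      simp only [e]
      exact ofReal_mem_slitPlane.2 (by positivity)))
  have h3 := c2.eventually_ne (by
    obtain ⟨v1, v2⟩ := cosSqrt_kappaMax hN1
    simp only [e, ofReal_pow]
    rw [v1, v2, one_mul, ← two_mul]
    exact mul_ne_zero two_ne_zero (div_ne_zero (by exact_mod_cast parity_ne_zero N)
      (by exact_mod_cast (omegaThr_pos hN1).ne')))
  filter_upwards [h1, h2, h3] with q a1 a2 a3 using ⟨⟨a1, a2⟩, a3⟩

lemma isRegular_of_lt {a : ℝ} (ha : 1 + a < omega N t) (ha0 : 0 < a) (hl : l ∈ closedBall 1 a) :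
  IsRegular N t l := by
  have h0 : 0 < omega N t := by linarith
  refine ⟨fun e => ?_, Or.inl ?_⟩
  · have := ofReal_omega N t
    rw [e, inv_zero] at this
    exact h0.ne' (by exact_mod_cast this)
  · have h1 := (abs_re_le_norm (l - 1)).trans (mem_closedBall_iff_norm.1 hl)
    rw [sub_re, one_re, abs_le] at h1
    have h2 : (kappaSq N t l).re = omega N t ^ 2 - l.re ^ 2 + l.im ^ 2 := by
      rw [kappaSq, ← ofReal_omega, ← ofReal_pow]
      simp [sq]
      ring
    rw [h2]
    nlinarith [sq_nonneg l.im]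

lemma ev_lambdaBr_ne (hN : 2 ≤ N) (hj : 1 ≤ j) (hjN : j < N) (hτ : (j, τ) ≠ (1, true)) : ∃ L : ℂ →
  ℂ, (∀ᶠ t : ℝ in 𝓝 0, L t = Λ (omega N t) j τ) ∧ ∀ᶠ q : ℂ² in 𝓝 (0, 1), L q.1 ^ 2 - q.2
  ^ 2 ≠ 0 := by
  obtain ⟨K, L, -, hL, -, eL⟩ := ex_lambdaFamily hj hjN hτ
  refine ⟨L, eL, ?_⟩
  have c : ContinuousAt (fun q => L q.1 ^ 2 - q.2 ^ 2) (0, 1) :=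
    ((hL.continuousAt.comp_of_eq continuousAt_fst rfl).pow 2).sub (by fun_prop)
  refine c.eventually_ne ?_
  have hN1 : 1 ≤ N := by omega
  have hE := omegaThr_smono hj hjN
  have hb := kappaBr_spec hj hτ hE
  have h0 : L 0 = Λ (ωₜ N) j τ := by simpa [omega_zero] using eL.self_of_nhds
  have e1 := hb.sq_add_sq (omegaThr_pos hN1) hj
  rw [omegaThr_sq hN1] at e1
  simp only [h0]
  intro h
  have h' : Λ (ωₜ N) j τ ^ 2 - 1 ^ 2 = 0 := by exact_mod_cast h
  rw [lambdaBranch] at h'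
  have e2 := (pow_left_inj₀ (hb.pos hj).le (kappaMax_nonneg hN1) two_ne_zero).1 (by linarith)
  have e3 := (kappaMax_mem_Ioo hN).1
  rw [← e2] at e3
  have e4 : (j : ℝ) ≤ N - 1 := by
    have : (j : ℝ) + 1 ≤ N := by exact_mod_cast hjN
    linarith
  nlinarith [hb.1.2, pi_pos, mul_le_mul_of_nonneg_right e4 pi_pos.le]

lemma ex_contour (hN : 2 ≤ N) {a : ℝ} (ha : AdmissibleRadius N a) (hγ : 0 < γ) : ∃ r, r < γ ∧ r ≤
  a ∧ (∀ᶠ t in 𝓝 (0 : ℂ), IsContour N r t) ∧ (∀ᶠ t : ℝ in 𝓝 0, ∀ m, contourWave N a t m =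
  contourWave N r t m) ∧ ∀ᶠ t : ℝ in 𝓝 0, ∀ k : Channel N, k.1.1 < N → ∀ l ∈ closedBall (1 : ℂ) r,
  (Λ (omega N t) k.1.1 k.1.2 : ℂ) ^ 2 - l ^ 2 ≠ 0 := by
  have hN1 : 1 ≤ N := by omega
  have hk : ∀ k : Channel N, ∃ L : ℂ → ℂ, k.1.1 < N → (∀ᶠ t : ℝ in 𝓝 0, L t = Λ (omega N
    t) k.1.1 k.1.2) ∧ ∀ᶠ q : ℂ² in 𝓝 (0, 1), L q.1 ^ 2 - q.2 ^ 2 ≠ 0 := fun k => by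
    by_cases h : k.1.1 < N
    · obtain ⟨⟨h1, -⟩, h2⟩ := mem_channels.1 k.2
      obtain ⟨L, hL⟩ := ev_lambdaBr_ne hN h1 h h2
      exact ⟨L, fun _ => hL⟩
    · exact ⟨0, fun h' => absurd h' h⟩
  choose L hL using hk
  have ev : ∀ᶠ q : ℂ² in 𝓝 (0, 1), ∀ k : Channel N, k.1.1 < N → L k q.1 ^ 2 - q.2 ^ 2 ≠ 0 :=
    eventually_all.2 fun k => by
      by_cases h : k.1.1 < N
      · exact (hL k h).2.mono fun q hq _ => hq
      · exact Eventually.of_forall fun q h' => absurd h' h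
  obtain ⟨r₁, hr₁, hb⟩ := eventually_nhds_iff_ball.1 ((ev_regular hN).and ev)
  obtain ⟨r, hr0, hr⟩ := exists_between (lt_min hr₁ (lt_min ha.1 (lt_min hγ one_pos)))
  simp at hr
  obtain ⟨hr1, hra, hrγ, hr2⟩ := hr
  have hb' : ∀ t : ℂ, ‖t‖ < r₁ → ∀ l ∈ closedBall (1 : ℂ) r, (t, l) ∈ ball ((0, 1) : ℂ²) r₁ :=
    fun t ht l hl => by
      rw [mem_ball, Prod.dist_eq]
      exact max_lt (by simpa using ht) ((mem_closedBall.1 hl).trans_lt hr1)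
  have small : ∀ᶠ t : ℂ in 𝓝 0, ‖t‖ < r₁ := by simpa using eventually_norm_sub_lt (0 : ℂ) hr₁
  have ann : ∀ᶠ t in 𝓝 0, ∀ l ∈ closedBall 1 a \ ball 1 (r / 2), gapFn N t l ≠ 0 := by
    refine IsCompact.eventually_forall_of_forall_eventually
      ((isCompact_closedBall 1 a).diff isOpen_ball) fun l hl => ?_
    refine (diffAt_gapFn (invEnergy_ne_zero hN1)).continuousAt.eventually_ne fun e => ?_
    have := ha.2.2 l (mem_closedBall_iff_norm.1 hl.1) (by simpa [gap_eq_gapFn] using e)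
    rw [this] at hl
    exact hl.2 (mem_ball_self (half_pos hr0))
  have mem : ∀ {l : ℂ}, r / 2 ≤ ‖l - 1‖ → ‖l - 1‖ ≤ a → l ∈ closedBall (1 : ℂ) a \ ball 1 (r / 2) :=
    fun h1 h2 => ⟨mem_closedBall_iff_norm.2 h2, fun h => absurd (mem_ball_iff_norm.1 h) h1.not_gt⟩
  refine ⟨r, hrγ, hra.le, ?_, ?_, ?_⟩
  · filter_upwards [small, ann] with t h1 h2
    exact ⟨hr0, hr2, fun l hl => (hb _ (hb' t h1 l hl)).1.1, fun l hl => (hb _ (hb' t h1 l hl)).1.2,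
      fun l h3 h4 => h2 l (mem h3 (h4.trans hra.le))⟩
  · filter_upwards [lim_ofReal_zero.eventually ann, (lim_omega hN1).eventually
      (eventually_gt_nhds (by linarith [ha.2.1] : 1 + a < ωₜ N))] with t h1 h2 m
    rw [contWave_eq, contWave_eq]
    funext p
    rw [circ_kernel_eq hr0 hra.le (fun l hl => isRegular_of_lt h2 ha.1 hl)
      fun l h3 h4 => h1 l (mem (by linarith) h4)]
  · have e : ∀ᶠ t : ℝ in 𝓝 0, ∀ k : Channel N, k.1.1 < N → L k t = Λ (omega N t) k.1.1 k.1.2 := eventually_all.2 fun k => by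
      by_cases h : k.1.1 < N
      · exact (hL k h).1.mono fun q hq _ => hq
      · exact Eventually.of_forall fun q h' => absurd h' h
    filter_upwards [lim_ofReal_zero.eventually small, e] with t h1 h2 k hk l hl
    rw [← h2 k hk]
    exact (hb _ (hb' t h1 l hl)).2 k hk

lemma qForm_add_left {v : 𝓦} (hw : Continuous w) (hw' : Continuous w') (hv : Continuous v) (b : ℝ)
  : qForm b (fun p => w p + w' p) v = qForm b w v + qForm b w' v := by
  have c : ∀ {u : 𝓦}, Continuous u → IntervalIntegrable (fun x => (u (x, b)).1 * conj (v (x, b)).2 -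
    (u (x, b)).2 * conj (v (x, b)).1) volume 0 1 := fun {u} hu => by
    have h1 : Continuous fun x => u (x, b) := hu.comp (by fun_prop)
    have h2 : Continuous fun x => v (x, b) := hv.comp (by fun_prop)
    exact ((h1.fst.mul (continuous_conj.comp h2.snd)).sub
      (h1.snd.mul (continuous_conj.comp h2.fst))).intervalIntegrable _ _
  rw [qForm, qForm, qForm, ← neg_add, ← iint_add (c hw) (c hw')]
  congr 2
  funext x
  simp
  ring

/-- The combination `c w₀ + d w₁` of the contour waves. -/
def comb (N : ℕ) (r t c d : ℝ) (p : ℝ²) : ℂ² :=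
  c • contourWave N r t 0 p + d • contourWave N r t 1 p

lemma qForm_comb_left (hc : ∀ m, Continuous (contourWave N r t m)) {v : 𝓦} (hv : Continuous v) (c
  d b : ℝ) : qForm b (comb N r t c d) v = c * qForm b (contourWave N r t 0) v + d * qForm b
  (contourWave N r t 1) v := by
  have e : comb N r t c d = fun p => (c : ℂ) • contourWave N r t 0 p
    + (d : ℂ) • contourWave N r t 1 p := by
    funext p; simp only [comb, coe_smul]
  have := qForm_add_left (w := fun p => (c : ℂ) • contourWave N r t 0 p)
    (w' := fun p => (d : ℂ) • contourWave N r t 1 p) ((hc 0).const_smul (c : ℂ))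
    ((hc 1).const_smul (d : ℂ)) hv b
  rw [e, this, qForm_smul_left, qForm_smul_left]

lemma cont_contourComb (hc : ∀ m, Continuous (contourWave N r t m)) (c d : ℝ) : Continuous (comb N
  r t c d) :=
  ((hc 0).const_smul c).add ((hc 1).const_smul d)

lemma IsContour.qForm_comb (h : IsContour N r t) (hc : ∀ m, Continuous (contourWave N r t m)) (c d
  c' d' b : ℝ) : qForm b (comb N r t c d) (comb N r t c' d') = I * (c * c' * fluxCo N r 0 t + (c
  * d' + d * c') * fluxCo N r 1 t + d * d' * fluxCo N r 2 t : ℝ) := by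
  have hv := cont_contourComb hc c' d'
  have e : ∀ m, qForm b (contourWave N r t m) (comb N r t c' d') = I * (c' * fluxCo N r m t + d'
    * fluxCo N r (m + 1) t) := fun m => by
    rw [← neg_neg (qForm b _ _), ← qForm_conj, qForm_comb_left hc (hc m), h.qForm_cwave,
      h.qForm_cwave, zero_add, add_comm 1 m]
    simp
    ring
  rw [qForm_comb_left hc hv, e, e]
  push_cast
  ring

/-- The coefficients of the waves `𝐰_N^±` with respect to the contour waves. -/
def edgeCo (N : ℕ) (r : ℝ) (τ : Bool) (t : ℝ) : ℝ² := let ρ := fun k => fluxCo N r k t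
  if τ then ((√(-ρ 0 + (ρ 0 / ρ 1) ^ 2 * ρ 2))⁻¹,
    (√(-ρ 0 + (ρ 0 / ρ 1) ^ 2 * ρ 2))⁻¹ * -(ρ 0 / ρ 1))
  else ((√(-ρ 0))⁻¹, 0)

lemma IsContour.edgeWave_eq (h : IsContour N r t) (hc : ∀ m, Continuous (contourWave N r t m)) (h1
  : fluxCo N r 1 t ≠ 0) (τ : Bool) : edgeWave N r t τ = comb N r t (edgeCo N r τ t).1
  (edgeCo N r τ t).2 := by
  have ea : aCoeff N r t = -fluxCo N r 0 t := by
    rw [aCoeff, h.qForm_cwave, ← mul_assoc, I_mul_I]; simp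
  have eb : bCoeff N r t = fluxCo N r 1 t := by
    rw [bCoeff, h.qForm_cwave, ← mul_assoc, neg_mul, I_mul_I]; simp
  have ep : plusWave N r t = comb N r t 1 (-(fluxCo N r 0 t / fluxCo N r 1 t)) := by
    funext p
    rw [plusWave, comb, ea, eb, one_smul, neg_div]
  funext p
  cases τ
  · simp [edgeWave, edgeCo, comb, ea]
  · have e2 : (-I * qForm 0 (plusWave N r t) (plusWave N r t)).re = -fluxCo N r 0 t + (fluxCo
      N r 0 t / fluxCo N r 1 t) ^ 2 * fluxCo N r 2 t := by
      rw [ep, h.qForm_comb hc, ← mul_assoc, neg_mul, I_mul_I, neg_neg, one_mul, ofReal_re]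
      field_simp
      ring
    simp only [edgeWave, edgeCo, if_true]
    rw [e2, ep]
    simp only [comb, one_smul, smul_add, smul_smul]

lemma anAt_sqrt_inv {g : ℝ → ℝ} (hg : AnalyticAt ℝ g 0) (h : 0 < g 0) : AnalyticAt ℝ (fun t =>
  (√(g t))⁻¹) 0 :=
  (((contDiffAt_sqrt h.ne').analyticAt).comp hg).inv (sqrt_pos.2 h).ne'

lemma exists_isWaveSystem (hN : 2 ≤ N) {a : ℝ} (ha : AdmissibleRadius N a) (hγ : 0 < γ) : ∃ r > 0,
  IsWaveSystem N a γ r := by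
  have hN1 : 1 ≤ N := by omega
  obtain ⟨r, hrγ, hra, hC, hE, hL⟩ := ex_contour hN ha hγ
  have hC' : ∀ᶠ t : ℝ in 𝓝 0, IsContour N r t := lim_ofReal_zero.eventually hC
  have fam := fun m => fam_contour hrγ hC m
  have an := anAt_fluxCoeff hC
  obtain ⟨ρ0, ρ1, ρ2⟩ := fluxCo_zero hN ha hra hC'.self_of_nhds
  have aα := (an 0).div (an 1) ρ1
  have aP : AnalyticAt ℝ (fun t => -fluxCo N r 0 t + (fluxCo N r 0 t / fluxCo N r 1 t) ^ 2
    * fluxCo N r 2 t) 0 :=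
    (an 0).neg.add ((aα.pow 2).mul (an 2))
  have hP : 0 < -fluxCo N r 0 0 + (fluxCo N r 0 0 / fluxCo N r 1 0) ^ 2 * fluxCo N r 2 0
    := by
    rw [ρ2, mul_zero, add_zero]; exact neg_pos.2 ρ0
  have hc : ∀ᶠ t : ℝ in 𝓝 0, ∀ m, Continuous (contourWave N r t m) := by
    filter_upwards [hC'] with t ht m
    exact ht.cont_cwave m
  have ev1 := (an 1).continuousAt.eventually_ne ρ1
  have ev0 := (an 0).continuousAt.eventually (eventually_lt_nhds ρ0)
  have evP := aP.continuousAt.eventually (eventually_gt_nhds hP)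
  have edge : ∀ᶠ t : ℝ in 𝓝 0, ∀ τ, comb N r t (edgeCo N r τ t).1 (edgeCo N r τ t).2 =
    edgeWave N a t τ := by
    filter_upwards [hC', hc, ev1, hE] with t h1 h2 h3 h4 τ
    rw [← h1.edgeWave_eq h2 h3]
    have hp : plusWave N a t = plusWave N r t := by
      funext p
      simp only [plusWave, aCoeff, bCoeff, h4]
    funext p
    simp only [edgeWave, aCoeff, hp, h4]
  have family : ∀ k : Channel N, IsFamily γ fun t => wave N a t k := fun k => by
    obtain ⟨⟨h1, h2⟩, h3⟩ := mem_channels.1 k.2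
    by_cases hk : k.1.1 < N
    · simpa only [wave, if_pos hk] using fam_oscWave hγ h1 hk h3
    · simp only [wave, if_neg hk]
      have c1 : AnalyticAt ℝ (fun t => (edgeCo N r k.1.2 t).1) 0 := by
        cases k.1.2
        · exact anAt_sqrt_inv (an 0).neg (neg_pos.2 ρ0)
        · exact anAt_sqrt_inv aP hP
      have c2 : AnalyticAt ℝ (fun t => (edgeCo N r k.1.2 t).2) 0 := by
        cases k.1.2
        · exact analyticAt_const
        · exact (anAt_sqrt_inv aP hP).mul aα.neg
      exact (((fam 0).smul c1).add ((fam 1).smul c2)).congr (edge.mono fun t ht => ht k.1.2)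
  have thr : ∀ᶠ t : ℝ in 𝓝 0, ∀ k : Channel N, k.1.1 < N → ωₜ k.1.1 < omega N t :=
    eventually_all.2 fun k => by
      by_cases hk : k.1.1 < N
      · exact ((lim_omega hN1).eventually (eventually_gt_nhds
          (omegaThr_smono (mem_channels.1 k.2).1.1 hk))).mono fun t ht _ => ht
      · exact Eventually.of_forall fun t h => absurd h hk
  have memC : ∀ᶠ t : ℝ in 𝓝 0, ∀ m : Fin 2, MemL (-γ) (contourWave N r t m) :=
    eventually_all.2 fun m => (fam m).mem
  have dirac : ∀ᶠ t : ℝ in 𝓝 0, ∀ k, HasDirac (wave N a t k) fun p => omega N t • wave N a t k p := by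
    filter_upwards [edge, thr, hC', memC] with t h1 h2 h3 h4 k
    obtain ⟨⟨h5, h6⟩, h7⟩ := mem_channels.1 k.2
    by_cases hk : k.1.1 < N
    · simpa only [wave, if_pos hk] using hasDirac_oscWave h5 h7 (h2 k hk)
    · simp only [wave, if_neg hk, ← h1]
      have d : ∀ m, HasDirac (contourWave N r t m) fun p => (omega N t : ℂ) • contourWave N r t m p :=
        fun m => by
        have := (h3.hasDirac m).const_smul (2 * π * I)⁻¹
        rw [contWave_eq, ofReal_omega]
        simpa only [smul_comm (2 * π * I : ℂ)⁻¹ (invEn N t)⁻¹] using this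
      have m0 := h4 0
      have m1 := h4 1
      set c := edgeCo N r k.1.2 t
      have := ((d 0).const_smul c.1).add ((d 1).const_smul c.2) (m0.const_smul _)
        (m1.const_smul _) ((m0.const_smul _).const_smul _) ((m1.const_smul _).const_smul _)
      refine this.congr (.of_forall fun p => ?_) (.of_forall fun p => ?_)
      · simp only [comb, coe_smul]
      · simp only [comb, coe_smul, smul_add, smul_comm (omega N t)]
  have flux : ∀ᶠ t : ℝ in 𝓝 0, ∀ j k b, qForm b (wave N a t j) (wave N a t k) = if j = k then (if
    j.1.2 then I else -I) else 0 := by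
    filter_upwards [edge, thr, hC', hc, ev1, ev0, evP, hL] with t h1 h2 h3 h4 h5 h6 h7 h8 j k b
    obtain ⟨⟨j1, j2⟩, j3⟩ := mem_channels.1 j.2
    obtain ⟨⟨k1, k2⟩, k3⟩ := mem_channels.1 k.2
    have cross : ∀ (j k : Channel N), j.1.1 < N → ¬k.1.1 < N → qForm b (wave N a t k) (wave N a t j)
      = 0 := fun j k hj hk => by
      obtain ⟨⟨j1, j2⟩, j3⟩ := mem_channels.1 j.2
      have hb := kappaBr_spec j1 j3 (h2 j hj)
      have E0 : 0 < omega N t := (omegaThr_pos j1).trans (h2 j hj)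
      have z : ∀ m, qForm b (contourWave N r t m) (oscWave (omega N t) j.1.1 j.1.2) = 0 :=
        fun m => by
        have hs := h3.qForm_planeWave_eq_zero m b
          (by
            rcases parity_eq_or j.1.1 N with e | e
            · have hk2 : ((kappaBranch (omega N t) j.1.1 j.1.2 : ℝ) : ℂ) ^ 2 = kappaSq N t
                (Λ (omega N t) j.1.1 j.1.2) := by
                rw [kappaSq, ← ofReal_omega]
                have := hb.sq_add_sq E0 j1
                rw [eq_sub_iff_add_eq]
                exact_mod_cast this
              refine Or.inr ⟨e, hk2, ?_, h8 j hj⟩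
              rw [gapFn, sincSqrt_eq hk2, csinc_ofReal, sinc_of_ne_zero (hb.pos j1).ne', hb.2.1,
                e, ← inv_inv (invEn N t), ← ofReal_omega]
              push_cast
              ring
            · exact Or.inl e)
        rw [contWave_eq, qForm_smul_left, ← neg_neg (qForm b _ _), ← qForm_conj]
        have e4 : qForm b (oscWave (omega N t) j.1.1 j.1.2) (fun p => ∮ l in C(1, r), kernelWave N m
          t l p) = _ :=
          qForm_smul_left b ((√(omega N t) / √|Λ (omega N t) j.1.1 j.1.2 - 1| : ℝ) : ℂ)
            _ _
        rw [e4, ← neg_neg (qForm b (planeWave _ _ _) _), ← qForm_conj, hs]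
        simp
      simp only [wave, if_neg hk, if_pos hj, ← h1]
      rw [qForm_comb_left h4, z, z, mul_zero, mul_zero, add_zero]
      exact (cont_plane _ _ _).const_smul (√(omega N t) / √|Λ (omega N t) j.1.1 j.1.2 - 1|)
    by_cases hj : j.1.1 < N <;> by_cases hk : k.1.1 < N
    · simp only [wave, if_pos hj, if_pos hk, qForm_oscWave j1 j3 k1 k3 (h2 j hj) (h2 k hk),
        Subtype.ext_iff]
    · rw [if_neg (fun e : j = k => hk (by rw [← e]; exact hj)), ← neg_neg (qForm b _ _), ← qForm_conj, cross j k hj hk]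
      simp
    · rw [if_neg (fun e : j = k => hj (by rw [e]; exact hk)), cross k j hk hj]
    · have jk : j = k ↔ j.1.2 = k.1.2 := by
        refine ⟨fun e => by rw [e], fun e => Subtype.ext (Prod.ext ?_ e)⟩
        exact (le_antisymm j2 (not_lt.1 hj)).trans (le_antisymm k2 (not_lt.1 hk)).symm
      simp only [wave, if_neg hj, if_neg hk, ← h1, h3.qForm_comb h4, jk]
      have s1 : (√(-fluxCo N r 0 t)) ^ 2 = -fluxCo N r 0 t := sq_sqrt (by linarith)
      have n1 : √(-fluxCo N r 0 t) ≠ 0 := (sqrt_pos.2 (by linarith)).ne'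
      have s2 := sq_sqrt h7.le
      have n2 := (sqrt_pos.2 h7).ne'
      set ρ := fun k => fluxCo N r k t with hρ
      cases j.1.2 <;> cases k.1.2 <;> simp only [edgeCo, if_true, reduceCtorEq, if_false,
        Bool.false_eq_true]
      · have : (√(-ρ 0))⁻¹ * (√(-ρ 0))⁻¹ * ρ 0 = -1 := by
          rw [← mul_inv, ← sq, show √(-ρ 0) ^ 2 = -ρ 0 from s1, inv_neg, neg_mul,
            inv_mul_cancel₀ (show ρ 0 ≠ 0 from h6.ne)]
        simp only [mul_zero, zero_mul, add_zero]
        rw [this]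
        simp
      · refine mul_eq_zero_of_right _ ?_
        norm_cast
        field_simp
        ring
      · refine mul_eq_zero_of_right _ ?_
        norm_cast
        field_simp
        ring
      · have h5' : ρ 1 ≠ 0 := h5
        set n := √(-ρ 0 + (ρ 0 / ρ 1) ^ 2 * ρ 2)
        have : n⁻¹ * n⁻¹ * ρ 0 + (n⁻¹ * (n⁻¹ * -(ρ 0 / ρ 1)) + n⁻¹ * -(ρ 0 / ρ 1) * n⁻¹) * ρ 1 + n⁻¹
          * -(ρ 0 / ρ 1) * (n⁻¹ * -(ρ 0 / ρ 1)) * ρ 2 = 1 := by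
          calc _ = (n ^ 2)⁻¹ * (-ρ 0 + (ρ 0 / ρ 1) ^ 2 * ρ 2) := by field_simp; ring
            _ = 1 := by rw [← s2, inv_mul_cancel₀ (pow_ne_zero 2 n2)]
        rw [this]
        simp
  obtain ⟨r', hr', hb⟩ := eventually_nhds_iff_ball.1
    (((eventually_all.2 fun k => (family k).cont).and (eventually_all.2 fun k => (family k).mem)).and
      (dirac.and flux))
  rw [ball_eq_Ioo, zero_sub, zero_add] at hb
  have sub : ∀ t ∈ Ico 0 r', t ∈ Ioo (-r') r' := fun t ht => ⟨by linarith [ht.1], ht.2⟩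
  exact ⟨r', hr', fun t ht => (hb t ht).1.1, fun t ht => (hb t ht).1.2,
    fun t ht => (hb t (sub t ht)).2.1, fun t ht => (hb t (sub t ht)).2.2,
    fun k => (family k).analytic⟩

end

end ZigzagRibbon

theorem mainTheorem6 (N : ℕ) (hN : 2 ≤ N) :
    (∃ γ, AdmissibleWeight N γ) ∧ (∃ a, AdmissibleRadius N a) ∧
    ∀ (γ a R₀ : ℝ) (χ : Bool → ℝ → ℝ), AdmissibleWeight N γ → AdmissibleRadius N a →
      0 < R₀ → IsCutoff R₀ χ →
      ∃ ε₀ > 0, ∃ δ₀ > 0, ∃ C : ℝ, ∀ P : ℝ × ℝ → ℝ, IsPotential R₀ P →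
        ∃ S : ℝ → ℝ → Matrix (Channel N) (Channel N) ℂ,
          (∀ ε ∈ Icc 0 ε₀, ∀ δ ∈ Icc (-δ₀) δ₀,
            IsScatteringMatrix N χ γ a ε δ P (S ε δ) ∧
            ∀ S', IsScatteringMatrix N χ γ a ε δ P S' → S' = S ε δ) ∧
          (∀ j k, AnalyticOn ℝ (fun q : ℝ × ℝ => S q.1 q.2 j k) (Icc 0 ε₀ ×ˢ Icc (-δ₀) δ₀)) ∧
          ∀ ε ∈ Icc 0 ε₀, ∀ δ ∈ Icc (-δ₀) δ₀, ∀ j k,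
            ‖(S ε δ - 1) j k
              - -Complex.I * δ * pairing P (wave N a ε j) (wave N a ε k)‖ ≤ C * δ ^ 2 :=
  ⟨exists_admissibleWeight hN, exists_admissibleRadius hN, fun _ _ _ _ hγ ha hR hχ =>
    let ⟨_, hr, h⟩ := exists_isWaveSystem hN ha hγ.1
    exists_scattering_of_waves hN hγ hr h hR hχ⟩
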